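/- For a directed graph $G=(V,E)$ on $n$ vertices and a set $T\subseteq V$ of terminals, a vertex multiway cut of $(G,T)$ is a set $S\subseteq V\setminus T$ such that $G-S$ contains no directed path from one terminal to a different terminal, and an edge multiway cut of $(G,T)$ is a set $F\subseteq E$ such that $G-F$ contains no such path. The problem Directed Multiway Cut asks, given $(G,T)$ and an integer $k\ge 0$, to find a multiway cut of size at most $k$ or to report that none exists. Both the vertex version and the edge version of Directed Multiway Cut can be solved by a deterministic algorithm in time $k^{O(k)}n^{O(1)}$. That is, for each version there are a single program for a random access machine (unit-cost steps; addition, truncated subtraction, zero tests and indirect addressing on natural numbers) and a constant $c$ such that, on every instance $(G,T,k)$ with $n$ vertices (given by $n$, $k$, the adjacency matrix of $G$ and the characteristic vector of $T$), the program halts after at most $c\cdot k^{ck}\cdot(n+1)^c$ steps (with $0^0=1$) and outputs either a multiway cut of $(G,T)$ of size at most $k$, or, if there is none, the answer "no". This improves the previous bound $2^{O(k^2)}n^{O(1)}$: for every constant $c$ and every $\varepsilon>0$, $k^{ck}=o\bigl(2^{\varepsilon k^2}\bigr)$ as $k\to\infty$. -/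

import Mathlib

namespace DirectedMultiwayCut

/-! ### Multiway cuts in directed graphs -/

/-- `S` is a vertex multiway cut of `(G, T)`: it contains no terminal, and in `G - S` there is no
directed path from a terminal to another one. -/
def IsVertexMultiwayCut {V : Type*} (G : Digraph V) (T S : Finset V) : Prop :=
  Disjoint S T ∧ ∀ s ∈ T, ∀ t ∈ T, s ≠ t →
    ¬ Relation.ReflTransGen (fun u v => G.Adj u v ∧ u ∉ S ∧ v ∉ S) s t

/-- `F` is an edge multiway cut of `(G, T)`: it consists of arcs of `G`, and in `G - F` there is no
directed path from a terminal to another one. -/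
def IsEdgeMultiwayCut {V : Type*} (G : Digraph V) (T : Finset V) (F : Finset (V × V)) : Prop :=
  (∀ a ∈ F, G.Adj a.1 a.2) ∧ ∀ s ∈ T, ∀ t ∈ T, s ≠ t →
    ¬ Relation.ReflTransGen (fun u v => G.Adj u v ∧ (u, v) ∉ F) s t

/-! ### A random access machine with a step count

Programs of a deterministic random access machine, written with structured control (sequence,
branch, loop) in place of jumps. Cells hold natural numbers, and the only arithmetic is addition and
truncated subtraction (no multiplication), at unit cost. A program mentions finitely many registers
and finitely many arrays; each array is an unbounded block of memory with indirect addressing. -/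

/-- A memory: the contents of each register, and the contents of each cell of each array. -/
structure State where
  reg : ℕ → ℕ
  arr : ℕ → ℕ → ℕ

/-- The state in which register `x` has been set to `v`. -/
def State.setReg (s : State) (x v : ℕ) : State :=
  { s with reg := Function.update s.reg x v }

/-- The state in which cell `i` of array `a` has been set to `v`. -/
def State.setArr (s : State) (a i v : ℕ) : State :=
  { s with arr := Function.update s.arr a (Function.update (s.arr a) i v) }

/-- Expressions: numerals, register contents, array look-ups, sums, truncated differences. -/
inductive Expr where
  | num (m : ℕ)
  | reg (x : ℕ)
  | arr (a : ℕ) (i : Expr)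
  | add (e f : Expr)
  | sub (e f : Expr)

/-- The value of an expression in a state. -/
def Expr.eval (s : State) : Expr → ℕ
  | .num m => m
  | .reg x => s.reg x
  | .arr a i => s.arr a (i.eval s)
  | .add e f => e.eval s + f.eval s
  | .sub e f => e.eval s - f.eval s

/-- The number of elementary operations needed to evaluate an expression. -/
def Expr.cost : Expr → ℕ
  | .num _ => 1
  | .reg _ => 1
  | .arr _ i => i.cost + 1
  | .add e f => e.cost + f.cost + 1
  | .sub e f => e.cost + f.cost + 1

/-- Programs. A test `e` counts as true if the value of `e` is not zero. -/
inductive Prog where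
  | skip
  | assign (x : ℕ) (e : Expr)
  | store (a : ℕ) (i e : Expr)
  | seq (p q : Prog)
  | branch (e : Expr) (p q : Prog)
  | loop (e : Expr) (p : Prog)

/-- `Exec p s t s'`: started in state `s`, the program `p` halts after exactly `t` steps, in
state `s'`. -/
inductive Exec : Prog → State → ℕ → State → Prop
  | skip (s : State) : Exec .skip s 1 s
  | assign (x : ℕ) (e : Expr) (s : State) :
      Exec (.assign x e) s (e.cost + 1) (s.setReg x (e.eval s))
  | store (a : ℕ) (i e : Expr) (s : State) :
      Exec (.store a i e) s (i.cost + e.cost + 1) (s.setArr a (i.eval s) (e.eval s))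
  | seq {p q : Prog} {s s' s'' : State} {t t' : ℕ} (hp : Exec p s t s') (hq : Exec q s' t' s'') :
      Exec (.seq p q) s (t + t') s''
  | branchTrue {e : Expr} {p : Prog} (q : Prog) {s s' : State} {t : ℕ} (he : e.eval s ≠ 0)
      (hp : Exec p s t s') : Exec (.branch e p q) s (e.cost + 1 + t) s'
  | branchFalse {e : Expr} (p : Prog) {q : Prog} {s s' : State} {t : ℕ} (he : e.eval s = 0)
      (hq : Exec q s t s') : Exec (.branch e p q) s (e.cost + 1 + t) s'
  | loopTrue {e : Expr} {p : Prog} {s s' s'' : State} {t t' : ℕ} (he : e.eval s ≠ 0)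
      (hp : Exec p s t s') (hl : Exec (.loop e p) s' t' s'') :
      Exec (.loop e p) s (e.cost + 1 + t + t') s''
  | loopFalse {e : Expr} (p : Prog) {s : State} (he : e.eval s = 0) :
      Exec (.loop e p) s (e.cost + 1) s

/-! ### Input and output conventions -/

open Classical in
/-- The memory holding the instance `(G, T, k)` on the vertices `0, …, n - 1`: register `0` holds `n`
and register `1` holds `k`, array `0` holds the adjacency matrix in row-major order, array `1` holds
the characteristic vector of `T`, and every other cell is zero. -/
noncomputable def inputState {n : ℕ} (G : Digraph (Fin n)) (T : Finset (Fin n)) (k : ℕ) : State where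
  reg x := if x = 0 then n else if x = 1 then k else 0
  arr a i :=
    if a = 0 then (if ∃ u v : Fin n, i = (u : ℕ) * n + (v : ℕ) ∧ G.Adj u v then 1 else 0)
    else if a = 1 then (if ∃ v ∈ T, i = (v : ℕ) then 1 else 0)
    else 0

/-- The final state `s` answers the search problem "find a vertex multiway cut of size at most `k`":
either register `0` holds `1` and array `2` holds the characteristic vector of such a cut, or register
`0` holds `0` and there is no such cut. -/
def AnswersVertex {n : ℕ} (G : Digraph (Fin n)) (T : Finset (Fin n)) (k : ℕ) (s : State) : Prop :=
  (s.reg 0 = 1 ∧ ∃ S : Finset (Fin n), IsVertexMultiwayCut G T S ∧ S.card ≤ k ∧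
      ∀ v : Fin n, s.arr 2 (v : ℕ) = if v ∈ S then 1 else 0) ∨
    (s.reg 0 = 0 ∧ ¬ ∃ S : Finset (Fin n), IsVertexMultiwayCut G T S ∧ S.card ≤ k)

/-- The final state `s` answers the search problem "find an edge multiway cut of size at most `k`":
either register `0` holds `1` and array `2` holds such a cut, as a 0-1 matrix in row-major order, or
register `0` holds `0` and there is no such cut. -/
def AnswersEdge {n : ℕ} (G : Digraph (Fin n)) (T : Finset (Fin n)) (k : ℕ) (s : State) : Prop :=
  (s.reg 0 = 1 ∧ ∃ F : Finset (Fin n × Fin n), IsEdgeMultiwayCut G T F ∧ F.card ≤ k ∧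
      ∀ u v : Fin n, s.arr 2 ((u : ℕ) * n + (v : ℕ)) = if (u, v) ∈ F then 1 else 0) ∨
    (s.reg 0 = 0 ∧ ¬ ∃ F : Finset (Fin n × Fin n), IsEdgeMultiwayCut G T F ∧ F.card ≤ k)

end DirectedMultiwayCut

/-! Let `S` be a solution of size at most `k`. Its shadow consists of the vertices outside `S` that
reach no terminal in `G - S`; the reversed graph gives a second shadow. If both are empty, every
vertex of `G - S` is reached from some terminal and reaches some terminal, necessarily the same one,
so orientations no longer matter. It therefore suffices to guess a set `Z` that contains both
shadows and misses `S` and `T`. Bypassing `Z` gives a symmetric graph, the torso: `S` is still a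
solution there (`sol_torso`), and every solution of the torso that avoids `T` is a solution of `G`
(`sol_of_torso`).

Undirected multiway cut is solved by pushing. Let `x` be a vertex of the furthest smallest cut
around a terminal. By submodularity some solution extending the current one either deletes `x` or
keeps `x` on the terminal's side (`Extends.enlarge`). Each choice raises twice the number of deleted
vertices plus the size of the cut, so `2 * k` bits describe a successful run for all terminals
together (`exists_bits`, `exists_bits_sweep`).

To find `Z`, choose `S` of least size, then with largest span (`S` and both shadows), then with
largest shadow. Exchanging the part of `S` inside a set `X` for the boundary of `X` never shrinks
what is cut off and swallows the boundary. Hence an exchange at no cost would contradict the choice: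
`S` is tight (`Extremal.tight`, `Extremal.tight_flip`). Tightness has two consequences. Every shadow
vertex lies in an important set whose boundary lies in `S` (`exists_important_of_mem_shadow`), and
pushing finds that set. Moreover, the boundaries of all important sets that meet `S` and have
boundary of size at most `k` are hit by a light family: each contains a member of a family of
nonempty sets `J` disjoint from `S` with total weight `∑ θ ^ |J| < 1`, where `θ` is of order `k ^
(-4)` (`exists_hitting_family`).

Suppose then that `C` contains `S` and no such `J`. The vertices that lie in an important set with
at most `k` boundary vertices, all in `C`, cover the shadow of `S` and miss `S`. The second shadow
is treated in the reversed graph, where vertices already removed are no longer deletable.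

If every vertex joins `C` with probability `2 ^ (-L)`, where `2 ^ L ≥ 4 * (k + 1) ^ 4`, then
conditionally on `S ⊆ C` the union bound leaves a positive probability that no `J` is contained in
`C`. Only the bits belonging to `S ∪ J` have to be independent, at most `2 * k * L` at a time. A
linear recurring sequence over the field with two elements of order `m`, with `2 ^ m > 2 ^ (3 * k *
L) * (N * L)`, provides this (`exists_recurrence_avoiding`). Such a sequence is given by `2 * m`
bits, so there are `2 ^ (2 * m)` guesses, which is `k ^ O(k)` times a polynomial in `N`.

The algorithm is written with loops whose lengths are registers fixed beforehand. Its running time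
is then a fixed polynomial in the largest loop length, and that length is polynomial in `2 ^ m`.
Every candidate is verified before it is output, so wrong guesses do no harm. The edge version is
reduced to the vertex version by subdividing the arcs and allowing only the subdividing vertices to
be deleted. -/

namespace DirectedMultiwayCut
open Relation

set_option linter.unusedSectionVars false

/-! ### Exchange arguments, extremal solutions and important sets -/

section Cuts
variable {V : Type*} [Fintype V] [DecidableEq V]

/-! ### Out-neighbourhoods, separators and shadows -/

open Classical in
/-- The out-neighbours of `A` outside `A`. -/
noncomputable def outN (R : V → V → Prop) (A : Finset V) : Finset V :=
  Finset.univ.filter fun v => v ∉ A ∧ ∃ u ∈ A, R u v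

theorem mem_outN {R : V → V → Prop} {A : Finset V} {v : V} :
    v ∈ outN R A ↔ v ∉ A ∧ ∃ u ∈ A, R u v := by
  simp [outN]

theorem outN_union_subset (R : V → V → Prop) (A B : Finset V) :
    outN R (A ∪ B) ⊆ outN R A ∪ outN R B := by
  intro v
  simp only [mem_outN, Finset.mem_union]
  grind

theorem outN_inter_subset (R : V → V → Prop) (A B : Finset V) :
    outN R (A ∩ B) ⊆ outN R A ∪ outN R B := by
  intro v
  simp only [mem_outN, Finset.mem_union, Finset.mem_inter]
  grind

/-- Counted vertex by vertex. The set `M` collects vertices whose presence in the boundary costs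
nothing: those already deleted, or those of the unknown solution. -/
theorem card_outN_submodular (R : V → V → Prop) (M A B : Finset V) :
    (outN R (A ∪ B) \ M).card + (outN R (A ∩ B) \ M).card ≤
      (outN R A \ M).card + (outN R B \ M).card := by
  rw [← Finset.card_union_add_card_inter (outN R (A ∪ B) \ M),
    ← Finset.card_union_add_card_inter (outN R A \ M)]
  apply Nat.add_le_add <;> apply Finset.card_le_card <;> intro v <;>
    simp only [mem_outN, Finset.mem_union, Finset.mem_inter, Finset.mem_sdiff] <;> grind

/-- `A` avoids the sinks `K`, and every vertex of its boundary may be deleted. -/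
def Feas (R : V → V → Prop) (K P A : Finset V) : Prop := Disjoint A K ∧ outN R A ⊆ P

theorem Feas.union {R : V → V → Prop} {K P A B : Finset V} (hA : Feas R K P A)
    (hB : Feas R K P B) : Feas R K P (A ∪ B) :=
  ⟨Finset.disjoint_union_left.2 ⟨hA.1, hB.1⟩,
    (outN_union_subset R A B).trans (Finset.union_subset hA.2 hB.2)⟩

theorem Feas.inter {R : V → V → Prop} {K P A B : Finset V} (hA : Feas R K P A)
    (hB : Feas R K P B) : Feas R K P (A ∩ B) :=
  ⟨hA.1.mono_left Finset.inter_subset_left,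
    (outN_inter_subset R A B).trans (Finset.union_subset hA.2 hB.2)⟩

/-- Arcs avoiding `S`. -/
def Av (R : V → V → Prop) (S : Finset V) (u v : V) : Prop := R u v ∧ u ∉ S ∧ v ∉ S

/-- No path between distinct terminals avoids `S`. -/
def Sol (R : V → V → Prop) (T S : Finset V) : Prop :=
  ∀ s ∈ T, ∀ t ∈ T, s ≠ t → ¬ ReflTransGen (Av R S) s t

open Classical in
/-- The vertices outside `S` from which no terminal can be reached in `G - S`. -/
noncomputable def shadow (R : V → V → Prop) (T S : Finset V) : Finset V :=
  Finset.univ.filter fun v => v ∉ S ∧ ¬ ∃ t ∈ T, ReflTransGen (Av R S) v t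

theorem mem_shadow {R : V → V → Prop} {T S : Finset V} {v : V} :
    v ∈ shadow R T S ↔ v ∉ S ∧ ¬ ∃ t ∈ T, ReflTransGen (Av R S) v t := by
  simp [shadow]

theorem reflTransGen_av_flip {R : V → V → Prop} {S : Finset V} {u v : V} :
    ReflTransGen (Av (flip R) S) u v ↔ ReflTransGen (Av R S) v u := by
  rw [← reflTransGen_swap]
  have : Av (flip R) S = Function.swap (Av R S) := by
    funext a b
    simp only [Av, flip, Function.swap, eq_iff_iff]
    tauto
  rw [this]

theorem Sol.flip {R : V → V → Prop} {T S : Finset V} (h : Sol R T S) : Sol (flip R) T S := by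
  intro s hs t ht hst
  rw [reflTransGen_av_flip]
  exact h t ht s hs hst.symm

theorem not_mem_of_reach {R : V → V → Prop} {S : Finset V} {u v : V} (hv : v ∉ S)
    (h : ReflTransGen (Av R S) u v) : u ∉ S := by
  rcases ReflTransGen.cases_head h with h | ⟨c, h, -⟩
  · exact h ▸ hv
  · exact h.2.1

theorem not_mem_of_reach' {R : V → V → Prop} {S : Finset V} {u v : V} (hu : u ∉ S)
    (h : ReflTransGen (Av R S) u v) : v ∉ S := by
  rcases ReflTransGen.cases_tail h with h | ⟨c, -, h⟩
  · exact h ▸ hu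
  · exact h.2.2

theorem stay {R : V → V → Prop} {S X : Finset V} (hX : outN R X ⊆ S) {u v : V} (hu : u ∈ X)
    (h : ReflTransGen (Av R S) u v) : v ∈ X := by
  induction h with
  | refl => exact hu
  | tail _ hbc ih =>
    by_contra hc
    exact hbc.2.2 (hX (mem_outN.2 ⟨hc, _, ih, hbc.1⟩))

theorem exit_path {R : V → V → Prop} {S X : Finset V} {u v : V} (hu : u ∈ X) (hv : v ∉ X)
    (h : ReflTransGen (Av R S) u v) :
    ∃ y ∈ outN R X, y ∉ S ∧ ReflTransGen (Av R S) y v := by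
  induction h using ReflTransGen.head_induction_on with
  | refl => exact absurd hu hv
  | head hab hbc ih =>
    rename_i a b
    by_cases hb : b ∈ X
    · exact ih hb
    · exact ⟨b, mem_outN.2 ⟨hb, _, hu, hab.1⟩, hab.2.2, hbc⟩

/-- `S` with its part inside `X` exchanged for the boundary of `X`. -/
noncomputable def swapOut (R : V → V → Prop) (S X : Finset V) : Finset V := (S \ X) ∪ outN R X

/-- Followed backwards from its end outside `X`, the path can never come from `X`, because the next
vertex would be in the boundary of `X`, which has been deleted. Outside `X` the new set contains
`S`. -/
theorem swap_path {R : V → V → Prop} {S X : Finset V} {u t : V} (ht : t ∉ X)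
    (h : ReflTransGen (Av R (swapOut R S X)) u t) : u ∉ X ∧ ReflTransGen (Av R S) u t := by
  induction h using ReflTransGen.head_induction_on with
  | refl => exact ⟨ht, .refl⟩
  | head hab hbc ih =>
    rename_i a b
    obtain ⟨hab, ha, hb⟩ := hab
    simp only [swapOut, Finset.mem_union, Finset.mem_sdiff, not_or, not_and, not_not] at ha hb
    have haX : a ∉ X := fun h => hb.2 (mem_outN.2 ⟨ih.1, a, h, hab⟩)
    exact ⟨haX, .head ⟨hab, fun h => haX (ha.1 h), fun h => ih.1 (hb.1 h)⟩ ih.2⟩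

theorem Sol.swapOut {R : V → V → Prop} {T S X : Finset V} (h : Sol R T S) (hX : Disjoint X T) :
    Sol R T (swapOut R S X) := fun s hs t ht hst hp =>
  h s hs t ht hst (swap_path (Finset.disjoint_right.1 hX ht) hp).2

/-- A vertex that still reaches a terminal after the exchange does so along a path outside `X` that
avoids `S`. Hence it lay neither in `X` nor in the old shadow. -/
theorem subset_swapOut_union_shadow {R : V → V → Prop} {T S X : Finset V} (hX : Disjoint X T) :
    S ∪ shadow R T S ∪ (X ∪ outN R X) ⊆ swapOut R S X ∪ shadow R T (swapOut R S X) := by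
  intro v hv
  by_contra hc
  simp only [Finset.mem_union, mem_shadow, not_or, not_and, not_not] at hc hv
  obtain ⟨hv1, hv2⟩ := hc
  obtain ⟨t, ht, hp⟩ := hv2 hv1
  obtain ⟨hvX, hp'⟩ := swap_path (Finset.disjoint_right.1 hX ht) hp
  simp only [DirectedMultiwayCut.swapOut, Finset.mem_union, Finset.mem_sdiff, not_or, not_and,
    not_not] at hv1
  have := hv1.1
  have := hv1.2
  have := hv.resolve_right (by tauto)
  rcases this with h | h
  · tauto
  · exact h.2 ⟨t, ht, hp'⟩

/-- The vertices that are deleted by `S`, cannot reach a terminal, or are not reached. -/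
noncomputable def span (R : V → V → Prop) (T S : Finset V) : Finset V :=
  S ∪ shadow R T S ∪ shadow (flip R) T S

theorem span_flip (R : V → V → Prop) (T S : Finset V) : span (flip R) T S = span R T S := by
  have : flip (flip R) = R := rfl
  simp only [span, this, Finset.union_assoc]
  rw [Finset.union_comm (shadow (flip R) T S)]

/-- The exchange is made for one orientation, yet it does not harm the shadow of the other one: a
path from a terminal to a vertex outside `X` also ends outside `X`, so `swap_path` applies. This is
why the first secondary criterion for choosing `S` is the span, which does not depend on the
orientation. -/
theorem subset_span_swapOut {R : V → V → Prop} {T S X : Finset V} (hX : Disjoint X T) :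
    span R T S ∪ (X ∪ outN R X) ⊆ span R T (swapOut R S X) := by
  intro v hv
  have key := subset_swapOut_union_shadow (R := R) (S := S) hX
  by_cases hv' : v ∈ S ∪ shadow R T S ∪ (X ∪ outN R X)
  · exact Finset.mem_union_left _ (key hv')
  · by_contra hc
    have hvf : v ∈ shadow (flip R) T S := by
      simp only [span, Finset.mem_union] at hv hv'
      tauto
    simp only [span, Finset.mem_union, not_or] at hc
    obtain ⟨⟨h1, h2⟩, h3⟩ := hc
    simp only [mem_shadow, h1, not_false_eq_true, true_and, not_not] at h2 h3
    obtain ⟨t, ht, hp⟩ := h3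
    rw [reflTransGen_av_flip] at hp
    have hvX : v ∉ X := by
      simp only [Finset.mem_union] at hv'
      tauto
    have := (swap_path hvX hp).2
    exact (mem_shadow.1 hvf).2 ⟨t, ht, by rwa [reflTransGen_av_flip]⟩

/-- Since `s` cannot be spared, some path between terminals meets `S` only in `s`. After its last
visit to `s` it starts from inside `X` and ends outside, hence passes through a boundary vertex that
still reaches a terminal in `G - S`. -/
theorem exists_boundary_not_shadow {R : V → V → Prop} {T S X : Finset V} (hS : Sol R T S)
    (hST : Disjoint S T) (hX : Disjoint X T) {s : V} (hsX : s ∈ X)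
    (hmin : ¬ Sol R T (S.erase s)) : ∃ y ∈ outN R X, y ∉ S ∧ y ∉ shadow R T S := by
  simp only [Sol, not_forall, not_not] at hmin
  obtain ⟨a, ha, b, hb, hab, hp⟩ := hmin
  have hbS : b ∉ S := Finset.disjoint_right.1 hST hb
  have hbX : b ∉ X := Finset.disjoint_right.1 hX hb
  -- Either the path avoids `S` altogether, or it is cut after its last visit to `s`.
  have key : ReflTransGen (Av R S) a b ∨ ∃ c, R s c ∧ c ∉ S ∧ ReflTransGen (Av R S) c b := by
    clear ha hab
    induction hp using ReflTransGen.head_induction_on with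
    | refl => exact .inl .refl
    | @head a c hac _ ih =>
      rcases ih with ih | ih
      · have hc := not_mem_of_reach hbS ih
        by_cases has : a = s
        · exact .inr ⟨c, has ▸ hac.1, hc, ih⟩
        · refine .inl (.head ⟨hac.1, fun h => hac.2.1 (Finset.mem_erase.2 ⟨has, h⟩), hc⟩ ih)
      · exact .inr ih
  rcases key with h | ⟨c, hsc, hcS, hcb⟩
  · exact absurd h (hS a ha b hb hab)
  · by_cases hcX : c ∈ X
    · obtain ⟨y, hy, hyS, hyb⟩ := exit_path hcX hbX hcb
      exact ⟨y, hy, hyS, fun h => (mem_shadow.1 h).2 ⟨b, hb, hyb⟩⟩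
    · exact ⟨c, mem_outN.2 ⟨hcX, s, hsX, hsc⟩, hcS, fun h => (mem_shadow.1 h).2 ⟨b, hb, hcb⟩⟩

/-- Exchanging the part of `S` inside `X` for the boundary of `X` makes `S` strictly larger. -/
def Tight (R : V → V → Prop) (K P S : Finset V) : Prop :=
  ∀ X, Feas R K P X → (X ∩ S).Nonempty → (X ∩ S).card < (outN R X \ S).card

/-- A smallest solution whose span is largest, with the largest reverse shadow among these. -/
structure Extremal (R : V → V → Prop) (T P S : Finset V) : Prop where
  sol : Sol R T S
  sub : S ⊆ P
  min : ∀ S', Sol R T S' → S' ⊆ P → S.card ≤ S'.card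
  span_le : ∀ S', Sol R T S' → S' ⊆ P → S'.card ≤ S.card →
    (span R T S').card ≤ (span R T S).card
  shadow_le : ∀ S', Sol R T S' → S' ⊆ P → S'.card ≤ S.card →
    (span R T S').card = (span R T S).card →
    (S' ∪ shadow R T S').card ≤ (S ∪ shadow R T S).card

theorem exists_extremal {R : V → V → Prop} {T P S₀ : Finset V} (h : Sol R T S₀) (hP : S₀ ⊆ P) :
    ∃ S, Extremal R T P S ∧ S.card ≤ S₀.card := by
  classical
  let F := Finset.univ.filter fun S => Sol R T S ∧ S ⊆ P
  have hF : ∀ S, S ∈ F ↔ Sol R T S ∧ S ⊆ P := fun S => by simp [F]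
  obtain ⟨S₁, h1, h1'⟩ := F.exists_min_image Finset.card ⟨S₀, (hF _).2 ⟨h, hP⟩⟩
  let F₂ := F.filter fun S => S.card ≤ S₁.card
  obtain ⟨S₂, h2, h2'⟩ := F₂.exists_max_image (fun S => (span R T S).card)
    ⟨S₁, Finset.mem_filter.2 ⟨h1, le_rfl⟩⟩
  let F₃ := F₂.filter fun S => (span R T S).card = (span R T S₂).card
  obtain ⟨S₃, h3, h3'⟩ := F₃.exists_max_image (fun S => (S ∪ shadow R T S).card)
    ⟨S₂, Finset.mem_filter.2 ⟨h2, rfl⟩⟩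
  obtain ⟨h3a, h3b⟩ := Finset.mem_filter.1 h3
  obtain ⟨h3c, h3d⟩ := Finset.mem_filter.1 h3a
  refine ⟨S₃, ⟨((hF _).1 h3c).1, ((hF _).1 h3c).2, ?_, ?_, ?_⟩, ?_⟩
  · intro S' hs hp
    exact h3d.trans (h1' _ ((hF _).2 ⟨hs, hp⟩))
  · intro S' hs hp hc
    rw [h3b]
    exact h2' _ (Finset.mem_filter.2 ⟨(hF _).2 ⟨hs, hp⟩, hc.trans h3d⟩)
  · intro S' hs hp hc he
    exact h3' _ (Finset.mem_filter.2 ⟨Finset.mem_filter.2 ⟨(hF _).2 ⟨hs, hp⟩, hc.trans h3d⟩,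
      he.trans h3b⟩)
  · exact h3d.trans (h1' _ ((hF _).2 ⟨h, hP⟩))

theorem Extremal.not_sol_erase {R : V → V → Prop} {T P S : Finset V} (h : Extremal R T P S)
    {s : V} (hs : s ∈ S) : ¬ Sol R T (S.erase s) := by
  intro hsol
  have := h.min _ hsol ((Finset.erase_subset _ _).trans h.sub)
  have := Finset.card_erase_lt_of_mem hs
  omega

theorem card_swapOut_le {R : V → V → Prop} {S X : Finset V}
    (h : (outN R X \ S).card ≤ (X ∩ S).card) : (swapOut R S X).card ≤ S.card := by
  have h1 : swapOut R S X ⊆ (S \ X) ∪ (outN R X \ S) := by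
    intro v
    simp only [swapOut, Finset.mem_union, Finset.mem_sdiff, mem_outN]
    tauto
  have h2 := (Finset.card_le_card h1).trans (Finset.card_union_le _ _)
  have h3 := Finset.card_sdiff_add_card_inter S X
  rw [Finset.inter_comm] at h3
  omega

/-- An exchange that does not enlarge `S` gives another smallest solution whose span, and whose
union with its shadow, contain the old ones. The choice of `S` forces equality in both, but the
boundary vertex from `exists_boundary_not_shadow` is newly cut off. -/
theorem Extremal.tight {R : V → V → Prop} {T P S : Finset V} (h : Extremal R T P S)
    (hPT : Disjoint P T) : Tight R T P S := by
  intro X hX hXS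
  by_contra hc
  push Not at hc
  obtain ⟨s, hs⟩ := hXS
  obtain ⟨hsX, hsS⟩ := Finset.mem_inter.1 hs
  have hcard := card_swapOut_le hc
  have hsol := h.sol.swapOut hX.1
  have hsub : swapOut R S X ⊆ P := Finset.union_subset (Finset.sdiff_subset.trans h.sub) hX.2
  have hsp := subset_span_swapOut (R := R) (S := S) hX.1
  have hr := subset_swapOut_union_shadow (R := R) (S := S) hX.1
  have hsp' := Finset.card_le_card (Finset.subset_union_left.trans hsp)
  have he := le_antisymm (h.span_le _ hsol hsub hcard) hsp'
  have hre := h.shadow_le _ hsol hsub hcard he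
  have hEq := Finset.eq_of_subset_of_card_le (Finset.subset_union_left.trans hr) hre
  obtain ⟨y, hy, hyS, hyr⟩ := exists_boundary_not_shadow h.sol (hPT.mono_left h.sub) hX.1 hsX
    (h.not_sol_erase hsS)
  have : y ∈ S ∪ shadow R T S := by
    rw [hEq]
    exact hr (Finset.mem_union_right _ (Finset.mem_union_right _ hy))
  simp only [Finset.mem_union] at this
  tauto

/-- Equality of the spans now places the boundary vertex from `exists_boundary_not_shadow` in the
shadow of the opposite orientation, which is part of `Z`. Forbidding the deletion of `Z` excludes
this, so no third extremality criterion is needed. -/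
theorem Extremal.tight_flip {R : V → V → Prop} {T P S Z : Finset V} (h : Extremal R T P S)
    (hPT : Disjoint P T) (hZ : shadow R T S ⊆ Z) : Tight (flip R) T (P \ Z) S := by
  intro X hX hXS
  by_contra hc
  push Not at hc
  obtain ⟨s, hs⟩ := hXS
  obtain ⟨hsX, hsS⟩ := Finset.mem_inter.1 hs
  have hcard := card_swapOut_le hc
  have hsol : Sol R T (swapOut (flip R) S X) := (h.sol.flip.swapOut hX.1).flip
  have hsub : swapOut (flip R) S X ⊆ P :=
    Finset.union_subset (Finset.sdiff_subset.trans h.sub) (hX.2.trans Finset.sdiff_subset)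
  have hsp := subset_span_swapOut (R := flip R) (S := S) hX.1
  rw [span_flip, span_flip] at hsp
  have hEq := Finset.eq_of_subset_of_card_le (Finset.subset_union_left.trans hsp)
    (h.span_le _ hsol hsub hcard)
  have hmin : ¬ Sol (flip R) T (S.erase s) := fun h' => h.not_sol_erase hsS h'.flip
  obtain ⟨y, hy, hyS, hyr⟩ := exists_boundary_not_shadow h.sol.flip (hPT.mono_left h.sub) hX.1 hsX
    hmin
  have : y ∈ span R T S := by
    rw [hEq]
    exact hsp (Finset.mem_union_right _ (Finset.mem_union_right _ hy))
  simp only [span, Finset.mem_union] at this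
  have := (Finset.mem_sdiff.1 (hX.2 hy)).2
  have := mt (@hZ y) this
  tauto

/-- Every larger feasible set has a larger boundary. -/
def Important (R : V → V → Prop) (K P X : Finset V) : Prop :=
  Feas R K P X ∧ ∀ B, Feas R K P B → X ⊆ B → (outN R B).card ≤ (outN R X).card → B = X

/-- The set is everything that is separated from the terminals by the part of `S` on which `v`
abuts. The last clause lets the pushing procedure recognize the complete boundary: once nothing of
the current cut is left, its deleted vertices already contain that boundary. -/
theorem exists_important_of_mem_shadow {R : V → V → Prop} {T P S : Finset V}
    (hS : S ⊆ P) (ht : Tight R T P S) {v : V}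
    (hv : v ∈ shadow R T S) : ∃ X, Important R T P X ∧ v ∈ X ∧ outN R X ⊆ S ∧
      ∀ A ⊆ X, v ∈ A → Disjoint (outN R A) X → outN R X ⊆ outN R A := by
  classical
  obtain ⟨hvS, hvT⟩ := mem_shadow.1 hv
  let A₀ : Finset V := Finset.univ.filter fun u => ReflTransGen (Av R S) v u
  have hA₀ : ∀ u, u ∈ A₀ ↔ ReflTransGen (Av R S) v u := fun u => by simp [A₀]
  let Y := outN R A₀
  have hYS : Y ⊆ S := by
    intro y hy
    obtain ⟨hy1, u, hu, hr⟩ := mem_outN.1 hy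
    by_contra hc
    exact hy1 ((hA₀ y).2 (((hA₀ u).1 hu).tail ⟨hr, not_mem_of_reach' hvS ((hA₀ u).1 hu), hc⟩))
  let X : Finset V := shadow R T Y
  have hX : ∀ u, u ∈ X ↔ u ∉ Y ∧ ¬ ∃ t ∈ T, ReflTransGen (Av R Y) u t := fun u => mem_shadow
  have hXT : Disjoint X T := by
    rw [Finset.disjoint_left]
    intro u hu ht
    exact ((hX u).1 hu).2 ⟨u, ht, .refl⟩
  have hA₀T : Disjoint A₀ T := by
    rw [Finset.disjoint_left]
    intro u hu ht
    exact hvT ⟨u, ht, (hA₀ u).1 hu⟩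
  have hA₀X : A₀ ⊆ X := by
    intro u hu
    refine (hX u).2 ⟨fun h => (mem_outN.1 h).1 hu, ?_⟩
    rintro ⟨t, ht, hp⟩
    exact Finset.disjoint_left.1 hA₀T (stay (Finset.Subset.refl _) hu hp) ht
  have hNX : outN R X = Y := by
    apply Finset.Subset.antisymm
    · intro y hy
      obtain ⟨hy1, u, hu, hr⟩ := mem_outN.1 hy
      by_contra hc
      rw [hX] at hy1 hu
      push Not at hy1
      obtain ⟨t, ht, hp⟩ := hy1 hc
      exact hu.2 ⟨t, ht, .head ⟨hr, hu.1, hc⟩ hp⟩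
    · intro y hy
      obtain ⟨hy1, u, hu, hr⟩ := mem_outN.1 hy
      exact mem_outN.2 ⟨fun h => ((hX y).1 h).1 hy, u, hA₀X hu, hr⟩
  have hfeas : Feas R T P X := ⟨hXT, by rw [hNX]; exact hYS.trans hS⟩
  refine ⟨X, ⟨hfeas, ?_⟩, hA₀X ((hA₀ v).2 .refl), by rw [hNX]; exact hYS, ?_⟩
  · intro B hB hXB hcard
    rw [hNX] at hcard
    have hYB : Y ⊆ B ∪ outN R B := by
      intro y hy
      rw [← hNX] at hy
      obtain ⟨-, u, hu, hr⟩ := mem_outN.1 hy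
      by_cases hyB : y ∈ B
      · exact Finset.mem_union_left _ hyB
      · exact Finset.mem_union_right _ (mem_outN.2 ⟨hyB, u, hXB hu, hr⟩)
    -- By tightness a competitor that meets `S` gains more boundary vertices outside `S` than it
    -- absorbs vertices of `Y`, so its boundary would be larger than `Y`.
    have hBS : ¬ (B ∩ S).Nonempty := by
      intro hne
      have h1 := ht B hB hne
      have h2 : (outN R B \ S).card ≤ (outN R B \ Y).card :=
        Finset.card_le_card (Finset.sdiff_subset_sdiff (Finset.Subset.refl _) hYS)
      have h3 : Y \ outN R B ⊆ B ∩ S := by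
        intro y hy
        obtain ⟨hy1, hy2⟩ := Finset.mem_sdiff.1 hy
        exact Finset.mem_inter.2 ⟨(Finset.mem_union.1 (hYB hy1)).resolve_right hy2, hYS hy1⟩
      have h3 := Finset.card_le_card h3
      have h4 := Finset.card_sdiff_add_card_inter (outN R B) Y
      have h5 := Finset.card_sdiff_add_card_inter Y (outN R B)
      rw [Finset.inter_comm] at h5
      omega
    have hYN : Y ⊆ outN R B := by
      intro y hy
      refine (Finset.mem_union.1 (hYB hy)).resolve_left fun h => ?_
      exact hBS ⟨y, Finset.mem_inter.2 ⟨h, hYS hy⟩⟩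
    have hEq : Y = outN R B := Finset.eq_of_subset_of_card_le hYN hcard
    refine Finset.Subset.antisymm ?_ hXB
    intro b hb
    refine (hX b).2 ⟨fun h => ?_, ?_⟩
    · rw [hEq] at h
      exact (mem_outN.1 h).1 hb
    · rintro ⟨t, ht, hp⟩
      exact Finset.disjoint_left.1 hB.1 (stay hEq.ge hb hp) ht
  · intro A hAX hvA hdis
    have : A₀ ⊆ A := by
      intro u hu
      have hp := (hA₀ u).1 hu
      clear hu
      induction hp with
      | refl => exact hvA
      | @tail b c h1 h2 ih =>
        by_contra hc
        exact Finset.disjoint_left.1 hdis (mem_outN.2 ⟨hc, b, ih, h2.1⟩)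
          (hA₀X ((hA₀ c).2 (h1.tail h2)))
    intro y hy
    have hyX := (mem_outN.1 hy).1
    rw [hNX] at hy
    obtain ⟨-, u, hu, hr⟩ := mem_outN.1 hy
    exact mem_outN.2 ⟨fun h => hyX (hAX h), u, this hu, hr⟩

end Cuts
end DirectedMultiwayCut

/-! ### A light family that hits the important sets meeting a tight set -/

namespace DirectedMultiwayCut
open Relation
set_option linter.unusedSectionVars false

section Counting
variable {V : Type*} [Fintype V] [DecidableEq V]

/-! ### Furthest minimizers -/

/-- `A` minimizes `f` on the family `𝓛` and contains every other minimizer. -/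
structure Furthest (𝓛 : Finset V → Prop) (f : Finset V → ℕ) (A : Finset V) : Prop where
  mem : 𝓛 A
  le : ∀ B, 𝓛 B → f A ≤ f B
  max : ∀ B, 𝓛 B → f B ≤ f A → B ⊆ A

/-- By submodularity the union of two minimizers is a minimizer, so a minimizer of largest
cardinality contains all others. -/
theorem exists_furthest {𝓛 : Finset V → Prop} {f : Finset V → ℕ}
    (hU : ∀ A B, 𝓛 A → 𝓛 B → 𝓛 (A ∪ B)) (hI : ∀ A B, 𝓛 A → 𝓛 B → 𝓛 (A ∩ B))
    (hf : ∀ A B, f (A ∪ B) + f (A ∩ B) ≤ f A + f B) (hne : ∃ A, 𝓛 A) :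
    ∃ A, Furthest 𝓛 f A := by
  classical
  obtain ⟨A₀, hA₀⟩ := hne
  let F := Finset.univ.filter fun A => 𝓛 A
  obtain ⟨A₁, h1, h1'⟩ := F.exists_min_image f ⟨A₀, by simp [F, hA₀]⟩
  let F₂ := F.filter fun A => f A ≤ f A₁
  obtain ⟨A₂, h2, h2'⟩ := F₂.exists_max_image Finset.card ⟨A₁, by simpa [F₂] using h1⟩
  simp only [F, F₂, Finset.mem_filter, Finset.mem_univ, true_and] at h1 h1' h2 h2'
  refine ⟨A₂, h2.1, fun B hB => h2.2.trans (h1' B hB), fun B hB hfB => ?_⟩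
  have h3 := hf A₂ B
  have h4 := h1' _ (hI _ _ h2.1 hB)
  have h5 := h2' (A₂ ∪ B) ⟨hU _ _ h2.1 hB, by omega⟩
  have h6 := Finset.eq_of_subset_of_card_le Finset.subset_union_left h5
  rw [h6]
  exact Finset.subset_union_right

/-- The feasible sets that contain `W` and neither meet nor touch `Q`. -/
def Far (R : V → V → Prop) (K P Q W A : Finset V) : Prop :=
  Feas R K P A ∧ W ⊆ A ∧ Disjoint (A ∪ outN R A) Q

theorem Far.union {R : V → V → Prop} {K P Q W A B : Finset V} (hA : Far R K P Q W A)
    (hB : Far R K P Q W B) : Far R K P Q W (A ∪ B) := by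
  refine ⟨hA.1.union hB.1, hA.2.1.trans Finset.subset_union_left, ?_⟩
  refine (Finset.disjoint_union_left.2 ⟨hA.2.2, hB.2.2⟩).mono_left ?_
  have := outN_union_subset R A B
  grind

theorem Far.inter {R : V → V → Prop} {K P Q W A B : Finset V} (hA : Far R K P Q W A)
    (hB : Far R K P Q W B) : Far R K P Q W (A ∩ B) := by
  refine ⟨hA.1.inter hB.1, Finset.subset_inter hA.2.1 hB.2.1, ?_⟩
  refine (Finset.disjoint_union_left.2 ⟨hA.2.2, hB.2.2⟩).mono_left ?_
  have := outN_inter_subset R A B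
  grind

theorem exists_furthest_far {R : V → V → Prop} {K P Q W : Finset V} (M : Finset V)
    (h : ∃ A, Far R K P Q W A) :
    ∃ A, Furthest (Far R K P Q W) (fun A => (outN R A \ M).card) A :=
  exists_furthest (fun _ _ => Far.union) (fun _ _ => Far.inter) (card_outN_submodular R M) h

theorem sum_biUnion_le_of_nonneg {ι α : Type*} [DecidableEq α] (s : Finset ι) (t : ι → Finset α)
    (w : α → ℚ) (hw : ∀ a, 0 ≤ w a) : ∑ a ∈ s.biUnion t, w a ≤ ∑ i ∈ s, ∑ a ∈ t i, w a := by
  classical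
  induction s using Finset.induction_on with
  | empty => simp
  | insert i s hi ih =>
    rw [Finset.biUnion_insert, Finset.sum_insert hi]
    have h := Finset.sum_union_inter (s₁ := t i) (s₂ := s.biUnion t) (f := w)
    have h' : 0 ≤ ∑ a ∈ t i ∩ s.biUnion t, w a := Finset.sum_nonneg fun a _ => hw a
    linarith

/-! ### Few important sets meet a tight set -/

/-- The important sets with small boundary that are consistent with a partial description. -/
structure Consistent (R : V → V → Prop) (K P : Finset V) (k : ℕ) (W Q D X : Finset V) : Prop where
  imp : Important R K P X
  card_le : (outN R X).card ≤ k
  sub : W ⊆ X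
  disj : Disjoint (X ∪ outN R X) Q
  del : D ⊆ outN R X

/-- Nonempty sets of at most `k` vertices outside `S`. -/
def Admissible (S : Finset V) (k : ℕ) (𝓕 : Finset (Finset V)) : Prop :=
  ∀ J ∈ 𝓕, J.Nonempty ∧ Disjoint J S ∧ J.card ≤ k

theorem Consistent.far {R : V → V → Prop} {K P : Finset V} {k : ℕ} {W Q D X : Finset V}
    (h : Consistent R K P k W Q D X) : Far R K P Q W X := ⟨h.imp.1, h.sub, h.disj⟩

theorem Consistent.card_add_card_le {R : V → V → Prop} {K P : Finset V} {k : ℕ}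
    {W Q D X : Finset V} (h : Consistent R K P k W Q D X) (S : Finset V) :
    D.card + (outN R X \ (S ∪ D)).card ≤ k := by
  refine le_trans ?_ h.card_le
  rw [← Finset.card_sdiff_add_card_eq_card h.del, add_comm]
  refine Nat.add_le_add_right (Finset.card_le_card ?_) _
  exact Finset.sdiff_subset_sdiff (Finset.Subset.refl _) Finset.subset_union_right

-- This shows that branching on the vertices of a few furthest cuts loses no consistent important
-- set. The cut value ignores `S`, so uncrossing `X` with a minimum cut might bring vertices of `S`
-- into the boundary free of charge. Forbidding the vertices of `S` away from `X` prevents it, and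
-- then importance of `X` forces the intersected cut into `X`.
theorem exists_separating_vertex {R : V → V → Prop} {K P S : Finset V} {k l : ℕ}
    {W Q D X : Finset V} (hX : Consistent R K P k W Q D X)
    (hl : ∀ A, Far R K P Q W A → l ≤ (outN R A \ (S ∪ D)).card) (hl0 : 0 < l)
    (B : Finset V → Finset V)
    (hB : ∀ Q', Q' = Q ∨ (∃ σ ∈ S \ (X ∪ outN R X), Q' = insert σ Q) →
      Far R K P Q' W (B Q') ∧ (outN R (B Q') \ (S ∪ D)).card = l) :
    ∃ Q', (Q' = Q ∨ ∃ σ ∈ S \ (X ∪ outN R X), Q' = insert σ Q) ∧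
      ∃ x ∈ outN R (B Q') \ (S ∪ D), x ∈ X ∪ outN R X := by
  classical
  -- It suffices to forbid these vertices one at a time, because the intersection of the resulting
  -- cuts avoids all of them. Thus `k + 1` cuts take the place of one for every subset of `S`.
  let QX := S \ (X ∪ outN R X)
  let 𝒬 : Finset (Finset V) := insert Q (QX.image fun σ => insert σ Q)
  have h𝒬 : ∀ Q', Q' ∈ 𝒬 ↔ Q' = Q ∨ ∃ σ ∈ QX, Q' = insert σ Q := by
    intro Q'
    simp only [𝒬, Finset.mem_insert, Finset.mem_image]
    simp only [eq_comm]
  have hne : 𝒬.Nonempty := ⟨Q, Finset.mem_insert_self _ _⟩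
  have hQ : ∀ Q' ∈ 𝒬, Q ⊆ Q' := by
    intro Q' hQ'
    rcases (h𝒬 Q').1 hQ' with rfl | ⟨σ, -, rfl⟩
    · exact Finset.Subset.refl _
    · exact Finset.subset_insert _ _
  -- The intersection of the minimum cuts is again a minimum cut with respect to `Q`.
  let A := 𝒬.inf' hne B
  have hA : Far R K P Q W A ∧ (outN R A \ (S ∪ D)).card ≤ l := by
    refine Finset.inf'_induction hne B (p := fun A => Far R K P Q W A ∧
      (outN R A \ (S ∪ D)).card ≤ l) ?_ ?_
    · rintro A₁ ⟨h1, h1'⟩ A₂ ⟨h2, h2'⟩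
      have h3 := card_outN_submodular R (S ∪ D) A₁ A₂
      have h4 := hl _ (h1.union h2)
      refine ⟨h1.inter h2, ?_⟩
      change (outN R (A₁ ∩ A₂) \ (S ∪ D)).card ≤ l
      omega
    · intro Q' hQ'
      obtain ⟨h1, h2⟩ := hB Q' ((h𝒬 Q').1 hQ')
      exact ⟨⟨h1.1, h1.2.1, h1.2.2.mono_right (hQ Q' hQ')⟩, h2.le⟩
  have hAB : ∀ Q' ∈ 𝒬, A ⊆ B Q' := fun Q' hQ' => Finset.inf'_le B hQ'
  have hAQ : Disjoint (A ∪ outN R A) QX := by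
    rw [Finset.disjoint_right]
    intro σ hσ hσA
    have hmem : insert σ Q ∈ 𝒬 := (h𝒬 _).2 (.inr ⟨σ, hσ, rfl⟩)
    have hσB := Finset.disjoint_right.1 (hB _ ((h𝒬 _).1 hmem)).1.2.2 (Finset.mem_insert_self σ Q)
    have := hAB _ hmem
    simp only [Finset.mem_union, mem_outN, not_or, not_and, not_exists] at hσA hσB
    rcases hσA with h | ⟨h, u, hu, hr⟩
    · exact hσB.1 (this h)
    · exact hσB.2 hσB.1 u (this hu) hr
  have hXA : X ∪ A = X := by
    refine hX.imp.2 _ (hX.imp.1.union hA.1.1) Finset.subset_union_left ?_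
    have h1 := card_outN_submodular R (S ∪ D) X A
    have h2 := hl _ (hX.far.inter hA.1)
    -- No uncounted vertex is new in the boundary: one in `S` would be a vertex of `QX` touched by
    -- `A`, and those of `D` are in the boundary of `X` anyway.
    have h3 : outN R (X ∪ A) ∩ (S ∪ D) ⊆ outN R X ∩ (S ∪ D) := by
      intro y hy
      obtain ⟨hy1, hy2⟩ := Finset.mem_inter.1 hy
      refine Finset.mem_inter.2 ⟨?_, hy2⟩
      obtain ⟨hy3, u, hu, hr⟩ := mem_outN.1 hy1
      rcases Finset.mem_union.1 hy2 with hyS | hyD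
      · by_contra hc
        have hyQ : y ∈ QX := by
          simp only [QX, Finset.mem_sdiff, Finset.mem_union]
          grind
        refine Finset.disjoint_right.1 hAQ hyQ ?_
        have huX : u ∉ X := fun h => hc (mem_outN.2 ⟨by grind, u, h, hr⟩)
        exact Finset.mem_union_right _ (mem_outN.2 ⟨by grind, u, by grind, hr⟩)
      · exact hX.del hyD
    have h4 := Finset.card_le_card h3
    have h5 := Finset.card_sdiff_add_card_inter (outN R (X ∪ A)) (S ∪ D)
    have h6 := Finset.card_sdiff_add_card_inter (outN R X) (S ∪ D)
    omega
  have hpos : (outN R A \ (S ∪ D)).Nonempty := by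
    rw [← Finset.card_pos]
    exact hl0.trans_le (hl _ hA.1)
  obtain ⟨x, hx⟩ := hpos
  obtain ⟨hx1, hx2⟩ := Finset.mem_sdiff.1 hx
  obtain ⟨hx3, u, hu, hr⟩ := mem_outN.1 hx1
  -- As `x` is not in the intersection, some `B Q'` misses it and, containing the predecessor `u` of
  -- `x`, has `x` in its boundary.
  have : ∃ Q' ∈ 𝒬, x ∉ B Q' := by
    by_contra hc
    push Not at hc
    refine hx3 ?_
    have : ({x} : Finset V) ≤ A := Finset.le_inf' hne B fun Q' hQ' => by
      simpa using hc Q' hQ'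
    exact this (Finset.mem_singleton_self x)
  obtain ⟨Q', hQ', hxB⟩ := this
  refine ⟨Q', (h𝒬 Q').1 hQ', x, Finset.mem_sdiff.2 ⟨mem_outN.2 ⟨hxB, u, hAB Q' hQ' hu, hr⟩, hx2⟩, ?_⟩
  have huX : u ∈ X := hXA ▸ Finset.mem_union_right X hu
  by_cases h : x ∈ X
  · exact Finset.mem_union_left _ h
  · exact Finset.mem_union_right _ (mem_outN.2 ⟨h, u, huX, hr⟩)

/-- A branching tree for the unknown `X`: `W` records vertices known to be inside, `D` boundary
vertices outside `S`, `Q` vertices kept away from the closure of `X`. The leaves are the sets `D`.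
The weight `θ ^ |D| * ρ ^ l` bounds the subtree: pushing gains a factor `ρ`, deleting a factor `θ /
ρ`, and there are at most `(k + 1) * k` vertices to branch on. Either choice raises `2 * |D| + l`,
which the fuel `n` measures. -/
theorem exists_hitting_family_aux {R : V → V → Prop} {K P S : Finset V} {k : ℕ}
    (ht : Tight R K P S) (hS : S.card ≤ k) {ρ θ : ℚ} (hρ : 0 < ρ) (hρ1 : ρ ≤ 1) (hθ : 0 < θ)
    (hsum : (k + 1) * (k * (ρ + θ / ρ)) ≤ 1) (n : ℕ) :
    ∀ (W Q D : Finset V) (l : ℕ), 2 * k + 1 ≤ n + 2 * D.card + l → (W ∩ S).Nonempty →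
      Disjoint D S → (∀ A, Far R K P Q W A → l ≤ (outN R A \ (S ∪ D)).card) →
      ∃ 𝓕 : Finset (Finset V), Admissible S k 𝓕 ∧
        ∑ J ∈ 𝓕, θ ^ J.card ≤ θ ^ D.card * ρ ^ l ∧
        ∀ X, Consistent R K P k W Q D X → ∃ J ∈ 𝓕, J ⊆ outN R X := by
  classical
  induction n with
  | zero =>
    intro W Q D l hn _ _ hl
    -- Here `2 * |D| + l > 2 * k`, which contradicts `|D| + l ≤ k` for any consistent set.
    refine ⟨∅, by simp [Admissible], by simp; positivity, fun X hX => ?_⟩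
    have := hX.card_add_card_le S
    have := hl _ hX.far
    omega
  | succ n ih =>
    intro W Q D l hn hW hD hl
    by_cases hempty : ∀ X, ¬ Consistent R K P k W Q D X
    · exact ⟨∅, by simp [Admissible], by simp; positivity, fun X hX => absurd hX (hempty X)⟩
    push Not at hempty
    obtain ⟨X₀, hX₀⟩ := hempty
    obtain ⟨A₀, hA₀⟩ := exists_furthest_far (S ∪ D) ⟨X₀, hX₀.far⟩
    obtain ⟨m, hm⟩ : ∃ m, m = (outN R A₀ \ (S ∪ D)).card := ⟨_, rfl⟩
    have hlm : l ≤ m := hm ▸ hl _ hA₀.mem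
    have hmin : ∀ A, Far R K P Q W A → m ≤ (outN R A \ (S ∪ D)).card :=
      fun A hA => hm ▸ hA₀.le A hA
    have hXk := hX₀.card_add_card_le S
    have hmk : D.card + m ≤ k := le_trans (Nat.add_le_add_left (hmin _ hX₀.far) _) hXk
    have hpow : θ ^ D.card * ρ ^ m ≤ θ ^ D.card * ρ ^ l :=
      mul_le_mul_of_nonneg_left (pow_le_pow_of_le_one hρ.le hρ1 hlm) (by positivity)
    rcases Nat.eq_zero_or_pos m with hm0 | hm0
    -- The boundary of `A₀` outside `S` is exhausted by `D`. As `A₀` meets `S`, tightness makes `D`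
    -- nonempty, so `D` is an admissible leaf.
    · refine ⟨{D}, ?_, ?_, fun X hX => ⟨D, Finset.mem_singleton_self D, hX.del⟩⟩
      · intro J hJ
        rw [Finset.mem_singleton.1 hJ]
        refine ⟨?_, hD, by omega⟩
        have h1 := ht A₀ hA₀.mem.1 (hW.mono (Finset.inter_subset_inter hA₀.mem.2.1
          (Finset.Subset.refl _)))
        have h2 : outN R A₀ \ S ⊆ D := by
          have h3 : outN R A₀ \ (S ∪ D) = ∅ := Finset.card_eq_zero.1 (by omega)
          intro y hy
          by_contra hc
          have : y ∈ outN R A₀ \ (S ∪ D) := by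
            simp only [Finset.mem_sdiff, Finset.mem_union] at hy ⊢
            tauto
          rw [h3] at this
          exact absurd this (Finset.notMem_empty _)
        rw [← Finset.card_pos]
        have := Finset.card_le_card h2
        omega
      · simp only [Finset.sum_singleton]
        refine le_trans (le_of_eq ?_) hpow
        rw [hm0]
        simp
    -- For a given `Q'` either the cut value exceeds `m` and a single recursive call serves, or a
    -- furthest cut of value `m` exists and each of its vertices is pushed or deleted.
    · have hstep : ∀ Q', Q ⊆ Q' → ∃ (𝓕 : Finset (Finset V)) (A' : Finset V),
          Admissible S k 𝓕 ∧
          ∑ J ∈ 𝓕, θ ^ J.card ≤ k * (ρ + θ / ρ) * (θ ^ D.card * ρ ^ m) ∧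
          (((∀ A, Far R K P Q' W A → m + 1 ≤ (outN R A \ (S ∪ D)).card) ∧
              ∀ X, Consistent R K P k W Q' D X → ∃ J ∈ 𝓕, J ⊆ outN R X) ∨
            (Far R K P Q' W A' ∧ (outN R A' \ (S ∪ D)).card = m ∧
              ∀ X, Consistent R K P k W Q' D X → ∀ x ∈ outN R A' \ (S ∪ D), x ∈ X ∪ outN R X →
                ∃ J ∈ 𝓕, J ⊆ outN R X)) := by
        intro Q' hQQ'
        have hfar : ∀ {W' A}, W ⊆ W' → Far R K P Q' W' A → Far R K P Q W A := fun hw h =>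
          ⟨h.1, hw.trans h.2.1, h.2.2.mono_right hQQ'⟩
        by_cases hQ' : ∀ A, Far R K P Q' W A → m + 1 ≤ (outN R A \ (S ∪ D)).card
        · obtain ⟨𝓕, h1, h2, h3⟩ := ih W Q' D (m + 1) (by omega) hW hD hQ'
          refine ⟨𝓕, ∅, h1, h2.trans ?_, .inl ⟨hQ', h3⟩⟩
          have hk1 : (1 : ℚ) ≤ k := by
            have : 1 ≤ k := by omega
            exact_mod_cast this
          have : ρ ≤ k * (ρ + θ / ρ) := by
            have : 0 < θ / ρ := by positivity
            nlinarith
          calc θ ^ D.card * ρ ^ (m + 1) = ρ * (θ ^ D.card * ρ ^ m) := by ring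
            _ ≤ _ := mul_le_mul_of_nonneg_right this (by positivity)
        · push Not at hQ'
          obtain ⟨A₁, hA₁, hA₁'⟩ := hQ'
          obtain ⟨A', hA'⟩ := exists_furthest_far (S ∪ D) ⟨A₁, hA₁⟩
          have hA'm : (outN R A' \ (S ∪ D)).card = m := by
            have := hA'.le _ hA₁
            have := hmin _ (hfar (Finset.Subset.refl _) hA'.mem)
            omega
          -- A cut of value `m` containing `x` would lie in the furthest cut `A'`, whereas `x` is on
          -- the boundary of `A'`; so pushing raises the value.
          have hpush : ∀ x ∈ outN R A' \ (S ∪ D), ∃ 𝓕 : Finset (Finset V), Admissible S k 𝓕 ∧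
              ∑ J ∈ 𝓕, θ ^ J.card ≤ θ ^ D.card * ρ ^ (m + 1) ∧
              ∀ X, Consistent R K P k (insert x W) Q' D X → ∃ J ∈ 𝓕, J ⊆ outN R X := by
            intro x hx
            refine ih (insert x W) Q' D (m + 1) (by omega) (hW.mono (Finset.inter_subset_inter
              (Finset.subset_insert _ _) (Finset.Subset.refl _))) hD ?_
            intro A hA
            by_contra hc
            have := hA'.max A ⟨hA.1, (Finset.subset_insert _ _).trans hA.2.1, hA.2.2⟩ (by omega)
            have hxA := this (hA.2.1 (Finset.mem_insert_self _ _))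
            exact (mem_outN.1 (Finset.mem_sdiff.1 hx).1).1 hxA
          have hdel : ∀ x ∈ outN R A' \ (S ∪ D), ∃ 𝓕 : Finset (Finset V), Admissible S k 𝓕 ∧
              ∑ J ∈ 𝓕, θ ^ J.card ≤ θ ^ (D.card + 1) * ρ ^ (m - 1) ∧
              ∀ X, Consistent R K P k W Q' (insert x D) X → ∃ J ∈ 𝓕, J ⊆ outN R X := by
            intro x hx
            have hx' := (Finset.mem_sdiff.1 hx).2
            simp only [Finset.mem_union, not_or] at hx'
            have hcard : (insert x D).card = D.card + 1 := Finset.card_insert_of_notMem hx'.2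
            rw [← hcard]
            refine ih W Q' (insert x D) (m - 1) (by omega) hW
              (Finset.disjoint_insert_left.2 ⟨hx'.1, hD⟩) ?_
            intro A hA
            have h1 := hmin _ (hfar (Finset.Subset.refl _) hA)
            have h2 : outN R A \ (S ∪ D) ⊆ insert x (outN R A \ (S ∪ insert x D)) := by
              intro y
              simp only [Finset.mem_sdiff, Finset.mem_union, Finset.mem_insert]
              tauto
            have h3 := (Finset.card_le_card h2).trans (Finset.card_insert_le _ _)
            omega
          choose! 𝓕₁ h11 h12 h13 using hpush
          choose! 𝓕₂ h21 h22 h23 using hdel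
          refine ⟨(outN R A' \ (S ∪ D)).biUnion fun x => 𝓕₁ x ∪ 𝓕₂ x, A', ?_, ?_,
            .inr ⟨hA'.mem, hA'm, ?_⟩⟩
          · intro J hJ
            obtain ⟨x, hx, hJ⟩ := Finset.mem_biUnion.1 hJ
            rcases Finset.mem_union.1 hJ with hJ | hJ
            · exact h11 x hx J hJ
            · exact h21 x hx J hJ
          · refine (sum_biUnion_le_of_nonneg _ _ _ fun a => by positivity).trans ?_
            have hx : ∀ x ∈ outN R A' \ (S ∪ D), ∑ J ∈ 𝓕₁ x ∪ 𝓕₂ x, θ ^ J.card ≤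
                (ρ + θ / ρ) * (θ ^ D.card * ρ ^ m) := by
              intro x hx
              have h := Finset.sum_union_inter (s₁ := 𝓕₁ x) (s₂ := 𝓕₂ x)
                (f := fun J => θ ^ J.card)
              have h' : 0 ≤ ∑ J ∈ 𝓕₁ x ∩ 𝓕₂ x, θ ^ J.card :=
                Finset.sum_nonneg fun a _ => by positivity
              have h1 := h12 x hx
              have h2 := h22 x hx
              -- Together the two branches at `x` cost the factor `ρ + θ / ρ`.
              have h3 : θ ^ D.card * ρ ^ (m + 1) + θ ^ (D.card + 1) * ρ ^ (m - 1) =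
                  (ρ + θ / ρ) * (θ ^ D.card * ρ ^ m) := by
                obtain ⟨j, rfl⟩ : ∃ j, m = j + 1 := ⟨m - 1, by omega⟩
                simp only [Nat.add_sub_cancel]
                field_simp
                ring
              linarith
            refine (Finset.sum_le_card_nsmul _ _ _ hx).trans ?_
            rw [hA'm, nsmul_eq_mul, mul_assoc]
            refine mul_le_mul_of_nonneg_right ?_ (by positivity)
            have : m ≤ k := by omega
            exact_mod_cast this
          · intro X hX x hx hxX
            rcases Finset.mem_union.1 hxX with h | h
            · obtain ⟨J, hJ, hJX⟩ := h13 x hx X ⟨hX.imp, hX.card_le,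
                Finset.insert_subset h hX.sub, hX.disj, hX.del⟩
              exact ⟨J, Finset.mem_biUnion.2 ⟨x, hx, Finset.mem_union_left _ hJ⟩, hJX⟩
            · obtain ⟨J, hJ, hJX⟩ := h23 x hx X ⟨hX.imp, hX.card_le, hX.sub, hX.disj,
                Finset.insert_subset h hX.del⟩
              exact ⟨J, Finset.mem_biUnion.2 ⟨x, hx, Finset.mem_union_right _ hJ⟩, hJX⟩
      choose! 𝓕 B h1 h2 h3 using hstep
      let 𝒬 : Finset (Finset V) := insert Q (S.image fun σ => insert σ Q)
      have h𝒬 : ∀ Q' ∈ 𝒬, Q ⊆ Q' := by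
        intro Q' hQ'
        simp only [𝒬, Finset.mem_insert, Finset.mem_image] at hQ'
        rcases hQ' with rfl | ⟨σ, -, rfl⟩
        · exact Finset.Subset.refl _
        · exact Finset.subset_insert _ _
      have hcard : 𝒬.card ≤ k + 1 :=
        (Finset.card_insert_le _ _).trans (Nat.add_le_add_right (Finset.card_image_le.trans hS) 1)
      refine ⟨𝒬.biUnion 𝓕, ?_, ?_, ?_⟩
      · intro J hJ
        obtain ⟨Q', hQ', hJ⟩ := Finset.mem_biUnion.1 hJ
        exact h1 Q' (h𝒬 Q' hQ') J hJ
      · refine (sum_biUnion_le_of_nonneg _ _ _ fun a => by positivity).trans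
          ((Finset.sum_le_card_nsmul _ _ _ fun Q' hQ' => h2 Q' (h𝒬 Q' hQ')).trans
            (le_trans ?_ hpow))
        rw [nsmul_eq_mul, ← mul_assoc]
        have h4 : 0 ≤ θ ^ D.card * ρ ^ m := by positivity
        have h5 : (𝒬.card : ℚ) ≤ k + 1 := by exact_mod_cast hcard
        have h6 : 0 ≤ k * (ρ + θ / ρ) := by positivity
        have h7 : (𝒬.card : ℚ) * (k * (ρ + θ / ρ)) ≤ 1 :=
          (mul_le_mul_of_nonneg_right h5 h6).trans hsum
        exact mul_le_of_le_one_left h4 h7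
      · intro X hX
        have hcons : ∀ σ ∈ S \ (X ∪ outN R X), Consistent R K P k W (insert σ Q) D X :=
          fun σ hσ => ⟨hX.imp, hX.card_le, hX.sub,
            Finset.disjoint_insert_right.2 ⟨(Finset.mem_sdiff.1 hσ).2, hX.disj⟩, hX.del⟩
        have hmem : ∀ σ ∈ S \ (X ∪ outN R X), insert σ Q ∈ 𝒬 := fun σ hσ =>
          Finset.mem_insert_of_mem (Finset.mem_image_of_mem _ (Finset.mem_sdiff.1 hσ).1)
        have hQ𝒬 : Q ∈ 𝒬 := Finset.mem_insert_self _ _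
        have hQ3 := (h3 Q (Finset.Subset.refl _)).resolve_left fun h => by
          have := h.1 A₀ hA₀.mem
          omega
        -- If forbidding some `σ` raises the cut value, the recursive call for it already covers
        -- `X`. Otherwise all the cuts have value `m`, and the separating vertex selects a branch.
        by_cases hex : ∃ σ ∈ S \ (X ∪ outN R X),
            ∀ A, Far R K P (insert σ Q) W A → m + 1 ≤ (outN R A \ (S ∪ D)).card
        · obtain ⟨σ, hσ, hA⟩ := hex
          have hσ3 := (h3 _ (h𝒬 _ (hmem σ hσ))).resolve_right fun h => by
            have := hA _ h.1
            omega
          obtain ⟨J, hJ, hJX⟩ := hσ3.2 X (hcons σ hσ)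
          exact ⟨J, Finset.mem_biUnion.2 ⟨_, hmem σ hσ, hJ⟩, hJX⟩
        · push Not at hex
          have hB : ∀ Q', Q' = Q ∨ (∃ σ ∈ S \ (X ∪ outN R X), Q' = insert σ Q) →
              Q' ∈ 𝒬 ∧ Consistent R K P k W Q' D X ∧ Far R K P Q' W (B Q') ∧
                (outN R (B Q') \ (S ∪ D)).card = m ∧
              ∀ X, Consistent R K P k W Q' D X → ∀ x ∈ outN R (B Q') \ (S ∪ D),
                x ∈ X ∪ outN R X → ∃ J ∈ 𝓕 Q', J ⊆ outN R X := by
            rintro Q' (rfl | ⟨σ, hσ, rfl⟩)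
            · exact ⟨hQ𝒬, hX, hQ3⟩
            · refine ⟨hmem σ hσ, hcons σ hσ, (h3 _ (h𝒬 _ (hmem σ hσ))).resolve_left fun h => ?_⟩
              obtain ⟨A, hA, hA'⟩ := hex σ hσ
              have := h.1 A hA
              omega
          obtain ⟨Q', hQ', x, hx, hxX⟩ := exists_separating_vertex hX hmin hm0 B
            fun Q' hQ' => ⟨(hB Q' hQ').2.2.1, (hB Q' hQ').2.2.2.1⟩
          obtain ⟨h4, h5, -, -, h6⟩ := hB Q' hQ'
          obtain ⟨J, hJ, hJX⟩ := h6 X h5 x hx hxX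
          exact ⟨J, Finset.mem_biUnion.2 ⟨Q', h4, hJ⟩, hJX⟩

/-- One tree for every vertex `w ∈ S` that `X` may contain. Tightness allows each tree to start at
cut value `1`, so the total weight is at most `k * ρ < 1`. -/
theorem exists_hitting_family {R : V → V → Prop} {K P S : Finset V} {k : ℕ}
    (ht : Tight R K P S) (hS : S.card ≤ k) {θ : ℚ} (hθ : 0 < θ) (hθ' : θ * (4 * (k + 1) ^ 4) ≤ 1) :
    ∃ 𝓕 : Finset (Finset V), Admissible S k 𝓕 ∧ ∑ J ∈ 𝓕, θ ^ J.card < 1 ∧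
      ∀ X, Important R K P X → (outN R X).card ≤ k → (X ∩ S).Nonempty →
        ∃ J ∈ 𝓕, J ⊆ outN R X := by
  classical
  -- The hypothesis says `θ ≤ ρ ^ 2`, hence `θ / ρ ≤ ρ`, and `(k + 1) ^ 2 * (2 * ρ) = 1` pays for
  -- the branching.
  obtain ⟨ρ, hρ⟩ : ∃ ρ : ℚ, ρ = 1 / (2 * (k + 1) ^ 2) := ⟨_, rfl⟩
  have hk : (0 : ℚ) ≤ k := Nat.cast_nonneg k
  have hρ0 : 0 < ρ := by rw [hρ]; positivity
  have hρ2 : ρ * (k + 1) ^ 2 = 1 / 2 := by rw [hρ]; field_simp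
  have hρ1 : ρ ≤ 1 := by nlinarith
  have hθρ : θ / ρ ≤ ρ := by
    rw [div_le_iff₀ hρ0, hρ]
    rw [← le_div_iff₀ (by positivity)] at hθ'
    refine hθ'.trans (le_of_eq ?_)
    field_simp
    norm_num
  have hsum : (k + 1) * (k * (ρ + θ / ρ)) ≤ 1 := by
    have h1 : k * (ρ + θ / ρ) ≤ (k + 1) * (2 * ρ) :=
      mul_le_mul (by linarith) (by linarith) (by positivity) (by positivity)
    have h2 := mul_le_mul_of_nonneg_left h1 (by positivity : (0 : ℚ) ≤ k + 1)
    nlinarith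
  have h : ∀ w ∈ S, ∃ 𝓕 : Finset (Finset V), Admissible S k 𝓕 ∧
      ∑ J ∈ 𝓕, θ ^ J.card ≤ θ ^ (∅ : Finset V).card * ρ ^ 1 ∧
      ∀ X, Consistent R K P k {w} ∅ ∅ X → ∃ J ∈ 𝓕, J ⊆ outN R X := by
    intro w hw
    refine exists_hitting_family_aux ht hS hρ0 hρ1 hθ hsum (2 * k) {w} ∅ ∅ 1 (by simp)
      ⟨w, by simp [hw]⟩ (by simp) ?_
    intro A hA
    have := ht A hA.1 ⟨w, Finset.mem_inter.2 ⟨hA.2.1 (Finset.mem_singleton_self w), hw⟩⟩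
    simp only [Finset.union_empty]
    omega
  choose! 𝓕 h1 h2 h3 using h
  refine ⟨S.biUnion 𝓕, ?_, ?_, ?_⟩
  · intro J hJ
    obtain ⟨w, hw, hJ⟩ := Finset.mem_biUnion.1 hJ
    exact h1 w hw J hJ
  · refine lt_of_le_of_lt ((sum_biUnion_le_of_nonneg _ _ _ fun a => by positivity).trans
      (Finset.sum_le_card_nsmul _ _ _ h2)) ?_
    have : (S.card : ℚ) ≤ k := by exact_mod_cast hS
    simp only [Finset.card_empty, pow_zero, one_mul, pow_one, nsmul_eq_mul]
    nlinarith
  · rintro X hX hk ⟨w, hw⟩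
    obtain ⟨hwX, hwS⟩ := Finset.mem_inter.1 hw
    obtain ⟨J, hJ, hJX⟩ := h3 w hwS X ⟨hX, hk, by simpa using hwX, by simp, by simp⟩
    exact ⟨J, Finset.mem_biUnion.2 ⟨w, hwS, hJ⟩, hJX⟩

end Counting
end DirectedMultiwayCut

/-! ### Derandomization by linear recurring sequences -/

namespace DirectedMultiwayCut

/-! ### Linear recurrences over the field with two elements -/

/-- `z` is a 0-1 sequence with the linear recurrence modulo 2 of order `m` and coefficients `a`. -/
structure Recurrence (m : ℕ) (a z : ℕ → ℕ) : Prop where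
  step : ∀ i, z (i + m) = (∑ j ∈ Finset.range m, a j * z (i + j)) % 2
  le : ∀ i, z i ≤ 1
  coeff : ∀ i, a i ≤ 1

/-- Each nonempty `c` is the support of a nonzero polynomial with at most `n` roots. The field has
more elements than all these polynomials have roots. -/
theorem exists_powers_not_sum_zero {K : Type*} [Field K] [Fintype K] [DecidableEq K]
    (𝓔 : Finset (Finset ℕ)) (n b : ℕ) (hn : ∀ E ∈ 𝓔, ∀ e ∈ E, e < n) (hb : ∀ E ∈ 𝓔, E.card ≤ b)
    (hcard : 𝓔.card * 2 ^ b * n < Fintype.card K) :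
    ∃ x : K, ∀ E ∈ 𝓔, ∀ c ⊆ E, c.Nonempty → ∑ e ∈ c, x ^ e ≠ 0 := by
  classical
  let p : Finset ℕ → Polynomial K := fun c => ∑ e ∈ c, Polynomial.X ^ e
  have hcoef : ∀ c e, (p c).coeff e = if e ∈ c then 1 else 0 := by
    intro c e
    simp [p, Polynomial.finsetSum_coeff, Polynomial.coeff_X_pow]
  have hp0 : ∀ c : Finset ℕ, c.Nonempty → p c ≠ 0 := by
    rintro c ⟨e, he⟩ h
    have := hcoef c e
    simp [h, he] at this
  let Bad : Finset K := 𝓔.biUnion fun E => E.powerset.biUnion fun c =>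
    if c.Nonempty then (p c).roots.toFinset else ∅
  have hBad : Bad.card < Fintype.card K := by
    refine lt_of_le_of_lt ?_ hcard
    rw [mul_assoc]
    refine Finset.card_biUnion_le_card_mul _ _ _ fun E hE => ?_
    refine (Finset.card_biUnion_le_card_mul _ _ n fun c hc => ?_).trans
      (Nat.mul_le_mul_right n ?_)
    · split_ifs with h
      · refine (Multiset.toFinset_card_le _).trans ((Polynomial.card_roots' _).trans ?_)
        refine Polynomial.natDegree_sum_le_of_forall_le _ _ fun e he => ?_
        rw [Polynomial.natDegree_X_pow]
        exact (hn E hE e (Finset.mem_powerset.1 hc he)).le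
      · simp
    · rw [Finset.card_powerset]
      exact Nat.pow_le_pow_right (by norm_num) (hb E hE)
  obtain ⟨x, hx⟩ : ∃ x, x ∉ Bad := by
    by_contra hc
    push Not at hc
    have : Bad = Finset.univ := Finset.eq_univ_iff_forall.2 hc
    rw [this, Finset.card_univ] at hBad
    exact lt_irrefl _ hBad
  refine ⟨x, fun E hE c hc hne h0 => hx ?_⟩
  refine Finset.mem_biUnion.2 ⟨E, hE, Finset.mem_biUnion.2 ⟨c, Finset.mem_powerset.2 hc, ?_⟩⟩
  rw [if_pos hne, Multiset.mem_toFinset, Polynomial.mem_roots (hp0 c hne), Polynomial.IsRoot]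
  simpa [p, Polynomial.eval_finsetSum] using h0

/-- Over the field with two elements a linear relation is just a vanishing sum over a subset. -/
theorem linearIndependent_of_sum_ne_zero {K : Type*} [Field K] [Algebra (ZMod 2) K] (x : K)
    (E : Finset ℕ) (h : ∀ c ⊆ E, c.Nonempty → ∑ e ∈ c, x ^ e ≠ 0) :
    LinearIndependent (ZMod 2) fun e : E => x ^ (e : ℕ) := by
  classical
  rw [Fintype.linearIndependent_iff]
  intro g hg
  by_contra hc
  push Not at hc
  obtain ⟨e, he⟩ := hc
  have h1 : ∀ y : ZMod 2, y ≠ 0 → y = 1 := by decide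
  let c : Finset E := Finset.univ.filter fun e => g e ≠ 0
  refine h (c.map ⟨Subtype.val, Subtype.val_injective⟩) ?_ ?_ ?_
  · intro i hi
    obtain ⟨i, -, rfl⟩ := Finset.mem_map.1 hi
    exact i.2
  · exact ⟨e, Finset.mem_map.2 ⟨e, by simp [c, he], rfl⟩⟩
  · rw [Finset.sum_map, ← hg, Finset.sum_filter]
    refine Finset.sum_congr rfl fun i _ => ?_
    by_cases hi : g i = 0
    · simp [hi]
    · simp [h1 _ hi]

theorem exists_linearMap_of_linearIndependent {F K ι : Type*} [Field F] [AddCommGroup K]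
    [Module F K] {v : ι → K} (hv : LinearIndependent F v) (g : ι → F) :
    ∃ ℓ : K →ₗ[F] F, ∀ i, ℓ (v i) = g i := by
  obtain ⟨ℓ, hℓ⟩ := LinearMap.exists_extend
    ((Finsupp.linearCombination F g).comp hv.repr)
  refine ⟨ℓ, fun i => ?_⟩
  have hi : v i ∈ Submodule.span F (Set.range v) := Submodule.subset_span ⟨i, rfl⟩
  have h1 := LinearMap.congr_fun hℓ ⟨v i, hi⟩
  simp only [LinearMap.comp_apply, Submodule.subtype_apply] at h1
  rw [h1]
  have : hv.repr ⟨v i, hi⟩ = Finsupp.single i 1 := hv.repr_eq_single i _ rfl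
  simp [this]

-- Union bound over the functionals that vanish at the positions in `ES`. By linear independence the
-- values at `E` are free, so at most a fraction `2 ^ (-|E|)` of these functionals vanishes on `E`
-- as well.
open Classical in
theorem exists_functional {K : Type*} [Field K] [Finite K] [Algebra (ZMod 2) K] (x : K)
    (ES : Finset ℕ) (𝓔 : Finset (Finset ℕ))
    (hli : ∀ E ∈ 𝓔, LinearIndependent (ZMod 2) fun e : (ES ∪ E : Finset ℕ) => x ^ (e : ℕ))
    (hdis : ∀ E ∈ 𝓔, Disjoint ES E) (hsum : ∑ E ∈ 𝓔, (1 / 2 : ℚ) ^ E.card < 1) :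
    ∃ ℓ : K →ₗ[ZMod 2] ZMod 2, (∀ e ∈ ES, ℓ (x ^ e) = 0) ∧
      ∀ E ∈ 𝓔, ∃ e ∈ E, ℓ (x ^ e) ≠ 0 := by
  have : Finite (K →ₗ[ZMod 2] ZMod 2) := DFunLike.finite _
  let _ := Fintype.ofFinite (K →ₗ[ZMod 2] ZMod 2)
  let A : Finset (K →ₗ[ZMod 2] ZMod 2) := Finset.univ.filter fun ℓ => ∀ e ∈ ES, ℓ (x ^ e) = 0
  let B : Finset ℕ → Finset (K →ₗ[ZMod 2] ZMod 2) := fun E => A.filter fun ℓ =>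
    ∀ e ∈ E, ℓ (x ^ e) = 0
  have hAB : ∀ E ∈ 𝓔, (B E).card * 2 ^ E.card ≤ A.card := by
    intro E hE
    have hsec : ∀ g : E → ZMod 2, ∃ ℓ : K →ₗ[ZMod 2] ZMod 2, (∀ e ∈ ES, ℓ (x ^ e) = 0) ∧
        ∀ e : E, ℓ (x ^ (e : ℕ)) = g e := by
      intro g
      obtain ⟨ℓ, hℓ⟩ := exists_linearMap_of_linearIndependent (hli E hE)
        fun e => if h : (e : ℕ) ∈ E then g ⟨e, h⟩ else 0
      refine ⟨ℓ, fun e he => ?_, fun e => ?_⟩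
      · have := hℓ ⟨e, Finset.mem_union_left _ he⟩
        simpa [Finset.disjoint_left.1 (hdis E hE) he] using this
      · have := hℓ ⟨e, Finset.mem_union_right _ e.2⟩
        simpa using this
    choose s hs1 hs2 using hsec
    have hc : Fintype.card (E → ZMod 2) = 2 ^ E.card := by simp [ZMod.card]
    rw [← hc, ← Finset.card_univ, ← Finset.card_product]
    -- Adding to a functional that vanishes on `E` a correction with prescribed values on `E` is
    -- injective, since the values on `E` recover the correction.
    refine Finset.card_le_card_of_injOn (fun q => q.1 + s q.2) ?_ ?_
    · rintro ⟨ℓ, g⟩ hq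
      simp only [Finset.coe_product, Set.mem_prod, Finset.mem_coe, B, A, Finset.mem_filter,
        Finset.mem_univ, true_and] at hq ⊢
      intro e he
      simp [hq.1.1 e he, hs1 g e he]
    · rintro ⟨ℓ, g⟩ hq ⟨ℓ', g'⟩ hq' heq
      simp only [Finset.coe_product, Set.mem_prod, Finset.mem_coe, B, A, Finset.mem_filter,
        Finset.mem_univ, true_and] at hq hq'
      have hgg : g = g' := by
        funext e
        have := LinearMap.congr_fun heq (x ^ (e : ℕ))
        simpa [hq.1.2 e e.2, hq'.1.2 e e.2, hs2] using this
      subst hgg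
      simpa using heq
  have hA0 : 0 < A.card := Finset.card_pos.2 ⟨0, by simp [A]⟩
  have hlt : (𝓔.biUnion B).card < A.card := by
    have h1 : ((𝓔.biUnion B).card : ℚ) ≤ ∑ E ∈ 𝓔, (A.card : ℚ) * (1 / 2) ^ E.card := by
      have : ((𝓔.biUnion B).card : ℚ) ≤ ∑ E ∈ 𝓔, ((B E).card : ℚ) := by
        exact_mod_cast Finset.card_biUnion_le
      refine this.trans (Finset.sum_le_sum fun E hE => ?_)
      rw [one_div, inv_pow, ← div_eq_mul_inv, le_div_iff₀ (by positivity)]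
      exact_mod_cast hAB E hE
    rw [← Finset.mul_sum] at h1
    have h2 : (0 : ℚ) < A.card := by exact_mod_cast hA0
    have : ((𝓔.biUnion B).card : ℚ) < A.card := by nlinarith
    exact_mod_cast this
  obtain ⟨ℓ, hℓ, hℓ'⟩ := Finset.exists_mem_notMem_of_card_lt_card hlt
  refine ⟨ℓ, (Finset.mem_filter.1 hℓ).2, fun E hE => ?_⟩
  by_contra hc
  push Not at hc
  exact hℓ' (Finset.mem_biUnion.2 ⟨E, hE, Finset.mem_filter.2 ⟨hℓ, hc⟩⟩)

/-- Multiplying a monic polynomial relation for `x` by `x ^ i` and applying `ℓ` gives the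
recurrence. Signs disappear modulo 2. -/
theorem exists_recurrence_of_functional {K : Type*} [Field K] [Algebra (ZMod 2) K]
    [FiniteDimensional (ZMod 2) K] {m : ℕ} (hm : Module.finrank (ZMod 2) K = m) (x : K)
    (ℓ : K →ₗ[ZMod 2] ZMod 2) :
    ∃ a, Recurrence m a fun i => (ℓ (x ^ i)).val := by
  obtain ⟨p, hp, hdeg, hx⟩ : ∃ p : Polynomial (ZMod 2), p.Monic ∧ p.natDegree = m ∧
      Polynomial.aeval x p = 0 := by
    have hint : IsIntegral (ZMod 2) x := IsIntegral.of_finite (ZMod 2) x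
    have hle : (minpoly (ZMod 2) x).natDegree ≤ m := hm ▸ minpoly.natDegree_le x
    -- The power of `X` pads the degree to exactly `m`, so that the order of the recurrence does not
    -- depend on `x`.
    refine ⟨minpoly (ZMod 2) x * Polynomial.X ^ (m - (minpoly (ZMod 2) x).natDegree),
      (minpoly.monic hint).mul (Polynomial.monic_X_pow _), ?_, by simp⟩
    rw [(minpoly.monic hint).natDegree_mul (Polynomial.monic_X_pow _), Polynomial.natDegree_X_pow]
    omega
  have hneg : ∀ y : ZMod 2, -y = y := by decide
  have hpow : x ^ m = ∑ j ∈ Finset.range m, p.coeff j • x ^ j := by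
    rw [Polynomial.aeval_eq_sum_range, hdeg, Finset.sum_range_succ, ← hdeg, hp.coeff_natDegree,
      one_smul, hdeg] at hx
    rw [add_eq_zero_iff_eq_neg'.1 hx, ← neg_one_smul (ZMod 2), hneg, one_smul]
  have hle : ∀ y : ZMod 2, y.val ≤ 1 := by decide
  refine ⟨fun j => (p.coeff j).val, fun i => ?_, fun i => hle _, fun i => hle _⟩
  have h1 : ℓ (x ^ (i + m)) = ∑ j ∈ Finset.range m, p.coeff j * ℓ (x ^ (i + j)) := by
    rw [pow_add, hpow, Finset.mul_sum, map_sum]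
    refine Finset.sum_congr rfl fun j _ => ?_
    rw [mul_smul_comm, map_smul, pow_add, smul_eq_mul]
  have h2 : ℓ (x ^ (i + m)) = ((∑ j ∈ Finset.range m, (p.coeff j).val * (ℓ (x ^ (i + j))).val :
      ℕ) : ZMod 2) := by
    rw [h1]
    push_cast
    simp
  simp only [h2, ZMod.val_natCast]

/-- The positions belonging to a set of vertices, `L` consecutive ones for each vertex. -/
def positions {N : ℕ} (L : ℕ) (U : Finset (Fin N)) : Finset ℕ :=
  (U ×ˢ Finset.range L).image fun q => (q.1 : ℕ) * L + q.2

theorem mem_positions {N L : ℕ} {U : Finset (Fin N)} {e : ℕ} :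
    e ∈ positions L U ↔ ∃ v ∈ U, ∃ r < L, e = (v : ℕ) * L + r := by
  simp only [positions, Finset.mem_image, Finset.mem_product, Finset.mem_range, Prod.exists]
  constructor
  · rintro ⟨v, r, ⟨hv, hr⟩, rfl⟩
    exact ⟨v, hv, r, hr, rfl⟩
  · rintro ⟨v, hv, r, hr, rfl⟩
    exact ⟨v, r, ⟨hv, hr⟩, rfl⟩

theorem position_inj {L v w r s : ℕ} (hr : r < L) (hs : s < L) (h : v * L + r = w * L + s) :
    v = w ∧ r = s := by
  have h1 : (v * L + r) / L = v := by
    rw [mul_comm, Nat.mul_add_div (by omega), Nat.div_eq_of_lt hr, add_zero]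
  have h2 : (w * L + s) / L = w := by
    rw [mul_comm, Nat.mul_add_div (by omega), Nat.div_eq_of_lt hs, add_zero]
  have : v = w := by rw [← h1, ← h2, h]
  subst this
  omega

theorem card_positions {N : ℕ} (L : ℕ) (U : Finset (Fin N)) :
    (positions L U).card = U.card * L := by
  rw [positions, Finset.card_image_of_injOn, Finset.card_product, Finset.card_range]
  rintro ⟨v, r⟩ h1 ⟨w, s⟩ h2 h
  simp only [Finset.coe_product, Set.mem_prod, Finset.coe_range, Set.mem_Iio] at h1 h2
  obtain ⟨h3, h4⟩ := position_inj h1.2 h2.2 h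
  exact Prod.ext (Fin.ext h3) h4

open Classical in
/-- The vertices all of whose positions carry a zero. -/
noncomputable def zeros (N L : ℕ) (z : ℕ → ℕ) : Finset (Fin N) :=
  Finset.univ.filter fun v => ∀ r < L, z (v * L + r) = 0

/-- The exponent `3 * k * L` is made up of `k * L` for the number of members of `𝓕` and `2 * k * L`
for the subsets of the positions of `S ∪ J`. A vertex lies in `zeros` if its `L` bits vanish, so `J`
is contained there with conditional probability `(2 ^ (-L)) ^ |J|`, and the weight hypothesis is the
union bound. -/
theorem exists_recurrence_avoiding {N k L m : ℕ} (S : Finset (Fin N)) (hS : S.card ≤ k)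
    (𝓕 : Finset (Finset (Fin N))) (h𝓕 : Admissible S k 𝓕)
    (hsum : ∑ J ∈ 𝓕, (1 / 2 ^ L : ℚ) ^ J.card < 1)
    (hm : 2 ^ (3 * k * L) * (N * L) < 2 ^ m) (hm0 : 0 < m) :
    ∃ a z, Recurrence m a z ∧ S ⊆ zeros N L z ∧ ∀ J ∈ 𝓕, ¬ J ⊆ zeros N L z := by
  classical
  have : Fact (Nat.Prime 2) := ⟨Nat.prime_two⟩
  let K := GaloisField 2 m
  let _ : Fintype K := Fintype.ofFinite K
  have hK : Fintype.card K = 2 ^ m := by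
    rw [← Nat.card_eq_fintype_card]
    exact GaloisField.card 2 m hm0.ne'
  have hU : ∀ J : Finset (Fin N), positions L (S ∪ J) = positions L S ∪ positions L J := by
    intro J
    rw [positions, Finset.union_product, Finset.image_union]
    rfl
  have hdis : ∀ J ∈ 𝓕, Disjoint (positions L S) (positions L J) := by
    intro J hJ
    rw [Finset.disjoint_left]
    intro e h1 h2
    obtain ⟨v, hv, r, hr, rfl⟩ := mem_positions.1 h1
    obtain ⟨w, hw, s, hs, h⟩ := mem_positions.1 h2
    have := Fin.ext (position_inj hr hs h).1
    subst this
    exact Finset.disjoint_left.1 (h𝓕 J hJ).2.1 hw hv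
  -- Every member has weight at least `2 ^ (-k * L)`, and the weights add up to less than one.
  have hcard𝓕 : 𝓕.card ≤ 2 ^ (k * L) := by
    have h1 : ∀ J ∈ 𝓕, (1 / 2 ^ L : ℚ) ^ k ≤ (1 / 2 ^ L : ℚ) ^ J.card := fun J hJ =>
      pow_le_pow_of_le_one (by positivity)
        (by rw [div_le_one (by positivity)]; exact one_le_pow₀ (by norm_num)) (h𝓕 J hJ).2.2
    have h2 := (Finset.card_nsmul_le_sum _ _ _ h1).trans hsum.le
    rw [nsmul_eq_mul, one_div, inv_pow, ← div_eq_mul_inv, div_le_one (by positivity), ← pow_mul,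
      mul_comm L k] at h2
    exact_mod_cast h2
  obtain ⟨x, hx⟩ := exists_powers_not_sum_zero (K := K)
    (𝓕.image fun J => positions L (S ∪ J)) (N * L) (2 * k * L) (by
      intro E hE e he
      obtain ⟨J, -, rfl⟩ := Finset.mem_image.1 hE
      obtain ⟨v, -, r, hr, rfl⟩ := mem_positions.1 he
      have := v.2
      calc (v : ℕ) * L + r < v * L + L := by omega
        _ = (v + 1) * L := by ring
        _ ≤ N * L := Nat.mul_le_mul_right L this) (by
      intro E hE
      obtain ⟨J, hJ, rfl⟩ := Finset.mem_image.1 hE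
      rw [card_positions]
      refine Nat.mul_le_mul_right L ((Finset.card_union_le _ _).trans ?_)
      have := (h𝓕 J hJ).2.2
      omega) (by
      rw [hK]
      refine lt_of_le_of_lt ?_ hm
      refine Nat.mul_le_mul_right _ ?_
      calc _ ≤ 2 ^ (k * L) * 2 ^ (2 * k * L) :=
            Nat.mul_le_mul_right _ (Finset.card_image_le.trans hcard𝓕)
        _ = 2 ^ (3 * k * L) := by rw [← pow_add]; congr 1; ring)
  obtain ⟨ℓ, h1, h2⟩ := exists_functional x (positions L S) (𝓕.image (positions L))
    (by
      intro E hE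
      obtain ⟨J, hJ, rfl⟩ := Finset.mem_image.1 hE
      refine linearIndependent_of_sum_ne_zero x _ ?_
      rw [← hU]
      exact hx _ (Finset.mem_image_of_mem (fun J => positions L (S ∪ J)) hJ))
    (by
      intro E hE
      obtain ⟨J, hJ, rfl⟩ := Finset.mem_image.1 hE
      exact hdis J hJ)
    (by
      refine lt_of_le_of_lt (Finset.sum_image_le_of_nonneg (g := positions L)
        (f := fun E => (1 / 2 : ℚ) ^ E.card) fun E _ => by positivity) (lt_of_eq_of_lt ?_ hsum)
      refine Finset.sum_congr rfl fun J _ => ?_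
      rw [card_positions, mul_comm, pow_mul, one_div_pow])
  have hf : Module.finrank (ZMod 2) K = m := GaloisField.finrank 2 hm0.ne'
  obtain ⟨a, ha⟩ := exists_recurrence_of_functional hf x ℓ
  refine ⟨a, _, ha, ?_, ?_⟩
  · intro v hv
    refine Finset.mem_filter.2 ⟨Finset.mem_univ _, fun r hr => ?_⟩
    simp only [h1 _ (mem_positions.2 ⟨v, hv, r, hr, rfl⟩), ZMod.val_zero]
  · intro J hJ hsub
    obtain ⟨e, he, hne⟩ := h2 _ (Finset.mem_image_of_mem _ hJ)
    obtain ⟨v, hv, r, hr, rfl⟩ := mem_positions.1 he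
    have := (Finset.mem_filter.1 (hsub hv)).2 r hr
    exact hne ((ZMod.val_eq_zero _).1 this)

end DirectedMultiwayCut

/-! ### Pushing procedures: important sets, undirected multiway cuts, and the torso -/

namespace DirectedMultiwayCut
open Relation
set_option linter.unusedSectionVars false

section Pushing
variable {V : Type*} [Fintype V] [LinearOrder V]

/-! ### Pushing along furthest cuts -/

/-- The feasible sets that contain `W` and avoid `D`. -/
def Side (R : V → V → Prop) (K P W D A : Finset V) : Prop :=
  Feas R K P A ∧ W ⊆ A ∧ Disjoint A D

theorem Side.union {R : V → V → Prop} {K P W D A B : Finset V} (hA : Side R K P W D A)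
    (hB : Side R K P W D B) : Side R K P W D (A ∪ B) :=
  ⟨hA.1.union hB.1, hA.2.1.trans Finset.subset_union_left,
    Finset.disjoint_union_left.2 ⟨hA.2.2, hB.2.2⟩⟩

theorem Side.inter {R : V → V → Prop} {K P W D A B : Finset V} (hA : Side R K P W D A)
    (hB : Side R K P W D B) : Side R K P W D (A ∩ B) :=
  ⟨hA.1.inter hB.1, Finset.subset_inter hA.2.1 hB.2.1,
    hA.2.2.mono_left Finset.inter_subset_left⟩

/-- `A` is the furthest smallest cut around `W` in `G - D`. -/
abbrev FurthestSide (R : V → V → Prop) (K P W D A : Finset V) : Prop :=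
  Furthest (Side R K P W D) (fun A => (outN R A \ D).card) A

theorem exists_furthestSide {R : V → V → Prop} {K P W D : Finset V}
    (h : ∃ A, Side R K P W D A) : ∃ A, FurthestSide R K P W D A :=
  exists_furthest (fun _ _ => Side.union) (fun _ _ => Side.inter) (card_outN_submodular R D) h

theorem FurthestSide.eq {R : V → V → Prop} {K P W D A B : Finset V}
    (hA : FurthestSide R K P W D A) (hB : FurthestSide R K P W D B) : A = B :=
  Finset.Subset.antisymm (hB.max _ hA.mem (hA.le _ hB.mem)) (hA.max _ hB.mem (hB.le _ hA.mem))

open Classical in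
/-- The furthest smallest cut around `W` in `G - D`. -/
noncomputable def farCut (R : V → V → Prop) (K P W D : Finset V) : Finset V :=
  if h : ∃ A, FurthestSide R K P W D A then outN R h.choose \ D else ∅

theorem FurthestSide.farCut_eq {R : V → V → Prop} {K P W D A : Finset V}
    (hA : FurthestSide R K P W D A) : farCut R K P W D = outN R A \ D := by
  have h : ∃ A, FurthestSide R K P W D A := ⟨A, hA⟩
  rw [farCut, dif_pos h, h.choose_spec.eq hA]

/-- A state of the pushing procedure: pushed vertices, deleted vertices, number of bits read. -/
structure PushState (V : Type*) where
  W : Finset V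
  D : Finset V
  pos : ℕ

open Classical in
/-- Delete or push the last vertex of the furthest smallest cut. -/
noncomputable def pushStep (R : V → V → Prop) (K P : Finset V) (bits : ℕ → ℕ)
    (st : PushState V) : PushState V :=
  if h : (farCut R K P st.W st.D).Nonempty then
    if bits st.pos = 1 then ⟨st.W, insert ((farCut R K P st.W st.D).max' h) st.D, st.pos + 1⟩
    else ⟨insert ((farCut R K P st.W st.D).max' h) st.W, st.D, st.pos + 1⟩
  else st

/-- A cut of size at most `k` remains. -/
def Valid (R : V → V → Prop) (K P : Finset V) (k : ℕ) (st : PushState V) : Prop :=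
  ∃ A, Side R K P st.W st.D A ∧ st.D.card + (outN R A \ st.D).card ≤ k

theorem Valid.card_farCut_le {R : V → V → Prop} {K P : Finset V} {k : ℕ} {st : PushState V}
    (h : Valid R K P k st) : st.D.card + (farCut R K P st.W st.D).card ≤ k := by
  obtain ⟨A, hA, hk⟩ := h
  obtain ⟨B, hB⟩ := exists_furthestSide ⟨A, hA⟩
  rw [hB.farCut_eq]
  have := hB.le A hA
  omega

/-- A cut around `insert x W` of the old size would be a minimum cut around `W`, hence contained in
the furthest one, whose boundary contains `x`. -/
theorem card_farCut_insert_left {R : V → V → Prop} {K P W D : Finset V} {x : V}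
    (hx : x ∈ farCut R K P W D) (hA : ∃ A, Side R K P (insert x W) D A) :
    (farCut R K P W D).card + 1 ≤ (farCut R K P (insert x W) D).card := by
  obtain ⟨A, hA⟩ := exists_furthestSide hA
  have hA' : Side R K P W D A :=
    ⟨hA.mem.1, (Finset.subset_insert _ _).trans hA.mem.2.1, hA.mem.2.2⟩
  obtain ⟨B, hB⟩ := exists_furthestSide ⟨A, hA'⟩
  rw [hB.farCut_eq] at hx ⊢
  rw [hA.farCut_eq]
  by_contra hc
  exact (mem_outN.1 (Finset.mem_sdiff.1 hx).1).1
    (hB.max A hA' (by omega) (hA.mem.2.1 (Finset.mem_insert_self _ _)))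

theorem card_farCut_insert_right {R : V → V → Prop} {K P W D : Finset V} {x : V}
    (hA : ∃ A, Side R K P W (insert x D) A) :
    (farCut R K P W D).card ≤ (farCut R K P W (insert x D)).card + 1 := by
  obtain ⟨A, hA⟩ := exists_furthestSide hA
  have hA' : Side R K P W D A :=
    ⟨hA.mem.1, hA.mem.2.1, hA.mem.2.2.mono_right (Finset.subset_insert _ _)⟩
  obtain ⟨B, hB⟩ := exists_furthestSide ⟨A, hA'⟩
  rw [hB.farCut_eq, hA.farCut_eq]
  have h1 := hB.le A hA'
  have h2 : outN R A \ D ⊆ insert x (outN R A \ insert x D) := by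
    intro y
    simp only [Finset.mem_sdiff, Finset.mem_insert]
    tauto
  exact h1.trans ((Finset.card_le_card h2).trans (Finset.card_insert_le _ _))

/-- `Good` is the invariant relating the state to an unknown target, and `hstep` says that one of
the two choices preserves it. The quantity `2 * |D| + |cut|` grows by at least one with every bit:
by the larger cut after a push, and after a deletion by `2` minus a loss of at most `1`. The prefix
`bits₀` keeps bits already used for earlier terminals, and only bits before the final position are
ever read. -/
theorem exists_bits_aux {R : V → V → Prop} {K P : Finset V} {k : ℕ}
    (Good : Finset V → Finset V → Prop)
    (hvalid : ∀ W D pos, Good W D → Valid R K P k ⟨W, D, pos⟩)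
    (hstep : ∀ W D, Good W D → ∀ x ∈ farCut R K P W D, Good (insert x W) D ∨ Good W (insert x D))
    (n : ℕ) : ∀ (st : PushState V) (bits₀ : ℕ → ℕ), Good st.W st.D →
      st.pos ≤ 2 * st.D.card + (farCut R K P st.W st.D).card →
      ∃ (bits : ℕ → ℕ) (st' : PushState V), (∀ i < st.pos, bits i = bits₀ i) ∧
        (∀ bits' : ℕ → ℕ, (∀ i < st'.pos, bits' i = bits i) →
          (pushStep R K P bits')^[n] st = st' ∧
          ∀ i ≤ n, Valid R K P k ((pushStep R K P bits')^[i] st)) ∧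
        Good st'.W st'.D ∧ st.pos ≤ st'.pos ∧
        st'.pos ≤ 2 * st'.D.card + (farCut R K P st'.W st'.D).card ∧
        (farCut R K P st'.W st'.D = ∅ ∨ st.pos + n ≤ st'.pos) := by
  induction n with
  | zero =>
    intro st bits₀ hG hp
    exact ⟨bits₀, st, fun _ _ => rfl, fun _ _ => ⟨rfl, fun i hi => by
      rw [Nat.le_zero.1 hi]
      exact hvalid _ _ _ hG⟩, hG, le_rfl, hp, .inr le_rfl⟩
  | succ n ih =>
    intro st bits₀ hG hp
    by_cases hne : (farCut R K P st.W st.D).Nonempty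
    · obtain ⟨x, hx⟩ : ∃ x, x = (farCut R K P st.W st.D).max' hne := ⟨_, rfl⟩
      have hxmem : x ∈ farCut R K P st.W st.D := hx ▸ Finset.max'_mem _ _
      obtain ⟨b, st₁, hst₁, hG₁, hp₁, hpos₁⟩ : ∃ (b : ℕ) (st₁ : PushState V),
          (∀ bits : ℕ → ℕ, bits st.pos = b → pushStep R K P bits st = st₁) ∧ Good st₁.W st₁.D ∧
          st₁.pos ≤ 2 * st₁.D.card + (farCut R K P st₁.W st₁.D).card ∧
          st₁.pos = st.pos + 1 := by
        rcases hstep _ _ hG x hxmem with h | h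
        · refine ⟨0, ⟨insert x st.W, st.D, st.pos + 1⟩, ?_, h, ?_, rfl⟩
          · intro bits hb
            rw [pushStep, dif_pos hne, if_neg (by omega), hx]
          · obtain ⟨A, hA, -⟩ := hvalid _ _ 0 h
            have := card_farCut_insert_left hxmem ⟨A, hA⟩
            simp only
            omega
        · refine ⟨1, ⟨st.W, insert x st.D, st.pos + 1⟩, ?_, h, ?_, rfl⟩
          · intro bits hb
            rw [pushStep, dif_pos hne, if_pos hb, hx]
          · obtain ⟨A, hA, -⟩ := hvalid _ _ 0 h
            have := card_farCut_insert_right ⟨A, hA⟩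
            have hxD : x ∉ st.D := by
              obtain ⟨A, hA, -⟩ := hvalid _ _ 0 hG
              obtain ⟨B, hB⟩ := exists_furthestSide ⟨A, hA⟩
              rw [hB.farCut_eq] at hxmem
              exact (Finset.mem_sdiff.1 hxmem).2
            simp only [Finset.card_insert_of_notMem hxD] at this ⊢
            omega
      obtain ⟨bits, st', h1, h2, h3, h4, h5, h6⟩ :=
        ih st₁ (Function.update bits₀ st.pos b) hG₁ hp₁
      have hb : bits st.pos = b := by
        rw [h1 _ (by omega), Function.update_self]
      refine ⟨bits, st', fun i hi => ?_, fun bits' hbits' => ?_, h3, by omega, h5, ?_⟩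
      · rw [h1 i (by omega), Function.update_of_ne (by omega)]
      · have hs := hst₁ bits' (by rw [hbits' _ (by omega), hb])
        obtain ⟨h7, h8⟩ := h2 bits' hbits'
        rw [Function.iterate_succ_apply, hs]
        refine ⟨h7, fun i hi => ?_⟩
        rcases i with - | i
        · exact hvalid _ _ _ hG
        · rw [Function.iterate_succ_apply, hs]
          exact h8 i (by omega)
      · rcases h6 with h6 | h6
        · exact .inl h6
        · exact .inr (by omega)
    · have hfix : ∀ (bits : ℕ → ℕ) (i : ℕ), (pushStep R K P bits)^[i] st = st := fun bits i =>
        Function.iterate_fixed (by rw [pushStep, dif_neg hne]) i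
      refine ⟨bits₀, st, fun _ _ => rfl, fun bits' _ => ⟨hfix _ _, fun i _ => ?_⟩, hG, le_rfl, hp,
        .inl (Finset.not_nonempty_iff_eq_empty.1 hne)⟩
      rw [hfix]
      exact hvalid _ _ _ hG

/-- The invariant keeps `|D| + |cut| ≤ k`, so `2 * |D| + |cut| ≤ 2 * k`. If all `2 * k` steps read a
bit, equality must hold and the cut is empty. -/
theorem exists_bits {R : V → V → Prop} {K P : Finset V} {k : ℕ}
    (Good : Finset V → Finset V → Prop)
    (hvalid : ∀ W D pos, Good W D → Valid R K P k ⟨W, D, pos⟩)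
    (hstep : ∀ W D, Good W D → ∀ x ∈ farCut R K P W D, Good (insert x W) D ∨ Good W (insert x D))
    (st : PushState V) (bits₀ : ℕ → ℕ) (hG : Good st.W st.D) (hp : st.pos ≤ 2 * st.D.card) :
      ∃ (bits : ℕ → ℕ) (st' : PushState V), (∀ i < st.pos, bits i = bits₀ i) ∧
        (∀ bits' : ℕ → ℕ, (∀ i < st'.pos, bits' i = bits i) →
          (pushStep R K P bits')^[2 * k] st = st' ∧
          ∀ i ≤ 2 * k, Valid R K P k ((pushStep R K P bits')^[i] st)) ∧
        Good st'.W st'.D ∧ st.pos ≤ st'.pos ∧ st'.pos ≤ 2 * st'.D.card ∧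
        farCut R K P st'.W st'.D = ∅ := by
  obtain ⟨bits, st', h1, h2, h3, h4, h5, h6⟩ :=
    exists_bits_aux Good hvalid hstep (2 * k) st bits₀ hG (by omega)
  have h7 := (hvalid _ _ 0 h3).card_farCut_le
  simp only at h7
  have h8 : farCut R K P st'.W st'.D = ∅ := by
    rcases h6 with h6 | h6
    · exact h6
    · rw [← Finset.card_eq_zero]
      omega
  refine ⟨bits, st', h1, h2, h3, h4, ?_, h8⟩
  rw [h8] at h5
  simpa using h5

/-! ### Finding important sets by pushing -/

/-- While `W ⊆ X` and `D ⊆ outN R X`, the furthest cut stays inside the important set `X`, so each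
of its boundary vertices lies in `X` and may be pushed, or lies in the boundary of `X` and may be
deleted. -/
theorem exists_bits_important {R : V → V → Prop} {K P X : Finset V} {k : ℕ} {v : V}
    (hX : Important R K P X) (hk : (outN R X).card ≤ k) (hv : v ∈ X)
    (hcl : ∀ A ⊆ X, v ∈ A → Disjoint (outN R A) X → outN R X ⊆ outN R A) :
    ∃ bits : ℕ → ℕ, ∀ bits' : ℕ → ℕ, (∀ i < 2 * k, bits' i = bits i) →
      ((pushStep R K P bits')^[2 * k] ⟨{v}, ∅, 0⟩).D = outN R X ∧
      ∀ i ≤ 2 * k, Valid R K P k ((pushStep R K P bits')^[i] ⟨{v}, ∅, 0⟩) := by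
  have hside : ∀ W D, W ⊆ X → D ⊆ outN R X → Side R K P W D X := fun W D hW hD =>
    ⟨hX.1, hW, Finset.disjoint_right.2 fun y hy => (mem_outN.1 (hD hy)).1⟩
  -- Uncrossing `X` with the furthest side yields a superset of `X` with no larger boundary, which
  -- importance forces to be `X`.
  have hsub : ∀ W D A, W ⊆ X → D ⊆ outN R X → FurthestSide R K P W D A → A ⊆ X := by
    intro W D A hW hD hA
    have h1 := hside W D hW hD
    have h2 := card_outN_submodular R D X A
    have h3 := hA.le _ (h1.inter hA.mem)
    have h4 : X ∪ A = X := by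
      refine hX.2 _ (h1.union hA.mem).1 Finset.subset_union_left ?_
      have h5 := Finset.card_sdiff_add_card_inter (outN R (X ∪ A)) D
      have h6 := Finset.card_sdiff_add_card_eq_card hD
      have h7 : (outN R (X ∪ A) ∩ D).card ≤ D.card := Finset.card_le_card Finset.inter_subset_right
      omega
    rw [← h4]
    exact Finset.subset_union_right
  obtain ⟨bits, st', -, h2, ⟨h3, h4, h5⟩, -, h6, h7⟩ := exists_bits (R := R) (K := K) (P := P)
    (k := k) (fun W D => W ⊆ X ∧ D ⊆ outN R X ∧ v ∈ W)
    (fun W D pos h => ⟨X, hside W D h.1 h.2.1, by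
      have := Finset.card_sdiff_add_card_eq_card h.2.1
      simp only
      omega⟩)
    (fun W D h x hx => by
      obtain ⟨A, hA⟩ := exists_furthestSide ⟨X, hside W D h.1 h.2.1⟩
      rw [hA.farCut_eq] at hx
      obtain ⟨-, u, hu, hr⟩ := mem_outN.1 (Finset.mem_sdiff.1 hx).1
      by_cases hxX : x ∈ X
      · exact .inl ⟨Finset.insert_subset hxX h.1, h.2.1, Finset.mem_insert_of_mem h.2.2⟩
      · exact .inr ⟨h.1, Finset.insert_subset
          (mem_outN.2 ⟨hxX, u, hsub W D A h.1 h.2.1 hA hu, hr⟩) h.2.1, h.2.2⟩)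
    ⟨{v}, ∅, 0⟩ (fun _ => 0) (by simpa using hv) (by simp)
  have hpos : st'.pos ≤ 2 * k := by
    have := Finset.card_le_card h4
    omega
  refine ⟨bits, fun bits' hb => ?_⟩
  obtain ⟨h8, h9⟩ := h2 bits' fun i hi => hb i (by omega)
  refine ⟨?_, h9⟩
  rw [h8]
  refine Finset.Subset.antisymm h4 ?_
  obtain ⟨A, hA⟩ := exists_furthestSide ⟨X, hside _ _ h3 h4⟩
  rw [hA.farCut_eq, Finset.sdiff_eq_empty_iff_subset] at h7
  -- With no cut left, the boundary of `A` lies in `D`, hence outside `X`, and the closing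
  -- hypothesis puts all of `outN R X` into it.
  refine (hcl A (hsub _ _ A h3 h4 hA) (hA.mem.2.1 h5) ?_).trans h7
  exact Finset.disjoint_left.2 fun y hy => (mem_outN.1 (h4 (h7 hy))).1

/-- `Y` certifies that `v` lies in an important set with boundary `Y ⊆ C`. -/
structure Certifies (R : V → V → Prop) (T P C : Finset V) (k : ℕ) (v : V) (Y : Finset V) :
    Prop where
  mem : v ∈ shadow R T Y
  imp : Important R T P (shadow R T Y)
  eq : outN R (shadow R T Y) = Y
  card_le : Y.card ≤ k
  sub : Y ⊆ C

/-- An important set is recovered from its boundary: otherwise the shadow of the boundary would be a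
larger feasible set with no larger boundary. Certificates therefore need to name only the boundary.
-/
theorem Important.shadow_eq {R : V → V → Prop} {T P X : Finset V} (hX : Important R T P X) :
    shadow R T (outN R X) = X := by
  have hsub : X ⊆ shadow R T (outN R X) := by
    intro u hu
    refine mem_shadow.2 ⟨fun h => (mem_outN.1 h).1 hu, ?_⟩
    rintro ⟨t, ht, hp⟩
    exact Finset.disjoint_left.1 hX.1.1 (stay (Finset.Subset.refl _) hu hp) ht
  have hN : outN R (shadow R T (outN R X)) ⊆ outN R X := by
    intro y hy
    obtain ⟨hy1, u, hu, hr⟩ := mem_outN.1 hy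
    by_contra hc
    rw [mem_shadow] at hy1 hu
    push Not at hy1
    obtain ⟨t, ht, hp⟩ := hy1 hc
    exact hu.2 ⟨t, ht, .head ⟨hr, hu.1, hc⟩ hp⟩
  refine hX.2 _ ⟨?_, hN.trans hX.1.2⟩ hsub (Finset.card_le_card hN)
  rw [Finset.disjoint_left]
  intro u hu ht
  exact (mem_shadow.1 hu).2 ⟨u, ht, .refl⟩

theorem exists_bits_certifies {R : V → V → Prop} {T P S C : Finset V} {k : ℕ} (hS : S ⊆ P)
    (ht : Tight R T P S) (hk : S.card ≤ k) (hC : S ⊆ C) {v : V} (hv : v ∈ shadow R T S) :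
    ∃ bits : ℕ → ℕ, ∀ bits' : ℕ → ℕ, (∀ i < 2 * k, bits' i = bits i) →
      Certifies R T P C k v ((pushStep R T P bits')^[2 * k] ⟨{v}, ∅, 0⟩).D ∧
      ∀ i ≤ 2 * k, Valid R T P k ((pushStep R T P bits')^[i] ⟨{v}, ∅, 0⟩) := by
  obtain ⟨X, hX, hvX, hXS, hcl⟩ := exists_important_of_mem_shadow hS ht hv
  have hXk := (Finset.card_le_card hXS).trans hk
  obtain ⟨bits, hb⟩ := exists_bits_important hX hXk hvX hcl
  refine ⟨bits, fun bits' h => ?_⟩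
  obtain ⟨h1, h2⟩ := hb bits' h
  refine ⟨?_, h2⟩
  rw [h1]
  have he := hX.shadow_eq
  exact ⟨by rw [he]; exact hvX, by rw [he]; exact hX, by rw [he], hXk, hXS.trans hC⟩

/-- For `v ∈ S` the certified important set would meet `S`, so its boundary, a subset of `C`, would
contain a member of `𝓕`. -/
theorem Certifies.not_mem {R : V → V → Prop} {T P S C Y : Finset V} {k : ℕ} {v : V}
    (h : Certifies R T P C k v Y) {𝓕 : Finset (Finset V)}
    (h𝓕 : ∀ X, Important R T P X → (outN R X).card ≤ k → (X ∩ S).Nonempty →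
      ∃ J ∈ 𝓕, J ⊆ outN R X) (hC : ∀ J ∈ 𝓕, ¬ J ⊆ C) : v ∉ S := by
  intro hv
  obtain ⟨J, hJ, hJX⟩ := h𝓕 _ h.imp (by rw [h.eq]; exact h.card_le)
    ⟨v, Finset.mem_inter.2 ⟨h.mem, hv⟩⟩
  rw [h.eq] at hJX
  exact hC J hJ (hJX.trans h.sub)

theorem Certifies.not_mem_terminals {R : V → V → Prop} {T P C Y : Finset V} {k : ℕ} {v : V}
    (h : Certifies R T P C k v Y) : v ∉ T := fun hv =>
  (mem_shadow.1 h.mem).2 ⟨v, hv, .refl⟩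

/-! ### Undirected multiway cut by pushing -/

theorem flip_eq_of_symmetric {H : V → V → Prop} (hH : ∀ u v, H u v → H v u) : flip H = H := by
  funext a b
  exact propext ⟨hH b a, hH a b⟩

/-- `D` extends to a small solution with `X` on the side of `t`. -/
structure Extends (H : V → V → Prop) (T P D : Finset V) (k : ℕ) (t : V) (S X : Finset V) :
    Prop where
  sol : Sol H T S
  sub : S ⊆ P
  card_le : S.card ≤ k
  del : D ⊆ S
  disj : Disjoint X S
  disjT : Disjoint X (T.erase t)
  out : outN H X ⊆ S

theorem Extends.side {H : V → V → Prop} {T P D W S X : Finset V} {k : ℕ} {t : V}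
    (h : Extends H T P D k t S X) (hW : W ⊆ X) : Side H (T.erase t) P W D X :=
  ⟨⟨h.disjT, h.out.trans h.sub⟩, hW, h.disj.mono_right h.del⟩

/-- The side of `t` may be assumed to contain the furthest smallest cut. This is the only step of
the undirected algorithm where symmetry of `H` is essential. -/
theorem Extends.enlarge {H : V → V → Prop} (hH : ∀ u v, H u v → H v u) {T P D W S X A : Finset V}
    {k : ℕ} {t : V} (h : Extends H T P D k t S X) (hW : W ⊆ X)
    (hA : FurthestSide H (T.erase t) P W D A) :
    Extends H T P D k t (swapOut H S (X ∪ A)) (X ∪ A) := by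
  have hs := h.side hW
  have hU := hs.union hA.mem
  have hnot : ∀ b ∈ T, b ≠ t → b ∉ X ∪ A := fun b hb hbt hbX =>
    Finset.disjoint_left.1 hU.1.1 hbX (Finset.mem_erase.2 ⟨hbt, hb⟩)
  refine ⟨?_, ?_, ?_, ?_, ?_, hU.1.1, Finset.subset_union_right⟩
  · intro a ha b hb hab hp
    -- One of the two terminals is not `t` and hence lies outside `X ∪ A`. By symmetry the path may
    -- be taken to end there, as `swap_path` requires.
    by_cases hbt : b = t
    · have hat : a ≠ t := fun h => hab (h.trans hbt.symm)
      have hp' : ReflTransGen (Av H (swapOut H S (X ∪ A))) b a := by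
        rw [← reflTransGen_av_flip, flip_eq_of_symmetric hH]
        exact hp
      exact h.sol b hb a ha hab.symm (swap_path (hnot a ha hat) hp').2
    · exact h.sol a ha b hb hab (swap_path (hnot b hb hbt) hp).2
  · exact Finset.union_subset (Finset.sdiff_subset.trans h.sub) hU.1.2
  · have h1 := card_outN_submodular H D X A
    have h2 := hA.le _ (hs.inter hA.mem)
    -- The boundary of `X`, all of it in `S`, is traded for that of `X ∪ A`, which outside `D` is no
    -- larger because `A` is a minimum cut.
    have h3 : swapOut H S (X ∪ A) ⊆ D ∪ ((S \ D) \ (outN H X \ D) ∪ (outN H (X ∪ A) \ D)) := by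
      intro y hy
      simp only [swapOut, Finset.mem_union, Finset.mem_sdiff, mem_outN] at hy ⊢
      grind
    have h4 := (Finset.card_le_card h3).trans ((Finset.card_union_le _ _).trans
      (Nat.add_le_add_left (Finset.card_union_le _ _) _))
    have h5 := Finset.card_sdiff_add_card_eq_card
      (Finset.sdiff_subset_sdiff h.out (Finset.Subset.refl D))
    have h6 := Finset.card_sdiff_add_card_eq_card h.del
    have h7 := h.card_le
    omega
  · intro y hy
    refine Finset.mem_union_left _ (Finset.mem_sdiff.2 ⟨h.del hy, ?_⟩)
    exact Finset.disjoint_right.1 hU.2.2 hy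
  · rw [Finset.disjoint_left]
    intro y hy hy'
    rcases Finset.mem_union.1 hy' with h' | h'
    · exact (Finset.mem_sdiff.1 h').2 hy
    · exact (mem_outN.1 h').1 hy

/-- In `G - D`, no other terminal can be reached from `t`. -/
def Isolated (H : V → V → Prop) (T D : Finset V) (t : V) : Prop :=
  ∀ b ∈ T, b ≠ t → ¬ ReflTransGen (Av H D) t b

theorem Isolated.mono {H : V → V → Prop} {T D D' : Finset V} {t : V} (h : Isolated H T D t)
    (hD : D ⊆ D') : Isolated H T D' t := fun b hb hbt hp =>
  h b hb hbt (ReflTransGen.mono (fun _ _ h => ⟨h.1, fun h' => h.2.1 (hD h'), fun h' => h.2.2 (hD h')⟩) _ _ hp)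

/-- `D` extends to a solution of size at most `k`. -/
def Extendable (H : V → V → Prop) (T P D : Finset V) (k : ℕ) : Prop :=
  ∃ S, Sol H T S ∧ S ⊆ P ∧ S.card ≤ k ∧ D ⊆ S

/-- The target is a solution that changes during the run: before each choice the side of `t` is
enlarged by the furthest cut. A vertex of that cut then lies on the enlarged side and is pushed, or
on its boundary, which belongs to the solution, and is deleted. -/
theorem exists_bits_isolate {H : V → V → Prop} (hH : ∀ u v, H u v → H v u) {T P D : Finset V}
    {k pos : ℕ} {t : V} (hPT : Disjoint P T) (ht : t ∈ T) (hD : Extendable H T P D k)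
    (hpos : pos ≤ 2 * D.card) (bits₀ : ℕ → ℕ) :
    ∃ (bits : ℕ → ℕ) (st' : PushState V), (∀ i < pos, bits i = bits₀ i) ∧
      (∀ bits' : ℕ → ℕ, (∀ i < st'.pos, bits' i = bits i) →
        (pushStep H (T.erase t) P bits')^[2 * k] ⟨{t}, D, pos⟩ = st' ∧
        ∀ i ≤ 2 * k, Valid H (T.erase t) P k
          ((pushStep H (T.erase t) P bits')^[i] ⟨{t}, D, pos⟩)) ∧
      Extendable H T P st'.D k ∧ pos ≤ st'.pos ∧ st'.pos ≤ 2 * st'.D.card ∧ D ⊆ st'.D ∧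
      Isolated H T st'.D t := by
  classical
  obtain ⟨S, hS, hSP, hSk, hDS⟩ := hD
  let X : Finset V := Finset.univ.filter fun u => ReflTransGen (Av H S) t u
  have hX : ∀ u, u ∈ X ↔ ReflTransGen (Av H S) t u := fun u => by simp [X]
  have htS : t ∉ S := Finset.disjoint_right.1 (hPT.mono_left hSP) ht
  have h0 : Extends H T P D k t S X := by
    refine ⟨hS, hSP, hSk, hDS, ?_, ?_, ?_⟩
    · exact Finset.disjoint_left.2 fun u hu => not_mem_of_reach' htS ((hX u).1 hu)
    · refine Finset.disjoint_left.2 fun u hu hu' => ?_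
      obtain ⟨h1, h2⟩ := Finset.mem_erase.1 hu'
      exact hS t ht u h2 h1.symm ((hX u).1 hu)
    · intro y hy
      obtain ⟨hy1, u, hu, hr⟩ := mem_outN.1 hy
      by_contra hc
      exact hy1 ((hX y).2 (((hX u).1 hu).tail ⟨hr, not_mem_of_reach' htS ((hX u).1 hu), hc⟩))
  obtain ⟨bits, st', h1, h2, ⟨⟨S', X', h3, h3'⟩, hD', h4⟩, h5, h6, h7⟩ :=
    exists_bits (R := H) (K := T.erase t) (P := P) (k := k)
    (fun W D' => (∃ S X, Extends H T P D' k t S X ∧ W ⊆ X) ∧ D ⊆ D' ∧ t ∈ W)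
    (fun W D' pos ⟨⟨S, X, h, hW⟩, _⟩ => ⟨X, h.side hW, by
      have h1 : D' ∪ (outN H X \ D') ⊆ S :=
        Finset.union_subset h.del (Finset.sdiff_subset.trans h.out)
      have h2 := Finset.card_le_card h1
      rw [Finset.card_union_of_disjoint Finset.disjoint_sdiff] at h2
      exact h2.trans h.card_le⟩)
    (fun W D' ⟨⟨S, X, h, hW⟩, hDD, htW⟩ x hx => by
      obtain ⟨A, hA⟩ := exists_furthestSide ⟨X, h.side hW⟩
      have h' := h.enlarge hH hW hA
      rw [hA.farCut_eq] at hx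
      obtain ⟨-, u, hu, hr⟩ := mem_outN.1 (Finset.mem_sdiff.1 hx).1
      by_cases hxX : x ∈ X ∪ A
      · exact .inl ⟨⟨_, _, h', Finset.insert_subset hxX (hW.trans Finset.subset_union_left)⟩, hDD,
          Finset.mem_insert_of_mem htW⟩
      · refine .inr ⟨⟨_, _, ⟨h'.sol, h'.sub, h'.card_le, Finset.insert_subset ?_ h'.del, h'.disj,
          h'.disjT, h'.out⟩, hW.trans Finset.subset_union_left⟩,
          hDD.trans (Finset.subset_insert _ _), htW⟩
        exact h'.out (mem_outN.2 ⟨hxX, u, Finset.mem_union_right _ hu, hr⟩))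
    ⟨{t}, D, pos⟩ bits₀ ⟨⟨S, X, h0, by simpa using (hX t).2 .refl⟩, Finset.Subset.refl _,
      by simp⟩ hpos
  refine ⟨bits, st', h1, h2, ⟨S', h3.sol, h3.sub, h3.card_le, h3.del⟩, h5, h6, hD', ?_⟩
  obtain ⟨A, hA⟩ := exists_furthestSide ⟨X', h3.side h3'⟩
  rw [hA.farCut_eq, Finset.sdiff_eq_empty_iff_subset] at h7
  intro b hb hbt hp
  exact Finset.disjoint_left.1 hA.mem.1.1 (stay h7 (hA.mem.2.1 h4) hp)
    (Finset.mem_erase.2 ⟨hbt, hb⟩)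

/-! ### The torso -/

/-- A path from `u` to `v` all of whose inner vertices lie in `Z`. -/
def Through (R : V → V → Prop) (Z : Finset V) (u v : V) : Prop :=
  ∃ y, ReflTransGen (fun a b => R a b ∧ b ∈ Z) u y ∧ R y v

/-- The symmetric torso of `G` on the complement of `Z`. -/
def Torso (R : V → V → Prop) (Z : Finset V) (u v : V) : Prop :=
  u ∉ Z ∧ v ∉ Z ∧ (Through R Z u v ∨ Through R Z v u)

theorem Torso.symm {R : V → V → Prop} {Z : Finset V} (u v : V) (h : Torso R Z u v) :
    Torso R Z v u := ⟨h.2.1, h.1, h.2.2.symm⟩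

theorem Through.reach {R : V → V → Prop} {Z S : Finset V} (hZS : Disjoint Z S) {u v : V}
    (h : Through R Z u v) (hu : u ∉ S) (hv : v ∉ S) : ReflTransGen (Av R S) u v := by
  obtain ⟨y, hp, hr⟩ := h
  have : y ∉ S ∧ ReflTransGen (Av R S) u y := by
    clear hr
    induction hp with
    | refl => exact ⟨hu, .refl⟩
    | tail _ hbc ih =>
      have hc := Finset.disjoint_left.1 hZS hbc.2
      exact ⟨hc, ih.2.tail ⟨hbc.1, ih.1, hc⟩⟩
  exact this.2.tail ⟨hr, this.1, hv⟩

/-- Only torso arcs used against their direction need an argument. A vertex outside both shadows is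
reached from a terminal and reaches one, and as `S` is a solution these coincide with the terminal
where the walk began. So the walk can be replaced by a directed path from that terminal. -/
theorem sol_torso {R : V → V → Prop} {T S Z : Finset V} (hS : Sol R T S) (hZS : Disjoint Z S)
    (h1 : shadow R T S ⊆ Z) (h2 : shadow (flip R) T S ⊆ Z) : Sol (Torso R Z) T S := by
  intro a ha b hb hab hp
  refine hS a ha b hb hab ?_
  clear hab hb
  induction hp with
  | refl => exact .refl
  | @tail c d _ hcd ih =>
    obtain ⟨⟨hcZ, hdZ, hT⟩, hcS, hdS⟩ := hcd
    rcases hT with hT | hT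
    · exact ih.trans (hT.reach hZS hcS hdS)
    · have hdc := hT.reach hZS hdS hcS
      have hc : ∃ t ∈ T, ReflTransGen (Av R S) c t := by
        by_contra hc
        exact hcZ (h1 (mem_shadow.2 ⟨hcS, hc⟩))
      have hd : ∃ t ∈ T, ReflTransGen (Av (flip R) S) d t := by
        by_contra hc
        exact hdZ (h2 (mem_shadow.2 ⟨hdS, hc⟩))
      obtain ⟨t', ht', hct⟩ := hc
      obtain ⟨t, ht, htd⟩ := hd
      rw [reflTransGen_av_flip] at htd
      have e1 : a = t' := by
        by_contra hne
        exact hS a ha t' ht' hne (ih.trans hct)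
      -- From `t` the path goes to `d`, along the arc taken backwards to `c`, and on to `t'`.
      have e2 : t = t' := by
        by_contra hne
        exact hS t ht t' ht' hne (htd.trans (hdc.trans hct))
      rwa [e1, ← e2]

/-- A path of `G - D` becomes a path of the torso by skipping its vertices in `Z`. The vertex `c` is
the last one outside `Z`. -/
theorem sol_of_torso {R : V → V → Prop} {T D Z : Finset V} (hD : Sol (Torso R Z) T D)
    (hZT : Disjoint Z T) (hDT : Disjoint D T) : Sol R T D := by
  intro a ha b hb hab hp
  have key : ∃ c, ReflTransGen (Av (Torso R Z) D) a c ∧ c ∉ Z ∧ c ∉ D ∧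
      ReflTransGen (fun a b => R a b ∧ b ∈ Z) c b := by
    clear hab hb
    induction hp with
    | refl => exact ⟨a, .refl, Finset.disjoint_right.1 hZT ha, Finset.disjoint_right.1 hDT ha, .refl⟩
    | @tail y y' _ hy ih =>
      obtain ⟨c, h1, h2, h3, h4⟩ := ih
      by_cases hyZ : y' ∈ Z
      · exact ⟨c, h1, h2, h3, h4.tail ⟨hy.1, hyZ⟩⟩
      · exact ⟨y', h1.tail ⟨⟨h2, hyZ, .inl ⟨y, h4, hy.1⟩⟩, h3, hy.2.2⟩, hyZ, hy.2.2, .refl⟩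
  obtain ⟨c, h1, -, -, h4⟩ := key
  rcases ReflTransGen.cases_tail h4 with h | ⟨y, -, -, h⟩
  · subst h
    exact hD a ha _ hb hab h1
  · exact Finset.disjoint_right.1 hZT hb h

theorem sol_of_isolated {H : V → V → Prop} {T D : Finset V} (h : ∀ t ∈ T, Isolated H T D t) :
    Sol H T D := fun s hs t ht hst => h s hs t ht hst.symm

end Pushing
end DirectedMultiwayCut

/-! ### Programs with bounded loops: semantics, frame conditions and running time -/

namespace DirectedMultiwayCut

/-! ### Programs with bounded loops -/

@[simp] theorem State.setReg_reg (s : State) (x v y : ℕ) :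
    (s.setReg x v).reg y = if y = x then v else s.reg y := by
  simp [State.setReg, Function.update_apply]

@[simp] theorem State.setReg_arr (s : State) (x v : ℕ) : (s.setReg x v).arr = s.arr := (rfl)

@[simp] theorem State.setArr_reg (s : State) (a i v : ℕ) : (s.setArr a i v).reg = s.reg := (rfl)

@[simp] theorem State.setArr_arr (s : State) (a i v b : ℕ) :
    (s.setArr a i v).arr b = if b = a then Function.update (s.arr b) i v else s.arr b := by
  by_cases h : b = a
  · subst h
    simp [State.setArr]
  · simp [State.setArr, h]

instance : Add Expr := ⟨.add⟩
instance : Sub Expr := ⟨.sub⟩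

@[simp] theorem Expr.eval_num (s : State) (n : ℕ) : (Expr.num n).eval s = n := (rfl)
@[simp] theorem Expr.eval_add (s : State) (e f : Expr) : (e + f).eval s = e.eval s + f.eval s :=
  (rfl)
@[simp] theorem Expr.eval_sub (s : State) (e f : Expr) : (e - f).eval s = e.eval s - f.eval s :=
  (rfl)
@[simp] theorem Expr.eval_reg (s : State) (x : ℕ) : (Expr.reg x).eval s = s.reg x := (rfl)
@[simp] theorem Expr.eval_arr (s : State) (a : ℕ) (i : Expr) :
    (Expr.arr a i).eval s = s.arr a (i.eval s) := (rfl)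

/-- Programs whose loops run a register from zero up to the value of another register. -/
inductive Cmd where
  | skip
  | assign (x : ℕ) (e : Expr)
  | store (a : ℕ) (i e : Expr)
  | seq (c d : Cmd)
  | ite (e : Expr) (c d : Cmd)
  | rep (x b : ℕ) (c : Cmd)

namespace Cmd

/-- The program that a bounded-loop program stands for. -/
def toProg : Cmd → Prog
  | skip => .skip
  | assign x e => .assign x e
  | store a i e => .store a i e
  | seq c d => .seq c.toProg d.toProg
  | ite e c d => .branch e c.toProg d.toProg
  | rep x b c => .seq (.assign x (.num 0)) (.loop (.sub (.reg b) (.reg x))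
      (.seq c.toProg (.assign x (.add (.reg x) (.num 1)))))

/-- The state after `i` rounds of a loop with counter `x`. -/
def loopState (f : State → State) (x : ℕ) (s : State) : ℕ → State
  | 0 => s.setReg x 0
  | i + 1 => (f (loopState f x s i)).setReg x (i + 1)

/-- The final state. -/
def run : Cmd → State → State
  | skip => fun s => s
  | assign x e => fun s => s.setReg x (e.eval s)
  | store a i e => fun s => s.setArr a (i.eval s) (e.eval s)
  | seq c d => fun s => d.run (c.run s)
  | ite e c d => fun s => if e.eval s = 0 then d.run s else c.run s
  | rep x b c => fun s => loopState c.run x s (s.reg b)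

/-- The number of steps. -/
def time : Cmd → State → ℕ
  | skip => fun _ => 1
  | assign _ e => fun _ => e.cost + 1
  | store _ i e => fun _ => i.cost + e.cost + 1
  | seq c d => fun s => c.time s + d.time (c.run s)
  | ite e c d => fun s => e.cost + 1 + if e.eval s = 0 then d.time s else c.time s
  | rep x b c => fun s => 6 + ∑ i ∈ Finset.range (s.reg b), (c.time (loopState c.run x s i) + 8)

/-- Whether a register may be written. -/
def wr : Cmd → ℕ → Bool
  | skip => fun _ => false
  | assign x _ => fun y => y == x
  | store _ _ _ => fun _ => false
  | seq c d => fun y => c.wr y || d.wr y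
  | ite _ c d => fun y => c.wr y || d.wr y
  | rep x _ c => fun y => y == x || c.wr y

/-- Whether an array may be written. -/
def wa : Cmd → ℕ → Bool
  | skip => fun _ => false
  | assign _ _ => fun _ => false
  | store a _ _ => fun b => b == a
  | seq c d => fun y => c.wa y || d.wa y
  | ite _ c d => fun y => c.wa y || d.wa y
  | rep _ _ c => fun y => c.wa y

/-- No loop writes its counter or its bound in its body. -/
def wf : Cmd → Bool
  | skip => true
  | assign _ _ => true
  | store _ _ _ => true
  | seq c d => c.wf && d.wf
  | ite _ c d => c.wf && d.wf
  | rep x b c => c.wf && !c.wr x && !c.wr b && !(x == b)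

/-- The registers that bound loops. -/
def bds : Cmd → List ℕ
  | skip => []
  | assign _ _ => []
  | store _ _ _ => []
  | seq c d => c.bds ++ d.bds
  | ite _ c d => c.bds ++ d.bds
  | rep _ b c => b :: c.bds

/-- A bound for the time in terms of a bound for all loop lengths. -/
def tb : Cmd → ℕ → ℕ
  | skip => fun _ => 1
  | assign _ e => fun _ => e.cost + 1
  | store _ i e => fun _ => i.cost + e.cost + 1
  | seq c d => fun B => c.tb B + d.tb B
  | ite e c d => fun B => e.cost + 1 + (d.tb B + c.tb B)
  | rep _ _ c => fun B => 6 + B * (c.tb B + 8)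

/-- The registers and arrays that `c` does not write agree in `s` and `s'`. -/
structure Agree (c : Cmd) (s s' : State) : Prop where
  reg : ∀ y, c.wr y = false → s'.reg y = s.reg y
  arr : ∀ a, c.wa a = false → s'.arr a = s.arr a

theorem agree_loopState {x b : ℕ} {c : Cmd} {s : State} (h : ∀ s, c.Agree s (c.run s)) (i : ℕ) :
    (rep x b c).Agree s (loopState c.run x s i) := by
  induction i with
  | zero =>
    refine ⟨fun y hy => ?_, fun a _ => rfl⟩
    simp only [wr, Bool.or_eq_false_iff, beq_eq_false_iff_ne] at hy
    simp [loopState, State.setReg_reg, hy.1]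
  | succ i ih =>
    refine ⟨fun y hy => ?_, fun a ha => ?_⟩
    · have hy' := hy
      simp only [wr, Bool.or_eq_false_iff, beq_eq_false_iff_ne] at hy
      simp only [loopState, State.setReg_reg, hy.1, if_false]
      rw [(h _).reg y hy.2, ih.reg y hy']
    · have ha' := ha
      simp only [wa] at ha
      simp only [loopState, State.setReg_arr]
      rw [(h _).arr a ha, ih.arr a ha']

theorem agree_run (c : Cmd) : ∀ s, c.Agree s (c.run s) := by
  induction c with
  | skip => exact fun s => ⟨fun _ _ => rfl, fun _ _ => rfl⟩
  | assign x e =>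
    refine fun s => ⟨fun y hy => ?_, fun _ _ => rfl⟩
    simp only [wr, beq_eq_false_iff_ne] at hy
    simp [run, State.setReg_reg, hy]
  | store a i e =>
    refine fun s => ⟨fun _ _ => rfl, fun b hb => ?_⟩
    simp only [wa, beq_eq_false_iff_ne] at hb
    simp [run, State.setArr_arr, hb]
  | seq c d ihc ihd =>
    refine fun s => ⟨fun y hy => ?_, fun y hy => ?_⟩
    · simp only [wr, Bool.or_eq_false_iff] at hy
      simp only [run]
      rw [(ihd _).reg y hy.2, (ihc _).reg y hy.1]
    · simp only [wa, Bool.or_eq_false_iff] at hy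
      simp only [run]
      rw [(ihd _).arr y hy.2, (ihc _).arr y hy.1]
  | ite e c d ihc ihd =>
    refine fun s => ⟨fun y hy => ?_, fun y hy => ?_⟩
    · simp only [wr, Bool.or_eq_false_iff] at hy
      simp only [run]
      split_ifs
      · exact (ihd _).reg y hy.2
      · exact (ihc _).reg y hy.1
    · simp only [wa, Bool.or_eq_false_iff] at hy
      simp only [run]
      split_ifs
      · exact (ihd _).arr y hy.2
      · exact (ihc _).arr y hy.1
  | rep x b c ih => exact fun s => agree_loopState ih _

theorem run_reg (c : Cmd) (s : State) {y : ℕ} (hy : c.wr y = false) : (c.run s).reg y = s.reg y :=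
  (agree_run c s).reg y hy

theorem run_arr (c : Cmd) (s : State) {a : ℕ} (ha : c.wa a = false) : (c.run s).arr a = s.arr a :=
  (agree_run c s).arr a ha

theorem loopState_reg_self (f : State → State) (x : ℕ) (s : State) (i : ℕ) :
    (loopState f x s i).reg x = i := by
  cases i <;> simp [loopState, State.setReg_reg]

/-- The invariant rule for loops. -/
theorem run_rep {x b : ℕ} {c : Cmd} {s : State} (I : ℕ → State → Prop)
    (h0 : I 0 (s.setReg x 0))
    (hs : ∀ i s', i < s.reg b → s'.reg x = i → (rep x b c).Agree s s' → I i s' →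
      I (i + 1) ((c.run s').setReg x (i + 1))) :
    I (s.reg b) ((rep x b c).run s) := by
  have : ∀ i ≤ s.reg b, I i (loopState c.run x s i) := by
    intro i
    induction i with
    | zero => exact fun _ => h0
    | succ i ih =>
      exact fun hi => hs i _ (by omega) (loopState_reg_self _ _ _ _)
        (agree_loopState (agree_run c) i) (ih (by omega))
  exact this _ le_rfl

/-- Links the denotational `run` and `time` with the operational semantics. If counter and bound are
untouched by the body, the test `bound - counter` fails exactly after the intended number of rounds.
-/
theorem exec (c : Cmd) : c.wf = true → ∀ s, Exec c.toProg s (c.time s) (c.run s) := by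
  induction c with
  | skip => exact fun _ s => .skip s
  | assign x e => exact fun _ s => .assign x e s
  | store a i e => exact fun _ s => .store a i e s
  | seq c d ihc ihd =>
    intro h s
    simp only [wf, Bool.and_eq_true] at h
    exact .seq (ihc h.1 s) (ihd h.2 _)
  | ite e c d ihc ihd =>
    intro h s
    simp only [wf, Bool.and_eq_true] at h
    simp only [toProg, run, time]
    split_ifs with he
    · exact .branchFalse _ he (ihd h.2 s)
    · exact .branchTrue _ he (ihc h.1 s)
  | rep x b c ih =>
    intro h s
    simp only [wf, Bool.and_eq_true, Bool.not_eq_true', beq_eq_false_iff_ne] at h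
    obtain ⟨⟨⟨hc, hx⟩, hb⟩, hxb⟩ := h
    have hbreg : ∀ i, (loopState c.run x s i).reg b = s.reg b := fun i =>
      (agree_loopState (x := x) (b := b) (agree_run c) i).reg b (by
        simp [wr, hb, beq_eq_false_iff_ne, hxb.symm])
    -- Induction on the number `d` of remaining rounds. A test takes four steps and so does the
    -- increment, which gives `8` per round and `4` for the final test; the initial assignment takes
    -- two more.
    have key : ∀ d ≤ s.reg b, Exec (.loop (.sub (.reg b) (.reg x))
        (.seq c.toProg (.assign x (.add (.reg x) (.num 1)))))
        (loopState c.run x s (s.reg b - d))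
        (4 + ∑ i ∈ Finset.Ico (s.reg b - d) (s.reg b), (c.time (loopState c.run x s i) + 8))
        (loopState c.run x s (s.reg b)) := by
      intro d
      induction d with
      | zero =>
        intro _
        simp only [Nat.sub_zero, Finset.Ico_self, Finset.sum_empty]
        exact .loopFalse _ (by simp [Expr.eval, hbreg, loopState_reg_self])
      | succ d ihd =>
        intro hd
        have hi : s.reg b - (d + 1) + 1 = s.reg b - d := by omega
        have h1 := ihd (by omega)
        rw [← hi] at h1
        rw [Finset.sum_eq_sum_Ico_succ_bot (by omega)]
        have h2 := Exec.seq (ih hc (loopState c.run x s (s.reg b - (d + 1))))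
          (Exec.assign x (.add (.reg x) (.num 1)) _)
        have h3 : (c.run (loopState c.run x s (s.reg b - (d + 1)))).setReg x
            (Expr.eval (c.run (loopState c.run x s (s.reg b - (d + 1))))
              (.add (.reg x) (.num 1))) = loopState c.run x s (s.reg b - (d + 1) + 1) := by
          simp only [loopState, Expr.eval]
          rw [run_reg c _ hx, loopState_reg_self]
        rw [h3] at h2
        have h4 := Exec.loopTrue (e := .sub (.reg b) (.reg x))
          (by simp only [Expr.eval, hbreg, loopState_reg_self]; omega) h2 h1
        convert h4 using 1
        simp only [Expr.cost]
        omega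
    have h1 := key _ le_rfl
    rw [Nat.sub_self] at h1
    have h2 := Exec.seq (Exec.assign x (.num 0) s) h1
    have h3 : (rep x b c).time s = (Expr.num 0).cost + 1 +
        (4 + ∑ i ∈ Finset.Ico 0 (s.reg b), (c.time (loopState c.run x s i) + 8)) := by
      change 6 + _ = 2 + _
      rw [Finset.range_eq_Ico]
      omega
    rw [h3]
    exact h2

/-- When no bounding register is ever written, loop lengths are known from the initial state, and
one number `B` bounds all of them at every nesting depth. -/
theorem time_le (c : Cmd) {B : ℕ} : ∀ s, (∀ b ∈ c.bds, c.wr b = false ∧ s.reg b ≤ B) →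
    c.time s ≤ c.tb B := by
  induction c with
  | skip => exact fun _ _ => le_rfl
  | assign x e => exact fun _ _ => le_rfl
  | store a i e => exact fun _ _ => le_rfl
  | seq c d ihc ihd =>
    intro s h
    simp only [bds, List.mem_append, wr, Bool.or_eq_false_iff] at h
    refine Nat.add_le_add (ihc s fun b hb => ⟨(h b (.inl hb)).1.1, (h b (.inl hb)).2⟩)
      (ihd _ fun b hb => ⟨(h b (.inr hb)).1.2, ?_⟩)
    rw [run_reg c s (h b (.inr hb)).1.1]
    exact (h b (.inr hb)).2
  | ite e c d ihc ihd =>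
    intro s h
    simp only [bds, List.mem_append, wr, Bool.or_eq_false_iff] at h
    have h1 := ihc s fun b hb => ⟨(h b (.inl hb)).1.1, (h b (.inl hb)).2⟩
    have h2 := ihd s fun b hb => ⟨(h b (.inr hb)).1.2, (h b (.inr hb)).2⟩
    simp only [time, tb]
    split_ifs <;> omega
  | rep x b c ih =>
    intro s h
    simp only [bds, List.mem_cons, wr, Bool.or_eq_false_iff] at h
    simp only [time, tb]
    refine Nat.add_le_add_left ?_ _
    have h1 : ∀ i ∈ Finset.range (s.reg b), c.time (loopState c.run x s i) + 8 ≤ c.tb B + 8 := by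
      intro i _
      refine Nat.add_le_add_right (ih _ fun y hy => ⟨(h y (.inr hy)).1.2, ?_⟩) _
      rw [(agree_loopState (x := x) (b := b) (agree_run c) i).reg y (by
        simp only [wr, Bool.or_eq_false_iff]
        exact (h y (.inr hy)).1)]
      exact (h y (.inr hy)).2
    refine (Finset.sum_le_card_nsmul _ _ _ h1).trans ?_
    rw [Finset.card_range, smul_eq_mul]
    exact Nat.mul_le_mul_right _ (h b (.inl rfl)).2

/-- The degree is the nesting depth of the loops, a constant of the program. Thus a bound on the
loop lengths is all that the time analysis needs. -/
theorem exists_tb_le (c : Cmd) : ∃ K d, ∀ B, c.tb B ≤ K * (B + 1) ^ d := by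
  have mono : ∀ {K K' d d' B : ℕ}, K ≤ K' → d ≤ d' → K * (B + 1) ^ d ≤ K' * (B + 1) ^ d' :=
    fun h h' => Nat.mul_le_mul h (Nat.pow_le_pow_right (by omega) h')
  induction c with
  | skip => exact ⟨1, 0, fun B => by simp [tb]⟩
  | assign x e => exact ⟨e.cost + 1, 0, fun B => by simp [tb]⟩
  | store a i e => exact ⟨i.cost + e.cost + 1, 0, fun B => by simp [tb]⟩
  | seq c d ihc ihd =>
    obtain ⟨K, m, h⟩ := ihc
    obtain ⟨K', m', h'⟩ := ihd
    refine ⟨K + K', max m m', fun B => ?_⟩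
    rw [add_mul]
    exact Nat.add_le_add ((h B).trans (mono le_rfl (le_max_left _ _)))
      ((h' B).trans (mono le_rfl (le_max_right _ _)))
  | ite e c d ihc ihd =>
    obtain ⟨K, m, h⟩ := ihc
    obtain ⟨K', m', h'⟩ := ihd
    refine ⟨e.cost + 1 + (K' + K), max m m', fun B => ?_⟩
    rw [add_mul (e.cost + 1), add_mul K' K]
    refine Nat.add_le_add ?_ (Nat.add_le_add ((h' B).trans (mono le_rfl (le_max_right _ _)))
      ((h B).trans (mono le_rfl (le_max_left _ _))))
    exact Nat.le_mul_of_pos_right _ (by positivity)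
  | rep x b c ih =>
    obtain ⟨K, m, h⟩ := ih
    refine ⟨6 + (K + 8), m + 1, fun B => ?_⟩
    have h1 : 1 ≤ (B + 1) ^ m := Nat.one_le_pow _ _ (by omega)
    have h2 := h B
    have h3 : B * (c.tb B + 8) ≤ (B + 1) * (K * (B + 1) ^ m + 8 * (B + 1) ^ m) :=
      Nat.mul_le_mul (by omega) (by omega)
    simp only [tb]
    calc 6 + B * (c.tb B + 8) ≤ 6 * (B + 1) ^ (m + 1) +
        (B + 1) * (K * (B + 1) ^ m + 8 * (B + 1) ^ m) := by
          refine Nat.add_le_add ?_ h3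
          exact Nat.le_mul_of_pos_right _ (by positivity)
      _ = (6 + (K + 8)) * (B + 1) ^ (m + 1) := by ring

end Cmd
end DirectedMultiwayCut

/-! ### Residual networks, and furthest cuts through the split network -/

namespace DirectedMultiwayCut
open Relation

/-! ### Residual networks -/

/-- `r` is the residual network of an integral flow of value `val` in the network `c`, with one more
unit on its way from `s` to `t` that has reached `u`. -/
structure Residual (M s t : ℕ) (c r : ℕ → ℕ → ℕ) (val u : ℕ) : Prop where
  symm : ∀ x < M, ∀ y < M, r x y + r y x = c x y + c y x
  net : ∀ x < M, ∑ y ∈ Finset.range M, (c x y : ℤ) - ∑ y ∈ Finset.range M, (r x y : ℤ) =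
    val * ((if x = s then 1 else 0) - if x = t then 1 else 0) +
      ((if x = s then 1 else 0) - if x = u then 1 else 0)

theorem Residual.refl (M s t : ℕ) (c : ℕ → ℕ → ℕ) : Residual M s t c c 0 s :=
  ⟨fun _ _ _ _ => rfl, fun x _ => by simp⟩

theorem Residual.arrive {M s t val : ℕ} {c r : ℕ → ℕ → ℕ} (h : Residual M s t c r val t) :
    Residual M s t c r (val + 1) s :=
  ⟨h.symm, fun x hx => by rw [h.net x hx]; push_cast; ring⟩

/-- Sending one unit along `(u, v)`. -/
def push (r : ℕ → ℕ → ℕ) (u v x y : ℕ) : ℕ :=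
  if x = u ∧ y = v then r u v - 1 else if x = v ∧ y = u then r v u + 1 else r x y

theorem Residual.push {M s t val u v : ℕ} {c r : ℕ → ℕ → ℕ} (h : Residual M s t c r val u)
    (hu : u < M) (hv : v < M) (huv : u ≠ v) (hr : r u v ≠ 0) :
    Residual M s t c (push r u v) val v := by
  refine ⟨fun x hx y hy => ?_, fun x hx => ?_⟩
  · rw [← h.symm x hx y hy]
    simp only [DirectedMultiwayCut.push]
    split_ifs <;> simp_all <;> omega
  · have h1 := h.net x hx
    have h2 : ∀ y, (DirectedMultiwayCut.push r u v x y : ℤ) = r x y -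
        (if x = u then if y = v then 1 else 0 else 0) +
        (if x = v then if y = u then 1 else 0 else 0) := by
      intro y
      simp only [DirectedMultiwayCut.push]
      split_ifs <;> simp_all <;> omega
    simp only [h2, Finset.sum_add_distrib, Finset.sum_sub_distrib]
    have h3 : ∑ y ∈ Finset.range M, (if x = u then if y = v then 1 else 0 else 0 : ℤ) =
        if x = u then 1 else 0 := by
      split_ifs <;> simp [hv]
    have h4 : ∑ y ∈ Finset.range M, (if x = v then if y = u then 1 else 0 else 0 : ℤ) =
        if x = v then 1 else 0 := by
      split_ifs <;> simp [hu]
    rw [h3, h4]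
    linarith

/-- The capacity of the cut `C`. -/
def cutCap (M : ℕ) (c : ℕ → ℕ → ℕ) (C : Finset ℕ) : ℕ :=
  ∑ x ∈ C, ∑ y ∈ Finset.range M \ C, c x y

/-- Summing the balance equations over `C` gives the value of the flow; arcs inside `C` cancel
because residual and original capacities agree on unordered pairs. -/
theorem Residual.cutCap_eq {M s t val : ℕ} {c r : ℕ → ℕ → ℕ} (h : Residual M s t c r val s)
    {C : Finset ℕ} (hC : C ⊆ Finset.range M) (hs : s ∈ C) (ht : t ∉ C) :
    cutCap M c C = val + cutCap M r C := by
  have h1 : ∑ x ∈ C, (∑ y ∈ Finset.range M, (c x y : ℤ) - ∑ y ∈ Finset.range M, (r x y : ℤ)) =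
      val := by
    rw [Finset.sum_congr rfl fun x hx => h.net x (Finset.mem_range.1 (hC hx))]
    simp [← Finset.mul_sum, Finset.sum_sub_distrib, hs, ht]
  have h2 : ∀ f : ℕ → ℕ → ℕ, ∑ x ∈ C, ∑ y ∈ Finset.range M, (f x y : ℤ) =
      cutCap M f C + ∑ x ∈ C, ∑ y ∈ C, (f x y : ℤ) := by
    intro f
    simp only [cutCap, Nat.cast_sum, ← Finset.sum_add_distrib, Finset.sum_sdiff hC]
  have h3 : ∑ x ∈ C, ∑ y ∈ C, (c x y : ℤ) = ∑ x ∈ C, ∑ y ∈ C, (r x y : ℤ) := by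
    have h4 : ∀ f : ℕ → ℕ → ℕ, 2 * ∑ x ∈ C, ∑ y ∈ C, (f x y : ℤ) =
        ∑ x ∈ C, ∑ y ∈ C, ((f x y : ℤ) + f y x) := by
      intro f
      simp only [Finset.sum_add_distrib]
      rw [Finset.sum_comm (f := fun x y => (f y x : ℤ))]
      ring
    have h5 : ∑ x ∈ C, ∑ y ∈ C, ((r x y : ℤ) + r y x) = ∑ x ∈ C, ∑ y ∈ C, ((c x y : ℤ) + c y x) :=
      Finset.sum_congr rfl fun x hx => Finset.sum_congr rfl fun y hy => by
        exact_mod_cast h.symm x (Finset.mem_range.1 (hC hx)) y (Finset.mem_range.1 (hC hy))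
    have := h4 c
    have := h4 r
    omega
  rw [Finset.sum_sub_distrib, h2, h2, h3] at h1
  omega

theorem le_cutCap {M : ℕ} {c : ℕ → ℕ → ℕ} {C : Finset ℕ} {x y : ℕ} (hx : x ∈ C) (hy : y < M)
    (hyC : y ∉ C) : c x y ≤ cutCap M c C :=
  (Finset.single_le_sum (f := fun y => c x y) (fun _ _ => Nat.zero_le _)
    (Finset.mem_sdiff.2 ⟨Finset.mem_range.2 hy, hyC⟩)).trans
    (Finset.single_le_sum (f := fun x => ∑ y ∈ Finset.range M \ C, c x y)
      (fun _ _ => Nat.zero_le _) hx)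

/-- `L` is the distance to `t` plus one, or zero where `t` cannot be reached. -/
structure Labels (M t : ℕ) (r : ℕ → ℕ → ℕ) (L : ℕ → ℕ) : Prop where
  root : L t = 1
  one : ∀ u < M, L u = 1 → u = t
  next : ∀ u < M, 1 < L u → ∃ v < M, r u v ≠ 0 ∧ L v + 1 = L u
  closed : ∀ u < M, ∀ v < M, r u v ≠ 0 → L v ≠ 0 → L u ≠ 0
  le : ∀ u < M, L u ≤ M

/-- The nodes without label. -/
def unlabelled (M : ℕ) (L : ℕ → ℕ) : Finset ℕ := (Finset.range M).filter fun x => L x = 0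

theorem mem_unlabelled {M : ℕ} {L : ℕ → ℕ} {x : ℕ} : x ∈ unlabelled M L ↔ x < M ∧ L x = 0 := by
  simp [unlabelled]

theorem Labels.ne_zero_iff {M t : ℕ} {r : ℕ → ℕ → ℕ} {L : ℕ → ℕ} (h : Labels M t r L) {u : ℕ}
    (hu : u < M) :
    L u ≠ 0 ↔ ReflTransGen (fun x y => x < M ∧ y < M ∧ r x y ≠ 0) u t := by
  constructor
  · have : ∀ n u, u < M → L u = n + 1 → ReflTransGen (fun x y => x < M ∧ y < M ∧ r x y ≠ 0) u t := by
      intro n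
      induction n with
      | zero =>
        intro u hu hL
        rw [h.one u hu hL]
      | succ n ih =>
        intro u hu hL
        obtain ⟨v, hv, hr, hL'⟩ := h.next u hu (by omega)
        exact .head ⟨hu, hv, hr⟩ (ih v hv (by omega))
    intro hL
    exact this (L u - 1) u hu (by omega)
  · intro hp
    induction hp using ReflTransGen.head_induction_on with
    | refl => simp [h.root]
    | head hr _ ih => exact h.closed _ hr.1 _ hr.2.1 hr.2.2 (ih hr.2.1)

theorem Labels.cutCap_eq_zero {M t : ℕ} {r : ℕ → ℕ → ℕ} {L : ℕ → ℕ} (h : Labels M t r L) :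
    cutCap M r (unlabelled M L) = 0 := by
  refine Finset.sum_eq_zero fun x hx => Finset.sum_eq_zero fun y hy => ?_
  rw [Finset.mem_sdiff, mem_unlabelled, Finset.mem_range] at hy
  rw [mem_unlabelled] at hx
  by_contra hr
  exact h.closed x hx.1 y hy.1 hr (fun h => hy.2 ⟨hy.1, h⟩) hx.2

/-- `C` is the largest cut of minimal capacity, and that capacity is at most `k`. -/
structure FurthestCut (M s t : ℕ) (c : ℕ → ℕ → ℕ) (k : ℕ) (C : Finset ℕ) : Prop where
  sub : C ⊆ Finset.range M
  source : s ∈ C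
  sink : t ∉ C
  cap_le : cutCap M c C ≤ k
  le : ∀ C' ⊆ Finset.range M, s ∈ C' → t ∉ C' → cutCap M c C ≤ cutCap M c C'
  max : ∀ C' ⊆ Finset.range M, s ∈ C' → t ∉ C' → cutCap M c C' ≤ cutCap M c C → C' ⊆ C

/-- No residual capacity leaves the set of unlabelled nodes, so it is a minimum cut. Conversely,
nothing residual leaves any other minimum cut, so none of its nodes reaches the sink and all of them
are unlabelled. Labelling from the sink, not from the source, is what yields the furthest cut. -/
theorem Residual.furthestCut {M s t val k : ℕ} {c r : ℕ → ℕ → ℕ} {L : ℕ → ℕ}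
    (h : Residual M s t c r val s) (hL : Labels M t r L) (hs : s < M)
    (hs0 : L s = 0) (hk : val ≤ k) : FurthestCut M s t c k (unlabelled M L) := by
  have hsub : unlabelled M L ⊆ Finset.range M := Finset.filter_subset _ _
  have hsC : s ∈ unlabelled M L := mem_unlabelled.2 ⟨hs, hs0⟩
  have htC : t ∉ unlabelled M L := fun h => by
    have := (mem_unlabelled.1 h).2
    rw [hL.root] at this
    omega
  have h1 := h.cutCap_eq hsub hsC htC
  rw [hL.cutCap_eq_zero] at h1
  refine ⟨hsub, hsC, htC, by omega, fun C hC hs ht => ?_, fun C hC hs ht hle => ?_⟩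
  · have := h.cutCap_eq hC hs ht
    omega
  · have h2 := h.cutCap_eq hC hs ht
    intro x hx
    have hxM := Finset.mem_range.1 (hC hx)
    refine mem_unlabelled.2 ⟨hxM, ?_⟩
    by_contra hne
    have hp := (hL.ne_zero_iff hxM).1 hne
    have : ∀ y, ReflTransGen (fun x y => x < M ∧ y < M ∧ r x y ≠ 0) x y → y ∈ C := by
      intro y hy
      induction hy with
      | refl => exact hx
      | tail _ hr ih =>
        by_contra hc
        have := le_cutCap (c := r) ih hr.2.1 hc
        omega
    exact ht (this t hp)

theorem Residual.label_source_eq_zero {M s t val : ℕ} {c r : ℕ → ℕ → ℕ} {L : ℕ → ℕ}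
    (h : Residual M s t c r val s) (hL : Labels M t r L) (hs : s < M) {C : Finset ℕ}
    (hC : C ⊆ Finset.range M) (hsC : s ∈ C) (htC : t ∉ C) (hcap : cutCap M c C ≤ val) :
    L s = 0 := by
  by_contra hne
  have hp := (hL.ne_zero_iff hs).1 hne
  have h2 := h.cutCap_eq hC hsC htC
  have : ∀ y, ReflTransGen (fun x y => x < M ∧ y < M ∧ r x y ≠ 0) s y → y ∈ C := by
    intro y hy
    induction hy with
    | refl => exact hsC
    | tail _ hr ih =>
      by_contra hc
      have := le_cutCap (c := r) ih hr.2.1 hc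
      omega
  exact htC (this t hp)

/-! ### The split network of a digraph -/

/-- The set of vertices at which an array is not zero. -/
def vset (N : ℕ) (f : ℕ → ℕ) : Finset (Fin N) := Finset.univ.filter fun v => f v ≠ 0

theorem mem_vset {N : ℕ} {f : ℕ → ℕ} {v : Fin N} : v ∈ vset N f ↔ f v ≠ 0 := by simp [vset]

/-- The digraph with a given adjacency matrix. -/
def adj (N : ℕ) (g : ℕ → ℕ) (u v : Fin N) : Prop := g (u * N + v) ≠ 0

/-- The capacities of the split network: a vertex `v` is split into the nodes `v` and `N + v`, the
source is `2 * N` and the sink `2 * N + 1`. -/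
def splitCap (k N : ℕ) (g w ks d p : ℕ → ℕ) (x y : ℕ) : ℕ :=
  if x < N then
    if y = N + x then
      if d x ≠ 0 then 0 else if w x ≠ 0 then k + 1 else if p x ≠ 0 then 1 else k + 1
    else 0
  else if x < N + N then
    if y < N then if g ((x - N) * N + y) ≠ 0 then k + 1 else 0
    else if y = N + N + 1 then if ks (x - N) ≠ 0 then k + 1 else 0 else 0
  else if x = N + N then if y < N then if w y ≠ 0 then k + 1 else 0 else 0
  else 0

section Split

variable {k N : ℕ} {g w ks d p : ℕ → ℕ}

theorem splitCap_split {v : ℕ} (hv : v < N) : splitCap k N g w ks d p v (N + v) =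
    if d v ≠ 0 then 0 else if w v ≠ 0 then k + 1 else if p v ≠ 0 then 1 else k + 1 := by
  simp [splitCap, hv]

theorem splitCap_arc {u v : ℕ} (hu : u < N) (hv : v < N) : splitCap k N g w ks d p (N + u) v =
    if g (u * N + v) ≠ 0 then k + 1 else 0 := by
  have h1 : ¬ N + u < N := by omega
  simp [splitCap, hv, hu, h1]

theorem splitCap_sink {u : ℕ} (hu : u < N) : splitCap k N g w ks d p (N + u) (N + N + 1) =
    if ks u ≠ 0 then k + 1 else 0 := by
  have h1 : ¬ N + u < N := by omega
  have h2 : ¬ N + N + 1 < N := by omega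
  simp [splitCap, hu, h1, h2]

theorem splitCap_source {v : ℕ} (hv : v < N) : splitCap k N g w ks d p (N + N) v =
    if w v ≠ 0 then k + 1 else 0 := by
  simp [splitCap, hv]

/-- The cut of the split network that belongs to `A`. -/
noncomputable def sideCut (N : ℕ) (g d : ℕ → ℕ) (A : Finset (Fin N)) : Finset ℕ :=
  insert (N + N) (((A ∪ outN (adj N g) A ∪ vset N d).image fun v : Fin N => (v : ℕ)) ∪
    A.image fun v : Fin N => N + (v : ℕ))

theorem mem_sideCut_in {A : Finset (Fin N)} {v : Fin N} :
    (v : ℕ) ∈ sideCut N g d A ↔ v ∈ A ∨ v ∈ outN (adj N g) A ∨ v ∈ vset N d := by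
  have h1 : (v : ℕ) ≠ N + N := by omega
  have h2 : ∀ a : Fin N, N + (a : ℕ) ≠ v := fun a => by omega
  simp [sideCut, h1, h2, Fin.val_inj]

theorem mem_sideCut_out {A : Finset (Fin N)} {v : Fin N} :
    N + (v : ℕ) ∈ sideCut N g d A ↔ v ∈ A := by
  have h1 : (v : ℕ) ≠ N := by omega
  have h2 : ∀ a : Fin N, (a : ℕ) ≠ N + v := fun a => by omega
  simp [sideCut, h1, h2, Fin.val_inj]

theorem sideCut_subset {A : Finset (Fin N)} : sideCut N g d A ⊆ Finset.range (N + N + 2) := by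
  intro x
  simp only [sideCut, Finset.mem_insert, Finset.mem_union, Finset.mem_image, Finset.mem_range]
  rintro (h | ⟨v, -, h⟩ | ⟨v, -, h⟩) <;> omega

theorem source_mem_sideCut {A : Finset (Fin N)} : N + N ∈ sideCut N g d A :=
  Finset.mem_insert_self _ _

theorem sink_not_mem_sideCut {A : Finset (Fin N)} : N + N + 1 ∉ sideCut N g d A := by
  simp only [sideCut, Finset.mem_insert, Finset.mem_union, Finset.mem_image]
  rintro (h | ⟨v, -, h⟩ | ⟨v, -, h⟩) <;> omega

/-- The only arcs of positive capacity leaving this cut are the split arcs of boundary vertices that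
are not deleted, each of capacity one. -/
theorem cutCap_sideCut_le {A : Finset (Fin N)}
    (hA : Side (adj N g) (vset N ks) (vset N p) (vset N w) (vset N d) A) :
    cutCap (N + N + 2) (splitCap k N g w ks d p) (sideCut N g d A) ≤
      (outN (adj N g) A \ vset N d).card := by
  obtain ⟨⟨hK, hP⟩, hW, hD⟩ := hA
  let Y := (outN (adj N g) A \ vset N d).image fun v : Fin N => (v : ℕ)
  have key : ∀ x ∈ sideCut N g d A, ∑ y ∈ Finset.range (N + N + 2) \ sideCut N g d A,
      splitCap k N g w ks d p x y ≤ if x ∈ Y then 1 else 0 := by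
    intro x hx
    have hx' := hx
    simp only [sideCut, Finset.mem_insert, Finset.mem_union (s := Finset.image _ _),
      Finset.mem_image] at hx'
    rcases hx' with rfl | ⟨v, hv, rfl⟩ | ⟨v, hv, rfl⟩
    · refine (Finset.sum_eq_zero fun y hy => ?_).trans_le (Nat.zero_le _)
      simp only [Finset.mem_sdiff] at hy
      by_cases hyN : y < N
      · rw [splitCap_source hyN, if_neg]
        intro h
        exact hy.2 (mem_sideCut_in (v := ⟨y, hyN⟩).2 (.inl (hW (mem_vset.2 h))))
      · simp [splitCap, hyN]
    · have h1 : ∑ y ∈ Finset.range (N + N + 2) \ sideCut N g d A,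
          splitCap k N g w ks d p v y ≤ ∑ y ∈ Finset.range (N + N + 2) \ sideCut N g d A,
            if y = N + v then splitCap k N g w ks d p v (N + v) else 0 := by
        refine Finset.sum_le_sum fun y _ => ?_
        by_cases hy : y = N + v
        · rw [if_pos hy, hy]
        · simp [splitCap, hy]
      refine h1.trans ?_
      rw [Finset.sum_ite_eq']
      split_ifs with h2 h3 h3
      · rw [splitCap_split v.2]
        obtain ⟨v', hv', hvv⟩ := Finset.mem_image.1 h3
        obtain rfl := Fin.val_injective hvv
        obtain ⟨ho, hd⟩ := Finset.mem_sdiff.1 hv'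
        rw [mem_vset, not_not] at hd
        have hw : w v' = 0 := by
          by_contra hc
          exact (mem_outN.1 ho).1 (hW (mem_vset.2 hc))
        simp [hd, hw, mem_vset.1 (hP ho)]
      · rw [splitCap_split v.2]
        rw [Finset.mem_sdiff, mem_sideCut_out] at h2
        have hd : v ∈ vset N d := by
          by_contra hd
          simp only [Finset.mem_union] at hv
          refine h3 (Finset.mem_image.2 ⟨v, Finset.mem_sdiff.2 ⟨?_, hd⟩, rfl⟩)
          tauto
        rw [if_pos (mem_vset.1 hd)]
      · omega
      · omega
    · refine (Finset.sum_eq_zero fun y hy => ?_).trans_le (Nat.zero_le _)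
      simp only [Finset.mem_sdiff] at hy
      by_cases hyN : y < N
      · rw [splitCap_arc v.2 hyN, if_neg]
        intro h
        refine hy.2 (mem_sideCut_in (v := ⟨y, hyN⟩).2 ?_)
        by_cases hyA : (⟨y, hyN⟩ : Fin N) ∈ A
        · exact .inl hyA
        · exact .inr (.inl (mem_outN.2 ⟨hyA, v, hv, h⟩))
      · by_cases hyt : y = N + N + 1
        · rw [hyt, splitCap_sink v.2, if_neg]
          intro h
          exact Finset.disjoint_left.1 hK hv (mem_vset.2 h)
        · have h1 : ¬ N + (v : ℕ) < N := by omega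
          simp [splitCap, hyN, hyt, h1]
  refine (Finset.sum_le_sum key).trans ?_
  rw [← Finset.sum_filter, Finset.sum_const, smul_eq_mul, mul_one]
  refine (Finset.card_le_card (t := Y) ?_).trans Finset.card_image_le
  intro x hx
  exact (Finset.mem_filter.1 hx).2

/-- The vertices on the near side of a cut of the split network. -/
def nearSide (N : ℕ) (d : ℕ → ℕ) (C : Finset ℕ) : Finset (Fin N) :=
  Finset.univ.filter fun v => d v = 0 ∧ (v : ℕ) ∈ C ∧ N + (v : ℕ) ∈ C

/-- The vertices that are cut by a cut of the split network. -/
def cutSet (N : ℕ) (d : ℕ → ℕ) (C : Finset ℕ) : Finset (Fin N) :=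
  Finset.univ.filter fun v => d v = 0 ∧ (v : ℕ) ∈ C ∧ N + (v : ℕ) ∉ C

theorem card_cutSet_le {C : Finset ℕ} :
    (cutSet N d C).card ≤ cutCap (N + N + 2) (splitCap k N g w ks d p) C := by
  have h1 : (cutSet N d C).card = ∑ v ∈ cutSet N d C, 1 := by simp
  rw [h1]
  calc ∑ v ∈ cutSet N d C, 1 ≤ ∑ v ∈ cutSet N d C,
        ∑ y ∈ Finset.range (N + N + 2) \ C, splitCap k N g w ks d p v y := by
        refine Finset.sum_le_sum fun v hv => ?_
        simp only [cutSet, Finset.mem_filter, Finset.mem_univ, true_and] at hv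
        have h2 : N + (v : ℕ) ∈ Finset.range (N + N + 2) \ C :=
          Finset.mem_sdiff.2 ⟨Finset.mem_range.2 (by omega), hv.2.2⟩
        refine le_trans ?_ (Finset.single_le_sum
          (f := fun y => splitCap k N g w ks d p v y) (fun _ _ => Nat.zero_le _) h2)
        rw [splitCap_split v.2]
        simp only [hv.1, ne_eq, not_true_eq_false, if_false]
        split_ifs <;> omega
    _ = ∑ x ∈ (cutSet N d C).image (fun v : Fin N => (v : ℕ)),
        ∑ y ∈ Finset.range (N + N + 2) \ C, splitCap k N g w ks d p x y := by
        rw [Finset.sum_image fun a _ b _ h => Fin.val_injective h]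
    _ ≤ _ := by
        refine Finset.sum_le_sum_of_subset fun x hx => ?_
        obtain ⟨v, hv, rfl⟩ := Finset.mem_image.1 hx
        simp only [cutSet, Finset.mem_filter, Finset.mem_univ, true_and] at hv
        exact hv.2.1

/-- The capacity `k + 1` serves as infinity: such an arc cannot leave a cut of capacity at most `k`.
Every requirement on `Side` is encoded by arcs of this kind or by the capacity zero of deleted
vertices. -/
theorem side_nearSide (hWD : Disjoint (vset N w) (vset N d)) (hDP : vset N d ⊆ vset N p)
    {C : Finset ℕ} (hs : N + N ∈ C) (ht : N + N + 1 ∉ C)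
    (hC : cutCap (N + N + 2) (splitCap k N g w ks d p) C ≤ k) :
    Side (adj N g) (vset N ks) (vset N p) (vset N w) (vset N d) (nearSide N d C) ∧
      outN (adj N g) (nearSide N d C) \ vset N d ⊆ cutSet N d C := by
  have hbig : ∀ x ∈ C, ∀ y < N + N + 2, splitCap k N g w ks d p x y = k + 1 → y ∈ C := by
    intro x hx y hy hxy
    by_contra hc
    have := le_cutCap (c := splitCap k N g w ks d p) hx hy hc
    omega
  have hmem : ∀ v : Fin N, v ∈ nearSide N d C ↔ d v = 0 ∧ (v : ℕ) ∈ C ∧ N + (v : ℕ) ∈ C :=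
    fun v => by simp [nearSide]
  have hout : outN (adj N g) (nearSide N d C) \ vset N d ⊆ cutSet N d C := by
    intro y hy
    obtain ⟨h1, h2⟩ := Finset.mem_sdiff.1 hy
    obtain ⟨h3, u, hu, hr⟩ := mem_outN.1 h1
    rw [mem_vset, not_not] at h2
    have hin : (y : ℕ) ∈ C := hbig _ ((hmem u).1 hu).2.2 _ (by omega) (by
      rw [splitCap_arc u.2 y.2]; exact if_pos hr)
    rw [hmem] at h3
    simp only [cutSet, Finset.mem_filter, Finset.mem_univ, true_and]
    tauto
  refine ⟨⟨⟨?_, ?_⟩, ?_, ?_⟩, hout⟩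
  · refine Finset.disjoint_left.2 fun v hv hk => ht (hbig _ ((hmem v).1 hv).2.2 _ (by omega) ?_)
    rw [splitCap_sink v.2, if_pos (mem_vset.1 hk)]
  · intro y hy
    by_cases hd : y ∈ vset N d
    · exact hDP hd
    · have h1 := hout (Finset.mem_sdiff.2 ⟨hy, hd⟩)
      simp only [cutSet, Finset.mem_filter, Finset.mem_univ, true_and] at h1
      by_contra hp
      rw [mem_vset, not_not] at hp
      refine h1.2.2 (hbig _ h1.2.1 _ (by omega) ?_)
      rw [splitCap_split y.2]
      simp [h1.1, hp]
  · intro v hv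
    have hd : d v = 0 := by
      by_contra hc
      exact Finset.disjoint_left.1 hWD hv (mem_vset.2 hc)
    rw [mem_vset] at hv
    have hin : (v : ℕ) ∈ C := hbig _ hs _ (by omega) (by rw [splitCap_source v.2, if_pos hv])
    refine (hmem v).2 ⟨hd, hin, hbig _ hin _ (by omega) ?_⟩
    rw [splitCap_split v.2]
    simp [hd, hv]
  · refine Finset.disjoint_left.2 fun v hv hd => mem_vset.1 hd ((hmem v).1 hv).1

/-- Passing from sides to cuts and back never increases the cost, so the two minima agree; the first
passage also transports maximality. -/
theorem FurthestCut.furthestSide {C : Finset ℕ}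
    (h : FurthestCut (N + N + 2) (N + N) (N + N + 1) (splitCap k N g w ks d p) k C)
    (hWD : Disjoint (vset N w) (vset N d)) (hDP : vset N d ⊆ vset N p) :
    FurthestSide (adj N g) (vset N ks) (vset N p) (vset N w) (vset N d) (nearSide N d C) ∧
      outN (adj N g) (nearSide N d C) \ vset N d = cutSet N d C := by
  obtain ⟨h1, h2⟩ := side_nearSide hWD hDP h.source h.sink h.cap_le
  have hle : ∀ A, Side (adj N g) (vset N ks) (vset N p) (vset N w) (vset N d) A →
      cutCap (N + N + 2) (splitCap k N g w ks d p) C ≤ (outN (adj N g) A \ vset N d).card :=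
    fun A hA => (h.le _ sideCut_subset source_mem_sideCut sink_not_mem_sideCut).trans
      (cutCap_sideCut_le hA)
  have h3 : (outN (adj N g) (nearSide N d C) \ vset N d).card ≤
      cutCap (N + N + 2) (splitCap k N g w ks d p) C :=
    (Finset.card_le_card h2).trans card_cutSet_le
  refine ⟨⟨h1, fun A hA => h3.trans (hle A hA), fun A hA hAc => ?_⟩, ?_⟩
  · have h4 := h.max _ sideCut_subset source_mem_sideCut sink_not_mem_sideCut
      ((cutCap_sideCut_le hA).trans (hAc.trans h3))
    intro v hv
    simp only [nearSide, Finset.mem_filter, Finset.mem_univ, true_and]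
    refine ⟨?_, h4 (mem_sideCut_in.2 (.inl hv)), h4 (mem_sideCut_out.2 hv)⟩
    by_contra hc
    exact Finset.disjoint_left.1 hA.2.2 hv (mem_vset.2 hc)
  · exact Finset.eq_of_subset_of_card_le h2 (card_cutSet_le.trans (hle _ h1))

/-- Labels in the split network tell reachability in the digraph. -/
theorem Labels.ne_zero_iff_reach {L : ℕ → ℕ}
    (h : Labels (N + N + 2) (N + N + 1) (splitCap k N g w ks d p) L) (v : Fin N) :
    (L v ≠ 0 ↔ v ∉ vset N d ∧ ∃ t ∈ vset N ks, t ∉ vset N d ∧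
      ReflTransGen (Av (adj N g) (vset N d)) v t) ∧
    (L (N + v) ≠ 0 ↔ ∃ t ∈ vset N ks, v = t ∨ ∃ u ∉ vset N d, adj N g v u ∧ t ∉ vset N d ∧
      ReflTransGen (Av (adj N g) (vset N d)) u t) ∧
    (L (N + N) ≠ 0 ↔ ∃ u ∈ vset N w, u ∉ vset N d ∧ ∃ t ∈ vset N ks, t ∉ vset N d ∧
      ReflTransGen (Av (adj N g) (vset N d)) u t) := by
  have hcap : ∀ u : Fin N, splitCap k N g w ks d p u (N + u) ≠ 0 ↔ u ∉ vset N d := by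
    intro u
    rw [splitCap_split u.2, mem_vset]
    split_ifs <;> simp_all
  have hin : ∀ u : Fin N, L u ≠ 0 ↔ u ∉ vset N d ∧ L (N + u) ≠ 0 := by
    intro u
    constructor
    · intro hu
      rcases eq_or_ne (L u) 1 with h1 | h1
      · have := h.one _ (by omega) h1
        omega
      obtain ⟨y, hy, hc, hL⟩ := h.next u (by omega) (by omega)
      have hyu : y = N + u := by
        by_contra hne
        simp [splitCap, hne] at hc
      subst hyu
      exact ⟨(hcap u).1 hc, by omega⟩
    · rintro ⟨hd, hL⟩
      exact h.closed _ (by omega) _ (by omega) ((hcap u).2 hd) hL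
  have hout : ∀ u : Fin N, L (N + u) ≠ 0 ↔ u ∈ vset N ks ∨ ∃ v, adj N g u v ∧ L v ≠ 0 := by
    intro u
    constructor
    · intro hu
      rcases eq_or_ne (L (N + u)) 1 with h1 | h1
      · have := h.one _ (by omega) h1
        omega
      obtain ⟨y, hy, hc, hL⟩ := h.next (N + u) (by omega) (by omega)
      by_cases hyN : y < N
      · refine .inr ⟨⟨y, hyN⟩, ?_, ?_⟩
        · rw [splitCap_arc u.2 hyN] at hc
          by_contra hg
          exact hc (if_neg hg)
        · change L y ≠ 0
          omega
      · have hyt : y = N + N + 1 := by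
          by_contra hne
          have h1 : ¬ N + (u : ℕ) < N := by omega
          simp [splitCap, hne, hyN, h1] at hc
        left
        rw [hyt, splitCap_sink u.2] at hc
        rw [mem_vset]
        by_contra hg
        exact hc (if_neg (not_not.2 hg))
    · rintro (hk | ⟨v, hr, hL⟩)
      · refine h.closed _ (by omega) (N + N + 1) (by omega) ?_ (by rw [h.root]; omega)
        rw [splitCap_sink u.2, if_pos (mem_vset.1 hk)]
        omega
      · refine h.closed _ (by omega) v (by omega) ?_ hL
        rw [splitCap_arc u.2 v.2]
        exact (if_pos hr).trans_ne (by omega)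
  have hsrc : L (N + N) ≠ 0 ↔ ∃ v ∈ vset N w, L v ≠ 0 := by
    constructor
    · intro hu
      rcases eq_or_ne (L (N + N)) 1 with h1 | h1
      · have := h.one _ (by omega) h1
        omega
      obtain ⟨y, hy, hc, hL⟩ := h.next (N + N) (by omega) (by omega)
      by_cases hyN : y < N
      · refine ⟨⟨y, hyN⟩, ?_, ?_⟩
        · rw [splitCap_source hyN] at hc
          rw [mem_vset]
          by_contra hg
          exact hc (if_neg (not_not.2 hg))
        · change L y ≠ 0
          omega
      · simp [splitCap, hyN] at hc
    · rintro ⟨v, hv, hL⟩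
      refine h.closed _ (by omega) v (by omega) ?_ hL
      rw [splitCap_source v.2, if_pos (mem_vset.1 hv)]
      omega
  have hreach : ∀ u : Fin N, L u ≠ 0 ↔ u ∉ vset N d ∧ ∃ t ∈ vset N ks, t ∉ vset N d ∧
      ReflTransGen (Av (adj N g) (vset N d)) u t := by
    intro u
    constructor
    · intro hu
      refine ⟨((hin u).1 hu).1, ?_⟩
      obtain ⟨n, hn⟩ : ∃ n, L u = n := ⟨_, rfl⟩
      induction n using Nat.strong_induction_on generalizing u with
      | _ n ih =>
        rcases eq_or_ne (L u) 1 with h1 | h1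
        · have := h.one _ (by omega) h1
          omega
        obtain ⟨y, hy, hc, hL⟩ := h.next u (by omega) (by omega)
        have hyu : y = N + u := by
          by_contra hne
          simp [splitCap, hne] at hc
        subst hyu
        have hud := (hcap u).1 hc
        rcases eq_or_ne (L (N + u)) 1 with h1 | h1
        · have := h.one _ (by omega) h1
          omega
        obtain ⟨z, hz, hc', hL'⟩ := h.next (N + u) (by omega) (by omega)
        by_cases hzN : z < N
        · have hz0 : L z ≠ 0 := by
            intro h0
            have := h.one (N + u) (by omega) (by omega)
            omega
          obtain ⟨t, ht, htd, hp⟩ := ih (L z) (by omega) ⟨z, hzN⟩ hz0 rfl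
          refine ⟨t, ht, htd, .head ⟨?_, hud, ((hin ⟨z, hzN⟩).1 hz0).1⟩ hp⟩
          rw [splitCap_arc u.2 hzN] at hc'
          by_contra hg
          exact hc' (if_neg hg)
        · have hzt : z = N + N + 1 := by
            by_contra hne
            have h1 : ¬ N + (u : ℕ) < N := by omega
            simp [splitCap, hne, hzN, h1] at hc'
          rw [hzt, splitCap_sink u.2] at hc'
          refine ⟨u, ?_, hud, .refl⟩
          rw [mem_vset]
          by_contra hg
          exact hc' (if_neg (not_not.2 hg))
    · rintro ⟨hud, t, ht, htd, hp⟩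
      induction hp using ReflTransGen.head_induction_on with
      | refl => exact (hin t).2 ⟨htd, (hout t).2 (.inl ht)⟩
      | head hr _ ih =>
        exact (hin _).2 ⟨hud, (hout _).2 (.inr ⟨_, hr.1, ih hr.2.2⟩)⟩
  refine ⟨hreach v, ?_, ?_⟩
  · rw [hout]
    constructor
    · rintro (hk | ⟨u, hr, hL⟩)
      · exact ⟨v, hk, .inl rfl⟩
      · obtain ⟨hu, t, ht, htd, hp⟩ := (hreach u).1 hL
        exact ⟨t, ht, .inr ⟨u, hu, hr, htd, hp⟩⟩
    · rintro ⟨t, ht, rfl | ⟨u, hu, hr, htd, hp⟩⟩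
      · exact .inl ht
      · exact .inr ⟨u, hr, (hreach u).2 ⟨hu, t, ht, htd, hp⟩⟩
  · rw [hsrc]
    constructor
    · rintro ⟨u, hu, hL⟩
      obtain ⟨h1, h2⟩ := (hreach u).1 hL
      exact ⟨u, hu, h1, h2⟩
    · rintro ⟨u, hu, h1, h2⟩
      exact ⟨u, hu, (hreach u).2 ⟨h1, h2⟩⟩

end Split
end DirectedMultiwayCut

/-! ### Maximum flow and furthest minimum cuts on the machine -/

namespace DirectedMultiwayCut
open Cmd

/-! ### Maximum flow on the machine

Registers: `0` and `1` hold the number of vertices of the input graph and `k`; `10`, `11` and `12` hold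
the number `N` of vertices of the working graph, the number `2 * N + 2` of nodes of its split network,
and `k + 1`. Arrays: `10` and `11` hold the multiples of `N` and of `2 * N + 2`, `15` the working graph,
`16` the sources, `17` the sinks, `18` the deleted and `19` the deletable vertices, `20` the residual
network, `21` the labels. -/

/-- An expression that is true if the values of `e` and `f` differ. -/
def Expr.ne (e f : Expr) : Expr := (e - f) + (f - e)

@[simp] theorem Expr.eval_ne (s : State) (e f : Expr) :
    (Expr.ne e f).eval s = 0 ↔ e.eval s = f.eval s := by
  simp only [Expr.ne, Expr.eval_add, Expr.eval_sub]
  omega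

namespace Cmd

@[simp] theorem run_skip (s : State) : skip.run s = s := (rfl)
@[simp] theorem run_assign (x : ℕ) (e : Expr) (s : State) :
    (assign x e).run s = s.setReg x (e.eval s) := (rfl)
@[simp] theorem run_store (a : ℕ) (i e : Expr) (s : State) :
    (store a i e).run s = s.setArr a (i.eval s) (e.eval s) := (rfl)
@[simp] theorem run_seq (c d : Cmd) (s : State) : (seq c d).run s = d.run (c.run s) := (rfl)
@[simp] theorem run_ite (e : Expr) (c d : Cmd) (s : State) :
    (ite e c d).run s = if e.eval s = 0 then d.run s else c.run s := (rfl)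

/-- Fill the first cells of the array `a`; the value is computed in the register `v` by `c`. -/
def fill (x b a v : ℕ) (c : Cmd) : Cmd := rep x b (seq c (store a (.reg x) (.reg v)))

/-- The value computed for a cell may rely only on what the whole loop leaves untouched, so `hF`
speaks of all states that agree with `s` there; the cells filled so far need no mention. -/
theorem run_fill {x b a v : ℕ} {c : Cmd} {s : State} (F : ℕ → ℕ) (hx : c.wr x = false)
    (ha : c.wa a = false)
    (hF : ∀ i < s.reg b, ∀ s', (fill x b a v c).Agree s s' → s'.reg x = i →
      (c.run s').reg v = F i) :
    ∀ i < s.reg b, ((fill x b a v c).run s).arr a i = F i := by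
  refine run_rep (fun n s' => ∀ i < n, s'.arr a i = F i) (fun i hi => absurd hi (by omega)) ?_
  intro n s' hn hxn hag ih i hi
  simp only [run_seq, run_store, Expr.eval_reg, State.setReg_arr, State.setArr_arr, if_true,
    run_reg c s' hx, run_arr c s' ha, hxn, Function.update_apply]
  split_ifs with h
  · rw [h]
    exact hF n hn s' hag hxn
  · exact ih i (by omega)

/-- Fill a matrix in the array `a`; the value is computed in the register `v` by `c`, and the array
`t` holds the multiples of the number of columns. -/
def fill₂ (x bx y by' t a v : ℕ) (c : Cmd) : Cmd :=
  rep x bx (rep y by' (seq c (store a (.arr t (.reg x) + .reg y) (.reg v))))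

theorem run_fill₂ {x bx y b t a v : ℕ} {c : Cmd} {s : State} (F : ℕ → ℕ → ℕ)
    (hx : c.wr x = false) (hy : c.wr y = false) (hb : c.wr b = false) (ha : c.wa a = false)
    (ht : c.wa t = false)
    (hxy : x ≠ y) (hta : t ≠ a) (hbx : b ≠ x) (hby : b ≠ y)
    (hmul : ∀ i < s.reg bx, s.arr t i = i * s.reg b)
    (hF : ∀ i < s.reg bx, ∀ j < s.reg b, ∀ s', (fill₂ x bx y b t a v c).Agree s s' →
      s'.reg x = i → s'.reg y = j → (c.run s').reg v = F i j) :
    ∀ i < s.reg bx, ∀ j < s.reg b, ((fill₂ x bx y b t a v c).run s).arr a (i * s.reg b + j) =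
      F i j := by
  have htw : (fill₂ x bx y b t a v c).wa t = false := by simp [fill₂, wa, ht, hta]
  refine run_rep (fun n s' => ∀ i < n, ∀ j < s.reg b, s'.arr a (i * s.reg b + j) = F i j)
    (fun i hi => absurd hi (by omega)) ?_
  intro n s' hn hxn hag ih
  have hag' : (fill₂ x bx y b t a v c).Agree s s' := hag
  have hsb : s'.reg b = s.reg b := hag.reg b (by simp [wr, hb, hbx, hby])
  simp only [State.setReg_arr]
  intro i hi j hj
  have key := run_rep (x := y) (b := b) (s := s')
    (c := seq c (store a (.arr t (.reg x) + .reg y) (.reg v)))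
    (fun n' s'' => ∀ i j, j < s.reg b → (i < n ∨ i = n ∧ j < n') →
      s''.arr a (i * s.reg b + j) = F i j)
    (by
      intro i j hj h
      exact ih i (by omega) j hj)
    (by
      intro n' s'' hn' hyn hag2 ih' i j hj h
      have hxn' : s''.reg x = n := by rw [hag2.reg x (by simp [wr, hx, hxy]), hxn]
      have hfull : (fill₂ x bx y b t a v c).Agree s s'' := by
        refine ⟨fun z hz => ?_, fun z hz => ?_⟩
        · rw [hag2.reg z, hag'.reg z hz]
          simp only [fill₂, wr, Bool.or_eq_false_iff] at hz ⊢
          exact hz.2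
        · rw [hag2.arr z, hag'.arr z hz]
          exact hz
      have htn : s''.arr t n = n * s.reg b := by rw [hfull.arr t htw, hmul n hn]
      simp only [run_seq, run_store, Expr.eval_reg, Expr.eval_add, Expr.eval_arr, State.setReg_arr,
        State.setArr_arr, if_true, run_reg c s'' hx, run_reg c s'' hy, run_arr c s'' ha,
        run_arr c s'' ht, hxn', hyn, htn, Function.update_apply]
      rw [hsb] at hn'
      split_ifs with hc
      · obtain ⟨rfl, rfl⟩ := position_inj hj hn' hc
        exact hF _ hn _ hj _ hfull hxn' hyn
      · refine ih' i j hj ?_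
        rcases h with h | ⟨rfl, h⟩
        · exact .inl h
        · refine .inr ⟨rfl, ?_⟩
          rcases Nat.lt_succ_iff_lt_or_eq.1 h with h | rfl
          · exact h
          · exact absurd rfl hc)
  exact key i j hj (by rw [hsb]; omega)

/-- Test whether a condition holds for all values of the register `x` below a bound; the condition is
evaluated in the register `v` by `c`, and the answer is recorded in `f`. -/
def checkAll (x b v f : ℕ) (c : Cmd) : Cmd := rep x b (seq c (ite (.reg v) skip (assign f (.num 0))))

theorem run_checkAll {x b v f : ℕ} {c : Cmd} {s : State} (F : ℕ → Prop) (hf : c.wr f = false)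
    (hxf : f ≠ x)
    (hF : ∀ i < s.reg b, ∀ s', (checkAll x b v f c).Agree s s' → s'.reg x = i →
      ((c.run s').reg v ≠ 0 ↔ F i)) :
    ((checkAll x b v f c).run s).reg f ≠ 0 ↔ s.reg f ≠ 0 ∧ ∀ i < s.reg b, F i := by
  refine run_rep (fun n s' => s'.reg f ≠ 0 ↔ s.reg f ≠ 0 ∧ ∀ i < n, F i) (by simp [hxf]) ?_
  intro n s' hn hxn hag ih
  have h1 := hF n hn s' hag hxn
  have h2 : (∀ i < n + 1, F i) ↔ (∀ i < n, F i) ∧ F n :=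
    ⟨fun h => ⟨fun i hi => h i (by omega), h n (by omega)⟩, fun h i hi => by
      rcases Nat.lt_succ_iff_lt_or_eq.1 hi with hi | rfl
      · exact h.1 i hi
      · exact h.2⟩
  simp only [run_seq, run_ite, Expr.eval_reg, run_assign, run_skip, Expr.eval_num]
  split_ifs with h
  · simp only [State.setReg_reg, hxf, if_false, if_true]
    rw [h2]
    tauto
  · simp only [State.setReg_reg, hxf, if_false, run_reg c s' hf]
    rw [h2, ih]
    tauto

end Cmd

/-- The registers and tables of the working graph are set up. -/
structure Env (N k : ℕ) (s : State) : Prop where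
  k_eq : s.reg 1 = k
  N_eq : s.reg 10 = N
  M_eq : s.reg 11 = N + N + 2
  k_succ : s.reg 12 = k + 1
  mulN : ∀ u < N, s.arr 10 u = u * N
  mulM : ∀ x < N + N + 2, s.arr 11 x = x * (N + N + 2)

/-- The command does not touch the setup of the working graph. -/
def Cmd.keepsEnv (c : Cmd) : Bool :=
  !c.wr 1 && !c.wr 10 && !c.wr 11 && !c.wr 12 && !c.wa 10 && !c.wa 11

theorem Env.of_agree {N k : ℕ} {s s' : State} (h : Env N k s) {c : Cmd} (hc : c.keepsEnv = true)
    (ha : c.Agree s s') : Env N k s' := by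
  simp only [keepsEnv, Bool.and_eq_true, Bool.not_eq_true'] at hc
  obtain ⟨⟨⟨⟨⟨h1, h2⟩, h3⟩, h4⟩, h5⟩, h6⟩ := hc
  exact ⟨by rw [ha.reg _ h1, h.k_eq], by rw [ha.reg _ h2, h.N_eq], by rw [ha.reg _ h3, h.M_eq],
    by rw [ha.reg _ h4, h.k_succ], by rw [ha.arr _ h5]; exact h.mulN,
    by rw [ha.arr _ h6]; exact h.mulM⟩

theorem Env.run {N k : ℕ} {s : State} (h : Env N k s) {c : Cmd} (hc : c.keepsEnv = true) :
    Env N k (c.run s) := h.of_agree hc (agree_run c s)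

/-- A matrix stored row by row. -/
def mat (M : ℕ) (f : ℕ → ℕ) (x y : ℕ) : ℕ := f (x * M + y)

/-- The capacity of the arc `(reg 30, reg 31)` of the split network. -/
def capCmd : Cmd := seq (assign 32 (.num 0))
  (ite (.reg 10 - .reg 30)
    (ite (.ne (.reg 31) (.reg 10 + .reg 30)) skip
      (ite (.arr 18 (.reg 30)) skip
        (ite (.arr 16 (.reg 30)) (assign 32 (.reg 12))
          (ite (.arr 19 (.reg 30)) (assign 32 (.num 1)) (assign 32 (.reg 12))))))
    (ite ((.reg 10 + .reg 10) - .reg 30)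
      (ite (.reg 10 - .reg 31)
        (ite (.arr 15 (.arr 10 (.reg 30 - .reg 10) + .reg 31)) (assign 32 (.reg 12)) skip)
        (ite (.ne (.reg 31) (.reg 10 + .reg 10 + .num 1)) skip
          (ite (.arr 17 (.reg 30 - .reg 10)) (assign 32 (.reg 12)) skip)))
      (ite (.ne (.reg 30) (.reg 10 + .reg 10)) skip
        (ite (.reg 10 - .reg 31) (ite (.arr 16 (.reg 31)) (assign 32 (.reg 12)) skip) skip))))

theorem run_capCmd {N k : ℕ} {s : State} (h : Env N k s) :
    (capCmd.run s).reg 32 = splitCap k N (s.arr 15) (s.arr 16) (s.arr 17) (s.arr 18) (s.arr 19)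
      (s.reg 30) (s.reg 31) := by
  simp only [capCmd, run_seq, run_ite, run_assign, run_skip, Expr.eval_sub, Expr.eval_reg,
    State.setReg_reg, Expr.eval_ne, Expr.eval_add, Expr.eval_arr, Expr.eval_num,
    State.setReg_arr, h.N_eq, h.k_succ, splitCap, Nat.sub_eq_zero_iff_le]
  simp only [Nat.reduceEqDiff, if_false]
  rcases lt_or_ge (s.reg 30) N with h1 | h1
  · simp only [h1, not_le.2 h1, if_true, if_false]
    split_ifs <;> simp_all
  · simp only [h1, not_lt.2 h1, if_true, if_false]
    rcases lt_or_ge (s.reg 30) (N + N) with h2 | h2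
    · simp only [h2, not_le.2 h2, if_true, if_false, h.mulN (s.reg 30 - N) (by omega)]
      rcases lt_or_ge (s.reg 31) N with h3 | h3
      · simp only [h3, not_le.2 h3, if_true, if_false]
        split_ifs <;> simp_all
      · simp only [h3, not_lt.2 h3, if_true, if_false]
        split_ifs <;> simp_all
    · simp only [h2, not_lt.2 h2, if_true, if_false]
      rcases lt_or_ge (s.reg 31) N with h3 | h3
      · simp only [h3, not_le.2 h3, if_true, if_false]
        split_ifs <;> simp_all
      · simp only [h3, not_lt.2 h3, if_true, if_false]
        split_ifs <;> simp_all

/-- Build the split network. -/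
def build : Cmd := fill₂ 30 11 31 11 11 20 32 capCmd

theorem run_build {N k : ℕ} {s : State} (h : Env N k s) : ∀ x < N + N + 2, ∀ y < N + N + 2,
    mat (N + N + 2) ((build.run s).arr 20) x y =
      splitCap k N (s.arr 15) (s.arr 16) (s.arr 17) (s.arr 18) (s.arr 19) x y := by
  have key := run_fill₂ (x := 30) (bx := 11) (y := 31) (b := 11) (t := 11) (a := 20) (v := 32)
    (c := capCmd) (s := s)
    (fun x y => splitCap k N (s.arr 15) (s.arr 16) (s.arr 17) (s.arr 18) (s.arr 19) x y)
    rfl rfl rfl rfl rfl (by decide) (by decide) (by decide) (by decide)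
    (by rw [h.M_eq]; exact h.mulM)
    (by
      intro i hi j hj s' hag hx hy
      rw [run_capCmd (h.of_agree rfl hag), hx, hy, hag.arr 15 rfl, hag.arr 16 rfl, hag.arr 17 rfl,
        hag.arr 18 rfl, hag.arr 19 rfl])
  rw [h.M_eq] at key
  exact key

/-! #### Labelling -/

open Classical in
/-- One round of the labelling: a node with an arc to a node of label `j + 1` below `b` gets label
`j + 2`. -/
noncomputable def labelRound (b : ℕ) (r : ℕ → ℕ → ℕ) (j : ℕ) (L : ℕ → ℕ) (u : ℕ) : ℕ :=
  if L u = 0 ∧ ∃ v < b, r u v ≠ 0 ∧ L v = j + 1 then j + 2 else L u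

theorem labelRound_zero (r : ℕ → ℕ → ℕ) (j : ℕ) (L : ℕ → ℕ) (u : ℕ) : labelRound 0 r j L u = L u := by
  simp [labelRound]

theorem labelRound_succ (b : ℕ) (r : ℕ → ℕ → ℕ) (j : ℕ) (L : ℕ → ℕ) (u : ℕ) :
    labelRound (b + 1) r j L u =
      if labelRound b r j L u = 0 then if r u b = 0 then labelRound b r j L u else
        if L b = j + 1 then j + 2 else labelRound b r j L u
      else labelRound b r j L u := by
  have h : (∃ v < b + 1, r u v ≠ 0 ∧ L v = j + 1) ↔
      (∃ v < b, r u v ≠ 0 ∧ L v = j + 1) ∨ r u b ≠ 0 ∧ L b = j + 1 := by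
    constructor
    · rintro ⟨v, hv, h1⟩
      rcases Nat.lt_succ_iff_lt_or_eq.1 hv with hv | rfl
      · exact .inl ⟨v, hv, h1⟩
      · exact .inr h1
    · rintro (⟨v, hv, h1⟩ | h1)
      · exact ⟨v, by omega, h1⟩
      · exact ⟨b, by omega, h1⟩
  simp only [labelRound, h]
  by_cases h1 : L u = 0 <;> by_cases h2 : ∃ v < b, r u v ≠ 0 ∧ L v = j + 1 <;>
    by_cases h3 : r u b = 0 <;> by_cases h4 : L b = j + 1 <;> simp only [h1, h2, h3, h4] <;> simp [h1, h3]

/-- The labels after `j` rounds. -/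
structure PartialLabels (M t : ℕ) (r : ℕ → ℕ → ℕ) (j : ℕ) (L : ℕ → ℕ) : Prop where
  root : L t = 1
  one : ∀ u < M, L u = 1 → u = t
  next : ∀ u < M, 1 < L u → ∃ v < M, r u v ≠ 0 ∧ L v + 1 = L u
  closed : ∀ u < M, ∀ v < M, r u v ≠ 0 → L v ≠ 0 → L v ≤ j → L u ≠ 0
  le : ∀ u < M, L u ≤ j + 1

theorem PartialLabels.step {M t : ℕ} {r : ℕ → ℕ → ℕ} {j : ℕ} {L L' : ℕ → ℕ} (ht : t < M)
    (h : PartialLabels M t r j L) (hL : ∀ u < M, L' u = labelRound M r j L u) :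
    PartialLabels M t r (j + 1) L' := by
  have h0 : ∀ u < M, L u ≠ 0 → L' u = L u := fun u hu hne => by
    rw [hL u hu, labelRound, if_neg (fun h => hne h.1)]
  have h1 : ∀ u < M, L u = 0 → L' u = j + 2 ∧ (∃ v < M, r u v ≠ 0 ∧ L v = j + 1) ∨
      L' u = 0 ∧ ¬ ∃ v < M, r u v ≠ 0 ∧ L v = j + 1 := fun u hu hz => by
    rw [hL u hu, labelRound]
    split_ifs with hc
    · exact .inl ⟨rfl, hc.2⟩
    · exact .inr ⟨hz, fun h => hc ⟨hz, h⟩⟩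
  refine ⟨?_, ?_, ?_, ?_, ?_⟩
  · rw [h0 t ht (by rw [h.root]; omega), h.root]
  · intro u hu hu1
    rcases eq_or_ne (L u) 0 with hz | hz
    · rcases h1 u hu hz with ⟨h2, -⟩ | ⟨h2, -⟩ <;> omega
    · exact h.one u hu (by rw [← h0 u hu hz, hu1])
  · intro u hu hu1
    rcases eq_or_ne (L u) 0 with hz | hz
    · rcases h1 u hu hz with ⟨h2, v, hv, hr, hLv⟩ | ⟨h2, -⟩
      · exact ⟨v, hv, hr, by rw [h0 v hv (by omega), h2, hLv]⟩
      · omega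
    · rw [h0 u hu hz] at hu1 ⊢
      obtain ⟨v, hv, hr, hLv⟩ := h.next u hu hu1
      exact ⟨v, hv, hr, by rw [h0 v hv (by omega), hLv]⟩
  · intro u hu v hv hr hv0 hvj hu0
    have hvz : L v ≠ 0 := by
      intro hz
      rcases h1 v hv hz with ⟨h2, -⟩ | ⟨h2, -⟩ <;> omega
    rw [h0 v hv hvz] at hvj
    have huz : L u = 0 := by
      by_contra hc
      rw [h0 u hu hc] at hu0
      exact hc hu0
    rcases h1 u hu huz with ⟨h2, -⟩ | ⟨-, h2⟩
    · omega
    · rcases Nat.lt_or_ge (L v) (j + 1) with h3 | h3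
      · exact h.closed u hu v hv hr hvz (by omega) huz
      · exact h2 ⟨v, hv, hr, by omega⟩
  · intro u hu
    rcases eq_or_ne (L u) 0 with hz | hz
    · rcases h1 u hu hz with ⟨h2, -⟩ | ⟨h2, -⟩ <;> omega
    · rw [h0 u hu hz]
      have := h.le u hu
      omega

/-- From a node with label `L u` there is a chain of nodes with all smaller positive labels, so `L u
≤ M`. Hence `M` rounds reach every node that can be labelled. -/
theorem PartialLabels.labels {M t : ℕ} {r : ℕ → ℕ → ℕ} {L : ℕ → ℕ}
    (h : PartialLabels M t r M L) : Labels M t r L := by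
  have hle : ∀ u < M, L u ≤ M := by
    intro u hu
    have hall : ∀ d, d < L u → ∃ w < M, L w = L u - d := by
      intro d
      induction d with
      | zero => exact fun _ => ⟨u, hu, rfl⟩
      | succ d ih =>
        intro hd
        obtain ⟨w, hw, hLw⟩ := ih (by omega)
        obtain ⟨v, hv, -, hLv⟩ := h.next w hw (by omega)
        exact ⟨v, hv, by omega⟩
    have hsub : Finset.Icc 1 (L u) ⊆ (Finset.range M).image L := by
      intro i hi
      rw [Finset.mem_Icc] at hi
      obtain ⟨w, hw, hLw⟩ := hall (L u - i) (by omega)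
      exact Finset.mem_image.2 ⟨w, Finset.mem_range.2 hw, by omega⟩
    have h1 := (Finset.card_le_card hsub).trans Finset.card_image_le
    simpa using h1
  exact ⟨h.root, h.one, h.next, fun u hu v hv hr h0 => h.closed u hu v hv hr h0 (hle v hv), hle⟩

/-- The inner loops of the labelling. -/
def labelRoundCmd : Cmd := rep 31 11 (rep 32 11 (ite (.arr 21 (.reg 31)) skip
  (ite (.arr 20 (.arr 11 (.reg 31) + .reg 32))
    (ite (.ne (.arr 21 (.reg 32)) (.reg 30 + .num 1)) skip (store 21 (.reg 31) (.reg 30 + .num 2))) skip)))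

/-- Compute the labels of the residual network. -/
def label : Cmd := seq (fill 30 11 21 32 (assign 32 (.num 0)))
  (seq (store 21 (.reg 10 + .reg 10 + .num 1) (.num 1)) (rep 30 11 labelRoundCmd))

/-- The labels are updated in place. This is harmless, since a new label is `j + 2` and replaces a
zero, while the round only looks for labels equal to `j + 1`. -/
theorem run_labelRoundCmd {N k : ℕ} {s : State} (h : Env N k s) : ∀ u < N + N + 2,
    (labelRoundCmd.run s).arr 21 u =
      labelRound (N + N + 2) (mat (N + N + 2) (s.arr 20)) (s.reg 30) (s.arr 21) u := by
  obtain ⟨M, hM⟩ : ∃ M, N + N + 2 = M := ⟨_, rfl⟩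
  have hsM := h.M_eq
  have hmul := h.mulM
  rw [hM] at hsM hmul ⊢
  set L := s.arr 21 with hL
  set r := mat M (s.arr 20) with hr
  set j := s.reg 30 with hj
  have key := run_rep (x := 31) (b := 11) (s := s)
    (c := rep 32 11 (ite (.arr 21 (.reg 31)) skip
      (ite (.arr 20 (.arr 11 (.reg 31) + .reg 32))
        (ite (.ne (.arr 21 (.reg 32)) (.reg 30 + .num 1)) skip (store 21 (.reg 31) (.reg 30 + .num 2))) skip)))
    (fun n s' => ∀ w < M, s'.arr 21 w = if w < n then labelRound M r j L w else L w)
    (by intro w _; simp [hL])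
    (by
      intro n s' hn hx hag ih
      rw [hsM] at hn
      have key2 := run_rep (x := 32) (b := 11) (s := s')
        (c := ite (.arr 21 (.reg 31)) skip
          (ite (.arr 20 (.arr 11 (.reg 31) + .reg 32))
            (ite (.ne (.arr 21 (.reg 32)) (.reg 30 + .num 1)) skip
              (store 21 (.reg 31) (.reg 30 + .num 2))) skip))
        (fun n' s'' => ∀ w < M, s''.arr 21 w =
          if w = n then labelRound n' r j L n else s'.arr 21 w)
        (by
          intro w hw
          simp only [State.setReg_arr]
          split_ifs with h1
          · rw [ih w hw, h1, if_neg (by omega), labelRound_zero]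
          · rfl)
        (by
          intro n' s'' hn' hx' hag' ih'
          have e1 : s'.reg 11 = M := by rw [hag.reg 11 rfl, hsM]
          rw [e1] at hn'
          have e2 : s''.reg 31 = n := by rw [hag'.reg 31 rfl, hx]
          have e3 : s''.reg 30 = j := by rw [hag'.reg 30 rfl, hag.reg 30 rfl]
          have e4 : s''.arr 20 = s.arr 20 := by rw [hag'.arr 20 rfl, hag.arr 20 rfl]
          have e5 : s''.arr 11 n = n * M := by rw [hag'.arr 11 rfl, hag.arr 11 rfl, hmul n hn]
          -- Whether an entry equals `j + 1` does not change during the round.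
          have hround : ∀ b w, labelRound b r j L w = j + 1 ↔ L w = j + 1 := by
            intro b w
            rw [labelRound]
            split_ifs with h4
            · omega
            · rfl
          have e6 : s''.arr 21 n' = j + 1 ↔ L n' = j + 1 := by
            rw [ih' n' hn']
            split_ifs with h1
            · rw [h1, hround]
            · rw [ih n' hn']
              split_ifs with h3
              · rw [hround]
              · rfl
          have e7 : s''.arr 20 (n * M + n') = r n n' := by rw [e4]; rfl
          have e8 := ih' n hn
          rw [if_pos rfl] at e8
          intro w hw
          have e10 := ih' w hw
          simp only [run_ite, run_skip, run_store, Expr.eval_arr, Expr.eval_add, Expr.eval_reg,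
            Expr.eval_ne, Expr.eval_num, e2, hx', e3, e5, e6, e7, e8, State.setReg_arr,
            labelRound_succ]
          rcases eq_or_ne w n with rfl | hwn
          · rw [if_pos rfl]
            split_ifs <;> simp [e8]
          · rw [if_neg hwn] at e10 ⊢
            split_ifs <;> simp [hwn, e10])
      have e1 : s'.reg 11 = M := by rw [hag.reg 11 rfl, hsM]
      rw [e1] at key2
      intro w hw
      rw [State.setReg_arr, key2 w hw]
      rcases eq_or_ne w n with rfl | hwn
      · rw [if_pos rfl, if_pos (Nat.lt_succ_self _)]
      · rw [if_neg hwn, ih w hw]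
        by_cases h1 : w < n
        · rw [if_pos h1, if_pos (by omega)]
        · rw [if_neg h1, if_neg (by omega)])
  rw [hsM] at key
  intro u hu
  have := key u hu
  rw [if_pos hu] at this
  exact this

theorem run_label {N k : ℕ} {s : State} (h : Env N k s) :
    Labels (N + N + 2) (N + N + 1) (mat (N + N + 2) (s.arr 20)) ((label.run s).arr 21) := by
  obtain ⟨M, hM⟩ : ∃ M, N + N + 2 = M := ⟨_, rfl⟩
  set s₁ := (fill 30 11 21 32 (assign 32 (.num 0))).run s with hs₁
  have h1 : Env N k s₁ := h.run rfl
  have hfill : ∀ i < N + N + 2, s₁.arr 21 i = 0 := by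
    have := run_fill (x := 30) (b := 11) (a := 21) (v := 32) (c := assign 32 (.num 0)) (s := s)
      (fun _ => 0) rfl rfl (by intros; simp)
    rw [h.M_eq] at this
    exact this
  set s₂ := (store 21 (.reg 10 + .reg 10 + .num 1) (.num 1)).run s₁ with hs₂
  have h2 : Env N k s₂ := h1.run rfl
  have hL : ∀ i < N + N + 2, s₂.arr 21 i = if i = N + N + 1 then 1 else 0 := by
    intro i hi
    simp only [hs₂, run_store, State.setArr_arr, Expr.eval_add, Expr.eval_reg, h1.N_eq,
      Expr.eval_num, if_true, Function.update_apply]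
    rw [hfill i hi]
  have h20 : s₂.arr 20 = s.arr 20 := by
    rw [hs₂, run_arr _ _ rfl, hs₁, run_arr _ _ rfl]
  have key := run_rep (x := 30) (b := 11) (s := s₂) (c := labelRoundCmd)
    (fun j s' => PartialLabels (N + N + 2) (N + N + 1) (mat (N + N + 2) (s.arr 20)) j (s'.arr 21))
    (by
      refine ⟨?_, ?_, ?_, ?_, ?_⟩
      · simp [hL]
      · intro u hu h
        rw [State.setReg_arr, hL u hu] at h
        split_ifs at h with h3
        exact h3
      · intro u hu h
        rw [State.setReg_arr, hL u hu] at h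
        split_ifs at h <;> omega
      · intros
        omega
      · intro u hu
        rw [State.setReg_arr, hL u hu]
        split_ifs <;> omega)
    (by
      intro j s' hj hx hag ih
      refine ih.step (by omega) fun u hu => ?_
      rw [State.setReg_arr, run_labelRoundCmd (h2.of_agree rfl hag) u hu, hx, hag.arr 20 rfl, h20])
  rw [h2.M_eq] at key
  exact key.labels

/-! #### Augmenting -/

theorem Residual.congr {M s t val u : ℕ} {c c' r r' : ℕ → ℕ → ℕ} (h : Residual M s t c r val u)
    (hc : ∀ x < M, ∀ y < M, c' x y = c x y) (hr : ∀ x < M, ∀ y < M, r' x y = r x y) :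
    Residual M s t c' r' val u := by
  refine ⟨fun x hx y hy => ?_, fun x hx => ?_⟩
  · rw [hr x hx y hy, hr y hy x hx, hc x hx y hy, hc y hy x hx, h.symm x hx y hy]
  · rw [← h.net x hx]
    congr 1
    · exact Finset.sum_congr rfl fun y hy => by rw [hc x hx y (Finset.mem_range.1 hy)]
    · exact Finset.sum_congr rfl fun y hy => by rw [hr x hx y (Finset.mem_range.1 hy)]

/-- Find a node below the node in register `33`. -/
def findNext : Cmd := rep 31 11 (ite (.arr 20 (.arr 11 (.reg 33) + .reg 31))
  (ite (.ne (.arr 21 (.reg 31) + .num 1) (.arr 21 (.reg 33))) skip (assign 34 (.reg 31))) skip)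

/-- Send one unit to the node in register `34`. -/
def pushUnit : Cmd :=
  seq (store 20 (.arr 11 (.reg 33) + .reg 34) (.arr 20 (.arr 11 (.reg 33) + .reg 34) - .num 1))
    (seq (store 20 (.arr 11 (.reg 34) + .reg 33)
      (.arr 20 (.arr 11 (.reg 34) + .reg 33) + .num 1)) (assign 33 (.reg 34)))

/-- Send one unit from the source to the sink. -/
def walk : Cmd := seq (assign 33 (.reg 10 + .reg 10))
  (rep 30 11 (ite (.arr 21 (.reg 33) - .num 1) (seq findNext pushUnit) skip))

theorem run_findNext {N k : ℕ} {s : State} (h : Env N k s) (hu : s.reg 33 < N + N + 2)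
    (hv : ∃ v < N + N + 2, mat (N + N + 2) (s.arr 20) (s.reg 33) v ≠ 0 ∧
      s.arr 21 v + 1 = s.arr 21 (s.reg 33)) :
    (findNext.run s).reg 34 < N + N + 2 ∧
      mat (N + N + 2) (s.arr 20) (s.reg 33) ((findNext.run s).reg 34) ≠ 0 ∧
      s.arr 21 ((findNext.run s).reg 34) + 1 = s.arr 21 (s.reg 33) := by
  obtain ⟨M, hM⟩ : ∃ M, N + N + 2 = M := ⟨_, rfl⟩
  have hsM := h.M_eq
  have hmul := h.mulM
  rw [hM] at hsM hmul hu hv ⊢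
  set u := s.reg 33 with hu'
  let good : ℕ → Prop := fun v => v < M ∧ mat M (s.arr 20) u v ≠ 0 ∧ s.arr 21 v + 1 = s.arr 21 u
  have key := run_rep (x := 31) (b := 11) (s := s)
    (c := ite (.arr 20 (.arr 11 (.reg 33) + .reg 31))
      (ite (.ne (.arr 21 (.reg 31) + .num 1) (.arr 21 (.reg 33))) skip (assign 34 (.reg 31))) skip)
    (fun n s' => (∃ v < n, good v) → good (s'.reg 34))
    (by
      rintro ⟨v, hv, -⟩
      omega)
    (by
      intro n s' hn hx hag ih
      rw [hsM] at hn
      have e1 : s'.reg 33 = u := hag.reg 33 rfl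
      have e2 : s'.arr 11 u = u * M := by rw [hag.arr 11 rfl, hmul u hu]
      have e3 : s'.arr 20 (u * M + n) = mat M (s.arr 20) u n := by rw [hag.arr 20 rfl]; rfl
      have e4 : s'.arr 21 = s.arr 21 := hag.arr 21 rfl
      have ih' : ¬ good n → (∃ v < n + 1, good v) → good (s'.reg 34) := by
        rintro h1 ⟨v, hv, h2⟩
        rcases Nat.lt_succ_iff_lt_or_eq.1 hv with hv | rfl
        · exact ih ⟨v, hv, h2⟩
        · exact absurd h2 h1
      simp only [run_ite, run_skip, run_assign, Expr.eval_arr, Expr.eval_add, Expr.eval_reg,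
        Expr.eval_ne, Expr.eval_num, e1, hx, e2, e3, e4]
      split_ifs with h1 h2
      · simp only [State.setReg_reg, Nat.reduceEqDiff, if_false]
        exact ih' fun h => h.2.1 h1
      · simp only [State.setReg_reg, Nat.reduceEqDiff, if_false, if_true]
        exact fun _ => ⟨hn, h1, h2⟩
      · simp only [State.setReg_reg, Nat.reduceEqDiff, if_false]
        exact ih' fun h => h2 h.2.2)
  rw [hsM] at key
  obtain ⟨v, hv, h1⟩ := hv
  exact key ⟨v, hv, hv, h1⟩

theorem run_pushUnit {N k : ℕ} {s : State} (h : Env N k s) (hu : s.reg 33 < N + N + 2)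
    (hv : s.reg 34 < N + N + 2) (huv : s.reg 33 ≠ s.reg 34) :
    (∀ x < N + N + 2, ∀ y < N + N + 2, mat (N + N + 2) ((pushUnit.run s).arr 20) x y =
      push (mat (N + N + 2) (s.arr 20)) (s.reg 33) (s.reg 34) x y) ∧
    (pushUnit.run s).reg 33 = s.reg 34 := by
  obtain ⟨M, hM⟩ : ∃ M, N + N + 2 = M := ⟨_, rfl⟩
  have hmul := h.mulM
  rw [hM] at hmul hu hv ⊢
  have h1 : s.reg 34 * M + s.reg 33 ≠ s.reg 33 * M + s.reg 34 := fun hc =>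
    huv (position_inj hv hu hc.symm).1
  refine ⟨fun x hx y hy => ?_, by simp [pushUnit]⟩
  have h2 : ∀ a < M, ∀ b < M, x * M + y = a * M + b ↔ x = a ∧ y = b := fun a _ b hb =>
    ⟨fun hc => position_inj hy hb hc, fun hc => by rw [hc.1, hc.2]⟩
  simp only [mat, pushUnit, run_seq, run_store, run_assign, State.setReg_arr, State.setArr_arr,
    State.setArr_reg, Expr.eval_arr, Expr.eval_add, Expr.eval_sub, Expr.eval_reg, Expr.eval_num,
    if_true, Nat.reduceEqDiff, if_false, hmul _ hu, hmul _ hv, Function.update_apply, h1, push,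
    h2 _ hu _ hv, h2 _ hv _ hu]
  split_ifs with h3 h4 <;> first | rfl | omega

/-- The unit descends one label per round until it reaches the sink, which has label one. The labels
were computed before the walk, but its pushes reduce only arcs leaving nodes with labels larger than
the current one, so the next arc is still available. -/
theorem run_walk {N k val : ℕ} {c : ℕ → ℕ → ℕ} {s : State} (h : Env N k s)
    (hres : Residual (N + N + 2) (N + N) (N + N + 1) c (mat (N + N + 2) (s.arr 20)) val (N + N))
    (hL : Labels (N + N + 2) (N + N + 1) (mat (N + N + 2) (s.arr 20)) (s.arr 21)) :
    (s.arr 21 (N + N) = 0 → (walk.run s).arr 20 = s.arr 20) ∧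
    (s.arr 21 (N + N) ≠ 0 → Residual (N + N + 2) (N + N) (N + N + 1) c
      (mat (N + N + 2) ((walk.run s).arr 20)) (val + 1) (N + N)) := by
  obtain ⟨M, hM⟩ : ∃ M, N + N + 2 = M := ⟨_, rfl⟩
  set s₁ := (assign 33 (.reg 10 + .reg 10)).run s with hs₁
  have h1 : Env N k s₁ := h.run rfl
  have e33 : s₁.reg 33 = N + N := by simp [hs₁, h.N_eq]
  have hsM := h1.M_eq
  rw [hM] at hres hL hsM ⊢
  set L := s.arr 21 with hLdef
  set r := mat M (s.arr 20) with hr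
  set σ := N + N with hσ
  have key := run_rep (x := 30) (b := 11) (s := s₁)
    (c := ite (.arr 21 (.reg 33) - .num 1) (seq findNext pushUnit) skip)
    -- After `n` rounds the label has dropped by `n`, or it is one and the unit rests at the sink;
    -- the maximum covers both cases. If the source is unlabelled, nothing moves.
    (fun n s' => s'.reg 33 < M ∧ (L σ = 0 → s'.arr 20 = s.arr 20 ∧ s'.reg 33 = σ) ∧
      (L σ ≠ 0 → L (s'.reg 33) ≠ 0 ∧ L (s'.reg 33) - 1 + n = max (L σ - 1) n ∧
        Residual M σ (σ + 1) c (mat M (s'.arr 20)) val (s'.reg 33) ∧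
        ∀ a < M, ∀ b < M, L a ≤ L (s'.reg 33) → r a b ≠ 0 → mat M (s'.arr 20) a b ≠ 0))
    (by
      simp only [State.setReg_reg, State.setReg_arr, Nat.reduceEqDiff, if_false, e33]
      refine ⟨by omega, fun _ => ⟨rfl, trivial⟩, fun h0 => ⟨h0, by omega, hres, ?_⟩⟩
      exact fun a _ b _ _ h => h)
    (by
      intro n s' hn hx hag ⟨i1, i2, i3⟩
      rw [hsM] at hn
      have e1 : s'.arr 21 = L := by rw [hag.arr 21 rfl]; rfl
      have hE : Env N k s' := h1.of_agree rfl hag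
      simp only [run_ite, Expr.eval_sub, Expr.eval_arr, Expr.eval_reg, Expr.eval_num, e1]
      split_ifs with h0
      · simp only [run_skip, State.setReg_reg, State.setReg_arr, Nat.reduceEqDiff, if_false]
        refine ⟨i1, i2, fun hne => ?_⟩
        obtain ⟨j1, j2, j3, j4⟩ := i3 hne
        exact ⟨j1, by omega, j3, j4⟩
      · have hne : L σ ≠ 0 := by
          intro hc
          rw [(i2 hc).2] at h0
          omega
        obtain ⟨j1, j2, j3, j4⟩ := i3 hne
        obtain ⟨v, hv, hrv, hLv⟩ := hL.next _ i1 (by omega)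
        have hf := run_findNext hE (by rw [hM]; exact i1) (by
          rw [hM, e1]
          exact ⟨v, hv, j4 _ i1 _ hv le_rfl hrv, hLv⟩)
        set s₂ := findNext.run s' with hs₂
        have e2 : s₂.reg 33 = s'.reg 33 := run_reg _ _ rfl
        have e3 : s₂.arr 20 = s'.arr 20 := run_arr _ _ rfl
        rw [hM, e1] at hf
        obtain ⟨f1, f2, f3⟩ := hf
        have huv : s'.reg 33 ≠ s₂.reg 34 := by
          intro hc
          rw [← hc] at f3
          omega
        have hp := run_pushUnit (s := s₂) (hE.run rfl) (by rw [hM, e2]; exact i1)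
          (by rw [hM]; exact f1) (by rw [e2]; exact huv)
        rw [hM, e2, e3] at hp
        obtain ⟨p1, p2⟩ := hp
        simp only [run_seq, ← hs₂, State.setReg_reg, State.setReg_arr, Nat.reduceEqDiff, if_false,
          p2]
        refine ⟨f1, fun hc => absurd hc hne, fun _ => ⟨?_, by omega, ?_, ?_⟩⟩
        · intro hz
          rw [hz] at f3
          omega
        · exact (j3.push i1 f1 huv f2).congr (fun _ _ _ _ => rfl) p1
        · intro a ha b hb hab hrab
          have hau : a ≠ s'.reg 33 := by
            rintro rfl
            omega
          rw [p1 a ha b hb, push, if_neg (fun hc => hau hc.1)]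
          split_ifs
          · omega
          · exact j4 a ha b hb (by omega) hrab)
  rw [hsM] at key
  obtain ⟨k1, k2, k3⟩ := key
  refine ⟨fun h0 => (k2 h0).1, fun h0 => ?_⟩
  obtain ⟨j1, j2, j3, -⟩ := k3 h0
  have h4 := hL.le σ (by omega)
  have h5 := hL.one _ k1 (by omega)
  rw [h5] at j3
  exact j3.arrive

/-- Compute a maximum flow, up to the value `k`, and the labels of its residual network. -/
def flow : Cmd := seq build (seq (rep 35 1 (seq label walk)) label)

/-- At most `k` augmentations are needed, as only cuts of capacity at most `k` matter. A source that
is still labelled at the end shows that there is no such cut. -/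
theorem run_flow {N k : ℕ} {s : State} (h : Env N k s) {c : ℕ → ℕ → ℕ}
    (hc : c = splitCap k N (s.arr 15) (s.arr 16) (s.arr 17) (s.arr 18) (s.arr 19)) :
    ((∃ C ⊆ Finset.range (N + N + 2), N + N ∈ C ∧ N + N + 1 ∉ C ∧ cutCap (N + N + 2) c C ≤ k) →
      (flow.run s).arr 21 (N + N) = 0) ∧
    ((flow.run s).arr 21 (N + N) = 0 → FurthestCut (N + N + 2) (N + N) (N + N + 1) c k
      (unlabelled (N + N + 2) ((flow.run s).arr 21))) := by
  obtain ⟨M, hM⟩ : ∃ M, N + N + 2 = M := ⟨_, rfl⟩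
  have hbuild := run_build h
  set s₁ := build.run s with hs₁
  have h1 : Env N k s₁ := h.run rfl
  rw [hM, ← hc] at hbuild
  have key := run_rep (x := 35) (b := 1) (s := s₁) (c := seq label walk)
    -- The value equals the number of rounds unless the sink became unreachable from the source, in
    -- which case the flow is maximal and no longer changes.
    (fun n s' => ∃ val ≤ n, Residual M (N + N) (N + N + 1) c (mat M (s'.arr 20)) val (N + N) ∧
      (val < n → ∀ L, Labels M (N + N + 1) (mat M (s'.arr 20)) L → L (N + N) = 0))
    ⟨0, le_rfl, (Residual.refl _ _ _ _).congr (fun _ _ _ _ => rfl) hbuild, fun h => by omega⟩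
    (by
      rintro n s' hn hx hag ⟨val, hval, hres, hdone⟩
      have hE : Env N k s' := h1.of_agree rfl hag
      have hL := run_label hE
      set s₂ := label.run s' with hs₂
      have e20 : s₂.arr 20 = s'.arr 20 := run_arr _ _ rfl
      rw [← e20] at hL hres hdone
      have hw := run_walk (hE.run (c := label) rfl) (by rw [hM]; exact hres) hL
      rw [← hs₂] at hw
      rw [hM] at hw hL
      simp only [run_seq, ← hs₂, State.setReg_arr]
      by_cases h0 : s₂.arr 21 (N + N) = 0
      · rw [hw.1 h0]
        refine ⟨val, by omega, hres, fun _ L hL' => ?_⟩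
        by_contra hne
        exact (hL.ne_zero_iff (by omega)).2 ((hL'.ne_zero_iff (by omega)).1 hne) h0
      · have hvn : val = n := by
          by_contra hne
          exact h0 (hdone (by omega) _ hL)
        exact ⟨val + 1, by omega, hw.2 h0, fun h => by omega⟩)
  rw [h1.k_eq] at key
  obtain ⟨val, hval, hres, hdone⟩ := key
  set s₂ := (rep 35 1 (seq label walk)).run s₁ with hs₂
  have h2 : Env N k s₂ := h1.run rfl
  have hL := run_label h2
  have hfin : flow.run s = label.run s₂ := rfl
  rw [← hfin] at hL
  rw [hM] at hL ⊢
  refine ⟨?_, fun h0 => hres.furthestCut hL (by omega) h0 hval⟩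
  rintro ⟨C, hC, hs, ht, hcap⟩
  rcases Nat.lt_or_ge val k with hlt | hge
  · exact hdone hlt _ hL
  · exact hres.label_source_eq_zero hL (by omega) hC hs ht (hcap.trans hge)

/-- What the labels computed by `flow` tell about the working graph. -/
theorem run_flow_side {N k : ℕ} {s : State} (h : Env N k s)
    (hWD : Disjoint (vset N (s.arr 16)) (vset N (s.arr 18)))
    (hDP : vset N (s.arr 18) ⊆ vset N (s.arr 19)) :
    ((∃ A, Side (adj N (s.arr 15)) (vset N (s.arr 17)) (vset N (s.arr 19)) (vset N (s.arr 16))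
        (vset N (s.arr 18)) A ∧ (outN (adj N (s.arr 15)) A \ vset N (s.arr 18)).card ≤ k) →
      (flow.run s).arr 21 (N + N) = 0) ∧
    ((flow.run s).arr 21 (N + N) = 0 → ∃ A, FurthestSide (adj N (s.arr 15)) (vset N (s.arr 17))
        (vset N (s.arr 19)) (vset N (s.arr 16)) (vset N (s.arr 18)) A ∧
      (outN (adj N (s.arr 15)) A \ vset N (s.arr 18)).card ≤ k ∧
      ∀ v : Fin N, v ∈ outN (adj N (s.arr 15)) A \ vset N (s.arr 18) ↔
        s.arr 18 v = 0 ∧ (flow.run s).arr 21 v = 0 ∧ (flow.run s).arr 21 (N + v) ≠ 0) := by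
  obtain ⟨h1, h2⟩ := run_flow h rfl
  refine ⟨?_, fun h0 => ?_⟩
  · rintro ⟨A, hA, hk⟩
    exact h1 ⟨_, sideCut_subset, source_mem_sideCut, sink_not_mem_sideCut,
      (cutCap_sideCut_le hA).trans hk⟩
  · have hC := h2 h0
    obtain ⟨hF, hout⟩ := hC.furthestSide hWD hDP
    refine ⟨_, hF, ?_, fun v => ?_⟩
    · rw [hout]
      exact card_cutSet_le.trans hC.cap_le
    · rw [hout]
      have h3 : (v : ℕ) < N + N + 2 := by omega
      have h4 : N + (v : ℕ) < N + N + 2 := by omega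
      simp [cutSet, mem_unlabelled, h3, h4]

end DirectedMultiwayCut

/-! ### Reachability, the pushing procedure and binary decoding on the machine -/

namespace DirectedMultiwayCut
open Cmd Relation

/-! ### Reachability on the machine -/

theorem Labels.congr {M t : ℕ} {r r' : ℕ → ℕ → ℕ} {L : ℕ → ℕ} (h : Labels M t r L)
    (hr : ∀ x < M, ∀ y < M, r x y = r' x y) : Labels M t r' L := by
  refine ⟨h.root, h.one, fun u hu hL => ?_, fun u hu v hv hc => ?_, h.le⟩
  · obtain ⟨v, hv, h1, h2⟩ := h.next u hu hL
    exact ⟨v, hv, by rw [← hr u hu v hv]; exact h1, h2⟩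
  · rw [← hr u hu v hv] at hc
    exact h.closed u hu v hv hc

/-- Label the nodes of the split network that reach the sink. -/
def reach : Cmd := seq build label

theorem run_reach {N k : ℕ} {s : State} (h : Env N k s) :
    Labels (N + N + 2) (N + N + 1) (splitCap k N (s.arr 15) (s.arr 16) (s.arr 17) (s.arr 18)
      (s.arr 19)) ((reach.run s).arr 21) :=
  (run_label (h.run (c := build) rfl)).congr (run_build h)

/-! ### Pushing on the machine -/

/-- The state of the pushing procedure: array `16` holds the pushed vertices, array `18` the deleted
ones, register `36` the number of bits read. -/
def pushState (N : ℕ) (s : State) : PushState (Fin N) :=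
  ⟨vset N (s.arr 16), vset N (s.arr 18), s.reg 36⟩

theorem vset_update {N : ℕ} (f : ℕ → ℕ) (x : Fin N) :
    vset N (Function.update f x 1) = insert x (vset N f) := by
  ext v
  simp only [mem_vset, Finset.mem_insert, Function.update_apply, Fin.val_inj]
  split_ifs with h <;> simp [h]

/-- Find the last vertex of the cut computed by `flow`. -/
def findLast : Cmd := seq (assign 37 (.num 0)) (rep 30 10 (ite (.arr 21 (.reg 30)) skip
  (ite (.arr 21 (.reg 10 + .reg 30))
    (ite (.arr 18 (.reg 30)) skip (seq (assign 37 (.num 1)) (assign 38 (.reg 30)))) skip)))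

/-- Delete or push the vertex in register `38`, depending on the next bit. -/
def useBit : Cmd := seq (ite (.ne (.arr 22 (.reg 36)) (.num 1)) (store 16 (.reg 38) (.num 1))
  (store 18 (.reg 38) (.num 1))) (assign 36 (.reg 36 + .num 1))

/-- One step of the pushing procedure. -/
def pushCmd : Cmd := seq flow (seq findLast (ite (.reg 37) useBit skip))

theorem run_findLast {N k : ℕ} {s : State} (h : Env N k s) {Y : Finset (Fin N)}
    (hY : ∀ v : Fin N, v ∈ Y ↔ s.arr 18 v = 0 ∧ s.arr 21 v = 0 ∧ s.arr 21 (N + v) ≠ 0) :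
    ((findLast.run s).reg 37 ≠ 0 ↔ Y.Nonempty) ∧
      ∀ hne : Y.Nonempty, (findLast.run s).reg 38 = Y.max' hne := by
  set s₁ := (assign 37 (.num 0)).run s with hs₁
  let good : ℕ → Prop := fun v => s.arr 18 v = 0 ∧ s.arr 21 v = 0 ∧ s.arr 21 (N + v) ≠ 0
  have h1 : Env N k s₁ := h.run rfl
  have key := run_rep (x := 30) (b := 10) (s := s₁)
    (c := ite (.arr 21 (.reg 30)) skip
      (ite (.arr 21 (.reg 10 + .reg 30))
        (ite (.arr 18 (.reg 30)) skip (seq (assign 37 (.num 1)) (assign 38 (.reg 30)))) skip))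
    (fun n s' => (s'.reg 37 ≠ 0 ↔ ∃ v < n, good v) ∧
      (s'.reg 37 ≠ 0 → s'.reg 38 < n ∧ good (s'.reg 38) ∧ ∀ v < n, good v → v ≤ s'.reg 38))
    (by simp [hs₁])
    (by
      rintro n s' hn hx hag ⟨i1, i2⟩
      rw [h1.N_eq] at hn
      have e1 : s'.arr 21 = s.arr 21 := hag.arr 21 rfl
      have e2 : s'.arr 18 = s.arr 18 := hag.arr 18 rfl
      have e3 : s'.reg 10 = N := by rw [hag.reg 10 rfl, h1.N_eq]
      have hno : ¬ good n → (s'.reg 37 ≠ 0 ↔ ∃ v < n + 1, good v) ∧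
          (s'.reg 37 ≠ 0 → s'.reg 38 < n + 1 ∧ good (s'.reg 38) ∧
            ∀ v < n + 1, good v → v ≤ s'.reg 38) := by
        intro hg
        have hlt : ∀ v < n + 1, good v → v < n := fun v hv hgv => by
          rcases Nat.lt_succ_iff_lt_or_eq.1 hv with hv | rfl
          · exact hv
          · exact absurd hgv hg
        refine ⟨i1.trans ⟨fun ⟨v, hv, hg⟩ => ⟨v, by omega, hg⟩,
          fun ⟨v, hv, hg⟩ => ⟨v, hlt v hv hg, hg⟩⟩, fun hne => ?_⟩
        obtain ⟨j1, j2, j3⟩ := i2 hne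
        exact ⟨by omega, j2, fun v hv hgv => j3 v (hlt v hv hgv) hgv⟩
      simp only [run_ite, run_skip, run_seq, run_assign, Expr.eval_arr, Expr.eval_add,
        Expr.eval_reg, Expr.eval_num, e1, e2, e3, hx]
      split_ifs with c1 c2 c3
      · simp only [State.setReg_reg, Nat.reduceEqDiff, if_false]
        exact hno fun hg => hg.2.2 c2
      · have hg : good n := ⟨c3, c1, c2⟩
        simp only [State.setReg_reg, Nat.reduceEqDiff, if_false, if_true, hx]
        exact ⟨⟨fun _ => ⟨n, by omega, hg⟩, fun _ => by omega⟩,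
          fun _ => ⟨by omega, hg, fun v hv _ => by omega⟩⟩
      · simp only [State.setReg_reg, Nat.reduceEqDiff, if_false]
        exact hno fun hg => c3 hg.1
      · simp only [State.setReg_reg, Nat.reduceEqDiff, if_false]
        exact hno fun hg => c1 hg.2.1)
  rw [h1.N_eq] at key
  obtain ⟨k1, k2⟩ := key
  change ((findLast.run s).reg 37 ≠ 0 ↔ _) at k1
  change (findLast.run s).reg 37 ≠ 0 → (findLast.run s).reg 38 < N ∧ _ at k2
  have hiff : (findLast.run s).reg 37 ≠ 0 ↔ Y.Nonempty := by
    rw [k1]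
    exact ⟨fun ⟨v, hv, hg⟩ => ⟨⟨v, hv⟩, (hY ⟨v, hv⟩).2 hg⟩,
      fun ⟨v, hv⟩ => ⟨v, v.2, (hY v).1 hv⟩⟩
  refine ⟨hiff, fun hne => ?_⟩
  obtain ⟨j1, j2, j3⟩ := k2 (hiff.2 hne)
  refine le_antisymm ?_ (j3 _ (Y.max' hne).2 ((hY _).1 (Y.max'_mem hne)))
  exact Y.le_max' ⟨_, j1⟩ ((hY ⟨_, j1⟩).2 j2)

theorem pushStep_congr {V : Type*} [Fintype V] [LinearOrder V] {R : V → V → Prop} {K P : Finset V}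
    {bits bits' : ℕ → ℕ} (h : ∀ i, bits i = 1 ↔ bits' i = 1) :
    pushStep R K P bits = pushStep R K P bits' := by
  funext st
  simp only [pushStep, h]

theorem farCut_subset {V : Type*} [Fintype V] [LinearOrder V] {R : V → V → Prop}
    {K P W D : Finset V} : farCut R K P W D ⊆ P := by
  rw [farCut]
  split_ifs with h
  · exact Finset.sdiff_subset.trans h.choose_spec.mem.1.2
  · exact Finset.empty_subset _

theorem pushStep_del_subset {V : Type*} [Fintype V] [LinearOrder V] {R : V → V → Prop}
    {K P : Finset V} {bits : ℕ → ℕ} {st : PushState V} (h : st.D ⊆ P) :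
    (pushStep R K P bits st).D ⊆ P := by
  rw [pushStep]
  split_ifs with h1 h2
  · exact Finset.insert_subset (farCut_subset (Finset.max'_mem _ h1)) h
  · exact h
  · exact h

/-- Validity guarantees a cut of size at most `k`, without which the truncated flow would not find
the furthest cut. It also makes the pushed and the deleted vertices disjoint. -/
theorem run_pushCmd {N k : ℕ} {s : State} (h : Env N k s)
    (hv : Valid (adj N (s.arr 15)) (vset N (s.arr 17)) (vset N (s.arr 19)) k (pushState N s))
    (hDP : vset N (s.arr 18) ⊆ vset N (s.arr 19)) :
    pushState N (pushCmd.run s) = pushStep (adj N (s.arr 15)) (vset N (s.arr 17))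
      (vset N (s.arr 19)) (s.arr 22) (pushState N s) := by
  obtain ⟨A, hA, hk⟩ := hv
  have hWD : Disjoint (vset N (s.arr 16)) (vset N (s.arr 18)) := hA.2.2.mono_left hA.2.1
  obtain ⟨f1, f2⟩ := run_flow_side h hWD hDP
  obtain ⟨B, hB, -, hY⟩ := f2 (f1 ⟨A, hA, by simp only [pushState] at hk; omega⟩)
  have hfar : farCut (adj N (s.arr 15)) (vset N (s.arr 17)) (vset N (s.arr 19))
      (pushState N s).W (pushState N s).D = outN (adj N (s.arr 15)) B \ vset N (s.arr 18) :=
    hB.farCut_eq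
  rw [← hB.farCut_eq] at hY
  set s₁ := flow.run s with hs₁
  have e18 : s₁.arr 18 = s.arr 18 := run_arr _ _ rfl
  rw [← e18] at hY
  have h1 : Env N k s₁ := h.run rfl
  obtain ⟨g1, g2⟩ := run_findLast h1 hY
  rw [e18] at g1 g2
  set s₂ := findLast.run s₁ with hs₂
  have e16 : s₂.arr 16 = s.arr 16 := by rw [hs₂, run_arr _ _ rfl, hs₁, run_arr _ _ rfl]
  have e18' : s₂.arr 18 = s.arr 18 := by rw [hs₂, run_arr _ _ rfl, e18]
  have e36 : s₂.reg 36 = s.reg 36 := by rw [hs₂, run_reg _ _ rfl, hs₁, run_reg _ _ rfl]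
  have e22 : s₂.arr 22 = s.arr 22 := by rw [hs₂, run_arr _ _ rfl, hs₁, run_arr _ _ rfl]
  have hrun : pushCmd.run s = if s₂.reg 37 = 0 then s₂ else useBit.run s₂ := rfl
  rw [hrun, pushStep]
  by_cases hne : (farCut (adj N (s.arr 15)) (vset N (s.arr 17)) (vset N (s.arr 19))
      (pushState N s).W (pushState N s).D).Nonempty
  · rw [dif_pos hne, if_neg (g1.2 hne)]
    have hx := g2 hne
    have hx' : s₂.reg 38 = (Finset.max' (farCut (adj N (s.arr 15)) (vset N (s.arr 17))
      (vset N (s.arr 19)) (pushState N s).W (pushState N s).D) hne : Fin N) := hx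
    generalize Finset.max' _ hne = x at hx'
    have hr : useBit.run s₂ = (if s.arr 22 (s.reg 36) = 1 then s₂.setArr 18 x 1
        else s₂.setArr 16 x 1).setReg 36 (s.reg 36 + 1) := by
      simp only [useBit, run_seq, run_ite, run_store, run_assign, Expr.eval_ne, Expr.eval_arr,
        Expr.eval_reg, Expr.eval_num, e22, e36, hx', Expr.eval_add]
      split_ifs <;> simp [e36]
    rw [hr]
    change _ = if s.arr 22 (s.reg 36) = 1 then _ else _
    split_ifs with hb
    · simp [pushState, e16, e18', vset_update]
    · simp [pushState, e16, e18', vset_update]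
  · rw [dif_neg hne, if_pos (by by_contra hc; exact hne (g1.1 hc))]
    simp only [pushState, e16, e18', e36]

/-- The pushing procedure. -/
def pushLoop : Cmd := rep 39 13 pushCmd

theorem run_pushLoop {N k : ℕ} {s : State} (h : Env N k s) (h13 : s.reg 13 = 2 * k)
    (hDP : vset N (s.arr 18) ⊆ vset N (s.arr 19))
    (hv : ∀ i ≤ 2 * k, Valid (adj N (s.arr 15)) (vset N (s.arr 17)) (vset N (s.arr 19)) k
      ((pushStep (adj N (s.arr 15)) (vset N (s.arr 17)) (vset N (s.arr 19)) (s.arr 22))^[i]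
        (pushState N s))) :
    pushState N (pushLoop.run s) = (pushStep (adj N (s.arr 15)) (vset N (s.arr 17))
      (vset N (s.arr 19)) (s.arr 22))^[2 * k] (pushState N s) := by
  have key := run_rep (x := 39) (b := 13) (s := s) (c := pushCmd)
    (fun n s' => n ≤ 2 * k → pushState N s' = (pushStep (adj N (s.arr 15)) (vset N (s.arr 17))
      (vset N (s.arr 19)) (s.arr 22))^[n] (pushState N s) ∧
      vset N (s'.arr 18) ⊆ vset N (s.arr 19))
    (by
      intro _
      simpa [pushState] using hDP)
    (by
      intro n s' hn hx hag ih hle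
      obtain ⟨i1, i2⟩ := ih (by omega)
      have e15 : s'.arr 15 = s.arr 15 := hag.arr 15 rfl
      have e17 : s'.arr 17 = s.arr 17 := hag.arr 17 rfl
      have e19 : s'.arr 19 = s.arr 19 := hag.arr 19 rfl
      have e22 : s'.arr 22 = s.arr 22 := hag.arr 22 rfl
      have hp := run_pushCmd (s := s') (h.of_agree rfl hag)
        (by rw [e15, e17, e19, i1]; exact hv n (by omega)) (by rw [e19]; exact i2)
      rw [e15, e17, e19, e22, i1] at hp
      have hps : pushState N ((pushCmd.run s').setReg 39 (n + 1)) = pushState N (pushCmd.run s') := by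
        simp [pushState]
      refine ⟨by rw [hps, hp, Function.iterate_succ_apply'], ?_⟩
      have hd : (pushState N (pushCmd.run s')).D ⊆ vset N (s.arr 19) := by
        rw [hp]
        refine pushStep_del_subset ?_
        rw [← i1]
        exact i2
      exact hd)
  rw [h13] at key
  exact (key le_rfl).1

/-! ### Reading the bits of a number -/

/-- Halve the register `41`, with the help of a bound in the register `b`. -/
def halve (b : ℕ) : Cmd := seq (assign 44 (.num 0)) (rep 43 b
  (ite (.reg 41 - (.reg 44 + .reg 44 + .num 1)) (assign 44 (.reg 44 + .num 1)) skip))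

/-- Without division or multiplication, the half is found by counting up while twice the count plus
one stays below the number; any sufficiently long loop will do. -/
theorem run_halve {b : ℕ} {s : State} (hb : s.reg 41 ≤ s.reg b) (hb44 : b ≠ 44) :
    ((halve b).run s).reg 44 = s.reg 41 / 2 := by
  have key := run_rep (x := 43) (b := b) (s := (assign 44 (.num 0)).run s)
    (c := ite (.reg 41 - (.reg 44 + .reg 44 + .num 1)) (assign 44 (.reg 44 + .num 1)) skip)
    (fun n s' => s'.reg 44 = min n (s.reg 41 / 2))
    (by simp)
    (by
      intro n s' hn hx hag ih
      have e1 : s'.reg 41 = s.reg 41 := by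
        rw [hag.reg 41 rfl]
        simp
      simp only [run_ite, run_skip, run_assign, Expr.eval_sub, Expr.eval_add, Expr.eval_reg,
        Expr.eval_num, e1, ih]
      split_ifs with h <;> simp [ih] <;> omega)
  have e2 : ((assign 44 (.num 0)).run s).reg b = s.reg b := by simp [hb44]
  rw [e2] at key
  change ((halve b).run s).reg 44 = _ at key
  rw [key]
  omega

/-- Write the binary digits of the register `src` to the array `a`; the register `cnt` holds the
number of digits, and the register `b` a bound for the number. -/
def decode (a src cnt b : ℕ) : Cmd := seq (assign 41 (.reg src)) (rep 42 cnt (seq (halve b)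
  (seq (store a (.reg 42) (.reg 41 - (.reg 44 + .reg 44))) (assign 41 (.reg 44)))))

theorem run_decode {a src cnt b : ℕ} {s : State} (hs : s.reg src ≤ s.reg b) (hb : b < 40)
    (hc : cnt < 40) : ∀ i < s.reg cnt,
    ((decode a src cnt b).run s).arr a i = s.reg src / 2 ^ i % 2 := by
  have key := run_rep (x := 42) (b := cnt) (s := (assign 41 (.reg src)).run s)
    (c := seq (halve b) (seq (store a (.reg 42) (.reg 41 - (.reg 44 + .reg 44)))
      (assign 41 (.reg 44))))
    (fun n s' => s'.reg 41 = s.reg src / 2 ^ n ∧ ∀ i < n, s'.arr a i = s.reg src / 2 ^ i % 2)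
    (by simp)
    (by
      rintro n s' hn hx hag ⟨i1, i2⟩
      have hb1 : s'.reg b = s.reg b := by
        rw [hag.reg b (by
          simp [wr, halve]
          omega)]
        have : b ≠ 41 := by omega
        simp [this]
      have hh := run_halve (s := s') (b := b)
        (by rw [i1, hb1]; exact (Nat.div_le_self _ _).trans hs) (by omega)
      set s₁ := (halve b).run s' with hs₁
      have e41 : s₁.reg 41 = s.reg src / 2 ^ n := by rw [hs₁, run_reg _ _ rfl, i1]
      have e42 : s₁.reg 42 = n := by rw [hs₁, run_reg _ _ rfl, hx]
      have ea : s₁.arr a = s'.arr a := run_arr _ _ rfl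
      rw [i1] at hh
      simp only [run_seq, ← hs₁, run_store, run_assign, State.setReg_reg, State.setReg_arr,
        State.setArr_reg, State.setArr_arr, Expr.eval_sub, Expr.eval_add, Expr.eval_reg, e41, e42,
        hh, ea, if_true, Nat.reduceEqDiff, if_false]
      refine ⟨by rw [Nat.div_div_eq_div_mul, pow_succ], fun i hi => ?_⟩
      rw [Function.update_apply]
      split_ifs with h
      · rw [h]
        omega
      · exact i2 i (by omega))
  have e2 : ((assign 41 (.reg src)).run s).reg cnt = s.reg cnt := by
    have : cnt ≠ 41 := by omega
    simp [this]
  rw [e2] at key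
  exact key.2

/-- Turns an existence statement about bit sequences into one about a number below `2 ^ n`, over
which a loop can run. -/
theorem exists_code (n : ℕ) (b : ℕ → ℕ) :
    ∃ code < 2 ^ n, ∀ i < n, code / 2 ^ i % 2 = if b i = 1 then 1 else 0 := by
  refine ⟨Nat.ofBits fun i : Fin n => decide (b i = 1), Nat.ofBits_lt_two_pow _, fun i hi => ?_⟩
  have h := Nat.testBit_ofBits_lt (fun i : Fin n => decide (b i = 1)) i hi
  rw [Nat.testBit_eq_decide_div_mod_eq] at h
  simp only [decide_eq_decide] at h
  split_ifs with hb
  · exact h.2 hb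
  · have := mt h.1 hb
    omega

end DirectedMultiwayCut

/-! ### Guessed vertex sets and shadow removal on the machine -/

namespace DirectedMultiwayCut
open Cmd Relation

/-! ### Linear recurrences on the machine

Registers `14`, `15` and `20` hold `L`, `m` and `N * L`; array `23` holds the `m` coefficients and the
`m` initial values, array `24` the sequence, and array `25` the set of its zero blocks. -/

/-- Compute the next term of the sequence. -/
def nextTerm : Cmd := seq (assign 46 (.num 0)) (seq (rep 47 15 (ite (.arr 23 (.reg 47))
  (ite (.arr 24 (.reg 45 + .reg 47)) (assign 46 (.num 1 - .reg 46)) skip) skip))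
  (store 24 (.reg 45 + .reg 15) (.reg 46)))

/-- Compute the sequence. -/
def sequenceCmd : Cmd := seq (fill 45 15 24 46 (assign 46 (.arr 23 (.reg 15 + .reg 45))))
  (rep 45 20 nextTerm)

/-- Compute the set of zero blocks of the sequence. -/
def zerosCmd : Cmd := seq (assign 48 (.num 0)) (rep 45 10 (seq (assign 46 (.num 1))
  (seq (rep 47 14 (seq (ite (.arr 24 (.reg 48)) (assign 46 (.num 0)) skip)
    (assign 48 (.reg 48 + .num 1)))) (store 25 (.reg 45) (.reg 46)))))

/-- The sum modulo 2 is kept as one bit, and replacing `b` by `1 - b` adds one to it. -/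
theorem run_nextTerm {m : ℕ} {a z : ℕ → ℕ} (hz : Recurrence m a z) {s : State}
    (h15 : s.reg 15 = m) (ha : ∀ i < m, s.arr 23 i = a i) {i : ℕ} (hi : s.reg 45 = i)
    (hseq : ∀ j < i + m, s.arr 24 j = z j) :
    ∀ j < i + 1 + m, (nextTerm.run s).arr 24 j = z j := by
  set s₁ := (assign 46 (.num 0)).run s with hs₁
  have key := run_rep (x := 47) (b := 15) (s := s₁)
    (c := ite (.arr 23 (.reg 47))
      (ite (.arr 24 (.reg 45 + .reg 47)) (assign 46 (.num 1 - .reg 46)) skip) skip)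
    (fun n s' => s'.reg 46 = (∑ j ∈ Finset.range n, a j * z (i + j)) % 2)
    (by simp [hs₁])
    (by
      intro n s' hn hx hag ih
      have h1 : s₁.reg 15 = m := by simp [hs₁, h15]
      rw [h1] at hn
      have e1 : s'.reg 45 = i := by rw [hag.reg 45 rfl]; simp [hs₁, hi]
      have e2 : s'.arr 23 n = a n := by rw [hag.arr 23 rfl]; simp [hs₁, ha n hn]
      have e3 : s'.arr 24 (i + n) = z (i + n) := by
        rw [hag.arr 24 rfl]
        simp [hs₁, hseq (i + n) (by omega)]
      rw [Finset.sum_range_succ]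
      have h2 := hz.coeff n
      have h3 := hz.le (i + n)
      simp only [run_ite, run_skip, run_assign, Expr.eval_arr, Expr.eval_add, Expr.eval_sub,
        Expr.eval_reg, Expr.eval_num, e1, hx, e2, e3]
      split_ifs with c1 c2
      · simp [ih, c1]
      · simp [ih, c2]
      · have c1' : a n = 1 := by omega
        have c2' : z (i + n) = 1 := by omega
        simp only [State.setReg_reg, Nat.reduceEqDiff, if_false, if_true, ih, c1', c2']
        omega)
  set s₂ := (rep 47 15 (ite (.arr 23 (.reg 47))
      (ite (.arr 24 (.reg 45 + .reg 47)) (assign 46 (.num 1 - .reg 46)) skip) skip)).run s₁ with hs₂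
  have h1 : s₁.reg 15 = m := by simp [hs₁, h15]
  rw [h1, ← hz.step] at key
  have e1 : s₂.reg 45 = i := by rw [hs₂, run_reg _ _ rfl]; simp [hs₁, hi]
  have e2 : s₂.reg 15 = m := by rw [hs₂, run_reg _ _ rfl, h1]
  have e3 : s₂.arr 24 = s.arr 24 := by rw [hs₂, run_arr _ _ rfl]; simp [hs₁]
  intro j hj
  have hr : nextTerm.run s = s₂.setArr 24 (i + m) (z (i + m)) := by
    change (store 24 (.reg 45 + .reg 15) (.reg 46)).run s₂ = _
    simp [e1, e2, key]
  rw [hr]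
  simp only [State.setArr_arr, if_true, e3, Function.update_apply]
  split_ifs with h
  · rw [h]
  · exact hseq j (by omega)

theorem run_sequenceCmd {m K : ℕ} {a z : ℕ → ℕ} (hz : Recurrence m a z) {s : State}
    (h15 : s.reg 15 = m) (h20 : s.reg 20 = K) (ha : ∀ i < m, s.arr 23 i = a i)
    (hz0 : ∀ i < m, s.arr 23 (m + i) = z i) :
    ∀ j < K, (sequenceCmd.run s).arr 24 j = z j := by
  have hf := run_fill (x := 45) (b := 15) (a := 24) (v := 46)
    (c := assign 46 (.arr 23 (.reg 15 + .reg 45))) (s := s) z rfl rfl (by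
      intro i hi s' hag hx
      rw [h15] at hi
      simp [hx, hag.reg 15 rfl, h15, hag.arr 23 rfl, hz0 i hi])
  set s₁ := (fill 45 15 24 46 (assign 46 (.arr 23 (.reg 15 + .reg 45)))).run s with hs₁
  have e15 : s₁.reg 15 = m := by rw [hs₁, run_reg _ _ rfl, h15]
  have e23 : s₁.arr 23 = s.arr 23 := run_arr _ _ rfl
  have e20 : s₁.reg 20 = K := by rw [hs₁, run_reg _ _ rfl, h20]
  have key := run_rep (x := 45) (b := 20) (s := s₁) (c := nextTerm)
    (fun n s' => ∀ j < n + m, s'.arr 24 j = z j)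
    (by
      intro j hj
      exact hf j (by omega))
    (by
      intro n s' hn hx hag ih
      exact run_nextTerm hz (by rw [hag.reg 15 rfl, e15])
        (by rw [hag.arr 23 rfl, e23]; exact ha) hx ih)
  rw [e20] at key
  exact fun j hj => key j (by omega)

theorem run_zerosCmd {N L : ℕ} {z : ℕ → ℕ} {s : State} (h10 : s.reg 10 = N) (h14 : s.reg 14 = L)
    (hseq : ∀ j < N * L, s.arr 24 j = z j) :
    vset N ((zerosCmd.run s).arr 25) = zeros N L z := by
  set s₁ := (assign 48 (.num 0)).run s with hs₁
  have key := run_rep (x := 45) (b := 10) (s := s₁)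
    (c := seq (assign 46 (.num 1)) (seq (rep 47 14 (seq (ite (.arr 24 (.reg 48))
      (assign 46 (.num 0)) skip) (assign 48 (.reg 48 + .num 1)))) (store 25 (.reg 45) (.reg 46))))
    (fun n s' => s'.reg 48 = n * L ∧
      ∀ v < n, (s'.arr 25 v ≠ 0 ↔ ∀ r < L, z (v * L + r) = 0))
    (by simp [hs₁])
    (by
      rintro n s' hn hx hag ⟨i1, i2⟩
      have hn' : n < N := by
        have : s₁.reg 10 = N := by simp [hs₁, h10]
        omega
      have e24 : s'.arr 24 = s.arr 24 := hag.arr 24 rfl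
      have e14 : s'.reg 14 = L := by rw [hag.reg 14 rfl]; simp [hs₁, h14]
      set s₂ := (assign 46 (.num 1)).run s' with hs₂
      have key2 := run_rep (x := 47) (b := 14) (s := s₂)
        (c := seq (ite (.arr 24 (.reg 48)) (assign 46 (.num 0)) skip)
          (assign 48 (.reg 48 + .num 1)))
        (fun n' s'' => s''.reg 48 = n * L + n' ∧ (s''.reg 46 ≠ 0 ↔ ∀ r < n', z (n * L + r) = 0))
        (by simp [hs₂, i1])
        (by
          rintro n' s'' hn2 hx2 hag2 ⟨j1, j2⟩
          have hnL : n' < L := by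
            have : s₂.reg 14 = L := by simp [hs₂, e14]
            omega
          have hlt : n * L + n' < N * L := by nlinarith
          have e : s''.arr 24 (n * L + n') = z (n * L + n') := by
            rw [hag2.arr 24 rfl]
            simp [hs₂, e24, hseq _ hlt]
          have hall : (∀ r < n' + 1, z (n * L + r) = 0) ↔
              (∀ r < n', z (n * L + r) = 0) ∧ z (n * L + n') = 0 :=
            ⟨fun h => ⟨fun r hr => h r (by omega), h n' (by omega)⟩, fun h r hr => by
              rcases Nat.lt_succ_iff_lt_or_eq.1 hr with hr | rfl
              · exact h.1 r hr
              · exact h.2⟩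
          rw [hall]
          simp only [run_seq, run_ite, run_assign, run_skip, Expr.eval_arr, Expr.eval_reg, j1, e,
            Expr.eval_add, Expr.eval_num]
          split_ifs with c
          · simp only [State.setReg_reg, Nat.reduceEqDiff, if_false, if_true, j1, c, and_true]
            exact ⟨by omega, j2⟩
          · simp only [State.setReg_reg, Nat.reduceEqDiff, if_false, if_true, j1, c, and_false]
            exact ⟨by omega, by simp⟩)
      have e14' : s₂.reg 14 = L := by simp [hs₂, e14]
      rw [e14'] at key2
      set s₃ := (rep 47 14 (seq (ite (.arr 24 (.reg 48)) (assign 46 (.num 0)) skip)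
          (assign 48 (.reg 48 + .num 1)))).run s₂ with hs₃
      have e25 : s₃.arr 25 = s'.arr 25 := by rw [hs₃, run_arr _ _ rfl]; rfl
      have e45 : s₃.reg 45 = n := by rw [hs₃, run_reg _ _ rfl]; simp [hs₂, hx]
      simp only [run_seq, ← hs₂, ← hs₃, run_store, State.setReg_reg, State.setReg_arr,
        State.setArr_arr, State.setArr_reg, Nat.reduceEqDiff, if_false, if_true, Expr.eval_reg, e45,
        key2.1, Function.update_apply, e25]
      refine ⟨by ring, fun v hv => ?_⟩
      split_ifs with h
      · rw [h]
        exact key2.2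
      · exact i2 v (by omega))
  have e10 : s₁.reg 10 = N := by simp [hs₁, h10]
  rw [e10] at key
  ext v
  rw [mem_vset, zeros, Finset.mem_filter]
  simp only [Finset.mem_univ, true_and]
  exact key.2 v v.2

/-! ### Shadow removal on the machine -/

/-- Importance quantifies over all supersets, but it holds exactly when the set is its own furthest
smallest cut, which one flow computation decides. Once the boundary of the furthest set `A` is `Y`,
the set `A` is separated from `T` by `Y` and so cannot exceed the shadow. -/
theorem certifies_iff {V : Type*} [Fintype V] [LinearOrder V] {R : V → V → Prop}
    {T P C Y A : Finset V} {k : ℕ} {v : V}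
    (hA : FurthestSide R T P (shadow R T Y) ∅ A) (hk : (outN R A).card ≤ k) :
    Certifies R T P C k v Y ↔ outN R A = Y ∧ Y ⊆ C ∧ v ∈ shadow R T Y := by
  have hle : ∀ B, Feas R T P B → shadow R T Y ⊆ B → (outN R A).card ≤ (outN R B).card := by
    intro B hB hX
    have := hA.le B ⟨hB, hX, Finset.disjoint_empty_right _⟩
    simpa using this
  have hmax : ∀ B, Feas R T P B → shadow R T Y ⊆ B → (outN R B).card ≤ (outN R A).card → B ⊆ A := by
    intro B hB hX hc
    exact hA.max B ⟨hB, hX, Finset.disjoint_empty_right _⟩ (by simpa using hc)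
  constructor
  · rintro ⟨h1, h2, h3, h4, h5⟩
    have hAX : A = shadow R T Y := h2.2 A hA.mem.1 hA.mem.2.1 (hle _ h2.1 (Finset.Subset.refl _))
    exact ⟨by rw [hAX, h3], h5, h1⟩
  · rintro ⟨h1, h2, h3⟩
    have hAX : A = shadow R T Y := by
      refine Finset.Subset.antisymm (fun u hu => mem_shadow.2 ⟨?_, ?_⟩) hA.mem.2.1
      · rw [← h1]
        exact fun h => (mem_outN.1 h).1 hu
      · rintro ⟨t, ht, hp⟩
        exact Finset.disjoint_left.1 hA.mem.1.1 (stay h1.le hu hp) ht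
    rw [hAX] at h1
    refine ⟨h3, ⟨hAX ▸ hA.mem.1, fun B hB hXB hc => ?_⟩, h1, ?_, h2⟩
    · refine Finset.Subset.antisymm ?_ hXB
      have := hmax B hB hXB (by rw [hAX]; exact hc)
      rwa [hAX] at this
    · rw [← h1, ← hAX]
      exact hk

/-- Set array `16` to the complement of array `18` in the set of vertices without label. -/
def shadowCmd : Cmd := fill 30 10 16 32 (seq (assign 32 (.num 0)) (ite (.arr 18 (.reg 30)) skip
  (ite (.arr 21 (.reg 30)) skip (assign 32 (.num 1)))))

/-- The test at a single vertex. -/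
def certCell : Cmd := seq (assign 32 (.num 1)) (ite (.arr 27 (.reg 30))
  (seq (ite (.arr 25 (.reg 30)) skip (assign 32 (.num 0)))
    (ite (.arr 21 (.reg 30)) (assign 32 (.num 0))
      (ite (.arr 21 (.reg 10 + .reg 30)) skip (assign 32 (.num 0)))))
  (ite (.arr 21 (.reg 30)) skip (ite (.arr 21 (.reg 10 + .reg 30)) (assign 32 (.num 0)) skip)))

/-- Test whether array `18` certifies that the vertex in register `51` is in a shadow. -/
def certifyCmd : Cmd :=
  seq (fill 30 10 27 32 (assign 32 (.arr 18 (.reg 30))))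
  (seq reach (seq shadowCmd (seq (fill 30 10 18 32 (assign 32 (.num 0))) (seq flow
  (seq (assign 49 (.num 1)) (seq (checkAll 30 10 32 49 certCell)
  (seq (ite (.arr 21 (.reg 10 + .reg 10)) (assign 49 (.num 0)) skip)
    (ite (.arr 16 (.reg 51)) skip (assign 49 (.num 0))))))))))

theorem run_shadowCmd {N k : ℕ} {s : State} (h : Env N k s) {g w ks p : ℕ → ℕ}
    (hL : Labels (N + N + 2) (N + N + 1) (splitCap k N g w ks (s.arr 18) p) (s.arr 21)) :
    vset N ((shadowCmd.run s).arr 16) = shadow (adj N g) (vset N ks) (vset N (s.arr 18)) := by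
  have hf := run_fill (x := 30) (b := 10) (a := 16) (v := 32)
    (c := seq (assign 32 (.num 0)) (ite (.arr 18 (.reg 30)) skip
      (ite (.arr 21 (.reg 30)) skip (assign 32 (.num 1))))) (s := s)
    (fun i => if s.arr 18 i = 0 ∧ s.arr 21 i = 0 then 1 else 0) rfl rfl (by
      intro i hi s' hag hx
      simp only [run_seq, run_assign, run_ite, run_skip, Expr.eval_arr, Expr.eval_reg,
        Expr.eval_num, State.setReg_reg, State.setReg_arr, hx, hag.arr 18 rfl, hag.arr 21 rfl,
        Nat.reduceEqDiff, if_false]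
      split_ifs <;> simp_all)
  rw [h.N_eq] at hf
  ext v
  have hv := (hL.ne_zero_iff_reach v).1
  rw [mem_vset, shadowCmd, hf v v.2, mem_shadow]
  have hno : ∀ t, v ∉ vset N (s.arr 18) → ReflTransGen (Av (adj N g) (vset N (s.arr 18))) v t →
      t ∉ vset N (s.arr 18) := by
    intro t hv hp
    induction hp with
    | refl => exact hv
    | tail _ hr _ => exact hr.2.2
  have h18 : s.arr 18 v = 0 ↔ v ∉ vset N (s.arr 18) := by rw [mem_vset, not_not]
  constructor
  · intro hne
    split_ifs at hne with hc
    · refine ⟨h18.1 hc.1, ?_⟩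
      rintro ⟨t, ht, hp⟩
      exact hv.2 ⟨h18.1 hc.1, t, ht, hno t (h18.1 hc.1) hp, hp⟩ hc.2
    · exact absurd rfl hne
  · rintro ⟨h1, h2⟩
    rw [if_pos]
    · omega
    · refine ⟨h18.2 h1, ?_⟩
      by_contra hc
      obtain ⟨-, t, ht, -, hp⟩ := hv.1 hc
      exact h2 ⟨t, ht, hp⟩

theorem run_certCell {N : ℕ} {s : State} (h : s.reg 10 = N) :
    (certCell.run s).reg 32 ≠ 0 ↔
      (s.arr 27 (s.reg 30) ≠ 0 → s.arr 25 (s.reg 30) ≠ 0) ∧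
      (s.arr 27 (s.reg 30) ≠ 0 ↔ s.arr 21 (s.reg 30) = 0 ∧ s.arr 21 (N + s.reg 30) ≠ 0) := by
  simp only [certCell, run_seq, run_assign, run_ite, run_skip, Expr.eval_arr, Expr.eval_reg,
    Expr.eval_num, Expr.eval_add, State.setReg_reg, State.setReg_arr, Nat.reduceEqDiff, if_false, h]
  split_ifs <;> simp_all

/-- Array `27` saves the proposed boundary, because the flow is computed with nothing deleted and
overwrites array `18` with zeros. -/
theorem run_certifyCmd {N k : ℕ} {s : State} (h : Env N k s) {v : Fin N} (h51 : s.reg 51 = v) :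
    (certifyCmd.run s).reg 49 ≠ 0 ↔ Certifies (adj N (s.arr 15)) (vset N (s.arr 17))
      (vset N (s.arr 19)) (vset N (s.arr 25)) k v (vset N (s.arr 18)) := by
  have f1 := run_fill (x := 30) (b := 10) (a := 27) (v := 32)
    (c := assign 32 (.arr 18 (.reg 30))) (s := s) (s.arr 18) rfl rfl (by
      intro i hi s' hag hx
      simp [hx, hag.arr 18 rfl])
  rw [h.N_eq] at f1
  set s₁ := (fill 30 10 27 32 (assign 32 (.arr 18 (.reg 30)))).run s with hs₁
  clear_value s₁
  have h1 : Env N k s₁ := by rw [hs₁]; exact h.run rfl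
  have hL := run_reach h1
  set s₂ := reach.run s₁ with hs₂
  clear_value s₂
  have h2 : Env N k s₂ := by rw [hs₂]; exact h1.run rfl
  have e15 : s₂.arr 15 = s.arr 15 := by rw [hs₂, run_arr _ _ rfl, hs₁, run_arr _ _ rfl]
  have e17 : s₂.arr 17 = s.arr 17 := by rw [hs₂, run_arr _ _ rfl, hs₁, run_arr _ _ rfl]
  have e18 : s₂.arr 18 = s.arr 18 := by rw [hs₂, run_arr _ _ rfl, hs₁, run_arr _ _ rfl]
  have e18' : s₁.arr 18 = s₂.arr 18 := by rw [hs₂, run_arr reach _ rfl]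
  rw [e18'] at hL
  have hW := run_shadowCmd h2 hL
  set s₃ := shadowCmd.run s₂ with hs₃
  clear_value s₃
  have h3 : Env N k s₃ := by rw [hs₃]; exact h2.run rfl
  have f4 := run_fill (x := 30) (b := 10) (a := 18) (v := 32) (c := assign 32 (.num 0)) (s := s₃)
    (fun _ => 0) rfl rfl (by intros; simp)
  rw [h3.N_eq] at f4
  set s₄ := (fill 30 10 18 32 (assign 32 (.num 0))).run s₃ with hs₄
  clear_value s₄
  have h4 : Env N k s₄ := by rw [hs₄]; exact h3.run rfl
  have a15 : s₁.arr 15 = s.arr 15 := by rw [hs₁, run_arr _ _ rfl]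
  have a17 : s₁.arr 17 = s.arr 17 := by rw [hs₁, run_arr _ _ rfl]
  rw [a15, a17, e18] at hW
  have b15 : s₄.arr 15 = s.arr 15 := by rw [hs₄, run_arr _ _ rfl, hs₃, run_arr _ _ rfl, e15]
  have b16 : s₄.arr 16 = s₃.arr 16 := by rw [hs₄, run_arr _ _ rfl]
  have b17 : s₄.arr 17 = s.arr 17 := by rw [hs₄, run_arr _ _ rfl, hs₃, run_arr _ _ rfl, e17]
  have b19 : s₄.arr 19 = s.arr 19 := by
    rw [hs₄, run_arr _ _ rfl, hs₃, run_arr _ _ rfl, hs₂, run_arr _ _ rfl, hs₁, run_arr _ _ rfl]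
  have b18 : vset N (s₄.arr 18) = ∅ := by
    ext u
    simp [mem_vset, f4 u u.2]
  have hfl := run_flow_side h4 (by rw [b18]; exact Finset.disjoint_empty_right _)
    (by rw [b18]; exact Finset.empty_subset _)
  rw [b15, b16, b17, b18, b19, hW] at hfl
  set s₅ := flow.run s₄ with hs₅
  clear_value s₅
  have h5 : Env N k s₅ := by rw [hs₅]; exact h4.run rfl
  set s₆ := (assign 49 (.num 1)).run s₅ with hs₆
  clear_value s₆
  have h6 : Env N k s₆ := by rw [hs₆]; exact h5.run rfl
  have hchk := run_checkAll (x := 30) (b := 10) (v := 32) (f := 49) (c := certCell) (s := s₆)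
    (fun i => (s.arr 18 i ≠ 0 → s.arr 25 i ≠ 0) ∧
      (s.arr 18 i ≠ 0 ↔ s₅.arr 21 i = 0 ∧ s₅.arr 21 (N + i) ≠ 0)) rfl (by decide) (by
      intro i hi s' hag hx
      rw [h6.N_eq] at hi
      rw [run_certCell (by rw [hag.reg 10 rfl, h6.N_eq]), hx, hag.arr 27 rfl, hag.arr 25 rfl,
        hag.arr 21 rfl]
      have c27 : s₆.arr 27 i = s.arr 18 i := by
        rw [← f1 i hi, hs₆, run_arr _ _ rfl, hs₅, run_arr _ _ rfl, hs₄, run_arr _ _ rfl, hs₃,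
          run_arr _ _ rfl, hs₂, run_arr _ _ rfl]
      have c25 : s₆.arr 25 = s.arr 25 := by
        rw [hs₆, run_arr _ _ rfl, hs₅, run_arr _ _ rfl, hs₄, run_arr _ _ rfl, hs₃,
          run_arr _ _ rfl, hs₂, run_arr _ _ rfl, hs₁, run_arr _ _ rfl]
      have c21 : s₆.arr 21 = s₅.arr 21 := by rw [hs₆, run_arr _ _ rfl]
      rw [c27, c25, c21])
  rw [h6.N_eq] at hchk
  set s₇ := (checkAll 30 10 32 49 certCell).run s₆ with hs₇
  clear_value s₇
  have h7 : Env N k s₇ := by rw [hs₇]; exact h6.run rfl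
  have d21 : s₇.arr 21 = s₅.arr 21 := by rw [hs₇, run_arr _ _ rfl, hs₆, run_arr _ _ rfl]
  have d16 : s₇.arr 16 = s₃.arr 16 := by
    rw [hs₇, run_arr _ _ rfl, hs₆, run_arr _ _ rfl, hs₅, run_arr _ _ rfl, b16]
  have d51 : s₇.reg 51 = v := by
    rw [hs₇, run_reg _ _ rfl, hs₆, run_reg _ _ rfl, hs₅, run_reg _ _ rfl, hs₄, run_reg _ _ rfl,
      hs₃, run_reg _ _ rfl, hs₂, run_reg _ _ rfl, hs₁, run_reg _ _ rfl, h51]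
  have hone : s₆.reg 49 ≠ 0 := by simp [hs₆]
  have hv : s₃.arr 16 v ≠ 0 ↔
      v ∈ shadow (adj N (s.arr 15)) (vset N (s.arr 17)) (vset N (s.arr 18)) := by
    rw [← hW, mem_vset]
  have hfinal : (certifyCmd.run s).reg 49 ≠ 0 ↔
      s₇.reg 49 ≠ 0 ∧ s₅.arr 21 (N + N) = 0 ∧ s₃.arr 16 v ≠ 0 := by
    have hr : certifyCmd.run s = (seq (ite (.arr 21 (.reg 10 + .reg 10)) (assign 49 (.num 0)) skip)
      (ite (.arr 16 (.reg 51)) skip (assign 49 (.num 0)))).run s₇ := by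
      rw [hs₇, hs₆, hs₅, hs₄, hs₃, hs₂, hs₁]
      rfl
    rw [hr, ← d16, ← d21]
    simp only [run_seq, run_ite, run_assign, run_skip, Expr.eval_arr, Expr.eval_reg, Expr.eval_num,
      Expr.eval_add, h7.N_eq]
    by_cases c1 : s₇.arr 21 (N + N) = 0 <;> by_cases c2 : s₇.arr 16 v = 0 <;>
      simp [c1, c2, d51]
  rw [hfinal, hchk, hv]
  constructor
  · rintro ⟨⟨-, h8⟩, h9, h10⟩
    obtain ⟨A, hA, hk, hmem⟩ := hfl.2 h9
    simp only [Finset.sdiff_empty] at hk hmem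
    refine (certifies_iff hA hk).2 ⟨?_, ?_, h10⟩
    · ext u
      rw [hmem, mem_vset]
      have := (h8 u u.2).2
      exact ⟨fun h => this.2 h.2, fun h => ⟨f4 u u.2, this.1 h⟩⟩
    · intro u hu
      exact mem_vset.2 ((h8 u u.2).1 (mem_vset.1 hu))
  · intro hc
    have h9 : s₅.arr 21 (N + N) = 0 := hfl.1 ⟨_, ⟨hc.imp.1, Finset.Subset.refl _,
      Finset.disjoint_empty_right _⟩, by rw [Finset.sdiff_empty, hc.eq]; exact hc.card_le⟩
    obtain ⟨A, hA, hk, hmem⟩ := hfl.2 h9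
    simp only [Finset.sdiff_empty] at hk hmem
    obtain ⟨h10, h11, h12⟩ := (certifies_iff hA hk).1 hc
    refine ⟨⟨hone, fun i hi => ⟨fun h => ?_, ?_⟩⟩, h9, h12⟩
    · exact mem_vset.1 (h11 (mem_vset.2 h : (⟨i, hi⟩ : Fin N) ∈ _))
    · have h13 := hmem ⟨i, hi⟩
      rw [h10, mem_vset] at h13
      exact ⟨fun h => (h13.1 h).2, fun h => h13.2 ⟨f4 i hi, h⟩⟩

/-- Try the pushing procedure on the vertex in register `51` and the bits in register `53`. -/
def tryCmd : Cmd := seq (decode 22 53 13 18)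
  (seq (fill 30 10 16 32 (seq (assign 32 (.num 0))
    (ite (.ne (.reg 30) (.reg 51)) skip (assign 32 (.num 1)))))
  (seq (fill 30 10 18 32 (assign 32 (.num 0))) (seq (assign 36 (.num 0)) (seq pushLoop certifyCmd))))

/-- The first part is unconditional: whatever the pushing procedure produced on bad bits, it is
accepted only after the certificate has been verified. The second part quantifies over all sequences
with the right first `2 * k` digits, since the array may hold anything beyond them. -/
theorem run_tryCmd {N k : ℕ} {s : State} (h : Env N k s) {v : Fin N} (h51 : s.reg 51 = v) :
    ((tryCmd.run s).reg 49 ≠ 0 → ∃ Y, Certifies (adj N (s.arr 15)) (vset N (s.arr 17))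
      (vset N (s.arr 19)) (vset N (s.arr 25)) k v Y) ∧
    (s.reg 13 = 2 * k → s.reg 53 ≤ s.reg 18 →
      (∀ bits : ℕ → ℕ, (∀ i < 2 * k, bits i = s.reg 53 / 2 ^ i % 2) →
        Certifies (adj N (s.arr 15)) (vset N (s.arr 17)) (vset N (s.arr 19)) (vset N (s.arr 25)) k v
          ((pushStep (adj N (s.arr 15)) (vset N (s.arr 17)) (vset N (s.arr 19)) bits)^[2 * k]
            ⟨{v}, ∅, 0⟩).D ∧
        ∀ i ≤ 2 * k, Valid (adj N (s.arr 15)) (vset N (s.arr 17)) (vset N (s.arr 19)) k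
          ((pushStep (adj N (s.arr 15)) (vset N (s.arr 17)) (vset N (s.arr 19)) bits)^[i]
            ⟨{v}, ∅, 0⟩)) →
      (tryCmd.run s).reg 49 ≠ 0) := by
  set s₁ := (decode 22 53 13 18).run s with hs₁
  clear_value s₁
  have h1 : Env N k s₁ := by rw [hs₁]; exact h.run rfl
  have c51 : s₁.reg 51 = v := by rw [hs₁, run_reg _ _ rfl, h51]
  have f2 := run_fill (x := 30) (b := 10) (a := 16) (v := 32)
    (c := seq (assign 32 (.num 0)) (ite (.ne (.reg 30) (.reg 51)) skip (assign 32 (.num 1))))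
    (s := s₁) (fun i => if i = v then 1 else 0) rfl rfl (by
      intro i hi s' hag hx
      have : s'.reg 51 = v := by rw [hag.reg 51 rfl, c51]
      simp only [run_seq, run_assign, run_ite, run_skip, Expr.eval_ne, Expr.eval_reg, Expr.eval_num,
        State.setReg_reg, hx, this, Nat.reduceEqDiff, if_false]
      split_ifs <;> simp)
  rw [h1.N_eq] at f2
  set s₂ := (fill 30 10 16 32 (seq (assign 32 (.num 0))
    (ite (.ne (.reg 30) (.reg 51)) skip (assign 32 (.num 1))))).run s₁ with hs₂
  clear_value s₂
  have h2 : Env N k s₂ := by rw [hs₂]; exact h1.run rfl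
  have f3 := run_fill (x := 30) (b := 10) (a := 18) (v := 32) (c := assign 32 (.num 0)) (s := s₂)
    (fun _ => 0) rfl rfl (by intros; simp)
  rw [h2.N_eq] at f3
  set s₃ := (fill 30 10 18 32 (assign 32 (.num 0))).run s₂ with hs₃
  clear_value s₃
  set s₄ := (assign 36 (.num 0)).run s₃ with hs₄
  clear_value s₄
  have h4 : Env N k s₄ := by
    rw [hs₄, hs₃]
    exact (h2.run (c := fill 30 10 18 32 (assign 32 (.num 0))) rfl).run
      (c := assign 36 (.num 0)) rfl
  have hpre : pushState N s₄ = ⟨{v}, ∅, 0⟩ := by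
    have a16 : s₄.arr 16 = s₂.arr 16 := by rw [hs₄, run_arr _ _ rfl, hs₃, run_arr _ _ rfl]
    have a18 : s₄.arr 18 = s₃.arr 18 := by rw [hs₄, run_arr _ _ rfl]
    simp only [pushState, a16, a18, PushState.mk.injEq]
    refine ⟨?_, ?_, by simp [hs₄]⟩
    · ext u
      rw [mem_vset, f2 u u.2]
      simp [Fin.val_inj]
    · ext u
      simp [mem_vset, f3 u u.2]
  have fr : ∀ a, (decode 22 53 13 18).wa a = false → (a == 16) = false → (a == 18) = false →
      s₄.arr a = s.arr a := by
    intro a h1 h2 h3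
    rw [hs₄, run_arr _ _ rfl, hs₃, run_arr _ _ (by simpa [fill, wa] using h3), hs₂,
      run_arr _ _ (by simpa [fill, wa] using h2), hs₁, run_arr _ _ h1]
  set s₅ := pushLoop.run s₄ with hs₅
  clear_value s₅
  have h5 : Env N k s₅ := by rw [hs₅]; exact h4.run rfl
  have e15 : s₅.arr 15 = s.arr 15 := by rw [hs₅, run_arr _ _ rfl, fr 15 rfl rfl rfl]
  have e17 : s₅.arr 17 = s.arr 17 := by rw [hs₅, run_arr _ _ rfl, fr 17 rfl rfl rfl]
  have e19 : s₅.arr 19 = s.arr 19 := by rw [hs₅, run_arr _ _ rfl, fr 19 rfl rfl rfl]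
  have e25 : s₅.arr 25 = s.arr 25 := by rw [hs₅, run_arr _ _ rfl, fr 25 rfl rfl rfl]
  have e51 : s₅.reg 51 = v := by
    rw [hs₅, run_reg _ _ rfl, hs₄, run_reg _ _ rfl, hs₃, run_reg _ _ rfl, hs₂, run_reg _ _ rfl, c51]
  have hc := run_certifyCmd h5 e51
  rw [e15, e17, e19, e25] at hc
  have hrun : tryCmd.run s = certifyCmd.run s₅ := by
    rw [hs₅, hs₄, hs₃, hs₂, hs₁]
    rfl
  rw [hrun]
  refine ⟨fun hne => ⟨_, hc.1 hne⟩, fun h13 h18 hbits => hc.2 ?_⟩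
  have hdec := run_decode (a := 22) (src := 53) (cnt := 13) (b := 18) h18 (by omega) (by omega)
  rw [h13, ← hs₁] at hdec
  have e22 : s₄.arr 22 = s₁.arr 22 := by
    rw [hs₄, run_arr _ _ rfl, hs₃, run_arr _ _ rfl, hs₂, run_arr _ _ rfl]
  obtain ⟨b1, b2⟩ := hbits (s₁.arr 22) hdec
  have hp := run_pushLoop h4 (by
    rw [hs₄, run_reg _ _ rfl, hs₃, run_reg _ _ rfl, hs₂, run_reg _ _ rfl, hs₁, run_reg _ _ rfl, h13])
    (by
      have : vset N (s₄.arr 18) = ∅ := congrArg PushState.D hpre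
      rw [this]
      exact Finset.empty_subset _)
    (by rw [fr 15 rfl rfl rfl, fr 17 rfl rfl rfl, fr 19 rfl rfl rfl, e22, hpre]; exact b2)
  rw [fr 15 rfl rfl rfl, fr 17 rfl rfl rfl, fr 19 rfl rfl rfl, e22, hpre] at hp
  rw [← hs₅] at hp
  have hD : vset N (s₅.arr 18) = _ := congrArg PushState.D hp
  rw [hD]
  exact b1

/-- Compute the vertices that are in a certified shadow, in array `26`. -/
def removeCmd : Cmd := seq (fill 30 10 26 32 (assign 32 (.num 0)))
  (rep 51 10 (rep 53 18 (seq tryCmd (ite (.reg 49) (store 26 (.reg 51) (.num 1)) skip))))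

theorem exists_code_certifies {V : Type*} [Fintype V] [LinearOrder V] {R : V → V → Prop}
    {T P S C : Finset V} {k : ℕ} (hS : S ⊆ P) (ht : Tight R T P S) (hk : S.card ≤ k) (hC : S ⊆ C)
    {v : V} (hv : v ∈ shadow R T S) :
    ∃ code < 2 ^ (2 * k), ∀ bits : ℕ → ℕ, (∀ i < 2 * k, bits i = code / 2 ^ i % 2) →
      Certifies R T P C k v ((pushStep R T P bits)^[2 * k] ⟨{v}, ∅, 0⟩).D ∧
      ∀ i ≤ 2 * k, Valid R T P k ((pushStep R T P bits)^[i] ⟨{v}, ∅, 0⟩) := by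
  obtain ⟨b, hb⟩ := exists_bits_certifies hS ht hk hC hv
  obtain ⟨code, hcode, hdig⟩ := exists_code (2 * k) b
  refine ⟨code, hcode, fun bits hbits => ?_⟩
  -- The digits match `b` only as answers to the question whether a bit is one. The hybrid sequence
  -- agrees with `b` where bits are read, and it gives the same pushing steps as the decoded digits.
  have h := hb (fun i => if i < 2 * k then b i else bits i) (fun i hi => if_pos hi)
  rwa [pushStep_congr (bits' := bits)] at h
  intro i
  split_ifs with hi
  · rw [hbits i hi, hdig i hi]
    split_ifs with h1 <;> simp [h1]
  · rfl

/-- The removed set does not depend on `S`: soundness concerns each removed vertex, while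
completeness holds simultaneously for every tight set contained in the guessed `C`. -/
theorem run_removeCmd {N k : ℕ} {s : State} (h : Env N k s)
    (h13 : s.reg 13 = 2 * k) (h18 : s.reg 18 = 2 ^ (2 * k)) :
    (∀ v ∈ vset N ((removeCmd.run s).arr 26), ∃ Y, Certifies (adj N (s.arr 15))
      (vset N (s.arr 17)) (vset N (s.arr 19)) (vset N (s.arr 25)) k v Y) ∧
    ∀ S ⊆ vset N (s.arr 19), Tight (adj N (s.arr 15)) (vset N (s.arr 17)) (vset N (s.arr 19)) S →
      S.card ≤ k → S ⊆ vset N (s.arr 25) →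
      shadow (adj N (s.arr 15)) (vset N (s.arr 17)) S ⊆ vset N ((removeCmd.run s).arr 26) := by
  set R := adj N (s.arr 15) with hR
  set T := vset N (s.arr 17) with hT
  set P := vset N (s.arr 19) with hP
  set C := vset N (s.arr 25) with hC
  let good : ℕ → Fin N → Prop := fun code v => ∀ bits : ℕ → ℕ,
    (∀ i < 2 * k, bits i = code / 2 ^ i % 2) →
      Certifies R T P C k v ((pushStep R T P bits)^[2 * k] ⟨{v}, ∅, 0⟩).D ∧
      ∀ i ≤ 2 * k, Valid R T P k ((pushStep R T P bits)^[i] ⟨{v}, ∅, 0⟩)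
  have f1 := run_fill (x := 30) (b := 10) (a := 26) (v := 32) (c := assign 32 (.num 0)) (s := s)
    (fun _ => 0) rfl rfl (by intros; simp)
  rw [h.N_eq] at f1
  set s₁ := (fill 30 10 26 32 (assign 32 (.num 0))).run s with hs₁
  clear_value s₁
  have h1 : Env N k s₁ := by rw [hs₁]; exact h.run rfl
  have a15 : s₁.arr 15 = s.arr 15 := by rw [hs₁, run_arr _ _ rfl]
  have a17 : s₁.arr 17 = s.arr 17 := by rw [hs₁, run_arr _ _ rfl]
  have a19 : s₁.arr 19 = s.arr 19 := by rw [hs₁, run_arr _ _ rfl]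
  have a25 : s₁.arr 25 = s.arr 25 := by rw [hs₁, run_arr _ _ rfl]
  have a13 : s₁.reg 13 = 2 * k := by rw [hs₁, run_reg _ _ rfl, h13]
  have a18 : s₁.reg 18 = 2 ^ (2 * k) := by rw [hs₁, run_reg _ _ rfl, h18]
  have key := run_rep (x := 51) (b := 10) (s := s₁)
    (c := rep 53 18 (seq tryCmd (ite (.reg 49) (store 26 (.reg 51) (.num 1)) skip)))
    (fun n s' => (∀ v : Fin N, s'.arr 26 v ≠ 0 → ∃ Y, Certifies R T P C k v Y) ∧
      ∀ v : Fin N, (v : ℕ) < n → ∀ code < 2 ^ (2 * k), good code v → s'.arr 26 v ≠ 0)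
    ⟨fun v hv => absurd (f1 v v.2) hv, fun v hv => absurd hv (by omega)⟩
    (by
      rintro n s' hn hx hag ⟨i1, i2⟩
      rw [h1.N_eq] at hn
      have key2 := run_rep (x := 53) (b := 18) (s := s')
        (c := seq tryCmd (ite (.reg 49) (store 26 (.reg 51) (.num 1)) skip))
        (fun n' s'' => (∀ v : Fin N, s''.arr 26 v ≠ 0 → ∃ Y, Certifies R T P C k v Y) ∧
          ∀ v : Fin N, (v : ℕ) < n + 1 → ∀ code < 2 ^ (2 * k), ((v : ℕ) = n → code < n') →
            good code v → s''.arr 26 v ≠ 0)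
        ⟨i1, fun v hv code hcode hvn hg => i2 v (by
          by_contra hc
          have := hvn (by omega)
          omega) code hcode hg⟩
        (by
          rintro n' s'' hn' hx' hag' ⟨j1, j2⟩
          have c18 : s'.reg 18 = 2 ^ (2 * k) := by rw [hag.reg 18 rfl, a18]
          have d18 : s''.reg 18 = 2 ^ (2 * k) := by rw [hag'.reg 18 rfl, c18]
          have d13 : s''.reg 13 = 2 * k := by rw [hag'.reg 13 rfl, hag.reg 13 rfl, a13]
          have d51 : s''.reg 51 = n := by rw [hag'.reg 51 rfl, hx]
          have hE : Env N k s'' := (h1.of_agree rfl hag).of_agree rfl hag'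
          have d15 : s''.arr 15 = s.arr 15 := by rw [hag'.arr 15 rfl, hag.arr 15 rfl, a15]
          have d17 : s''.arr 17 = s.arr 17 := by rw [hag'.arr 17 rfl, hag.arr 17 rfl, a17]
          have d19 : s''.arr 19 = s.arr 19 := by rw [hag'.arr 19 rfl, hag.arr 19 rfl, a19]
          have d25 : s''.arr 25 = s.arr 25 := by rw [hag'.arr 25 rfl, hag.arr 25 rfl, a25]
          obtain ⟨t1, t2⟩ := run_tryCmd hE (v := ⟨n, hn⟩) d51
          rw [d15, d17, d19, d25, ← hR, ← hT, ← hP, ← hC] at t1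
          rw [d15, d17, d19, d25, ← hR, ← hT, ← hP, ← hC] at t2
          have t2' := t2 d13 (by rw [hx', d18]; omega)
          rw [hx'] at t2'
          set s₃ := tryCmd.run s'' with hs₃
          clear_value s₃
          have e26 : s₃.arr 26 = s''.arr 26 := by rw [hs₃, run_arr _ _ rfl]
          have e51 : s₃.reg 51 = n := by rw [hs₃, run_reg _ _ rfl, d51]
          simp only [run_seq, ← hs₃, run_ite, run_store, run_skip, Expr.eval_reg, Expr.eval_num,
            e51, State.setReg_arr]
          have hstep : ∀ v : Fin N, (v : ℕ) < n + 1 → ∀ code < 2 ^ (2 * k),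
              ((v : ℕ) = n → code < n' + 1) → good code v →
              s''.arr 26 v ≠ 0 ∨ (v : ℕ) = n ∧ s₃.reg 49 ≠ 0 := by
            intro v hv code hcode hvn hg
            by_cases hcn : (v : ℕ) = n → code < n'
            · exact .inl (j2 v hv code hcode hcn hg)
            · push Not at hcn
              have hc : code = n' := by
                have := hvn hcn.1
                omega
              obtain rfl : v = ⟨n, hn⟩ := Fin.ext hcn.1
              refine .inr ⟨rfl, t2' ?_⟩
              rw [hc] at hg
              exact hg
          split_ifs with c
          · rw [e26]
            refine ⟨j1, fun v hv code hcode hvn hg => ?_⟩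
            rcases hstep v hv code hcode hvn hg with h | h
            · exact h
            · exact absurd c h.2
          · simp only [State.setArr_arr, if_true, Function.update_apply, e26]
            refine ⟨fun v hv => ?_, fun v hv code hcode hvn hg => ?_⟩
            · split_ifs at hv with hvn
              · obtain rfl : v = ⟨n, hn⟩ := Fin.ext hvn
                exact t1 c
              · exact j1 v hv
            · split_ifs with hvn'
              · omega
              · rcases hstep v hv code hcode hvn hg with h | h
                · exact h
                · exact absurd h.1 hvn')
      rw [hag.reg 18 rfl, a18] at key2
      simp only [State.setReg_arr]
      exact ⟨key2.1, fun v hv code hcode hg => key2.2 v hv code hcode (fun _ => hcode) hg⟩)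
  rw [h1.N_eq, hs₁] at key
  refine ⟨fun v hv => key.1 v (mem_vset.1 hv), fun S hS ht hk hSC v hv => mem_vset.2 ?_⟩
  obtain ⟨code, hcode, hg⟩ := exists_code_certifies hS ht hk hSC hv
  exact key.2 v v.2 code hcode hg

end DirectedMultiwayCut

/-! ### Computing the torso -/

namespace DirectedMultiwayCut
open Cmd Relation

/-! ### The torso on the machine

Arrays `12`, `13` and `14` hold the adjacency matrix, the terminals and the deletable vertices of the
instance, array `29` the set that is removed, array `31` the relation `Through`, array `30` the torso. -/

/-- The torso without loops. -/
def TorsoNe {V : Type*} [Fintype V] [LinearOrder V] (R : V → V → Prop) (Z : Finset V) (u v : V) :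
    Prop := u ≠ v ∧ Torso R Z u v

theorem TorsoNe.symm {V : Type*} [Fintype V] [LinearOrder V] {R : V → V → Prop} {Z : Finset V}
    (u v : V) (h : TorsoNe R Z u v) : TorsoNe R Z v u := ⟨h.1.symm, h.2.symm⟩

/-- Loops do not affect reachability. They are dropped because the machine's label does not test
`Through` on the diagonal, where the starting vertex is itself the sink. -/
theorem sol_torsoNe {V : Type*} [Fintype V] [LinearOrder V] {R : V → V → Prop} {Z T S : Finset V} :
    Sol (TorsoNe R Z) T S ↔ Sol (Torso R Z) T S := by
  have h : ∀ s t, ReflTransGen (Av (TorsoNe R Z) S) s t ↔ ReflTransGen (Av (Torso R Z) S) s t := by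
    intro s t
    constructor
    · exact ReflTransGen.mono (fun _ _ h => ⟨h.1.2, h.2⟩) _ _
    · intro hp
      induction hp with
      | refl => exact .refl
      | @tail b c _ hr ih =>
        by_cases hbc : b = c
        · exact hbc ▸ ih
        · exact ih.tail ⟨⟨hbc, hr.1⟩, hr.2⟩
  simp only [Sol, h]

/-- When everything outside `Z` except `v` is deleted, a walk to `v` cut at its first visit to `v`
has all inner vertices in `Z`. The first step is split off because `u` itself may be among the
deleted vertices. -/
theorem through_iff {V : Type*} [Fintype V] [LinearOrder V] {R : V → V → Prop} {Z D : Finset V} {u v : V}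
    (hD : ∀ x, x ∈ D ↔ x ∉ Z ∧ x ≠ v) :
    (∃ w ∉ D, R u w ∧ ReflTransGen (Av R D) w v) ↔ Through R Z u v := by
  have hvD : v ∉ D := fun h => ((hD v).1 h).2 rfl
  constructor
  · rintro ⟨w, hw, hr, hp⟩
    induction hp using ReflTransGen.head_induction_on generalizing u with
    | refl => exact ⟨u, .refl, hr⟩
    | @head a c hac _ ih =>
      by_cases hav : a = v
      · exact ⟨u, .refl, hav ▸ hr⟩
      · have haZ : a ∈ Z := by
          by_contra hc
          exact hw ((hD a).2 ⟨hc, hav⟩)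
        obtain ⟨y, hy, hyv⟩ := ih (u := a) hac.2.2 hac.1
        exact ⟨y, .head ⟨hr, haZ⟩ hy, hyv⟩
  · rintro ⟨y, hp, hy⟩
    induction hp using ReflTransGen.head_induction_on with
    | refl => exact ⟨v, hvD, hy, .refl⟩
    | @head a c hac _ ih =>
      obtain ⟨w, hw, hr, hq⟩ := ih
      have hc : c ∉ D := fun h => ((hD c).1 h).1 hac.2
      exact ⟨c, hc, hac.1, .head ⟨hr, hc, hw⟩ hq⟩

/-- Let the vertex in register `51` be the only source. -/
def sourceCmd : Cmd := fill 30 10 16 32 (seq (assign 32 (.num 0))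
  (ite (.ne (.reg 30) (.reg 51)) skip (assign 32 (.num 1))))

/-- Let the vertex in register `51` be the only sink. -/
def sinkCmd : Cmd := fill 30 10 17 32 (seq (assign 32 (.num 0))
  (ite (.ne (.reg 30) (.reg 51)) skip (assign 32 (.num 1))))

/-- Let the terminals other than the vertex in register `51` be the sinks. -/
def otherSinksCmd : Cmd := fill 30 10 17 32 (seq (assign 32 (.num 0))
  (ite (.ne (.reg 30) (.reg 51)) (assign 32 (.arr 13 (.reg 30))) skip))

/-- Let all vertices outside array `29` but the one in register `51` be deleted. -/
def outsideCmd : Cmd := fill 30 10 18 32 (seq (assign 32 (.num 0))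
  (ite (.arr 29 (.reg 30)) skip (ite (.ne (.reg 30) (.reg 51)) (assign 32 (.num 1)) skip)))

theorem run_sourceCmd {N : ℕ} {s : State} (h : s.reg 10 = N) {v : Fin N} (h51 : s.reg 51 = v) :
    vset N ((sourceCmd.run s).arr 16) = {v} := by
  have hf := run_fill (x := 30) (b := 10) (a := 16) (v := 32)
    (c := seq (assign 32 (.num 0)) (ite (.ne (.reg 30) (.reg 51)) skip (assign 32 (.num 1))))
    (s := s) (fun i => if i = v then 1 else 0) rfl rfl (by
      intro i hi s' hag hx
      have : s'.reg 51 = v := by rw [hag.reg 51 rfl, h51]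
      simp only [run_seq, run_assign, run_ite, run_skip, Expr.eval_ne, Expr.eval_reg, Expr.eval_num,
        State.setReg_reg, hx, this, Nat.reduceEqDiff, if_false]
      split_ifs <;> simp)
  ext u
  rw [mem_vset, sourceCmd, hf u (by omega)]
  simp [Fin.val_inj]

theorem run_sinkCmd {N : ℕ} {s : State} (h : s.reg 10 = N) {v : Fin N} (h51 : s.reg 51 = v) :
    vset N ((sinkCmd.run s).arr 17) = {v} := by
  have hf := run_fill (x := 30) (b := 10) (a := 17) (v := 32)
    (c := seq (assign 32 (.num 0)) (ite (.ne (.reg 30) (.reg 51)) skip (assign 32 (.num 1))))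
    (s := s) (fun i => if i = v then 1 else 0) rfl rfl (by
      intro i hi s' hag hx
      have : s'.reg 51 = v := by rw [hag.reg 51 rfl, h51]
      simp only [run_seq, run_assign, run_ite, run_skip, Expr.eval_ne, Expr.eval_reg, Expr.eval_num,
        State.setReg_reg, hx, this, Nat.reduceEqDiff, if_false]
      split_ifs <;> simp)
  ext u
  rw [mem_vset, sinkCmd, hf u (by omega)]
  simp [Fin.val_inj]

theorem run_otherSinksCmd {N : ℕ} {s : State} (h : s.reg 10 = N) {v : Fin N}
    (h51 : s.reg 51 = v) :
    vset N ((otherSinksCmd.run s).arr 17) = (vset N (s.arr 13)).erase v := by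
  have hf := run_fill (x := 30) (b := 10) (a := 17) (v := 32)
    (c := seq (assign 32 (.num 0))
      (ite (.ne (.reg 30) (.reg 51)) (assign 32 (.arr 13 (.reg 30))) skip))
    (s := s) (fun i => if i = v then 0 else s.arr 13 i) rfl rfl (by
      intro i hi s' hag hx
      have h1 : s'.reg 51 = v := by rw [hag.reg 51 rfl, h51]
      have h2 : s'.arr 13 = s.arr 13 := hag.arr 13 rfl
      simp only [run_seq, run_assign, run_ite, run_skip, Expr.eval_ne, Expr.eval_reg, Expr.eval_num,
        Expr.eval_arr, State.setReg_arr, State.setReg_reg, hx, h1, h2, Nat.reduceEqDiff, if_false]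
      split_ifs <;> simp)
  ext u
  rw [mem_vset, otherSinksCmd, hf u (by omega), Finset.mem_erase, mem_vset]
  by_cases huv : u = v <;> simp [huv, Fin.val_inj]

theorem run_outsideCmd {N : ℕ} {s : State} (h : s.reg 10 = N) {v : Fin N}
    (h51 : s.reg 51 = v) (x : Fin N) :
    x ∈ vset N ((outsideCmd.run s).arr 18) ↔ x ∉ vset N (s.arr 29) ∧ x ≠ v := by
  have hf := run_fill (x := 30) (b := 10) (a := 18) (v := 32)
    (c := seq (assign 32 (.num 0))
      (ite (.arr 29 (.reg 30)) skip (ite (.ne (.reg 30) (.reg 51)) (assign 32 (.num 1)) skip)))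
    (s := s) (fun i => if s.arr 29 i = 0 ∧ i ≠ v then 1 else 0) rfl rfl (by
      intro i hi s' hag hx
      have h1 : s'.reg 51 = v := by rw [hag.reg 51 rfl, h51]
      have h2 : s'.arr 29 = s.arr 29 := hag.arr 29 rfl
      simp only [run_seq, run_assign, run_ite, run_skip, Expr.eval_ne, Expr.eval_reg, Expr.eval_num,
        Expr.eval_arr, State.setReg_arr, State.setReg_reg, hx, h1, h2, Nat.reduceEqDiff, if_false]
      split_ifs <;> simp_all)
  rw [mem_vset, outsideCmd, hf x (by omega), mem_vset]
  simp [Fin.val_inj]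

/-- One entry of the matrix of `Through`. -/
def throughCell : Cmd := seq (assign 32 (.num 0)) (ite (.arr 29 (.reg 51)) skip
  (ite (.arr 29 (.reg 30)) skip (ite (.ne (.reg 30) (.reg 51))
    (ite (.arr 21 (.reg 10 + .reg 30)) (assign 32 (.num 1)) skip) skip)))

/-- One column of the matrix of `Through`. -/
def throughColumn : Cmd := rep 30 10 (seq throughCell
  (store 31 (.arr 10 (.reg 30) + .reg 51) (.reg 32)))

/-- The torso. -/
def torsoCmd : Cmd := seq (fill₂ 30 10 31 10 10 15 32 (assign 32 (.arr 12 (.arr 10 (.reg 30) + .reg 31))))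
  (seq (rep 51 10 (seq outsideCmd (seq sinkCmd (seq reach throughColumn))))
  (fill₂ 30 10 31 10 10 30 32 (assign 32 (.arr 31 (.arr 10 (.reg 30) + .reg 31) +
    .arr 31 (.arr 10 (.reg 31) + .reg 30)))))

theorem adj_congr {N : ℕ} {f g : ℕ → ℕ} (h : ∀ i < N, ∀ j < N, f (i * N + j) = g (i * N + j)) :
    adj N f = adj N g := by
  funext u v
  rw [adj, adj, h u u.2 v v.2]

/-- Copy the adjacency matrix to the working graph. -/
theorem run_copyGraph {N k : ℕ} {s : State} (h : Env N k s) {a : ℕ} (h15 : a ≠ 15) :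
    adj N (((fill₂ 30 10 31 10 10 15 32
      (assign 32 (.arr a (.arr 10 (.reg 30) + .reg 31)))).run s).arr 15) = adj N (s.arr a) := by
  have key := run_fill₂ (x := 30) (bx := 10) (y := 31) (b := 10) (t := 10) (a := 15) (v := 32)
    (c := assign 32 (.arr a (.arr 10 (.reg 30) + .reg 31))) (s := s) (fun i j => s.arr a (i * N + j))
    rfl rfl rfl rfl rfl (by decide) (by decide) (by decide) (by decide)
    (by rw [h.N_eq]; exact h.mulN)
    (by
      intro i hi j hj s' hag hx hy
      rw [h.N_eq] at hi
      have e1 : s'.arr 10 i = i * N := by rw [hag.arr 10 rfl, h.mulN i hi]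
      have e2 : s'.arr a = s.arr a := hag.arr a (by simp [fill₂, wa, h15])
      simp [hx, hy, e1, e2])
  rw [h.N_eq] at key
  exact adj_congr key

theorem run_throughColumn {N k : ℕ} {s : State} (h : Env N k s) {v : ℕ} (h51 : s.reg 51 = v)
    (hv : v < N) {F : ℕ → ℕ → ℕ}
    (hF : ∀ u < N, F u v =
      if s.arr 29 v = 0 ∧ s.arr 29 u = 0 ∧ u ≠ v ∧ s.arr 21 (N + u) ≠ 0 then 1 else 0)
    (hold : ∀ u < N, ∀ w < v, s.arr 31 (u * N + w) = F u w) :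
    ∀ u < N, ∀ w < v + 1, (throughColumn.run s).arr 31 (u * N + w) = F u w := by
  have key := run_rep (x := 30) (b := 10) (s := s)
    (c := seq throughCell (store 31 (.arr 10 (.reg 30) + .reg 51) (.reg 32)))
    (fun n s' => ∀ u < N, ∀ w < v + 1, (u < n ∨ w < v) → s'.arr 31 (u * N + w) = F u w)
    (by
      intro u hu w hw h
      exact hold u hu w (by omega))
    (by
      intro n s' hn hx hag ih u hu w hw huw
      rw [h.N_eq] at hn
      have e29 : s'.arr 29 = s.arr 29 := hag.arr 29 rfl
      have e21 : s'.arr 21 = s.arr 21 := hag.arr 21 rfl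
      have e51 : s'.reg 51 = v := by rw [hag.reg 51 rfl, h51]
      have e10 : s'.reg 10 = N := by rw [hag.reg 10 rfl, h.N_eq]
      have em : s'.arr 10 n = n * N := by rw [hag.arr 10 rfl, h.mulN n hn]
      have hcell : (throughCell.run s').reg 32 = F n v := by
        rw [hF n hn]
        simp only [throughCell, run_seq, run_assign, run_ite, run_skip, Expr.eval_ne, Expr.eval_reg,
          Expr.eval_num, Expr.eval_arr, Expr.eval_add, State.setReg_arr, State.setReg_reg, hx, e29,
          e21, e51, e10, Nat.reduceEqDiff, if_false]
        split_ifs <;> simp_all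
      obtain ⟨s₁, hs₁⟩ : ∃ s₁, s₁ = throughCell.run s' := ⟨_, rfl⟩
      have c30 : s₁.reg 30 = n := by rw [hs₁, run_reg _ _ rfl, hx]
      have c51 : s₁.reg 51 = v := by rw [hs₁, run_reg _ _ rfl, e51]
      have c10 : s₁.arr 10 n = n * N := by rw [hs₁, run_arr _ _ rfl, em]
      have c31 : s₁.arr 31 = s'.arr 31 := by rw [hs₁, run_arr _ _ rfl]
      rw [← hs₁] at hcell
      simp only [run_seq, ← hs₁, run_store, State.setReg_arr, State.setArr_arr, if_true,
        Expr.eval_add, Expr.eval_arr, Expr.eval_reg, c30, c51, c10, c31, hcell,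
        Function.update_apply]
      split_ifs with hc
      · obtain ⟨rfl, rfl⟩ := position_inj (by omega) hv hc
        rfl
      · refine ih u hu w hw ?_
        by_contra hno
        push Not at hno
        have h1 : w = v := by omega
        have h2 : u = n := by omega
        exact hc (by rw [h1, h2]))
  rw [h.N_eq] at key
  exact fun u hu w hw => key u hu w hw (.inl hu)

theorem run_torsoCmd {N k : ℕ} {s : State} (h : Env N k s) :
    adj N ((torsoCmd.run s).arr 30) = TorsoNe (adj N (s.arr 12)) (vset N (s.arr 29)) := by
  classical
  have hcopy := run_copyGraph h (a := 12) (by decide)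
  set s₁ := (fill₂ 30 10 31 10 10 15 32 (assign 32 (.arr 12 (.arr 10 (.reg 30) + .reg 31)))).run s
    with hs₁
  clear_value s₁
  have h1 : Env N k s₁ := by rw [hs₁]; exact h.run rfl
  have e29 : s₁.arr 29 = s.arr 29 := by rw [hs₁, run_arr _ _ rfl]
  set R := adj N (s.arr 12) with hR
  set Z := vset N (s.arr 29) with hZ
  let F : ℕ → ℕ → ℕ := fun u v => if ∃ (hu : u < N) (hv : v < N), (⟨v, hv⟩ : Fin N) ∉ Z ∧
    (⟨u, hu⟩ : Fin N) ∉ Z ∧ u ≠ v ∧ Through R Z ⟨u, hu⟩ ⟨v, hv⟩ then 1 else 0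
  have key := run_rep (x := 51) (b := 10) (s := s₁)
    (c := seq outsideCmd (seq sinkCmd (seq reach throughColumn)))
    (fun n s' => ∀ u < N, ∀ w < n, s'.arr 31 (u * N + w) = F u w)
    (fun u _ w hw => absurd hw (by omega))
    (by
      intro n s' hn hx hag ih
      rw [h1.N_eq] at hn
      have hE : Env N k s' := h1.of_agree rfl hag
      have hout := run_outsideCmd (v := ⟨n, hn⟩) hE.N_eq hx
      have d29 : s'.arr 29 = s.arr 29 := by rw [hag.arr 29 rfl, e29]
      rw [d29, ← hZ] at hout
      obtain ⟨s₂, hs₂⟩ : ∃ s₂, s₂ = outsideCmd.run s' := ⟨_, rfl⟩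
      rw [← hs₂] at hout
      have h2 : Env N k s₂ := by rw [hs₂]; exact hE.run rfl
      have c51 : s₂.reg 51 = n := by rw [hs₂, run_reg _ _ rfl, hx]
      have hsink := run_sinkCmd (v := ⟨n, hn⟩) h2.N_eq c51
      obtain ⟨s₃, hs₃⟩ : ∃ s₃, s₃ = sinkCmd.run s₂ := ⟨_, rfl⟩
      rw [← hs₃] at hsink
      have h3 : Env N k s₃ := by rw [hs₃]; exact h2.run rfl
      have c18 : s₃.arr 18 = s₂.arr 18 := by rw [hs₃, run_arr _ _ rfl]
      have c15 : s₃.arr 15 = s₁.arr 15 := by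
        rw [hs₃, run_arr _ _ rfl, hs₂, run_arr _ _ rfl, hag.arr 15 rfl]
      have hL := run_reach h3
      obtain ⟨s₄, hs₄⟩ : ∃ s₄, s₄ = reach.run s₃ := ⟨_, rfl⟩
      rw [← hs₄] at hL
      have h4 : Env N k s₄ := by rw [hs₄]; exact h3.run rfl
      have f51 : s₄.reg 51 = n := by rw [hs₄, run_reg _ _ rfl, hs₃, run_reg _ _ rfl, c51]
      have f29 : s₄.arr 29 = s.arr 29 := by
        rw [hs₄, run_arr _ _ rfl, hs₃, run_arr _ _ rfl, hs₂, run_arr _ _ rfl, d29]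
      have f31 : s₄.arr 31 = s'.arr 31 := by
        rw [hs₄, run_arr _ _ rfl, hs₃, run_arr _ _ rfl, hs₂, run_arr _ _ rfl]
      have hcol := run_throughColumn h4 f51 hn (F := F) (by
        intro u hu
        have hu' := (hL.ne_zero_iff_reach ⟨u, hu⟩).2.1
        rw [c15, hcopy, hsink, c18] at hu'
        have hz : ∀ x (hx : x < N), s₄.arr 29 x = 0 ↔ (⟨x, hx⟩ : Fin N) ∉ Z := by
          intro x hx
          rw [f29, hZ, mem_vset, not_not]
        have hvD : (⟨n, hn⟩ : Fin N) ∉ vset N (s₂.arr 18) := fun hc => ((hout _).1 hc).2 rfl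
        -- The label is read at the outgoing copy `N + u`, so a deletion of `u` itself does not
        -- matter.
        have hiff : u ≠ n → (s₄.arr 21 (N + u) ≠ 0 ↔ Through R Z ⟨u, hu⟩ ⟨n, hn⟩) := by
          intro hun
          rw [← through_iff hout]
          refine hu'.trans ⟨?_, ?_⟩
          · rintro ⟨t, ht, h | ⟨w, hw, hr, -, hp⟩⟩
            · rw [Finset.mem_singleton] at ht
              exact absurd (congrArg Fin.val (h.trans ht)) hun
            · rw [Finset.mem_singleton] at ht
              exact ⟨w, hw, hr, ht ▸ hp⟩
          · rintro ⟨w, hw, hr, hp⟩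
            exact ⟨_, Finset.mem_singleton_self _, .inr ⟨w, hw, hr, hvD, hp⟩⟩
        refine if_congr ?_ rfl rfl
        constructor
        · rintro ⟨_, _, a1, a2, a3, a4⟩
          exact ⟨(hz n hn).2 a1, (hz u hu).2 a2, a3, (hiff a3).2 a4⟩
        · rintro ⟨a1, a2, a3, a4⟩
          exact ⟨hu, hn, (hz n hn).1 a1, (hz u hu).1 a2, a3, (hiff a3).1 a4⟩)
        (by rw [f31]; exact ih)
      have hrun : (seq outsideCmd (seq sinkCmd (seq reach throughColumn))).run s' =
          throughColumn.run s₄ := by rw [hs₄, hs₃, hs₂]; rfl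
      rw [hrun, State.setReg_arr]
      exact hcol)
  rw [h1.N_eq] at key
  obtain ⟨s₂, hs₂⟩ : ∃ s₂, s₂ = (rep 51 10 (seq outsideCmd (seq sinkCmd (seq reach
    throughColumn)))).run s₁ := ⟨_, rfl⟩
  rw [← hs₂] at key
  have h2 : Env N k s₂ := by rw [hs₂]; exact h1.run rfl
  have key2 := run_fill₂ (x := 30) (bx := 10) (y := 31) (b := 10) (t := 10) (a := 30) (v := 32)
    (c := assign 32 (.arr 31 (.arr 10 (.reg 30) + .reg 31) +
      .arr 31 (.arr 10 (.reg 31) + .reg 30))) (s := s₂) (fun i j => F i j + F j i)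
    rfl rfl rfl rfl rfl (by decide) (by decide) (by decide) (by decide)
    (by rw [h2.N_eq]; exact h2.mulN)
    (by
      intro i hi j hj s' hag hx hy
      rw [h2.N_eq] at hi hj
      have e1 : s'.arr 10 i = i * N := by rw [hag.arr 10 rfl, h2.mulN i hi]
      have e2 : s'.arr 10 j = j * N := by rw [hag.arr 10 rfl, h2.mulN j hj]
      have e3 : s'.arr 31 = s₂.arr 31 := hag.arr 31 rfl
      simp [hx, hy, e1, e2, e3, key i hi j hj, key j hj i hi])
  rw [h2.N_eq] at key2
  have hrun : torsoCmd.run s = (fill₂ 30 10 31 10 10 30 32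
      (assign 32 (.arr 31 (.arr 10 (.reg 30) + .reg 31) +
        .arr 31 (.arr 10 (.reg 31) + .reg 30)))).run s₂ := by rw [hs₂, hs₁]; rfl
  rw [hrun]
  funext u v
  have hFz : ∀ a b : Fin N, F a b ≠ 0 ↔ b ∉ Z ∧ a ∉ Z ∧ a ≠ b ∧ Through R Z a b := by
    intro a b
    have h3 : F a b = if ∃ (hu : (a : ℕ) < N) (hv : (b : ℕ) < N), (⟨b, hv⟩ : Fin N) ∉ Z ∧
        (⟨a, hu⟩ : Fin N) ∉ Z ∧ (a : ℕ) ≠ b ∧ Through R Z ⟨a, hu⟩ ⟨b, hv⟩ then 1 else 0 := rfl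
    rw [h3]
    constructor
    · intro hne
      split_ifs at hne with hc
      · obtain ⟨_, _, a1, a2, a3, a4⟩ := hc
        exact ⟨a1, a2, fun hab => a3 (congrArg _ hab), a4⟩
      · exact absurd rfl hne
    · rintro ⟨a1, a2, a3, a4⟩
      rw [if_pos ⟨a.2, b.2, a1, a2, fun hab => a3 (Fin.ext hab), a4⟩]
      omega
  rw [adj, key2 u u.2 v v.2]
  have h4 : F u v + F v u ≠ 0 ↔ F u v ≠ 0 ∨ F v u ≠ 0 := by omega
  rw [h4, hFz, hFz, TorsoNe, Torso]
  refine propext ⟨?_, ?_⟩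
  · rintro (⟨a1, a2, a3, a4⟩ | ⟨a1, a2, a3, a4⟩)
    · exact ⟨a3, a2, a1, .inl a4⟩
    · exact ⟨a3.symm, a1, a2, .inr a4⟩
  · rintro ⟨a1, a2, a3, a4 | a4⟩
    · exact .inl ⟨a3, a2, a1, a4⟩
    · exact .inr ⟨a2, a3, a1.symm, a4⟩

end DirectedMultiwayCut

/-! ### Undirected multiway cut over all terminals, and verification of candidates -/

namespace DirectedMultiwayCut
open Cmd Relation

/-! ### Undirected multiway cut on the machine -/

section Sweep

variable {N : ℕ}

/-- The pushing procedure, one terminal after the other. -/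
noncomputable def sweep (H : Fin N → Fin N → Prop) (T P : Finset (Fin N)) (k : ℕ) (bits : ℕ → ℕ) :
    ℕ → PushState (Fin N)
  | 0 => ⟨∅, ∅, 0⟩
  | n + 1 => open Classical in if h : ∃ hn : n < N, (⟨n, hn⟩ : Fin N) ∈ T then
      (pushStep H (T.erase ⟨n, h.1⟩) P bits)^[2 * k]
        ⟨{⟨n, h.1⟩}, (sweep H T P k bits n).D, (sweep H T P k bits n).pos⟩
    else sweep H T P k bits n

theorem sweep_succ_of_mem {H : Fin N → Fin N → Prop} {T P : Finset (Fin N)} {k : ℕ} {bits : ℕ → ℕ}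
    {t : Fin N} (ht : t ∈ T) : sweep H T P k bits (t + 1) =
      (pushStep H (T.erase t) P bits)^[2 * k]
        ⟨{t}, (sweep H T P k bits t).D, (sweep H T P k bits t).pos⟩ := by
  rw [sweep, dif_pos ⟨t.2, ht⟩]

theorem sweep_succ_of_not_mem {H : Fin N → Fin N → Prop} {T P : Finset (Fin N)} {k : ℕ}
    {bits : ℕ → ℕ} {t : Fin N} (ht : t ∉ T) :
    sweep H T P k bits (t + 1) = sweep H T P k bits t := by
  rw [sweep, dif_neg]
  rintro ⟨_, h⟩
  exact ht h

theorem sweep_congr {H : Fin N → Fin N → Prop} {T P : Finset (Fin N)} {k : ℕ} {bits bits' : ℕ → ℕ}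
    (h : ∀ i, bits i = 1 ↔ bits' i = 1) (n : ℕ) :
    sweep H T P k bits n = sweep H T P k bits' n := by
  induction n with
  | zero => rfl
  | succ n ih => simp only [sweep, ih, pushStep_congr h]

/-- No cut that occurs in the procedure is too large. -/
def SweepValid (H : Fin N → Fin N → Prop) (T P : Finset (Fin N)) (k : ℕ) (bits : ℕ → ℕ) (n : ℕ) :
    Prop :=
  ∀ t ∈ T, (t : ℕ) < n → ∀ i ≤ 2 * k, Valid H (T.erase t) P k ((pushStep H (T.erase t) P bits)^[i]
    ⟨{t}, (sweep H T P k bits t).D, (sweep H T P k bits t).pos⟩)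

/-- The deleted set and the reading position are carried from terminal to terminal, so the
inequality `pos ≤ 2 * |D|` makes `2 * k` bits suffice for all terminals together. Isolation of
earlier terminals persists because the deleted set only grows. -/
theorem exists_bits_sweep {H : Fin N → Fin N → Prop} (hH : ∀ u v, H u v → H v u)
    {T P : Finset (Fin N)} {k : ℕ} (hPT : Disjoint P T) (hE : Extendable H T P ∅ k) (n : ℕ)
    (hn : n ≤ N) : ∃ (bits : ℕ → ℕ) (st : PushState (Fin N)),
      (∀ bits' : ℕ → ℕ, (∀ i < st.pos, bits' i = bits i) →
        sweep H T P k bits' n = st ∧ SweepValid H T P k bits' n) ∧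
      Extendable H T P st.D k ∧ st.pos ≤ 2 * st.D.card ∧
      ∀ t ∈ T, (t : ℕ) < n → Isolated H T st.D t := by
  induction n with
  | zero =>
    exact ⟨fun _ => 0, ⟨∅, ∅, 0⟩, fun _ _ => ⟨rfl, fun _ _ h => absurd h (by omega)⟩, hE, by simp,
      fun _ _ h => absurd h (by omega)⟩
  | succ n ih =>
    obtain ⟨b, st, h1, h2, h3, h4⟩ := ih (by omega)
    have hlt : ∀ t : Fin N, (t : ℕ) < n + 1 → (t : ℕ) < n ∨ t = ⟨n, hn⟩ := fun t ht => by
      rcases Nat.lt_succ_iff_lt_or_eq.1 ht with ht | ht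
      · exact .inl ht
      · exact .inr (Fin.ext ht)
    by_cases ht : (⟨n, hn⟩ : Fin N) ∈ T
    · obtain ⟨b', st', g1, g2, g3, g4, g5, g6, g7⟩ := exists_bits_isolate hH hPT ht h2 h3 b
      refine ⟨b', st', fun bits hbits => ?_, g3, g5, fun t htT htn => ?_⟩
      · obtain ⟨i1, i2⟩ := h1 bits fun i hi => by rw [hbits i (by omega), g1 i hi]
        obtain ⟨j1, j2⟩ := g2 bits hbits
        have hs := sweep_succ_of_mem (H := H) (P := P) (k := k) (bits := bits) ht
        simp only [i1] at hs
        refine ⟨hs.trans j1, fun t htT htn => ?_⟩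
        rcases hlt t htn with h | rfl
        · exact i2 t htT h
        · simp only [i1]
          exact j2
      · rcases hlt t htn with h | rfl
        · exact (h4 t htT h).mono g6
        · exact g7
    · refine ⟨b, st, fun bits hbits => ?_, h2, h3, fun t htT htn => ?_⟩
      · obtain ⟨i1, i2⟩ := h1 bits hbits
        have hs := sweep_succ_of_not_mem (H := H) (P := P) (k := k) (bits := bits) ht
        refine ⟨hs.trans i1, fun t htT htn => ?_⟩
        rcases hlt t htn with h | rfl
        · exact i2 t htT h
        · exact absurd htT ht
      · rcases hlt t htn with h | rfl
        · exact h4 t htT h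
        · exact absurd htT ht

theorem exists_code_sweep {H : Fin N → Fin N → Prop} (hH : ∀ u v, H u v → H v u)
    {T P : Finset (Fin N)} {k : ℕ} (hPT : Disjoint P T) {S : Finset (Fin N)} (hS : Sol H T S)
    (hSP : S ⊆ P) (hk : S.card ≤ k) :
    ∃ code < 2 ^ (2 * k), ∀ bits : ℕ → ℕ, (∀ i < 2 * k, bits i = code / 2 ^ i % 2) →
      SweepValid H T P k bits N ∧ Sol H T (sweep H T P k bits N).D ∧
      (sweep H T P k bits N).D ⊆ P ∧ (sweep H T P k bits N).D.card ≤ k := by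
  obtain ⟨b, st, h1, ⟨S', -, hS'P, hS'k, hDS'⟩, h3, h4⟩ :=
    exists_bits_sweep hH hPT ⟨S, hS, hSP, hk, Finset.empty_subset _⟩ N le_rfl
  obtain ⟨code, hcode, hdig⟩ := exists_code (2 * k) b
  have hcard := (Finset.card_le_card hDS').trans hS'k
  refine ⟨code, hcode, fun bits hbits => ?_⟩
  obtain ⟨g1, g2⟩ := h1 (fun i => if i < 2 * k then b i else bits i)
    (fun i hi => if_pos (by omega))
  have hc : ∀ i, (if i < 2 * k then b i else bits i) = 1 ↔ bits i = 1 := by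
    intro i
    split_ifs with hi
    · rw [hbits i hi, hdig i hi]
      split_ifs with h1 <;> simp [h1]
    · rfl
  rw [← sweep_congr hc, g1]
  refine ⟨?_, sol_of_isolated fun t ht => h4 t ht t.2, hDS'.trans hS'P, hcard⟩
  intro t ht htN i hi
  have := g2 t ht htN i hi
  rwa [pushStep_congr hc, sweep_congr hc] at this

end Sweep

theorem pushStep_iterate_del_subset {V : Type*} [Fintype V] [LinearOrder V] {R : V → V → Prop}
    {K P : Finset V} {bits : ℕ → ℕ} {st : PushState V} (h : st.D ⊆ P) (n : ℕ) :
    ((pushStep R K P bits)^[n] st).D ⊆ P := by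
  induction n with
  | zero => exact h
  | succ n ih =>
    rw [Function.iterate_succ_apply']
    exact pushStep_del_subset ih

/-- The loop over the terminals. -/
def sweepLoop : Cmd := rep 51 10 (ite (.arr 13 (.reg 51))
  (seq sourceCmd (seq otherSinksCmd pushLoop)) skip)

/-- Run the pushing procedure for all terminals in the torso, with the bits of register `58`. -/
def sweepCmd : Cmd := seq (decode 22 58 13 18)
  (seq (fill₂ 30 10 31 10 10 15 32 (assign 32 (.arr 30 (.arr 10 (.reg 30) + .reg 31))))
  (seq (fill 30 10 19 32 (seq (assign 32 (.arr 14 (.reg 30)))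
    (ite (.arr 29 (.reg 30)) (assign 32 (.num 0)) skip)))
  (seq (fill 30 10 18 32 (assign 32 (.num 0))) (seq (assign 36 (.num 0)) sweepLoop))))

theorem run_sweepLoop {N k : ℕ} {s : State} (h : Env N k s) (h13 : s.reg 13 = 2 * k)
    (h36 : s.reg 36 = 0) (h18 : vset N (s.arr 18) = ∅)
    (hv : SweepValid (adj N (s.arr 15)) (vset N (s.arr 13)) (vset N (s.arr 19)) k (s.arr 22) N) :
    vset N ((sweepLoop.run s).arr 18) =
      (sweep (adj N (s.arr 15)) (vset N (s.arr 13)) (vset N (s.arr 19)) k (s.arr 22) N).D := by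
  set H := adj N (s.arr 15) with hH
  set T := vset N (s.arr 13) with hT
  set P := vset N (s.arr 19) with hP
  set b := s.arr 22 with hb
  have key := run_rep (x := 51) (b := 10) (s := s)
    (c := ite (.arr 13 (.reg 51)) (seq sourceCmd (seq otherSinksCmd pushLoop)) skip)
    (fun n s' => vset N (s'.arr 18) = (sweep H T P k b n).D ∧ s'.reg 36 = (sweep H T P k b n).pos ∧
      vset N (s'.arr 18) ⊆ P)
    (by
      simp only [State.setReg_arr, State.setReg_reg, Nat.reduceEqDiff, if_false, h18, h36]
      exact ⟨rfl, rfl, Finset.empty_subset _⟩)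
    (by
      rintro n s' hn hx hag ⟨i1, i2, i3⟩
      rw [h.N_eq] at hn
      have d13 : s'.arr 13 = s.arr 13 := hag.arr 13 rfl
      have hE : Env N k s' := h.of_agree rfl hag
      have hmem : s'.arr 13 n ≠ 0 ↔ (⟨n, hn⟩ : Fin N) ∈ T := by rw [d13, hT, mem_vset]
      simp only [run_ite, run_seq, run_skip, Expr.eval_arr, Expr.eval_reg, hx]
      split_ifs with hc
      · have ht : (⟨n, hn⟩ : Fin N) ∉ T := fun hc' => hmem.2 hc' hc
        have hs : sweep H T P k b (n + 1) = sweep H T P k b n := sweep_succ_of_not_mem ht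
        rw [hs]
        simp only [State.setReg_arr, State.setReg_reg, Nat.reduceEqDiff, if_false]
        exact ⟨i1, i2, i3⟩
      · have ht := hmem.1 hc
        have hs : sweep H T P k b (n + 1) = _ := sweep_succ_of_mem ht
        have hsrc := run_sourceCmd (v := ⟨n, hn⟩) hE.N_eq hx
        obtain ⟨s₁, hs₁⟩ : ∃ s₁, s₁ = sourceCmd.run s' := ⟨_, rfl⟩
        rw [← hs₁] at hsrc ⊢
        have h1 : Env N k s₁ := by rw [hs₁]; exact hE.run rfl
        have hsnk := run_otherSinksCmd (v := ⟨n, hn⟩) h1.N_eq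
          (show s₁.reg 51 = n by rw [hs₁, run_reg _ _ rfl, hx])
        have f13 : s₁.arr 13 = s.arr 13 := by rw [hs₁, run_arr _ _ rfl, d13]
        rw [f13, ← hT] at hsnk
        obtain ⟨s₂, hs₂⟩ : ∃ s₂, s₂ = otherSinksCmd.run s₁ := ⟨_, rfl⟩
        rw [← hs₂] at hsnk ⊢
        have h2 : Env N k s₂ := by rw [hs₂]; exact h1.run rfl
        have g15 : s₂.arr 15 = s.arr 15 := by
          rw [hs₂, run_arr _ _ rfl, hs₁, run_arr _ _ rfl, hag.arr 15 rfl]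
        have g16 : s₂.arr 16 = s₁.arr 16 := by rw [hs₂, run_arr _ _ rfl]
        have g18 : s₂.arr 18 = s'.arr 18 := by rw [hs₂, run_arr _ _ rfl, hs₁, run_arr _ _ rfl]
        have g19 : s₂.arr 19 = s.arr 19 := by
          rw [hs₂, run_arr _ _ rfl, hs₁, run_arr _ _ rfl, hag.arr 19 rfl]
        have g22 : s₂.arr 22 = b := by
          rw [hs₂, run_arr _ _ rfl, hs₁, run_arr _ _ rfl, hag.arr 22 rfl]
        have g13 : s₂.reg 13 = 2 * k := by
          rw [hs₂, run_reg _ _ rfl, hs₁, run_reg _ _ rfl, hag.reg 13 rfl, h13]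
        have g36 : s₂.reg 36 = s'.reg 36 := by rw [hs₂, run_reg _ _ rfl, hs₁, run_reg _ _ rfl]
        have hpre : pushState N s₂ = ⟨{⟨n, hn⟩}, (sweep H T P k b n).D, (sweep H T P k b n).pos⟩ := by
          simp only [pushState, g16, hsrc, g18, i1, g36, i2]
        have hp := run_pushLoop h2 g13 (by rw [g18, g19]; exact i3)
          (by rw [g15, hsnk, g19, g22, hpre]; exact hv _ ht hn)
        rw [g15, hsnk, g19, g22, hpre] at hp
        rw [← hH, ← hP] at hp
        have hp2 : pushState N (pushLoop.run s₂) = sweep H T P k b (n + 1) := hp.trans hs.symm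
        simp only [State.setReg_arr, State.setReg_reg, Nat.reduceEqDiff, if_false]
        have hD : vset N ((pushLoop.run s₂).arr 18) = (sweep H T P k b (n + 1)).D :=
          congrArg PushState.D hp2
        refine ⟨hD, congrArg PushState.pos hp2, ?_⟩
        rw [hD, hs]
        exact pushStep_iterate_del_subset (by rw [← i1]; exact i3) _)
  rw [h.N_eq] at key
  exact key.1

theorem run_sweepCmd {N k : ℕ} {s : State} (h : Env N k s) (h13 : s.reg 13 = 2 * k)
    (h58 : s.reg 58 ≤ s.reg 18)
    (hv : ∀ bits : ℕ → ℕ, (∀ i < 2 * k, bits i = s.reg 58 / 2 ^ i % 2) →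
      SweepValid (adj N (s.arr 30)) (vset N (s.arr 13)) (vset N (s.arr 14) \ vset N (s.arr 29)) k
        bits N) :
    ∃ bits : ℕ → ℕ, (∀ i < 2 * k, bits i = s.reg 58 / 2 ^ i % 2) ∧
      vset N ((sweepCmd.run s).arr 18) = (sweep (adj N (s.arr 30)) (vset N (s.arr 13))
        (vset N (s.arr 14) \ vset N (s.arr 29)) k bits N).D := by
  have hdec := run_decode (a := 22) (src := 58) (cnt := 13) (b := 18) h58 (by omega) (by omega)
  rw [h13] at hdec
  obtain ⟨s₁, hs₁⟩ : ∃ s₁, s₁ = (decode 22 58 13 18).run s := ⟨_, rfl⟩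
  rw [← hs₁] at hdec
  have h1 : Env N k s₁ := by rw [hs₁]; exact h.run rfl
  have hcopy := run_copyGraph h1 (a := 30) (by decide)
  obtain ⟨s₂, hs₂⟩ : ∃ s₂, s₂ = (fill₂ 30 10 31 10 10 15 32
    (assign 32 (.arr 30 (.arr 10 (.reg 30) + .reg 31)))).run s₁ := ⟨_, rfl⟩
  rw [← hs₂] at hcopy
  have h2 : Env N k s₂ := by rw [hs₂]; exact h1.run rfl
  have f3 := run_fill (x := 30) (b := 10) (a := 19) (v := 32)
    (c := seq (assign 32 (.arr 14 (.reg 30))) (ite (.arr 29 (.reg 30)) (assign 32 (.num 0)) skip))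
    (s := s₂) (fun i => if s.arr 29 i = 0 then s.arr 14 i else 0) rfl rfl (by
      intro i hi s' hag hx
      have e1 : s'.arr 14 = s.arr 14 := by
        rw [hag.arr 14 rfl, hs₂, run_arr _ _ rfl, hs₁, run_arr _ _ rfl]
      have e2 : s'.arr 29 = s.arr 29 := by
        rw [hag.arr 29 rfl, hs₂, run_arr _ _ rfl, hs₁, run_arr _ _ rfl]
      simp only [run_seq, run_assign, run_ite, run_skip, Expr.eval_reg, Expr.eval_num,
        Expr.eval_arr, State.setReg_arr, State.setReg_reg, hx, e1, e2, Nat.reduceEqDiff, if_false]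
      by_cases c : s.arr 29 i = 0 <;> simp [c])
  rw [h2.N_eq] at f3
  obtain ⟨s₃, hs₃⟩ : ∃ s₃, s₃ = (fill 30 10 19 32 (seq (assign 32 (.arr 14 (.reg 30)))
    (ite (.arr 29 (.reg 30)) (assign 32 (.num 0)) skip))).run s₂ := ⟨_, rfl⟩
  rw [← hs₃] at f3
  have h3 : Env N k s₃ := by rw [hs₃]; exact h2.run rfl
  have f4 := run_fill (x := 30) (b := 10) (a := 18) (v := 32) (c := assign 32 (.num 0)) (s := s₃)
    (fun _ => 0) rfl rfl (by intros; simp)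
  rw [h3.N_eq] at f4
  obtain ⟨s₄, hs₄⟩ : ∃ s₄, s₄ = (fill 30 10 18 32 (assign 32 (.num 0))).run s₃ := ⟨_, rfl⟩
  rw [← hs₄] at f4
  have h4 : Env N k s₄ := by rw [hs₄]; exact h3.run rfl
  obtain ⟨s₅, hs₅⟩ : ∃ s₅, s₅ = (assign 36 (.num 0)).run s₄ := ⟨_, rfl⟩
  have h5 : Env N k s₅ := by rw [hs₅]; exact h4.run rfl
  have g15 : s₅.arr 15 = s₂.arr 15 := by
    rw [hs₅, run_arr _ _ rfl, hs₄, run_arr _ _ rfl, hs₃, run_arr _ _ rfl]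
  have g30 : s₁.arr 30 = s.arr 30 := by rw [hs₁, run_arr _ _ rfl]
  have g13 : s₅.arr 13 = s.arr 13 := by
    rw [hs₅, run_arr _ _ rfl, hs₄, run_arr _ _ rfl, hs₃, run_arr _ _ rfl, hs₂, run_arr _ _ rfl,
      hs₁, run_arr _ _ rfl]
  have g22 : s₅.arr 22 = s₁.arr 22 := by
    rw [hs₅, run_arr _ _ rfl, hs₄, run_arr _ _ rfl, hs₃, run_arr _ _ rfl, hs₂, run_arr _ _ rfl]
  have g19 : vset N (s₅.arr 19) = vset N (s.arr 14) \ vset N (s.arr 29) := by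
    rw [hs₅, run_arr _ _ rfl, hs₄, run_arr _ _ rfl]
    ext u
    rw [mem_vset, f3 u u.2, Finset.mem_sdiff, mem_vset, mem_vset]
    split_ifs with hc <;> simp [hc]
  have g18 : vset N (s₅.arr 18) = ∅ := by
    rw [hs₅, run_arr _ _ rfl]
    ext u
    simp [mem_vset, f4 u u.2]
  have r13 : s₅.reg 13 = 2 * k := by
    rw [hs₅, run_reg _ _ rfl, hs₄, run_reg _ _ rfl, hs₃, run_reg _ _ rfl, hs₂, run_reg _ _ rfl,
      hs₁, run_reg _ _ rfl, h13]
  have r36 : s₅.reg 36 = 0 := by rw [hs₅]; simp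
  have hl := run_sweepLoop h5 r13 r36 g18 (by rw [g15, hcopy, g30, g13, g19, g22]; exact hv _ hdec)
  rw [g15, hcopy, g30, g13, g19, g22] at hl
  have hrun : sweepCmd.run s = sweepLoop.run s₅ := by rw [hs₅, hs₄, hs₃, hs₂, hs₁]; rfl
  exact ⟨s₁.arr 22, hdec, by rw [hrun]; exact hl⟩

/-! ### Verification of solutions on the machine -/

/-- Count the elements of array `18` in register `54`. -/
def countCmd : Cmd := seq (assign 54 (.num 0))
  (rep 30 10 (ite (.arr 18 (.reg 30)) (assign 54 (.reg 54 + .num 1)) skip))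

/-- Test whether no other terminal can be reached from a terminal. -/
def separateCmd : Cmd := rep 51 10 (ite (.arr 13 (.reg 51)) (seq sourceCmd (seq otherSinksCmd
  (seq reach (ite (.arr 21 (.reg 10 + .reg 10)) (assign 49 (.num 0)) skip)))) skip)

/-- Test whether array `18` is a solution of size at most `k`. -/
def checkCmd : Cmd :=
  seq (fill₂ 30 10 31 10 10 15 32 (assign 32 (.arr 12 (.arr 10 (.reg 30) + .reg 31))))
  (seq (assign 49 (.num 1)) (seq (checkAll 30 10 32 49 (seq (assign 32 (.num 1))
    (ite (.arr 18 (.reg 30)) (assign 32 (.arr 14 (.reg 30))) skip)))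
  (seq countCmd (seq (ite (.reg 54 - .reg 1) (assign 49 (.num 0)) skip) separateCmd))))

theorem run_countCmd {N : ℕ} {s : State} (h : s.reg 10 = N) :
    (countCmd.run s).reg 54 = (vset N (s.arr 18)).card := by
  obtain ⟨s₁, hs₁⟩ : ∃ s₁, s₁ = (assign 54 (.num 0)).run s := ⟨_, rfl⟩
  have h1 : s₁.reg 10 = N := by rw [hs₁, run_reg _ _ rfl, h]
  have key := run_rep (x := 30) (b := 10) (s := s₁)
    (c := ite (.arr 18 (.reg 30)) (assign 54 (.reg 54 + .num 1)) skip)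
    (fun n s' => s'.reg 54 = ((Finset.range n).filter fun i => s.arr 18 i ≠ 0).card)
    (by simp [hs₁])
    (by
      intro n s' hn hx hag ih
      have e : s'.arr 18 = s.arr 18 := by rw [hag.arr 18 rfl, hs₁, run_arr _ _ rfl]
      simp only [run_ite, run_assign, run_skip, Expr.eval_arr, Expr.eval_reg, Expr.eval_add,
        Expr.eval_num, hx, e]
      rw [Finset.range_add_one, Finset.filter_insert]
      by_cases hc : s.arr 18 n = 0
      · rw [if_pos hc, if_neg (not_not.2 hc)]
        simpa using ih
      · rw [if_neg hc, if_pos hc, Finset.card_insert_of_notMem (by simp)]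
        simpa using ih)
  rw [h1] at key
  have hrun : countCmd.run s = (rep 30 10 (ite (.arr 18 (.reg 30))
    (assign 54 (.reg 54 + .num 1)) skip)).run s₁ := by rw [hs₁]; rfl
  rw [hrun, key]
  have hb := Finset.card_bij (s := vset N (s.arr 18))
    (t := (Finset.range N).filter fun i => s.arr 18 i ≠ 0) (fun v _ => (v : ℕ))
    (fun v hv => by simpa using mem_vset.1 hv) (fun a _ b _ hab => Fin.val_injective hab)
    (fun i hi => by
      simp only [Finset.mem_filter, Finset.mem_range] at hi
      exact ⟨⟨i, hi.1⟩, mem_vset.2 hi.2, rfl⟩)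
  exact hb.symm

theorem run_separateCmd {N k : ℕ} {s : State} (h : Env N k s)
    (hDT : Disjoint (vset N (s.arr 18)) (vset N (s.arr 13))) :
    (separateCmd.run s).reg 49 ≠ 0 ↔ s.reg 49 ≠ 0 ∧
      Sol (adj N (s.arr 15)) (vset N (s.arr 13)) (vset N (s.arr 18)) := by
  set R := adj N (s.arr 15) with hR
  set T := vset N (s.arr 13) with hT
  set D := vset N (s.arr 18) with hD
  have key := run_rep (x := 51) (b := 10) (s := s)
    (c := ite (.arr 13 (.reg 51)) (seq sourceCmd (seq otherSinksCmd
      (seq reach (ite (.arr 21 (.reg 10 + .reg 10)) (assign 49 (.num 0)) skip)))) skip)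
    (fun n s' => s'.reg 49 ≠ 0 ↔ s.reg 49 ≠ 0 ∧ ∀ t ∈ T, (t : ℕ) < n →
      ∀ u ∈ T, t ≠ u → ¬ ReflTransGen (Av R D) t u)
    (by simp)
    (by
      rintro n s' hn hx hag ih
      rw [h.N_eq] at hn
      have d13 : s'.arr 13 = s.arr 13 := hag.arr 13 rfl
      have hE : Env N k s' := h.of_agree rfl hag
      have hmem : s'.arr 13 n ≠ 0 ↔ (⟨n, hn⟩ : Fin N) ∈ T := by rw [d13, hT, mem_vset]
      have hstep : (∀ t ∈ T, (t : ℕ) < n + 1 → ∀ u ∈ T, t ≠ u → ¬ ReflTransGen (Av R D) t u) ↔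
          (∀ t ∈ T, (t : ℕ) < n → ∀ u ∈ T, t ≠ u → ¬ ReflTransGen (Av R D) t u) ∧
          ((⟨n, hn⟩ : Fin N) ∈ T → ∀ u ∈ T, (⟨n, hn⟩ : Fin N) ≠ u →
            ¬ ReflTransGen (Av R D) ⟨n, hn⟩ u) := by
        constructor
        · exact fun h => ⟨fun t ht htn => h t ht (by omega), fun ht => h _ ht (by simp)⟩
        · rintro ⟨g1, g2⟩ t ht htn
          rcases Nat.lt_succ_iff_lt_or_eq.1 htn with h | h
          · exact g1 t ht h
          · obtain rfl : t = ⟨n, hn⟩ := Fin.ext h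
            exact g2 ht
      rw [hstep]
      simp only [run_ite, run_seq, run_skip, Expr.eval_arr, Expr.eval_reg, hx]
      by_cases hc : s'.arr 13 n = 0
      · have ht : (⟨n, hn⟩ : Fin N) ∉ T := fun hc' => hmem.2 hc' hc
        rw [if_pos hc]
        simp only [State.setReg_reg, Nat.reduceEqDiff, if_false]
        rw [ih]
        exact ⟨fun h => ⟨h.1, h.2, fun h' => absurd h' ht⟩, fun h => ⟨h.1, h.2.1⟩⟩
      · rw [if_neg hc]
        have ht := hmem.1 hc
        have hsrc := run_sourceCmd (v := ⟨n, hn⟩) hE.N_eq hx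
        obtain ⟨s₁, hs₁⟩ : ∃ s₁, s₁ = sourceCmd.run s' := ⟨_, rfl⟩
        rw [← hs₁] at hsrc ⊢
        have h1 : Env N k s₁ := by rw [hs₁]; exact hE.run rfl
        have hsnk := run_otherSinksCmd (v := ⟨n, hn⟩) h1.N_eq
          (show s₁.reg 51 = n by rw [hs₁, run_reg _ _ rfl, hx])
        have f13 : s₁.arr 13 = s.arr 13 := by rw [hs₁, run_arr _ _ rfl, d13]
        rw [f13, ← hT] at hsnk
        obtain ⟨s₂, hs₂⟩ : ∃ s₂, s₂ = otherSinksCmd.run s₁ := ⟨_, rfl⟩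
        rw [← hs₂] at hsnk ⊢
        have h2 : Env N k s₂ := by rw [hs₂]; exact h1.run rfl
        have g15 : s₂.arr 15 = s.arr 15 := by
          rw [hs₂, run_arr _ _ rfl, hs₁, run_arr _ _ rfl, hag.arr 15 rfl]
        have g16 : s₂.arr 16 = s₁.arr 16 := by rw [hs₂, run_arr _ _ rfl]
        have g18 : s₂.arr 18 = s.arr 18 := by
          rw [hs₂, run_arr _ _ rfl, hs₁, run_arr _ _ rfl, hag.arr 18 rfl]
        have hL := ((run_reach h2).ne_zero_iff_reach ⟨n, hn⟩).2.2
        rw [g15, g16, g18, hsrc, hsnk, ← hR, ← hD] at hL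
        obtain ⟨s₃, hs₃⟩ : ∃ s₃, s₃ = reach.run s₂ := ⟨_, rfl⟩
        rw [← hs₃] at hL ⊢
        have h3 : Env N k s₃ := by rw [hs₃]; exact h2.run rfl
        have g49 : s₃.reg 49 = s'.reg 49 := by
          rw [hs₃, run_reg _ _ rfl, hs₂, run_reg _ _ rfl, hs₁, run_reg _ _ rfl]
        have hL' : s₃.arr 21 (N + N) ≠ 0 ↔ ¬ ((⟨n, hn⟩ : Fin N) ∈ T → ∀ u ∈ T,
            (⟨n, hn⟩ : Fin N) ≠ u → ¬ ReflTransGen (Av R D) ⟨n, hn⟩ u) := by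
          rw [hL]
          push Not
          constructor
          · rintro ⟨u, hu, -, t, htT, -, hp⟩
            rw [Finset.mem_singleton] at hu
            subst hu
            exact ⟨ht, t, Finset.mem_of_mem_erase htT, (Finset.ne_of_mem_erase htT).symm, hp⟩
          · rintro ⟨-, u, hu, hne, hp⟩
            exact ⟨_, Finset.mem_singleton_self _, Finset.disjoint_right.1 hDT ht, u,
              Finset.mem_erase.2 ⟨hne.symm, hu⟩, Finset.disjoint_right.1 hDT hu, hp⟩
        simp only [Expr.eval_add, Expr.eval_reg]
        rw [h3.N_eq]
        by_cases c0 : s₃.arr 21 (N + N) = 0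
        · rw [if_pos c0]
          simp only [State.setReg_reg, Nat.reduceEqDiff, if_false, g49]
          rw [ih]
          exact ⟨fun h => ⟨h.1, h.2, by by_contra hc2; exact hL'.2 hc2 c0⟩, fun h => ⟨h.1, h.2.1⟩⟩
        · have := hL'.1 c0
          rw [if_neg c0]
          simp only [run_assign, State.setReg_reg, Nat.reduceEqDiff, if_false, if_true,
            Expr.eval_num]
          exact ⟨fun h => absurd rfl h, fun h => absurd h.2.2 this⟩)
  rw [h.N_eq] at key
  refine key.trans (and_congr_right fun _ => ?_)
  exact ⟨fun h t ht u hu htu => h t ht t.2 u hu htu, fun h t ht _ u hu htu => h t ht u hu htu⟩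

/-- Needed when the candidate contains undeletable vertices, possibly terminals: `run_separateCmd`
does not apply then, but the flag is already zero and is never raised. -/
theorem separateCmd_stay {s : State} (h : s.reg 49 = 0) : (separateCmd.run s).reg 49 = 0 := by
  refine run_rep (x := 51) (b := 10) (s := s)
    (c := ite (.arr 13 (.reg 51)) (seq sourceCmd (seq otherSinksCmd
      (seq reach (ite (.arr 21 (.reg 10 + .reg 10)) (assign 49 (.num 0)) skip)))) skip)
    (fun _ s' => s'.reg 49 = 0) (by simp [h]) ?_
  intro n s' _ _ _ ih
  rw [State.setReg_reg, if_neg (by decide), run_ite]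
  by_cases hc : Expr.eval s' (.arr 13 (.reg 51)) = 0
  · rw [if_pos hc, run_skip, ih]
  · rw [if_neg hc, run_seq, run_seq, run_seq]
    obtain ⟨s₃, hs₃⟩ : ∃ s₃, s₃ = reach.run (otherSinksCmd.run (sourceCmd.run s')) := ⟨_, rfl⟩
    have g : s₃.reg 49 = 0 := by
      rw [hs₃, run_reg _ _ rfl, run_reg _ _ rfl, run_reg _ _ rfl, ih]
    rw [← hs₃, run_ite]
    split_ifs
    · rw [run_skip, g]
    · simp

theorem run_checkCmd {N k : ℕ} {s : State} (h : Env N k s)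
    (hPT : Disjoint (vset N (s.arr 14)) (vset N (s.arr 13))) :
    (checkCmd.run s).reg 49 ≠ 0 ↔ vset N (s.arr 18) ⊆ vset N (s.arr 14) ∧
      (vset N (s.arr 18)).card ≤ k ∧
      Sol (adj N (s.arr 12)) (vset N (s.arr 13)) (vset N (s.arr 18)) := by
  have hcopy := run_copyGraph h (a := 12) (by decide)
  obtain ⟨s₁, hs₁⟩ : ∃ s₁, s₁ = (fill₂ 30 10 31 10 10 15 32
    (assign 32 (.arr 12 (.arr 10 (.reg 30) + .reg 31)))).run s := ⟨_, rfl⟩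
  rw [← hs₁] at hcopy
  have h1 : Env N k s₁ := by rw [hs₁]; exact h.run rfl
  obtain ⟨s₂, hs₂⟩ : ∃ s₂, s₂ = (assign 49 (.num 1)).run s₁ := ⟨_, rfl⟩
  have h2 : Env N k s₂ := by rw [hs₂]; exact h1.run rfl
  have hone : s₂.reg 49 ≠ 0 := by rw [hs₂]; simp
  have hchk := run_checkAll (x := 30) (b := 10) (v := 32) (f := 49)
    (c := seq (assign 32 (.num 1)) (ite (.arr 18 (.reg 30)) (assign 32 (.arr 14 (.reg 30))) skip))
    (s := s₂) (fun i => s.arr 18 i ≠ 0 → s.arr 14 i ≠ 0) rfl (by decide) (by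
      intro i hi s' hag hx
      have e1 : s'.arr 18 = s.arr 18 := by
        rw [hag.arr 18 rfl, hs₂, run_arr _ _ rfl, hs₁, run_arr _ _ rfl]
      have e2 : s'.arr 14 = s.arr 14 := by
        rw [hag.arr 14 rfl, hs₂, run_arr _ _ rfl, hs₁, run_arr _ _ rfl]
      simp only [run_seq, run_assign, run_ite, run_skip, Expr.eval_arr, Expr.eval_reg,
        Expr.eval_num, State.setReg_reg, State.setReg_arr, hx, e1, e2, Nat.reduceEqDiff, if_false]
      by_cases c : s.arr 18 i = 0 <;> simp [c])
  rw [h2.N_eq] at hchk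
  obtain ⟨s₃, hs₃⟩ : ∃ s₃, s₃ = (checkAll 30 10 32 49 (seq (assign 32 (.num 1))
    (ite (.arr 18 (.reg 30)) (assign 32 (.arr 14 (.reg 30))) skip))).run s₂ := ⟨_, rfl⟩
  rw [← hs₃] at hchk
  have h3 : Env N k s₃ := by rw [hs₃]; exact h2.run rfl
  have hcnt := run_countCmd h3.N_eq
  obtain ⟨s₄, hs₄⟩ : ∃ s₄, s₄ = countCmd.run s₃ := ⟨_, rfl⟩
  rw [← hs₄] at hcnt
  have h4 : Env N k s₄ := by rw [hs₄]; exact h3.run rfl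
  obtain ⟨s₅, hs₅⟩ : ∃ s₅, s₅ = (ite (.reg 54 - .reg 1) (assign 49 (.num 0)) skip).run s₄ :=
    ⟨_, rfl⟩
  have h5 : Env N k s₅ := by rw [hs₅]; exact h4.run rfl
  have fr : ∀ a, (a == 15) = false → (countCmd.wa a) = false → s₅.arr a = s.arr a := by
    intro a ha hc
    rw [hs₅, run_arr _ _ rfl, hs₄, run_arr _ _ hc, hs₃, run_arr _ _ rfl, hs₂, run_arr _ _ rfl, hs₁,
      run_arr _ _ (by simpa [fill₂, wa] using ha)]
  have e18 : s₃.arr 18 = s.arr 18 := by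
    rw [hs₃, run_arr _ _ rfl, hs₂, run_arr _ _ rfl, hs₁, run_arr _ _ rfl]
  have g15 : s₅.arr 15 = s₁.arr 15 := by
    rw [hs₅, run_arr _ _ rfl, hs₄, run_arr _ _ rfl, hs₃, run_arr _ _ rfl, hs₂, run_arr _ _ rfl]
  have e49 : s₄.reg 49 = s₃.reg 49 := by rw [hs₄, run_reg _ _ rfl]
  have h49 : s₅.reg 49 ≠ 0 ↔ s₃.reg 49 ≠ 0 ∧ (vset N (s.arr 18)).card ≤ k := by
    rw [hs₅]
    simp only [run_ite, run_assign, run_skip, Expr.eval_sub, Expr.eval_reg, hcnt, h4.k_eq, e18]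
    split_ifs with c
    · rw [e49]
      exact ⟨fun h => ⟨h, by omega⟩, fun h => h.1⟩
    · simp only [State.setReg_reg, if_true, Expr.eval_num]
      exact ⟨fun h => absurd rfl h, fun h => absurd h.2 (by omega)⟩
  have hrun : checkCmd.run s = separateCmd.run s₅ := by rw [hs₅, hs₄, hs₃, hs₂, hs₁]; rfl
  have hsub : (∀ i < N, s.arr 18 i ≠ 0 → s.arr 14 i ≠ 0) ↔ vset N (s.arr 18) ⊆ vset N (s.arr 14) :=
    ⟨fun h u hu => mem_vset.2 (h u u.2 (mem_vset.1 hu)),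
      fun h i hi hne => mem_vset.1 (h (mem_vset.2 hne : (⟨i, hi⟩ : Fin N) ∈ _))⟩
  rw [hsub] at hchk
  by_cases hD : vset N (s.arr 18) ⊆ vset N (s.arr 14)
  · have hsep := run_separateCmd h5 (by
      rw [fr 18 rfl rfl, fr 13 rfl rfl]
      exact hPT.mono_left hD)
    rw [g15, hcopy, fr 18 rfl rfl, fr 13 rfl rfl, h49, hchk, ← hrun] at hsep
    rw [hsep]
    exact ⟨fun h => ⟨hD, h.1.2, h.2⟩, fun h => ⟨⟨⟨hone, hD⟩, h.2.1⟩, h.2.2⟩⟩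
  · have h0 : s₅.reg 49 = 0 := by
      by_contra hc
      exact hD (hchk.1 (h49.1 hc).1).2
    have hstay := separateCmd_stay h0
    rw [hrun]
    exact ⟨fun h => absurd hstay h, fun h => absurd h.1 hD⟩

end DirectedMultiwayCut

/-! ### The complete search: two guesses, two removals, one sweep -/

namespace DirectedMultiwayCut
open Cmd Relation

/-! ### The search on the machine

Register `55` is `1` as soon as a solution has been found, and then array `2` holds it. Registers `13`,
`14`, `15`, `16`, `17`, `18` and `20` hold `2 * k`, `L`, `m`, `2 * m`, `2 ^ (2 * m)`, `2 ^ (2 * k)` and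
`N * L`. -/

/-- Combines the hitting family with its derandomization. It is applied twice, to the graph and to
the reversed graph with fewer deletable vertices. -/
theorem exists_guess {N k L m : ℕ} {R : Fin N → Fin N → Prop} {T P S : Finset (Fin N)}
    (ht : Tight R T P S) (hS : S.card ≤ k) (hL : 4 * (k + 1) ^ 4 ≤ 2 ^ L)
    (hm : 2 ^ (3 * k * L) * (N * L) < 2 ^ m) (hm0 : 0 < m) :
    ∃ a z, Recurrence m a z ∧ S ⊆ zeros N L z ∧
      ∀ v Y, Certifies R T P (zeros N L z) k v Y → v ∉ S := by
  have hθ : (1 / 2 ^ L : ℚ) * (4 * (k + 1) ^ 4) ≤ 1 := by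
    rw [one_div_mul_eq_div, div_le_one (by positivity)]
    exact_mod_cast hL
  obtain ⟨𝓕, h1, h2, h3⟩ := exists_hitting_family ht hS (θ := 1 / 2 ^ L) (by positivity) hθ
  obtain ⟨a, z, hz, hsub, hav⟩ := exists_recurrence_avoiding S hS 𝓕 h1 h2 hm hm0
  exact ⟨a, z, hz, hsub, fun v Y hY => hY.not_mem h3 hav⟩

/-- Compute the set `25` from the number in the register `x`. -/
def guessCmd (x : ℕ) : Cmd := seq (decode 23 x 16 17) (seq sequenceCmd zerosCmd)

theorem exists_code_guess {N L m : ℕ} {a z : ℕ → ℕ} (hz : Recurrence m a z) :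
    ∃ code < 2 ^ (2 * m), ∀ x, ∀ s : State, s.reg 10 = N → s.reg 14 = L → s.reg 15 = m →
      s.reg 16 = 2 * m → s.reg 20 = N * L → s.reg x = code → s.reg x ≤ s.reg 17 →
      vset N (((guessCmd x).run s).arr 25) = zeros N L z := by
  -- A recurring sequence is determined by its `m` coefficients and its `m` initial terms, encoded
  -- in this order.
  obtain ⟨code, hc, hd⟩ := exists_code (2 * m) fun i => if i < m then a i else z (i - m)
  have h01 : ∀ n ≤ 1, (if n = 1 then 1 else 0) = n := by
    intro n hn
    split_ifs <;> omega
  refine ⟨code, hc, fun x s h10 h14 h15 h16 h20 hx hx17 => ?_⟩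
  have hdec := run_decode (a := 23) (src := x) (cnt := 16) (b := 17) hx17 (by omega) (by omega)
  rw [h16, hx] at hdec
  obtain ⟨s₁, hs₁⟩ : ∃ s₁, s₁ = (decode 23 x 16 17).run s := ⟨_, rfl⟩
  rw [← hs₁] at hdec
  have hseq := run_sequenceCmd (s := s₁) hz (by rw [hs₁, run_reg _ _ rfl, h15])
    (by rw [hs₁, run_reg _ _ rfl, h20])
    (fun i hi => by
      rw [hdec i (by omega), hd i (by omega)]
      simp only [hi, if_true]
      exact h01 _ (hz.coeff i))
    (fun i hi => by
      rw [hdec (m + i) (by omega), hd (m + i) (by omega)]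
      simp only [show ¬ m + i < m by omega, if_false, Nat.add_sub_cancel_left]
      exact h01 _ (hz.le i))
  obtain ⟨s₂, hs₂⟩ : ∃ s₂, s₂ = sequenceCmd.run s₁ := ⟨_, rfl⟩
  rw [← hs₂] at hseq
  have hzr := run_zerosCmd (N := N) (L := L) (s := s₂)
    (by rw [hs₂, run_reg _ _ rfl, hs₁, run_reg _ _ rfl, h10])
    (by rw [hs₂, run_reg _ _ rfl, hs₁, run_reg _ _ rfl, h14]) hseq
  have hrun : (guessCmd x).run s = zerosCmd.run s₂ := by rw [hs₂, hs₁]; rfl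
  rw [hrun, hzr]

/-- Copy the first `N` cells of array `a` to array `b`. -/
def copyCmd (a b : ℕ) : Cmd := fill 30 10 b 32 (assign 32 (.arr a (.reg 30)))

theorem run_copyCmd {N : ℕ} {s : State} (h : s.reg 10 = N) {a b : ℕ} (hab : a ≠ b) :
    vset N (((copyCmd a b).run s).arr b) = vset N (s.arr a) := by
  have key := run_fill (x := 30) (b := 10) (a := b) (v := 32) (c := assign 32 (.arr a (.reg 30)))
    (s := s) (s.arr a) rfl rfl (by
      intro i hi s' hag hx
      have e : s'.arr a = s.arr a := hag.arr a (by simp [fill, wa, hab])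
      simp [hx, e])
  rw [h] at key
  ext v
  rw [mem_vset, copyCmd, key v v.2, mem_vset]

/-- The instance and the parameters of the search are in place. -/
structure Ready {N : ℕ} (R : Fin N → Fin N → Prop) (T P : Finset (Fin N)) (k L m : ℕ) (s : State) :
    Prop where
  env : Env N k s
  graph : adj N (s.arr 12) = R
  terminals : vset N (s.arr 13) = T
  deletable : vset N (s.arr 14) = P
  r13 : s.reg 13 = 2 * k
  r14 : s.reg 14 = L
  r15 : s.reg 15 = m
  r16 : s.reg 16 = 2 * m
  r17 : s.reg 17 = 2 ^ (2 * m)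
  r18 : s.reg 18 = 2 ^ (2 * k)
  r20 : s.reg 20 = N * L

/-- The command does not touch the instance and the parameters of the search. -/
def Cmd.keepsReady (c : Cmd) : Bool :=
  c.keepsEnv && !c.wa 12 && !c.wa 13 && !c.wa 14 && !c.wr 13 && !c.wr 14 && !c.wr 15 && !c.wr 16 &&
    !c.wr 17 && !c.wr 18 && !c.wr 20

section Search

variable {N : ℕ} {R : Fin N → Fin N → Prop} {T P : Finset (Fin N)} {k L m : ℕ} {s : State}

theorem Ready.of_agree (h : Ready R T P k L m s) {s' : State} {c : Cmd} (hc : c.keepsReady = true)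
    (ha : c.Agree s s') : Ready R T P k L m s' := by
  simp only [keepsReady, Bool.and_eq_true, Bool.not_eq_true'] at hc
  obtain ⟨⟨⟨⟨⟨⟨⟨⟨⟨⟨h0, h1⟩, h2⟩, h3⟩, h4⟩, h5⟩, h6⟩, h7⟩, h8⟩, h9⟩, h10⟩ := hc
  exact ⟨h.env.of_agree h0 ha, by rw [ha.arr _ h1, h.graph], by rw [ha.arr _ h2, h.terminals],
    by rw [ha.arr _ h3, h.deletable], by rw [ha.reg _ h4, h.r13], by rw [ha.reg _ h5, h.r14],
    by rw [ha.reg _ h6, h.r15], by rw [ha.reg _ h7, h.r16], by rw [ha.reg _ h8, h.r17],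
    by rw [ha.reg _ h9, h.r18], by rw [ha.reg _ h10, h.r20]⟩

theorem Ready.run (h : Ready R T P k L m s) {c : Cmd} (hc : c.keepsReady = true) :
    Ready R T P k L m (c.run s) := h.of_agree hc (agree_run c s)

/-- The first removal: compute array `28`. -/
def removeOut : Cmd := seq (guessCmd 56)
  (seq (fill₂ 30 10 31 10 10 15 32 (assign 32 (.arr 12 (.arr 10 (.reg 30) + .reg 31))))
  (seq (copyCmd 13 17) (seq (copyCmd 14 19) (seq removeCmd (copyCmd 26 28)))))

/-- Copy the reversed graph to the working graph. -/
def reverseCmd : Cmd :=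
  fill₂ 30 10 31 10 10 15 32 (assign 32 (.arr 12 (.arr 10 (.reg 31) + .reg 30)))

/-- Compute the deletable vertices outside array `28`. -/
def restCmd : Cmd := fill 30 10 19 32 (seq (assign 32 (.arr 14 (.reg 30)))
  (ite (.arr 28 (.reg 30)) (assign 32 (.num 0)) skip))

/-- Compute the union of arrays `26` and `28`. -/
def unionCmd : Cmd := fill 30 10 29 32 (assign 32 (.arr 26 (.reg 30) + .arr 28 (.reg 30)))

/-- The second removal: compute array `29`. -/
def removeIn : Cmd := seq (guessCmd 57) (seq reverseCmd
  (seq (copyCmd 13 17) (seq restCmd (seq removeCmd unionCmd))))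

theorem run_removeOut (h : Ready R T P k L m s) {C : Finset (Fin N)}
    (hC : vset N (((guessCmd 56).run s).arr 25) = C) :
    (∀ v ∈ vset N ((removeOut.run s).arr 28), ∃ Y, Certifies R T P C k v Y) ∧
    ∀ S ⊆ P, Tight R T P S → S.card ≤ k → S ⊆ C →
      shadow R T S ⊆ vset N ((removeOut.run s).arr 28) := by
  obtain ⟨s₁, hs₁⟩ : ∃ s₁, s₁ = (guessCmd 56).run s := ⟨_, rfl⟩
  rw [← hs₁] at hC
  have h1 : Ready R T P k L m s₁ := by rw [hs₁]; exact h.run rfl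
  have hcopy := run_copyGraph h1.env (a := 12) (by decide)
  rw [h1.graph] at hcopy
  obtain ⟨s₂, hs₂⟩ : ∃ s₂, s₂ = (fill₂ 30 10 31 10 10 15 32
    (assign 32 (.arr 12 (.arr 10 (.reg 30) + .reg 31)))).run s₁ := ⟨_, rfl⟩
  rw [← hs₂] at hcopy
  have h2 : Ready R T P k L m s₂ := by rw [hs₂]; exact h1.run rfl
  have hT := run_copyCmd h2.env.N_eq (a := 13) (b := 17) (by decide)
  rw [h2.terminals] at hT
  obtain ⟨s₃, hs₃⟩ : ∃ s₃, s₃ = (copyCmd 13 17).run s₂ := ⟨_, rfl⟩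
  rw [← hs₃] at hT
  have h3 : Ready R T P k L m s₃ := by rw [hs₃]; exact h2.run rfl
  have hP := run_copyCmd h3.env.N_eq (a := 14) (b := 19) (by decide)
  rw [h3.deletable] at hP
  obtain ⟨s₄, hs₄⟩ : ∃ s₄, s₄ = (copyCmd 14 19).run s₃ := ⟨_, rfl⟩
  rw [← hs₄] at hP
  have h4 : Ready R T P k L m s₄ := by rw [hs₄]; exact h3.run rfl
  have hr := run_removeCmd h4.env h4.r13 h4.r18
  have e15 : s₄.arr 15 = s₂.arr 15 := by rw [hs₄, run_arr _ _ rfl, hs₃, run_arr _ _ rfl]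
  have e17 : s₄.arr 17 = s₃.arr 17 := by rw [hs₄, run_arr _ _ rfl]
  have e25 : s₄.arr 25 = s₁.arr 25 := by
    rw [hs₄, run_arr _ _ rfl, hs₃, run_arr _ _ rfl, hs₂, run_arr _ _ rfl]
  rw [e15, e17, e25, hcopy, hT, hP, hC] at hr
  obtain ⟨s₅, hs₅⟩ : ∃ s₅, s₅ = removeCmd.run s₄ := ⟨_, rfl⟩
  rw [← hs₅] at hr
  have h5 : Ready R T P k L m s₅ := by rw [hs₅]; exact h4.run rfl
  have hfin := run_copyCmd h5.env.N_eq (a := 26) (b := 28) (by decide)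
  have hrun : removeOut.run s = (copyCmd 26 28).run s₅ := by rw [hs₅, hs₄, hs₃, hs₂, hs₁]; rfl
  rw [hrun, hfin]
  exact hr

theorem run_reverseCmd (h : Env N k s) :
    adj N ((reverseCmd.run s).arr 15) = flip (adj N (s.arr 12)) := by
  have key := run_fill₂ (x := 30) (bx := 10) (y := 31) (b := 10) (t := 10) (a := 15) (v := 32)
    (c := assign 32 (.arr 12 (.arr 10 (.reg 31) + .reg 30))) (s := s)
    (fun i j => s.arr 12 (j * N + i))
    rfl rfl rfl rfl rfl (by decide) (by decide) (by decide) (by decide)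
    (by rw [h.N_eq]; exact h.mulN)
    (by
      intro i hi j hj s' hag hx hy
      rw [h.N_eq] at hj
      have e1 : s'.arr 10 j = j * N := by rw [hag.arr 10 rfl, h.mulN j hj]
      have e2 : s'.arr 12 = s.arr 12 := hag.arr 12 rfl
      simp [hx, hy, e1, e2])
  rw [h.N_eq] at key
  funext u v
  rw [adj, reverseCmd, key u u.2 v v.2]
  rfl

theorem run_restCmd (h : s.reg 10 = N) :
    vset N ((restCmd.run s).arr 19) = vset N (s.arr 14) \ vset N (s.arr 28) := by
  have key := run_fill (x := 30) (b := 10) (a := 19) (v := 32)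
    (c := seq (assign 32 (.arr 14 (.reg 30))) (ite (.arr 28 (.reg 30)) (assign 32 (.num 0)) skip))
    (s := s) (fun i => if s.arr 28 i = 0 then s.arr 14 i else 0) rfl rfl (by
      intro i hi s' hag hx
      have e1 : s'.arr 14 = s.arr 14 := hag.arr 14 rfl
      have e2 : s'.arr 28 = s.arr 28 := hag.arr 28 rfl
      simp only [run_seq, run_assign, run_ite, run_skip, Expr.eval_reg, Expr.eval_num,
        Expr.eval_arr, State.setReg_arr, State.setReg_reg, hx, e1, e2, Nat.reduceEqDiff, if_false]
      by_cases hc : s.arr 28 i = 0 <;> simp [hc])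
  rw [h] at key
  ext u
  rw [mem_vset, restCmd, key u u.2, Finset.mem_sdiff, mem_vset, mem_vset]
  by_cases hc : s.arr 28 u = 0 <;> simp [hc]

theorem run_unionCmd (h : s.reg 10 = N) :
    vset N ((unionCmd.run s).arr 29) = vset N (s.arr 26) ∪ vset N (s.arr 28) := by
  have key := run_fill (x := 30) (b := 10) (a := 29) (v := 32)
    (c := assign 32 (.arr 26 (.reg 30) + .arr 28 (.reg 30)))
    (s := s) (fun i => s.arr 26 i + s.arr 28 i) rfl rfl (by
      intro i hi s' hag hx
      have e1 : s'.arr 26 = s.arr 26 := hag.arr 26 rfl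
      have e2 : s'.arr 28 = s.arr 28 := hag.arr 28 rfl
      simp [hx, e1, e2])
  rw [h] at key
  ext u
  rw [mem_vset, unionCmd, key u u.2, Finset.mem_union, mem_vset, mem_vset]
  omega

theorem run_removeIn (h : Ready R T P k L m s) {C Z : Finset (Fin N)}
    (hC : vset N (((guessCmd 57).run s).arr 25) = C) (hZ : vset N (s.arr 28) = Z) :
    Z ⊆ vset N ((removeIn.run s).arr 29) ∧
    (∀ v ∈ vset N ((removeIn.run s).arr 29), v ∉ Z → ∃ Y, Certifies (flip R) T (P \ Z) C k v Y) ∧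
    ∀ S ⊆ P \ Z, Tight (flip R) T (P \ Z) S → S.card ≤ k → S ⊆ C →
      shadow (flip R) T S ⊆ vset N ((removeIn.run s).arr 29) := by
  obtain ⟨s₁, hs₁⟩ : ∃ s₁, s₁ = (guessCmd 57).run s := ⟨_, rfl⟩
  rw [← hs₁] at hC
  have h1 : Ready R T P k L m s₁ := by rw [hs₁]; exact h.run rfl
  have hcopy := run_reverseCmd h1.env
  rw [h1.graph] at hcopy
  obtain ⟨s₂, hs₂⟩ : ∃ s₂, s₂ = reverseCmd.run s₁ := ⟨_, rfl⟩
  rw [← hs₂] at hcopy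
  have h2 : Ready R T P k L m s₂ := by rw [hs₂]; exact h1.run rfl
  have hT := run_copyCmd h2.env.N_eq (a := 13) (b := 17) (by decide)
  rw [h2.terminals] at hT
  obtain ⟨s₃, hs₃⟩ : ∃ s₃, s₃ = (copyCmd 13 17).run s₂ := ⟨_, rfl⟩
  rw [← hs₃] at hT
  have h3 : Ready R T P k L m s₃ := by rw [hs₃]; exact h2.run rfl
  have hP := run_restCmd h3.env.N_eq
  have e28 : s₃.arr 28 = s.arr 28 := by
    rw [hs₃, run_arr _ _ rfl, hs₂, run_arr _ _ rfl, hs₁, run_arr _ _ rfl]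
  rw [h3.deletable, e28, hZ] at hP
  obtain ⟨s₄, hs₄⟩ : ∃ s₄, s₄ = restCmd.run s₃ := ⟨_, rfl⟩
  rw [← hs₄] at hP
  have h4 : Ready R T P k L m s₄ := by rw [hs₄]; exact h3.run rfl
  have hr := run_removeCmd h4.env h4.r13 h4.r18
  have e15 : s₄.arr 15 = s₂.arr 15 := by rw [hs₄, run_arr _ _ rfl, hs₃, run_arr _ _ rfl]
  have e17 : s₄.arr 17 = s₃.arr 17 := by rw [hs₄, run_arr _ _ rfl]
  have e25 : s₄.arr 25 = s₁.arr 25 := by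
    rw [hs₄, run_arr _ _ rfl, hs₃, run_arr _ _ rfl, hs₂, run_arr _ _ rfl]
  rw [e15, e17, e25, hcopy, hT, hP, hC] at hr
  obtain ⟨s₅, hs₅⟩ : ∃ s₅, s₅ = removeCmd.run s₄ := ⟨_, rfl⟩
  rw [← hs₅] at hr
  have h5 : Ready R T P k L m s₅ := by rw [hs₅]; exact h4.run rfl
  have hfin := run_unionCmd h5.env.N_eq
  have e28' : s₅.arr 28 = s.arr 28 := by rw [hs₅, run_arr _ _ rfl, hs₄, run_arr _ _ rfl, e28]
  rw [e28', hZ] at hfin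
  have hrun : removeIn.run s = unionCmd.run s₅ := by rw [hs₅, hs₄, hs₃, hs₂, hs₁]; rfl
  rw [hrun, hfin]
  refine ⟨Finset.subset_union_right, fun v hv hvZ => ?_, fun S h1 h2 h3 h4 =>
    (hr.2 S h1 h2 h3 h4).trans Finset.subset_union_left⟩
  rcases Finset.mem_union.1 hv with hv | hv
  · exact hr.1 v hv
  · exact absurd hv hvZ

/-- A small solution. -/
structure Small (R : Fin N → Fin N → Prop) (T P : Finset (Fin N)) (k : ℕ) (S : Finset (Fin N)) :
    Prop where
  sol : Sol R T S
  sub : S ⊆ P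
  card_le : S.card ≤ k

/-- What the search has stored is right. -/
def Sound (R : Fin N → Fin N → Prop) (T P : Finset (Fin N)) (k : ℕ) (s : State) : Prop :=
  s.reg 55 = 0 ∨ s.reg 55 = 1 ∧ ∃ S, Small R T P k S ∧
    ∀ v : Fin N, s.arr 2 v = if v ∈ S then 1 else 0

/-- The command keeps what has been found, and keeps it right. -/
def Step (R : Fin N → Fin N → Prop) (T P : Finset (Fin N)) (k : ℕ) (s s' : State) : Prop :=
  (Sound R T P k s → Sound R T P k s') ∧ (s.reg 55 = 1 → s'.reg 55 = 1)

theorem Step.trans {s₁ s₂ s₃ : State} (h : Step R T P k s₁ s₂) (h' : Step R T P k s₂ s₃) :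
    Step R T P k s₁ s₃ := ⟨fun a => h'.1 (h.1 a), fun a => h'.2 (h.2 a)⟩

theorem step_of_eq {s s' : State} (h : s'.reg 55 = s.reg 55) (h2 : s'.arr 2 = s.arr 2) :
    Step R T P k s s' := ⟨fun a => by rwa [Sound, h, h2], fun a => h.trans a⟩

theorem step_run {c : Cmd} (h : c.wr 55 = false) (h2 : c.wa 2 = false) :
    Step R T P k s (c.run s) := step_of_eq (run_reg _ _ h) (run_arr _ _ h2)

/-- For completeness of a search loop it is enough that one particular round succeeds: later rounds
keep the flag, and every round keeps the stored answer right. -/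
theorem step_rep {x b : ℕ} {c : Cmd} (hx : 55 ≠ x)
    (h : ∀ i s', i < s.reg b → s'.reg x = i → (rep x b c).Agree s s' → Step R T P k s' (c.run s')) :
    Step R T P k s ((rep x b c).run s) ∧
      ∀ i₀ < s.reg b, (∀ s', s'.reg x = i₀ → (rep x b c).Agree s s' → (c.run s').reg 55 = 1) →
        ((rep x b c).run s).reg 55 = 1 := by
  have hset : ∀ (s' : State) v, (s'.setReg x v).reg 55 = s'.reg 55 := fun s' v => by simp [hx]
  refine ⟨?_, fun i₀ hi₀ hh => ?_⟩
  · refine run_rep (fun _ s' => Step R T P k s s') (step_of_eq (hset _ _) rfl) ?_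
    intro i s' hi hxi hag ih
    exact (ih.trans (h i s' hi hxi hag)).trans (step_of_eq (hset _ _) rfl)
  · refine run_rep (x := x) (b := b) (c := c) (s := s) (fun i s' => i₀ < i → s'.reg 55 = 1)
      (fun h => absurd h (by omega)) ?_ hi₀
    intro i s' hi hxi hag ih hlt
    rw [hset]
    rcases Nat.lt_succ_iff_lt_or_eq.1 hlt with hlt | rfl
    · exact (h i s' hi hxi hag).2 (ih hlt)
    · exact hh s' hxi hag

/-- Store array `18` as the answer if it has passed the test. -/
def outputCmd : Cmd := ite (.reg 49) (seq (fill 30 10 2 32 (ite (.arr 18 (.reg 30))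
  (assign 32 (.num 1)) (assign 32 (.num 0)))) (assign 55 (.num 1))) skip

/-- Compute a candidate for the torso and test it. -/
def candidateCmd : Cmd := seq sweepCmd (seq checkCmd outputCmd)

theorem run_outputCmd (h : s.reg 10 = N) :
    (s.reg 49 = 0 → outputCmd.run s = s) ∧ (s.reg 49 ≠ 0 → (outputCmd.run s).reg 55 = 1 ∧
      ∀ v : Fin N, (outputCmd.run s).arr 2 v = if v ∈ vset N (s.arr 18) then 1 else 0) := by
  refine ⟨fun h0 => by simp [outputCmd, h0], fun h0 => ?_⟩
  have key := run_fill (x := 30) (b := 10) (a := 2) (v := 32)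
    (c := ite (.arr 18 (.reg 30)) (assign 32 (.num 1)) (assign 32 (.num 0)))
    (s := s) (fun i => if s.arr 18 i = 0 then 0 else 1) rfl rfl (by
      intro i hi s' hag hx
      have e1 : s'.arr 18 = s.arr 18 := hag.arr 18 rfl
      simp only [run_ite, run_assign, Expr.eval_reg, Expr.eval_num, Expr.eval_arr, hx, e1]
      by_cases hc : s.arr 18 i = 0 <;> simp [hc])
  rw [h] at key
  have hrun : outputCmd.run s = ((fill 30 10 2 32 (ite (.arr 18 (.reg 30))
      (assign 32 (.num 1)) (assign 32 (.num 0)))).run s).setReg 55 1 := by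
    rw [outputCmd, run_ite, Expr.eval_reg, if_neg h0]
    rfl
  rw [hrun]
  refine ⟨by simp, fun v => ?_⟩
  rw [State.setReg_arr, key v v.2]
  by_cases hc : s.arr 18 v = 0 <;> simp [hc, mem_vset]

theorem run_check_output (h : Ready R T P k L m s) (hPT : Disjoint P T) :
    Step R T P k s ((seq checkCmd outputCmd).run s) ∧
      (Small R T P k (vset N (s.arr 18)) → ((seq checkCmd outputCmd).run s).reg 55 = 1) := by
  have hc := run_checkCmd h.env (by rw [h.deletable, h.terminals]; exact hPT)
  rw [h.graph, h.terminals, h.deletable] at hc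
  obtain ⟨s₁, hs₁⟩ : ∃ s₁, s₁ = checkCmd.run s := ⟨_, rfl⟩
  rw [← hs₁] at hc
  have h1 : Ready R T P k L m s₁ := by rw [hs₁]; exact h.run rfl
  have e18 : s₁.arr 18 = s.arr 18 := by rw [hs₁, run_arr _ _ rfl]
  have hst : Step R T P k s s₁ := by rw [hs₁]; exact step_run rfl rfl
  obtain ⟨o1, o2⟩ := run_outputCmd h1.env.N_eq
  rw [run_seq, ← hs₁]
  rw [e18] at o2
  by_cases h0 : s₁.reg 49 = 0
  · rw [o1 h0]
    exact ⟨hst, fun hS => absurd h0 (hc.2 ⟨hS.sub, hS.card_le, hS.sol⟩)⟩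
  · obtain ⟨p1, p2⟩ := o2 h0
    obtain ⟨q1, q2, q3⟩ := hc.1 h0
    exact ⟨⟨fun _ => .inr ⟨p1, _, ⟨q3, q1, q2⟩, p2⟩, fun _ => p1⟩, fun _ => p1⟩

theorem step_candidateCmd (h : Ready R T P k L m s) (hPT : Disjoint P T) :
    Step R T P k s (candidateCmd.run s) :=
  (step_run (c := sweepCmd) rfl rfl).trans (run_check_output (h.run rfl) hPT).1

theorem run_candidateCmd (h : Ready R T P k L m s) (hPT : Disjoint P T)
    {H : Fin N → Fin N → Prop} (hH : adj N (s.arr 30) = H) {Z : Finset (Fin N)}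
    (hZ : vset N (s.arr 29) = Z) (hcode : s.reg 58 < 2 ^ (2 * k))
    (hs : ∀ bits : ℕ → ℕ, (∀ i < 2 * k, bits i = s.reg 58 / 2 ^ i % 2) →
      SweepValid H T (P \ Z) k bits N ∧ Small R T P k (sweep H T (P \ Z) k bits N).D) :
    (candidateCmd.run s).reg 55 = 1 := by
  obtain ⟨bits, hb, hD⟩ := run_sweepCmd h.env h.r13 (by rw [h.r18]; omega) (by
    rw [hH, h.terminals, h.deletable, hZ]
    exact fun bits hbits => (hs bits hbits).1)
  rw [hH, h.terminals, h.deletable, hZ] at hD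
  obtain ⟨s₁, hs₁⟩ : ∃ s₁, s₁ = sweepCmd.run s := ⟨_, rfl⟩
  rw [← hs₁] at hD
  have h1 : Ready R T P k L m s₁ := by rw [hs₁]; exact h.run rfl
  have hsmall := (hs bits hb).2
  rw [← hD] at hsmall
  have hfin := (run_check_output h1 hPT).2 hsmall
  rw [candidateCmd, run_seq, ← hs₁]
  exact hfin

/-- The search for all guesses of the second removal. -/
def searchIn : Cmd := rep 57 17 (seq removeIn (seq torsoCmd (rep 58 18 candidateCmd)))

/-- The search. -/
def searchCmd : Cmd := seq (assign 55 (.num 0)) (rep 56 17 (seq removeOut searchIn))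

theorem step_candidates (h : Ready R T P k L m s) (hPT : Disjoint P T) :
    Step R T P k s ((rep 58 18 candidateCmd).run s) :=
  (step_rep (by decide) fun _ _ _ _ hag => step_candidateCmd (h.of_agree rfl hag) hPT).1

theorem step_searchIn_body (h : Ready R T P k L m s) (hPT : Disjoint P T) :
    Step R T P k s ((seq removeIn (seq torsoCmd (rep 58 18 candidateCmd))).run s) := by
  have h1 : Step R T P k s (removeIn.run s) := step_run rfl rfl
  have hr : Ready R T P k L m (removeIn.run s) := h.run rfl
  rw [run_seq, run_seq]
  generalize removeIn.run s = s₁ at *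
  have h2 : Step R T P k s₁ (torsoCmd.run s₁) := step_run rfl rfl
  have hr2 : Ready R T P k L m (torsoCmd.run s₁) := hr.run rfl
  generalize torsoCmd.run s₁ = s₂ at *
  exact h1.trans (h2.trans (step_candidates hr2 hPT))

theorem step_searchIn (h : Ready R T P k L m s) (hPT : Disjoint P T) :
    Step R T P k s (searchIn.run s) := by
  exact (step_rep (by decide) fun _ s' _ _ hag => step_searchIn_body (h.of_agree rfl hag) hPT).1

theorem step_searchCmd_body (h : Ready R T P k L m s) (hPT : Disjoint P T) :
    Step R T P k s ((seq removeOut searchIn).run s) := by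
  have h1 : Step R T P k s (removeOut.run s) := step_run rfl rfl
  have hr : Ready R T P k L m (removeOut.run s) := h.run rfl
  rw [run_seq]
  generalize removeOut.run s = s₁ at *
  exact h1.trans (step_searchIn hr hPT)

theorem run_candidates (h : Ready R T P k L m s) (hPT : Disjoint P T)
    {S Z : Finset (Fin N)} (hS : Small R T P k S) (hZ : vset N (s.arr 29) = Z)
    (hH : adj N (s.arr 30) = TorsoNe R Z)
    (hZS : Disjoint Z S) (hZT : Disjoint Z T) (h1 : shadow R T S ⊆ Z)
    (h2 : shadow (flip R) T S ⊆ Z) : ((rep 58 18 candidateCmd).run s).reg 55 = 1 := by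
  obtain ⟨code, hc, hcode⟩ := exists_code_sweep (H := TorsoNe R Z) TorsoNe.symm (T := T)
    (P := P \ Z) (k := k) (hPT.mono_left Finset.sdiff_subset)
    (sol_torsoNe.2 (sol_torso hS.sol hZS h1 h2))
    (Finset.subset_sdiff.2 ⟨hS.sub, hZS.symm⟩) hS.card_le
  refine (step_rep (by decide)
    fun _ _ _ _ hag => step_candidateCmd (h.of_agree rfl hag) hPT).2 code (by rw [h.r18]; exact hc) ?_
  intro s' hx hag
  refine run_candidateCmd (h.of_agree rfl hag) hPT (by rw [hag.arr 30 rfl, hH])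
    (by rw [hag.arr 29 rfl, hZ]) (by rw [hx]; exact hc) fun bits hbits => ?_
  rw [hx] at hbits
  obtain ⟨g1, g2, g3, g4⟩ := hcode bits hbits
  have g3' := g3.trans Finset.sdiff_subset
  exact ⟨g1, sol_of_torso (sol_torsoNe.1 g2) hZT (hPT.mono_left g3'), g3', g4⟩

theorem run_searchIn (h : Ready R T P k L m s) (hPT : Disjoint P T)
    (hL : 4 * (k + 1) ^ 4 ≤ 2 ^ L) (hm : 2 ^ (3 * k * L) * (N * L) < 2 ^ m) (hm0 : 0 < m)
    {S Z : Finset (Fin N)} (hE : Extremal R T P S) (hk : S.card ≤ k) (hZ : vset N (s.arr 28) = Z)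
    (hZS : Disjoint Z S) (hZT : Disjoint Z T) (h1 : shadow R T S ⊆ Z) :
    (searchIn.run s).reg 55 = 1 := by
  have ht := hE.tight_flip hPT h1
  obtain ⟨a, z, hz, hSC, hcert⟩ := exists_guess ht hk hL hm hm0
  obtain ⟨code, hc, hcode⟩ := exists_code_guess (N := N) (L := L) hz
  refine (step_rep (R := R) (T := T) (P := P) (k := k) (by decide)
    fun _ s' _ _ hag => step_searchIn_body (h.of_agree rfl hag) hPT).2 code
      (by rw [h.r17]; exact hc) ?_
  intro s' hx hag
  have h' : Ready R T P k L m s' := h.of_agree rfl hag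
  have hg := hcode 57 s' h'.env.N_eq h'.r14 h'.r15 h'.r16 h'.r20 hx (by rw [hx, h'.r17]; exact hc.le)
  obtain ⟨r1, r2, r3⟩ := run_removeIn h' hg (by rw [hag.arr 28 rfl, hZ])
  obtain ⟨s₁, hs₁⟩ : ∃ s₁, s₁ = removeIn.run s' := ⟨_, rfl⟩
  rw [← hs₁] at r1 r2 r3
  have h1' : Ready R T P k L m s₁ := by rw [hs₁]; exact h'.run rfl
  have htor := run_torsoCmd h1'.env
  rw [h1'.graph] at htor
  obtain ⟨s₂, hs₂⟩ : ∃ s₂, s₂ = torsoCmd.run s₁ := ⟨_, rfl⟩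
  rw [← hs₂] at htor
  have h2' : Ready R T P k L m s₂ := by rw [hs₂]; exact h1'.run rfl
  have e29 : s₂.arr 29 = s₁.arr 29 := by rw [hs₂, run_arr _ _ rfl]
  have hrun : (seq removeIn (seq torsoCmd (rep 58 18 candidateCmd))).run s' =
      (rep 58 18 candidateCmd).run s₂ := by rw [hs₂, hs₁]; rfl
  rw [hrun]
  refine run_candidates h2' hPT ⟨hE.sol, hE.sub, hk⟩ (congrArg _ e29) htor ?_ ?_ (h1.trans r1)
    (r3 S (Finset.subset_sdiff.2 ⟨hE.sub, hZS.symm⟩) ht hk hSC)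
  · rw [Finset.disjoint_left]
    intro v hv
    by_cases hvZ : v ∈ Z
    · exact Finset.disjoint_left.1 hZS hvZ
    · obtain ⟨Y, hY⟩ := r2 v hv hvZ
      exact hcert v Y hY
  · rw [Finset.disjoint_left]
    intro v hv
    by_cases hvZ : v ∈ Z
    · exact Finset.disjoint_left.1 hZT hvZ
    · obtain ⟨Y, hY⟩ := r2 v hv hvZ
      exact hY.not_mem_terminals

theorem run_searchCmd (h : Ready R T P k L m s) (hPT : Disjoint P T)
    (hL : 4 * (k + 1) ^ 4 ≤ 2 ^ L) (hm : 2 ^ (3 * k * L) * (N * L) < 2 ^ m) (hm0 : 0 < m) :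
    ((searchCmd.run s).reg 55 = 1 ∧ ∃ S, Small R T P k S ∧
      ∀ v : Fin N, (searchCmd.run s).arr 2 v = if v ∈ S then 1 else 0) ∨
    ((searchCmd.run s).reg 55 = 0 ∧ ¬ ∃ S, Small R T P k S) := by
  obtain ⟨s₁, hs₁⟩ : ∃ s₁, s₁ = (assign 55 (.num 0)).run s := ⟨_, rfl⟩
  have h1 : Ready R T P k L m s₁ := by rw [hs₁]; exact h.run rfl
  have h0 : Sound R T P k s₁ := .inl (by rw [hs₁]; simp)
  obtain ⟨st, hit⟩ := step_rep (R := R) (T := T) (P := P) (k := k) (s := s₁) (x := 56) (b := 17)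
    (c := seq removeOut searchIn) (by decide) fun _ s' _ _ hag =>
      step_searchCmd_body (h1.of_agree rfl hag) hPT
  have hrun : searchCmd.run s = (rep 56 17 (seq removeOut searchIn)).run s₁ := by rw [hs₁]; rfl
  rw [hrun]
  obtain ⟨s₃, hs₃⟩ : ∃ s₃, s₃ = (rep 56 17 (seq removeOut searchIn)).run s₁ := ⟨_, rfl⟩
  rw [← hs₃] at st hit ⊢
  by_cases hex : ∃ S, Small R T P k S
  · refine .inl ?_
    have h55 : s₃.reg 55 = 1 := by
      obtain ⟨S₀, hS₀⟩ := hex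
      obtain ⟨S, hE, hSc⟩ := exists_extremal hS₀.sol hS₀.sub
      have hk := hSc.trans hS₀.card_le
      have ht := hE.tight hPT
      obtain ⟨a, z, hz, hSC, hcert⟩ := exists_guess ht hk hL hm hm0
      obtain ⟨code, hc, hcode⟩ := exists_code_guess (N := N) (L := L) hz
      refine hit code (by rw [h1.r17]; exact hc) fun s' hx hag => ?_
      have h' : Ready R T P k L m s' := h1.of_agree rfl hag
      have hg := hcode 56 s' h'.env.N_eq h'.r14 h'.r15 h'.r16 h'.r20 hx
        (by rw [hx, h'.r17]; exact hc.le)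
      obtain ⟨r1, r2⟩ := run_removeOut h' hg
      rw [run_seq]
      have h2 : Ready R T P k L m (removeOut.run s') := h'.run rfl
      generalize removeOut.run s' = s₂ at *
      refine run_searchIn h2 hPT hL hm hm0 hE hk rfl ?_ ?_ (r2 S hE.sub ht hk hSC)
      · rw [Finset.disjoint_left]
        intro v hv
        obtain ⟨Y, hY⟩ := r1 v hv
        exact hcert v Y hY
      · rw [Finset.disjoint_left]
        intro v hv
        obtain ⟨Y, hY⟩ := r1 v hv
        exact hY.not_mem_terminals
    rcases st.1 h0 with h | h
    · rw [h55] at h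
      exact absurd h (by decide)
    · exact h
  · rcases st.1 h0 with h | ⟨-, S, hS, -⟩
    · exact .inr ⟨h, hex⟩
    · exact absurd ⟨S, hS⟩ hex

end Search
end DirectedMultiwayCut

namespace DirectedMultiwayCut
open Cmd Relation

/-! ### The parameters of the search -/

/-- The multiples of the register `x`, in array `a`. -/
def tableCmd (x a : ℕ) : Cmd := seq (assign 60 (.num 0))
  (rep 30 x (seq (store a (.reg 30) (.reg 60)) (assign 60 (.reg 60 + .reg x))))

theorem run_tableCmd {s : State} {x a : ℕ} (hx : x ≠ 30) (hx' : x ≠ 60) :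
    ∀ i < s.reg x, ((tableCmd x a).run s).arr a i = i * s.reg x := by
  have key := run_rep (x := 30) (b := x) (s := (assign 60 (.num 0)).run s)
    (c := seq (store a (.reg 30) (.reg 60)) (assign 60 (.reg 60 + .reg x)))
    (fun n s' => s'.reg 60 = n * s.reg x ∧ ∀ i < n, s'.arr a i = i * s.reg x) (by simp) (by
      rintro n s' hn h30 hag ⟨i1, i2⟩
      have e : s'.reg x = s.reg x := by
        rw [hag.reg x (by simp [wr, hx, hx']), run_reg _ _ (by simp [wr, hx'])]
      refine ⟨?_, fun i hi => ?_⟩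
      · simp [i1, e, add_mul]
      · simp only [run_seq, run_store, run_assign, State.setReg_arr, State.setArr_arr, if_true,
          Function.update_apply, Expr.eval_reg, h30]
        split_ifs with h
        · rw [h, i1]
        · exact i2 i (by omega))
  have e : ((assign 60 (.num 0)).run s).reg x = s.reg x := run_reg _ _ (by simp [wr, hx'])
  rw [e] at key
  exact key.2

/-- The number of doublings that lead from `1` to the register `x`, in the register `d`. -/
def logCmd (x d : ℕ) : Cmd := seq (assign 61 (.num 1)) (seq (assign d (.num 0))
  (rep 30 x (ite (.reg x - .reg 61) (seq (assign 61 (.reg 61 + .reg 61))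
    (assign d (.reg d + .num 1))) skip)))

theorem run_logCmd {s : State} {x d : ℕ} (hx : x < 30) (hd : 61 < d) :
    s.reg x ≤ 2 ^ ((logCmd x d).run s).reg d ∧
      2 ^ ((logCmd x d).run s).reg d ≤ 2 * s.reg x + 1 := by
  obtain ⟨s₁, hs₁⟩ : ∃ s₁, s₁ = (assign d (.num 0)).run ((assign 61 (.num 1)).run s) := ⟨_, rfl⟩
  have e : s₁.reg x = s.reg x := by
    rw [hs₁, run_reg _ _ (by simp [wr]; omega), run_reg _ _ (by simp [wr]; omega)]
  have key := run_rep (x := 30) (b := x) (s := s₁)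
    (c := ite (.reg x - .reg 61) (seq (assign 61 (.reg 61 + .reg 61))
      (assign d (.reg d + .num 1))) skip)
    (fun n s' => s'.reg 61 = 2 ^ s'.reg d ∧ (s'.reg 61 < s.reg x → s'.reg d = n) ∧
      s'.reg 61 ≤ 2 * s.reg x + 1)
    (by
      have h1 : 61 ≠ d := by omega
      have h2 : d ≠ 30 := by omega
      simp [hs₁, h1, h2])
    (by
      rintro n s' hn h30 hag ⟨i1, i2, i3⟩
      have e' : s'.reg x = s.reg x := by
        rw [hag.reg x (by simp [wr]; omega), e]
      have h1 : 61 ≠ d := by omega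
      have h2 : d ≠ 30 := by omega
      have h3 : d ≠ 61 := by omega
      simp only [run_ite, run_seq, run_skip, run_assign, Expr.eval_sub, Expr.eval_reg, e']
      by_cases hc : s.reg x - s'.reg 61 = 0
      · rw [if_pos hc]
        simp only [State.setReg_reg, h2, if_false, Nat.reduceEqDiff]
        exact ⟨i1, fun h => by omega, i3⟩
      · rw [if_neg hc]
        have := i2 (by omega)
        simp only [State.setReg_reg, h1, h2, h3, if_false, Nat.reduceEqDiff, if_true,
          Expr.eval_add, Expr.eval_reg, Expr.eval_num]
        refine ⟨by rw [pow_succ, i1]; omega, fun h => by omega, by omega⟩)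
  rw [e] at key
  obtain ⟨k1, k2, k3⟩ := key
  have hrun : (logCmd x d).run s = (rep 30 x (ite (.reg x - .reg 61)
    (seq (assign 61 (.reg 61 + .reg 61)) (assign d (.reg d + .num 1))) skip)).run s₁ := by
    rw [hs₁]; rfl
  rw [hrun, ← k1]
  refine ⟨?_, k3⟩
  by_contra hc
  have h1 := k2 (by omega)
  rw [h1] at k1
  have := Nat.lt_two_pow_self (n := s.reg x)
  omega

/-- The register `d` becomes two to the power of the register `x`. -/
def powCmd (x d : ℕ) : Cmd := seq (assign d (.num 1)) (rep 30 x (assign d (.reg d + .reg d)))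

theorem run_powCmd {s : State} {x d : ℕ} (hd : d ≠ 30) (hxd : x ≠ d) :
    ((powCmd x d).run s).reg d = 2 ^ s.reg x := by
  have key := run_rep (x := 30) (b := x) (s := (assign d (.num 1)).run s)
    (c := assign d (.reg d + .reg d)) (fun n s' => s'.reg d = 2 ^ n) (by simp [hd]) (by
      intro n s' _ _ _ ih
      simp only [run_assign, State.setReg_reg, hd, if_false, if_true, Expr.eval_add, Expr.eval_reg,
        ih, pow_succ]
      omega)
  have e : ((assign d (.num 1)).run s).reg x = s.reg x := run_reg _ _ (by simp [wr, hxd])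
  rw [e] at key
  exact key

/-- Add a multiple of the register `14` to the register `d`. -/
def mulCmd (x d : ℕ) : Cmd := rep 30 x (assign d (.reg d + .reg 14))

theorem run_mulCmd {s : State} {x d : ℕ} (hd : d ≠ 30) (hd' : d ≠ 14) :
    ((mulCmd x d).run s).reg d = s.reg d + s.reg x * s.reg 14 := by
  refine run_rep (x := 30) (b := x) (s := s) (c := assign d (.reg d + .reg 14))
    (fun n s' => s'.reg d = s.reg d + n * s.reg 14) (by simp [hd]) ?_
  intro n s' _ _ hag ih
  have e : s'.reg 14 = s.reg 14 := hag.reg 14 (by simp [wr, hd'.symm])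
  simp only [run_assign, State.setReg_reg, hd, if_false, if_true, Expr.eval_add, Expr.eval_reg,
    ih, e]
  ring

/-- The sizes that need no loop. -/
def sizesCmd : Cmd := seq (assign 11 (.reg 10 + .reg 10 + .num 2))
  (seq (assign 12 (.reg 1 + .num 1)) (assign 13 (.reg 1 + .reg 1)))

/-- The tables of multiples. -/
def tablesCmd : Cmd := seq (tableCmd 10 10) (tableCmd 11 11)

/-- The numbers `L` and `m`. -/
def lengthsCmd : Cmd := seq (logCmd 12 62) (seq (logCmd 10 63)
  (seq (assign 14 (.reg 62 + .reg 62 + .reg 62 + .reg 62 + .num 2))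
  (seq (assign 15 (.reg 14 + .reg 63 + .num 1))
  (seq (mulCmd 1 15) (seq (mulCmd 1 15) (seq (mulCmd 1 15) (assign 16 (.reg 15 + .reg 15))))))))

/-- The numbers of guesses. -/
def powersCmd : Cmd := seq (powCmd 16 17) (seq (powCmd 13 18) (seq (assign 20 (.num 0))
  (mulCmd 10 20)))

/-- Compute all parameters. -/
def setupCmd : Cmd := seq sizesCmd (seq tablesCmd (seq lengthsCmd powersCmd))

/-- The requirements on the parameters. -/
structure Parameters (N k L m : ℕ) : Prop where
  density : 4 * (k + 1) ^ 4 ≤ 2 ^ L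
  length : 2 ^ (3 * k * L) * (N * L) < 2 ^ m
  pos : 0 < m
  le : 2 ^ m ≤ (1024 * (k + 1) ^ 4) ^ (3 * k + 1) * (8 * (N + 1))
  dom : 2 * k ≤ 2 * m
  N_le : N ≤ 2 ^ m
  L_le : L ≤ m

theorem parameters_of_logs {N k l lN : ℕ} (h1 : k + 1 ≤ 2 ^ l) (h2 : 2 ^ l ≤ 2 * (k + 1) + 1)
    (h3 : N ≤ 2 ^ lN) (h4 : 2 ^ lN ≤ 2 * N + 1) :
    Parameters N k (4 * l + 2) (4 * l + 2 + lN + 1 + 3 * k * (4 * l + 2)) := by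
  have hL : 2 ^ (4 * l + 2) = 4 * (2 ^ l) ^ 4 := by rw [pow_add, ← pow_mul, mul_comm l 4]; ring
  have hm : 2 ^ (4 * l + 2 + lN + 1 + 3 * k * (4 * l + 2)) =
      2 ^ (3 * k * (4 * l + 2)) * (2 * (2 ^ lN * 2 ^ (4 * l + 2))) := by
    rw [pow_add, pow_add, pow_add]; ring
  have hk : k ≤ 3 * k * (4 * l + 2) := by
    calc k = 1 * k * 1 := by ring
      _ ≤ 3 * k * (4 * l + 2) := by gcongr <;> omega
  have hle : 2 ^ (4 * l + 2) ≤ 1024 * (k + 1) ^ 4 := by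
    calc 2 ^ (4 * l + 2) = 4 * (2 ^ l) ^ 4 := hL
      _ ≤ 4 * (4 * (k + 1)) ^ 4 := by gcongr; omega
      _ = 1024 * (k + 1) ^ 4 := by ring
  refine ⟨?_, ?_, by omega, ?_, by omega, ?_, by omega⟩
  · rw [hL]
    gcongr
  · rw [hm]
    refine Nat.mul_lt_mul_of_pos_left ?_ (by positivity)
    have hpos : 0 < 2 ^ lN * 2 ^ (4 * l + 2) := by positivity
    calc N * (4 * l + 2) ≤ 2 ^ lN * 2 ^ (4 * l + 2) := Nat.mul_le_mul h3 Nat.lt_two_pow_self.le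
      _ < 2 * (2 ^ lN * 2 ^ (4 * l + 2)) := by omega
  · rw [hm, mul_comm (3 * k), pow_mul]
    calc (2 ^ (4 * l + 2)) ^ (3 * k) * (2 * (2 ^ lN * 2 ^ (4 * l + 2)))
        ≤ (1024 * (k + 1) ^ 4) ^ (3 * k) * (2 * ((2 * N + 1) * (1024 * (k + 1) ^ 4))) := by gcongr
      _ = (1024 * (k + 1) ^ 4) ^ (3 * k + 1) * (2 * (2 * N + 1)) := by rw [pow_succ]; ring
      _ ≤ (1024 * (k + 1) ^ 4) ^ (3 * k + 1) * (8 * (N + 1)) := Nat.mul_le_mul_left _ (by omega)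
  · refine h3.trans (Nat.pow_le_pow_right (by omega) (by omega))

theorem run_lengthsCmd {N k : ℕ} {s : State} (h1 : s.reg 1 = k) (h10 : s.reg 10 = N)
    (h12 : s.reg 12 = k + 1) : ∃ L m, Parameters N k L m ∧ (lengthsCmd.run s).reg 14 = L ∧
      (lengthsCmd.run s).reg 15 = m ∧ (lengthsCmd.run s).reg 16 = 2 * m := by
  obtain ⟨a1, a2⟩ := run_logCmd (s := s) (x := 12) (d := 62) (by decide) (by decide)
  obtain ⟨s₁, hs₁⟩ : ∃ s₁, s₁ = (logCmd 12 62).run s := ⟨_, rfl⟩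
  rw [← hs₁, h12] at a1 a2
  obtain ⟨b1, b2⟩ := run_logCmd (s := s₁) (x := 10) (d := 63) (by decide) (by decide)
  have e10 : s₁.reg 10 = N := by rw [hs₁, run_reg _ _ rfl, h10]
  obtain ⟨s₂, hs₂⟩ : ∃ s₂, s₂ = (logCmd 10 63).run s₁ := ⟨_, rfl⟩
  rw [← hs₂, e10] at b1 b2
  have e62 : s₂.reg 62 = s₁.reg 62 := by rw [hs₂, run_reg _ _ rfl]
  have e1 : s₂.reg 1 = k := by rw [hs₂, run_reg _ _ rfl, hs₁, run_reg _ _ rfl, h1]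
  rw [← e62] at a1 a2
  refine ⟨_, _, parameters_of_logs a1 a2 b1 b2, ?_⟩
  obtain ⟨s₃, hs₃⟩ : ∃ s₃, s₃ = (assign 15 (.reg 14 + .reg 63 + .num 1)).run
    ((assign 14 (.reg 62 + .reg 62 + .reg 62 + .reg 62 + .num 2)).run s₂) := ⟨_, rfl⟩
  have c14 : s₃.reg 14 = 4 * s₂.reg 62 + 2 := by
    rw [hs₃]
    simp
    omega
  have c15 : s₃.reg 15 = s₃.reg 14 + s₂.reg 63 + 1 := by
    rw [hs₃]
    simp
  have c1 : s₃.reg 1 = k := by rw [hs₃, run_reg _ _ rfl, run_reg _ _ rfl, e1]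
  have m1 := run_mulCmd (s := s₃) (x := 1) (d := 15) (by decide) (by decide)
  obtain ⟨s₄, hs₄⟩ : ∃ s₄, s₄ = (mulCmd 1 15).run s₃ := ⟨_, rfl⟩
  have m2 := run_mulCmd (s := s₄) (x := 1) (d := 15) (by decide) (by decide)
  obtain ⟨s₅, hs₅⟩ : ∃ s₅, s₅ = (mulCmd 1 15).run s₄ := ⟨_, rfl⟩
  have m3 := run_mulCmd (s := s₅) (x := 1) (d := 15) (by decide) (by decide)
  obtain ⟨s₆, hs₆⟩ : ∃ s₆, s₆ = (mulCmd 1 15).run s₅ := ⟨_, rfl⟩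
  rw [← hs₄] at m1
  rw [← hs₅] at m2
  rw [← hs₆] at m3
  have d1 : s₄.reg 1 = k := by rw [hs₄, run_reg _ _ rfl, c1]
  have d14 : s₄.reg 14 = s₃.reg 14 := by rw [hs₄, run_reg _ _ rfl]
  have f1 : s₅.reg 1 = k := by rw [hs₅, run_reg _ _ rfl, d1]
  have f14 : s₅.reg 14 = s₃.reg 14 := by rw [hs₅, run_reg _ _ rfl, d14]
  have g14 : s₆.reg 14 = s₃.reg 14 := by rw [hs₆, run_reg _ _ rfl, f14]
  have g15 : s₆.reg 15 = 4 * s₂.reg 62 + 2 + s₂.reg 63 + 1 + 3 * k * (4 * s₂.reg 62 + 2) := by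
    rw [m3, m2, m1, f14, d14, f1, d1, c1, c15, c14]
    ring
  have hrun : lengthsCmd.run s = (assign 16 (.reg 15 + .reg 15)).run s₆ := by
    rw [hs₆, hs₅, hs₄, hs₃, hs₂, hs₁]; rfl
  rw [hrun]
  refine ⟨by rw [run_reg _ _ rfl, g14, c14], by rw [run_reg _ _ rfl, g15], ?_⟩
  simp only [run_assign, State.setReg_reg, if_true, Expr.eval_add, Expr.eval_reg, g15]
  ring

theorem run_setupCmd {N k : ℕ} {s : State} (h1 : s.reg 1 = k) (h10 : s.reg 10 = N) :
    ∃ L m, Parameters N k L m ∧ Ready (adj N (s.arr 12)) (vset N (s.arr 13)) (vset N (s.arr 14)) k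
      L m (setupCmd.run s) := by
  obtain ⟨s₁, hs₁⟩ : ∃ s₁, s₁ = sizesCmd.run s := ⟨_, rfl⟩
  have a1 : s₁.reg 1 = k := by rw [hs₁, run_reg _ _ rfl, h1]
  have a10 : s₁.reg 10 = N := by rw [hs₁, run_reg _ _ rfl, h10]
  have a11 : s₁.reg 11 = N + N + 2 := by simp [hs₁, sizesCmd, h10]
  have a12 : s₁.reg 12 = k + 1 := by simp [hs₁, sizesCmd, h1]
  have a13 : s₁.reg 13 = 2 * k := by simp [hs₁, sizesCmd, h1]; omega
  have t10 := run_tableCmd (s := s₁) (x := 10) (a := 10) (by decide) (by decide)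
  obtain ⟨s₂, hs₂⟩ : ∃ s₂, s₂ = (tableCmd 10 10).run s₁ := ⟨_, rfl⟩
  have b11 : s₂.reg 11 = N + N + 2 := by rw [hs₂, run_reg _ _ rfl, a11]
  have t11 := run_tableCmd (s := s₂) (x := 11) (a := 11) (by decide) (by decide)
  obtain ⟨s₃, hs₃⟩ : ∃ s₃, s₃ = (tableCmd 11 11).run s₂ := ⟨_, rfl⟩
  rw [← hs₂, a10] at t10
  rw [← hs₃, b11] at t11
  have c : ∀ y, (tableCmd 10 10).wr y = false → (tableCmd 11 11).wr y = false →
      s₃.reg y = s₁.reg y := fun y h h' => by rw [hs₃, run_reg _ _ h', hs₂, run_reg _ _ h]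
  obtain ⟨L, m, hp, d14, d15, d16⟩ := run_lengthsCmd (s := s₃) (N := N) (k := k)
    (by rw [c 1 rfl rfl, a1]) (by rw [c 10 rfl rfl, a10]) (by rw [c 12 rfl rfl, a12])
  obtain ⟨s₄, hs₄⟩ : ∃ s₄, s₄ = lengthsCmd.run s₃ := ⟨_, rfl⟩
  rw [← hs₄] at d14 d15 d16
  have d13 : s₄.reg 13 = 2 * k := by rw [hs₄, run_reg _ _ rfl, c 13 rfl rfl, a13]
  have p17 := run_powCmd (s := s₄) (x := 16) (d := 17) (by decide) (by decide)
  obtain ⟨s₅, hs₅⟩ : ∃ s₅, s₅ = (powCmd 16 17).run s₄ := ⟨_, rfl⟩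
  rw [← hs₅, d16] at p17
  have p18 := run_powCmd (s := s₅) (x := 13) (d := 18) (by decide) (by decide)
  have e13 : s₅.reg 13 = 2 * k := by rw [hs₅, run_reg _ _ rfl, d13]
  obtain ⟨s₆, hs₆⟩ : ∃ s₆, s₆ = (assign 20 (.num 0)).run ((powCmd 13 18).run s₅) := ⟨_, rfl⟩
  have f18 : s₆.reg 18 = 2 ^ (2 * k) := by rw [hs₆, run_reg _ _ rfl, p18, e13]
  have f20 : s₆.reg 20 = 0 := by rw [hs₆]; simp
  have g : ∀ y, powersCmd.wr y = false → s₆.reg y = s₄.reg y := fun y h => by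
    simp only [powersCmd, wr, Bool.or_eq_false_iff] at h
    rw [hs₆, run_reg (assign 20 (.num 0)) _ h.2.2.1, run_reg _ _ h.2.1, hs₅, run_reg _ _ h.1]
  have f10 : s₆.reg 10 = N := by
    rw [g 10 rfl, hs₄, run_reg _ _ rfl, c 10 rfl rfl, a10]
  have m20 := run_mulCmd (s := s₆) (x := 10) (d := 20) (by decide) (by decide)
  rw [f20, f10, g 14 rfl, d14] at m20
  have hrun : setupCmd.run s = (mulCmd 10 20).run s₆ := by
    rw [hs₆, hs₅, hs₄, hs₃, hs₂, hs₁]; rfl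
  have ha : ∀ a, (setupCmd.run s).arr a = s₃.arr a := fun a => by
    rw [hrun, run_arr _ _ rfl, hs₆, run_arr _ _ rfl, run_arr _ _ rfl, hs₅, run_arr _ _ rfl, hs₄,
      run_arr _ _ rfl]
  have ha' : ∀ a, setupCmd.wa a = false → (setupCmd.run s).arr a = s.arr a :=
    fun a h => run_arr _ _ h
  have hq : ∀ y, powersCmd.wr y = false → (setupCmd.run s).reg y = s₄.reg y := fun y h => by
    have h' := h
    simp only [powersCmd, wr, Bool.or_eq_false_iff] at h'
    rw [hrun, run_reg _ _ (by simpa [mulCmd, wr] using h'.2.2.2), g y h]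
  refine ⟨L, m, hp, ⟨?_, ?_, ?_, ?_, fun u hu => ?_, fun u hu => ?_⟩, ?_, ?_, ?_, ?_, ?_, ?_, ?_, ?_,
    ?_, ?_⟩
  · rw [hq 1 rfl, hs₄, run_reg _ _ rfl, c 1 rfl rfl, a1]
  · rw [hq 10 rfl, hs₄, run_reg _ _ rfl, c 10 rfl rfl, a10]
  · rw [hq 11 rfl, hs₄, run_reg _ _ rfl, c 11 rfl rfl, a11]
  · rw [hq 12 rfl, hs₄, run_reg _ _ rfl, c 12 rfl rfl, a12]
  · rw [ha 10, hs₃, run_arr _ _ rfl, t10 u hu]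
  · rw [ha 11, t11 u hu]
  · rw [ha' 12 rfl]
  · rw [ha' 13 rfl]
  · rw [ha' 14 rfl]
  · rw [hq 13 rfl, d13]
  · rw [hq 14 rfl, d14]
  · rw [hq 15 rfl, d15]
  · rw [hq 16 rfl, d16]
  · rw [hrun, run_reg _ _ rfl, hs₆, run_reg _ _ rfl, run_reg _ _ rfl, p17]
  · rw [hrun, run_reg _ _ rfl, f18]
  · rw [hrun, m20]
    omega

end DirectedMultiwayCut

namespace DirectedMultiwayCut
open Cmd Relation

/-! ### Running times -/

/-- The command does not touch the parameters of the search. -/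
def Cmd.keepsParameters (c : Cmd) : Bool :=
  c.keepsEnv && !c.wr 13 && !c.wr 14 && !c.wr 15 && !c.wr 16 && !c.wr 17 && !c.wr 18 && !c.wr 20

theorem Ready.reload {N : ℕ} {R R' : Fin N → Fin N → Prop} {T P T' P' : Finset (Fin N)}
    {k L m : ℕ} {s : State} (h : Ready R T P k L m s) {c : Cmd} (hc : c.keepsParameters = true)
    (hR : adj N ((c.run s).arr 12) = R') (hT : vset N ((c.run s).arr 13) = T')
    (hP : vset N ((c.run s).arr 14) = P') : Ready R' T' P' k L m (c.run s) := by
  simp only [keepsParameters, Bool.and_eq_true, Bool.not_eq_true'] at hc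
  obtain ⟨⟨⟨⟨⟨⟨⟨h0, h4⟩, h5⟩, h6⟩, h7⟩, h8⟩, h9⟩, h10⟩ := hc
  exact ⟨h.env.run h0, hR, hT, hP, by rw [run_reg _ _ h4, h.r13], by rw [run_reg _ _ h5, h.r14],
    by rw [run_reg _ _ h6, h.r15], by rw [run_reg _ _ h7, h.r16], by rw [run_reg _ _ h8, h.r17],
    by rw [run_reg _ _ h9, h.r18], by rw [run_reg _ _ h10, h.r20]⟩

/-- The registers that bound loops in the search. -/
def bounds : List ℕ := [1, 10, 11, 12, 13, 14, 15, 16, 17, 18, 20]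

theorem Ready.reg_le {N : ℕ} {R : Fin N → Fin N → Prop} {T P : Finset (Fin N)}
    {k L m : ℕ} {s : State} (h : Ready R T P k L m s) (hp : Parameters N k L m) :
    ∀ b ∈ bounds, s.reg b ≤ 4 * (2 ^ m) ^ 2 := by
  have h1 : m < 2 ^ m := Nat.lt_two_pow_self
  have h2 : 2 ^ m ≤ (2 ^ m) ^ 2 := Nat.le_self_pow (by omega) _
  have h3 := hp.N_le
  have h4 := hp.L_le
  have h5 := hp.dom
  have h6 : 2 ^ (2 * m) = (2 ^ m) ^ 2 := by rw [mul_comm, pow_mul]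
  have h7 : 2 ^ (2 * k) ≤ 2 ^ (2 * m) := Nat.pow_le_pow_right (by omega) h5
  have h8 : N * L < 2 ^ m := lt_of_le_of_lt (Nat.le_mul_of_pos_left _ (by positivity)) hp.length
  simp only [bounds, List.mem_cons, List.not_mem_nil, or_false, forall_eq_or_imp, forall_eq,
    h.env.k_eq, h.env.N_eq, h.env.M_eq, h.env.k_succ, h.r13, h.r14, h.r15, h.r16, h.r17, h.r18,
    h.r20]
  generalize 2 ^ m = Q at *
  generalize Q ^ 2 = Q2 at *
  refine ⟨?_, ?_, ?_, ?_, ?_, ?_, ?_, ?_, ?_, ?_, ?_⟩ <;> omega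

/-- All loops of `c` are bounded by registers of the list, and `c` does not write these. -/
def Cmd.boundedBy (c : Cmd) (l : List ℕ) : Bool := 
  c.bds.all l.contains && l.all fun b => !c.wr b

theorem Cmd.time_le_of_boundedBy {c : Cmd} {l : List ℕ} (hc : c.boundedBy l = true) {B : ℕ}
    {s : State} (h : ∀ b ∈ l, s.reg b ≤ B) : c.time s ≤ c.tb B := by
  simp only [boundedBy, List.all_eq_true, Bool.and_eq_true, List.contains_iff_mem,
    Bool.not_eq_true'] at hc
  exact time_le c s fun b hb => ⟨hc.2 b (hc.1 b hb), h b (hc.1 b hb)⟩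

theorem time_setupCmd {B : ℕ} {s : State} (h : ∀ b ∈ bounds, (setupCmd.run s).reg b ≤ B) :
    setupCmd.time s ≤ setupCmd.tb B := by
  obtain ⟨s₁, hs₁⟩ : ∃ s₁, s₁ = sizesCmd.run s := ⟨_, rfl⟩
  obtain ⟨s₂, hs₂⟩ : ∃ s₂, s₂ = tablesCmd.run s₁ := ⟨_, rfl⟩
  obtain ⟨s₃, hs₃⟩ : ∃ s₃, s₃ = lengthsCmd.run s₂ := ⟨_, rfl⟩
  have hrun : setupCmd.run s = powersCmd.run s₃ := by rw [hs₃, hs₂, hs₁]; rfl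
  have htime : setupCmd.time s = sizesCmd.time s + (tablesCmd.time s₁ + (lengthsCmd.time s₂ +
    powersCmd.time s₃)) := by rw [hs₃, hs₂, hs₁]; rfl
  rw [hrun] at h
  have f3 : ∀ b ∈ [16, 13, 10], s₃.reg b ≤ B := by
    intro b hb
    rw [← run_reg powersCmd s₃ (show powersCmd.wr b = false by revert b; decide)]
    exact h b (by revert b; decide)
  have f2 : ∀ b ∈ [12, 10, 1], s₂.reg b ≤ B := by
    intro b hb
    rw [← run_reg lengthsCmd s₂ (show lengthsCmd.wr b = false by revert b; decide), ← hs₃,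
      ← run_reg powersCmd s₃ (show powersCmd.wr b = false by revert b; decide)]
    exact h b (by revert b; decide)
  have f1 : ∀ b ∈ [10, 11], s₁.reg b ≤ B := by
    intro b hb
    rw [← run_reg tablesCmd s₁ (show tablesCmd.wr b = false by revert b; decide), ← hs₂,
      ← run_reg lengthsCmd s₂ (show lengthsCmd.wr b = false by revert b; decide), ← hs₃,
      ← run_reg powersCmd s₃ (show powersCmd.wr b = false by revert b; decide)]
    exact h b (by revert b; decide)
  rw [htime]
  exact Nat.add_le_add (time_le_of_boundedBy (l := []) rfl (by simp)) (Nat.add_le_add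
    (time_le_of_boundedBy rfl f1) (Nat.add_le_add (time_le_of_boundedBy rfl f2)
      (time_le_of_boundedBy rfl f3)))

set_option maxRecDepth 10000 in
theorem searchCmd_boundedBy : searchCmd.boundedBy bounds = true := rfl

/-- Run the search on an instance that is computed from the input. -/
def solve (size load answer : Cmd) : Cmd :=
  seq size (seq setupCmd (seq load (seq searchCmd answer)))

theorem pow_bound (k : ℕ) : (1024 * (k + 1) ^ 4) ^ (3 * k + 1) ≤ 2 ^ 60 * k ^ (72 * k) := by
  rcases Nat.lt_or_ge k 2 with hk | hk
  · interval_cases k <;> norm_num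
  · have h1 : 1024 ≤ k ^ 10 := le_trans (by norm_num) (Nat.pow_le_pow_left hk 10)
    have h2 : k + 1 ≤ k ^ 2 := by nlinarith
    calc (1024 * (k + 1) ^ 4) ^ (3 * k + 1) ≤ (k ^ 10 * (k ^ 2) ^ 4) ^ (3 * k + 1) := by gcongr
      _ = k ^ (18 * (3 * k + 1)) := by rw [← pow_mul, ← pow_add, ← pow_mul]
      _ ≤ k ^ (72 * k) := Nat.pow_le_pow_right (by omega) (by omega)
      _ ≤ 2 ^ 60 * k ^ (72 * k) := Nat.le_mul_of_pos_left _ (by positivity)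

theorem time_bound (K d : ℕ) : ∃ c : ℕ, ∀ n N k L m : ℕ, Parameters N k L m → N ≤ n + n * n →
    K * (4 * (2 ^ m) ^ 2 + 1) ^ d ≤ c * k ^ (c * k) * (n + 1) ^ c := by
  refine ⟨K * 2 ^ (130 * d) + 144 * d, fun n N k L m hp hN => ?_⟩
  set c := K * 2 ^ (130 * d) + 144 * d with hc
  have h1 : 1 ≤ 2 ^ m := Nat.one_le_two_pow
  have h2 : 2 ^ m ≤ 2 ^ 63 * k ^ (72 * k) * (n + 1) ^ 2 := by
    calc 2 ^ m ≤ (1024 * (k + 1) ^ 4) ^ (3 * k + 1) * (8 * (N + 1)) := hp.le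
      _ ≤ (2 ^ 60 * k ^ (72 * k)) * (8 * (n + 1) ^ 2) :=
        Nat.mul_le_mul (pow_bound k) (by nlinarith)
      _ = 2 ^ 63 * k ^ (72 * k) * (n + 1) ^ 2 := by ring
  have hpow : k ^ (144 * d * k) ≤ k ^ (c * k) := by
    rcases Nat.eq_zero_or_pos k with h | h
    · simp [h]
    · exact Nat.pow_le_pow_right h (Nat.mul_le_mul_right _ (by omega))
  calc K * (4 * (2 ^ m) ^ 2 + 1) ^ d ≤ K * ((4 * (2 ^ 63 * k ^ (72 * k) * (n + 1) ^ 2)) ^ 2) ^ d := by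
        refine Nat.mul_le_mul_left _ (Nat.pow_le_pow_left ?_ _)
        calc 4 * (2 ^ m) ^ 2 + 1 ≤ (4 * 2 ^ m) ^ 2 := by nlinarith
          _ ≤ _ := by gcongr
    _ = K * 2 ^ (130 * d) * k ^ (144 * d * k) * (n + 1) ^ (4 * d) := by
        rw [← pow_mul, show 4 * (2 ^ 63 * k ^ (72 * k) * (n + 1) ^ 2) =
          2 ^ 65 * k ^ (72 * k) * (n + 1) ^ 2 by ring, mul_pow, mul_pow, ← pow_mul, ← pow_mul,
          ← pow_mul, show 65 * (2 * d) = 130 * d by ring, show 72 * k * (2 * d) = 144 * d * k by ring,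
          show 2 * (2 * d) = 4 * d by ring]
        ring
    _ ≤ c * k ^ (c * k) * (n + 1) ^ c := by
        refine Nat.mul_le_mul (Nat.mul_le_mul (by omega) hpow)
          (Nat.pow_le_pow_right (by omega) (by omega))

theorem exists_time_solve {size load answer : Cmd} (h1 : size.boundedBy [0] = true)
    (h2 : load.boundedBy [0, 10] = true) (h3 : answer.boundedBy [10] = true)
    (hload : load.keepsParameters = true) (h0 : size.wr 0 = false) (h1' : size.wr 1 = false) :
    ∃ c : ℕ, ∀ (s : State) (N : ℕ), (size.run s).reg 10 = N → s.reg 0 ≤ N →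
      N ≤ s.reg 0 + s.reg 0 * s.reg 0 → (solve size load answer).time s ≤
        c * s.reg 1 ^ (c * s.reg 1) * (s.reg 0 + 1) ^ c := by
  obtain ⟨K, d, hK⟩ := exists_tb_le (solve size load answer)
  obtain ⟨c, hc⟩ := time_bound K d
  refine ⟨c, fun s N hN hle hle' => ?_⟩
  obtain ⟨s₁, hs₁⟩ : ∃ s₁, s₁ = size.run s := ⟨_, rfl⟩
  have a1 : s₁.reg 1 = s.reg 1 := by rw [hs₁, run_reg _ _ h1']
  have a0 : s₁.reg 0 = s.reg 0 := by rw [hs₁, run_reg _ _ h0]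
  rw [← hs₁] at hN
  obtain ⟨L, m, hp, hr⟩ := run_setupCmd a1 hN
  obtain ⟨s₂, hs₂⟩ : ∃ s₂, s₂ = setupCmd.run s₁ := ⟨_, rfl⟩
  have hB := hr.reg_le hp
  have tset := time_setupCmd hB
  rw [← hs₂] at hB hr
  have b0 : s₂.reg 0 = s.reg 0 := by rw [hs₂, run_reg _ _ rfl, a0]
  have hr3 := hr.reload hload rfl rfl rfl
  obtain ⟨s₃, hs₃⟩ : ∃ s₃, s₃ = load.run s₂ := ⟨_, rfl⟩
  rw [← hs₃] at hr3
  have hr4 := hr3.run (c := searchCmd) rfl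
  have hB3 := hr3.reg_le hp
  obtain ⟨s₄, hs₄⟩ : ∃ s₄, s₄ = searchCmd.run s₃ := ⟨_, rfl⟩
  rw [← hs₄] at hr4
  have hB4 := hr4.reg_le hp
  have htime : (solve size load answer).time s = size.time s + (setupCmd.time s₁ + (load.time s₂ +
    (searchCmd.time s₃ + answer.time s₄))) := by rw [hs₄, hs₃, hs₂, hs₁]; rfl
  refine le_trans ?_ ((hK _).trans (hc _ N _ L m hp hle'))
  have hN10 : N ≤ 4 * (2 ^ m) ^ 2 := by
    have := hB 10 (by decide)
    rwa [hr.env.N_eq] at this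
  rw [htime]
  refine Nat.add_le_add (time_le_of_boundedBy h1 ?_) (Nat.add_le_add tset (Nat.add_le_add
    (time_le_of_boundedBy h2 ?_) (Nat.add_le_add (time_le_of_boundedBy searchCmd_boundedBy hB3)
      (time_le_of_boundedBy h3 ?_))))
  · intro b hb
    rw [List.mem_singleton.1 hb]
    omega
  · intro b hb
    simp only [List.mem_cons, List.not_mem_nil, or_false] at hb
    rcases hb with rfl | rfl
    · omega
    · exact hB 10 (by decide)
  · intro b hb
    rw [List.mem_singleton.1 hb]
    exact hB4 10 (by decide)

theorem run_solve {size load answer : Cmd} {s : State} {N k : ℕ} (hN : (size.run s).reg 10 = N)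
    (h1 : s.reg 1 = k) (h1' : size.wr 1 = false) (hload : load.keepsParameters = true)
    {R : Fin N → Fin N → Prop} {T P : Finset (Fin N)} (hPT : Disjoint P T)
    (hR : ∀ s', Env N k s' → (∀ y, size.wr y = false → setupCmd.wr y = false → s'.reg y = s.reg y) →
      (∀ a, size.wa a = false → setupCmd.wa a = false → s'.arr a = s.arr a) →
      adj N ((load.run s').arr 12) = R ∧ vset N ((load.run s').arr 13) = T ∧
        vset N ((load.run s').arr 14) = P) :
    ∃ s' : State, s'.reg 10 = N ∧ (∀ y, size.wr y = false → setupCmd.wr y = false →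
        load.wr y = false → searchCmd.wr y = false → s'.reg y = s.reg y) ∧
      (solve size load answer).run s = answer.run s' ∧
      ((s'.reg 55 = 1 ∧ ∃ S, Small R T P k S ∧ ∀ v : Fin N, s'.arr 2 v = if v ∈ S then 1 else 0) ∨
        (s'.reg 55 = 0 ∧ ¬ ∃ S, Small R T P k S)) := by
  obtain ⟨s₁, hs₁⟩ : ∃ s₁, s₁ = size.run s := ⟨_, rfl⟩
  have a1 : s₁.reg 1 = k := by rw [hs₁, run_reg _ _ h1', h1]
  rw [← hs₁] at hN
  obtain ⟨L, m, hp, hr⟩ := run_setupCmd a1 hN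
  obtain ⟨s₂, hs₂⟩ : ∃ s₂, s₂ = setupCmd.run s₁ := ⟨_, rfl⟩
  rw [← hs₂] at hr
  obtain ⟨r1, r2, r3⟩ := hR s₂ hr.env
    (fun y h h' => by rw [hs₂, run_reg _ _ h', hs₁, run_reg _ _ h])
    (fun y h h' => by rw [hs₂, run_arr _ _ h', hs₁, run_arr _ _ h])
  have hr3 := hr.reload hload r1 r2 r3
  obtain ⟨s₃, hs₃⟩ : ∃ s₃, s₃ = load.run s₂ := ⟨_, rfl⟩
  rw [← hs₃] at hr3
  have hfin := run_searchCmd hr3 hPT hp.density hp.length hp.pos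
  have hr4 := hr3.run (c := searchCmd) rfl
  obtain ⟨s₄, hs₄⟩ : ∃ s₄, s₄ = searchCmd.run s₃ := ⟨_, rfl⟩
  rw [← hs₄] at hfin hr4
  refine ⟨s₄, hr4.env.N_eq, fun y e1 e2 e3 e4 => ?_, by rw [hs₄, hs₃, hs₂, hs₁]; rfl, hfin⟩
  rw [hs₄, run_reg _ _ e4, hs₃, run_reg _ _ e3, hs₂, run_reg _ _ e2, hs₁, run_reg _ _ e1]

end DirectedMultiwayCut

namespace DirectedMultiwayCut
open Cmd Relation

/-! ### The vertex version -/

/-- The instance is its own graph. -/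
def vertexSize : Cmd := assign 10 (.reg 0)

/-- Load the instance of the vertex version. -/
def vertexLoad : Cmd :=
  seq (fill₂ 30 10 31 10 10 12 32 (assign 32 (.arr 0 (.arr 10 (.reg 30) + .reg 31))))
  (seq (copyCmd 1 13) (fill 30 10 14 32 (assign 32 (.num 1 - .arr 1 (.reg 30)))))

/-- Report whether a solution has been found. -/
def vertexAnswer : Cmd := assign 0 (.reg 55)

theorem inputState_graph {n : ℕ} (G : Digraph (Fin n)) (T : Finset (Fin n)) (k : ℕ) (u v : Fin n) :
    (inputState G T k).arr 0 ((u : ℕ) * n + v) ≠ 0 ↔ G.Adj u v := by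
  simp only [inputState, if_true]
  split_ifs with h
  · obtain ⟨u', v', h1, h2⟩ := h
    obtain ⟨h3, h4⟩ := position_inj v.2 v'.2 h1
    rw [Fin.ext h3, Fin.ext h4]
    exact ⟨fun _ => h2, fun _ => by decide⟩
  · exact ⟨fun h' => absurd rfl h', fun h' => absurd ⟨u, v, rfl, h'⟩ h⟩

theorem inputState_terminals {n : ℕ} (G : Digraph (Fin n)) (T : Finset (Fin n)) (k : ℕ)
    (i : ℕ) : (inputState G T k).arr 1 i = if ∃ v ∈ T, i = (v : ℕ) then 1 else 0 := by
  simp [inputState]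

theorem inputState_terminals_ne {n : ℕ} (G : Digraph (Fin n)) (T : Finset (Fin n)) (k : ℕ)
    (v : Fin n) : (inputState G T k).arr 1 v ≠ 0 ↔ v ∈ T := by
  rw [inputState_terminals]
  split_ifs with h
  · obtain ⟨v', h1, h2⟩ := h
    rw [Fin.ext h2]
    exact ⟨fun _ => h1, fun _ => by decide⟩
  · exact ⟨fun h' => absurd rfl h', fun h' => absurd ⟨v, h', rfl⟩ h⟩

theorem small_vertex {n : ℕ} {G : Digraph (Fin n)} {T : Finset (Fin n)} {k : ℕ}
    {S : Finset (Fin n)} :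
    Small G.Adj T Tᶜ k S ↔ IsVertexMultiwayCut G T S ∧ S.card ≤ k :=
  ⟨fun h => ⟨⟨Finset.subset_compl_iff_disjoint_right.1 h.sub, h.sol⟩, h.card_le⟩,
    fun h => ⟨h.1.2, Finset.subset_compl_iff_disjoint_right.2 h.1.1, h.2⟩⟩

theorem run_vertexLoad {n k : ℕ} {G : Digraph (Fin n)} {T : Finset (Fin n)} {s : State}
    (h : Env n k s) (h0 : s.arr 0 = (inputState G T k).arr 0)
    (h1 : s.arr 1 = (inputState G T k).arr 1) :
    adj n ((vertexLoad.run s).arr 12) = G.Adj ∧ vset n ((vertexLoad.run s).arr 13) = T ∧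
      vset n ((vertexLoad.run s).arr 14) = Tᶜ := by
  have key := run_fill₂ (x := 30) (bx := 10) (y := 31) (b := 10) (t := 10) (a := 12) (v := 32)
    (c := assign 32 (.arr 0 (.arr 10 (.reg 30) + .reg 31))) (s := s)
    (fun i j => s.arr 0 (i * n + j))
    rfl rfl rfl rfl rfl (by decide) (by decide) (by decide) (by decide)
    (by rw [h.N_eq]; exact h.mulN)
    (by
      intro i hi j hj s' hag hx hy
      rw [h.N_eq] at hi
      have e1 : s'.arr 10 i = i * n := by rw [hag.arr 10 rfl, h.mulN i hi]
      have e2 : s'.arr 0 = s.arr 0 := hag.arr 0 rfl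
      simp [hx, hy, e1, e2])
  rw [h.N_eq] at key
  obtain ⟨s₁, hs₁⟩ : ∃ s₁, s₁ = (fill₂ 30 10 31 10 10 12 32
    (assign 32 (.arr 0 (.arr 10 (.reg 30) + .reg 31)))).run s := ⟨_, rfl⟩
  rw [← hs₁] at key
  have c10 : s₁.reg 10 = n := by rw [hs₁, run_reg _ _ rfl, h.N_eq]
  have c1 : s₁.arr 1 = s.arr 1 := by rw [hs₁, run_arr _ _ rfl]
  have hT := run_copyCmd c10 (a := 1) (b := 13) (by decide)
  obtain ⟨s₂, hs₂⟩ : ∃ s₂, s₂ = (copyCmd 1 13).run s₁ := ⟨_, rfl⟩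
  rw [← hs₂, c1, h1] at hT
  have d10 : s₂.reg 10 = n := by rw [hs₂, run_reg _ _ rfl, c10]
  have d1 : s₂.arr 1 = s.arr 1 := by rw [hs₂, run_arr _ _ rfl, c1]
  have key2 := run_fill (x := 30) (b := 10) (a := 14) (v := 32)
    (c := assign 32 (.num 1 - .arr 1 (.reg 30))) (s := s₂) (fun i => 1 - s.arr 1 i) rfl rfl (by
      intro i hi s' hag hx
      have e : s'.arr 1 = s.arr 1 := by rw [hag.arr 1 rfl, d1]
      simp [hx, e])
  rw [d10, h1] at key2
  have hrun : vertexLoad.run s = (fill 30 10 14 32 (assign 32 (.num 1 - .arr 1 (.reg 30)))).run s₂ := by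
    rw [hs₂, hs₁]; rfl
  rw [hrun]
  refine ⟨?_, ?_, ?_⟩
  · rw [run_arr _ _ rfl, hs₂, run_arr _ _ rfl]
    funext u v
    rw [adj, key u u.2 v v.2, h0]
    exact propext (inputState_graph G T k u v)
  · rw [run_arr _ _ rfl, hT]
    ext v
    rw [mem_vset]
    exact inputState_terminals_ne G T k v
  · ext v
    rw [mem_vset, key2 v v.2, Finset.mem_compl, ← inputState_terminals_ne G T k v,
      inputState_terminals]
    split_ifs <;> simp

theorem exists_vertex_program : ∃ (P : Prog) (c : ℕ),
    ∀ (n : ℕ) (G : Digraph (Fin n)) (T : Finset (Fin n)) (k : ℕ), ∃ (t : ℕ) (s : State),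
      Exec P (inputState G T k) t s ∧ t ≤ c * k ^ (c * k) * (n + 1) ^ c ∧ AnswersVertex G T k s := by
  obtain ⟨c, hc⟩ := exists_time_solve (size := vertexSize) (load := vertexLoad)
    (answer := vertexAnswer) rfl rfl rfl rfl rfl rfl
  refine ⟨(solve vertexSize vertexLoad vertexAnswer).toProg, c, fun n G T k => ⟨_, _,
    exec _ rfl _, hc _ n rfl le_rfl (Nat.le_add_right _ _), ?_⟩⟩
  obtain ⟨s', -, -, hrun, hs'⟩ := run_solve (size := vertexSize) (load := vertexLoad)
    (answer := vertexAnswer) (s := inputState G T k) (N := n) (k := k) rfl rfl rfl rfl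
    (R := G.Adj) (T := T) (P := Tᶜ) disjoint_compl_left
    (fun s' hE _ ha => run_vertexLoad hE (ha 0 rfl rfl) (ha 1 rfl rfl))
  rw [hrun]
  have h0 : (vertexAnswer.run s').reg 0 = s'.reg 55 := by simp [vertexAnswer]
  have h2 : (vertexAnswer.run s').arr 2 = s'.arr 2 := run_arr _ _ rfl
  rw [AnswersVertex, h0, h2]
  simp only [small_vertex, and_assoc] at hs' ⊢
  exact hs'

/-! ### The edge version -/

section Edge

variable {n : ℕ}

/-- The vertex that subdivides the arc `(u, v)`. -/
def arcNode (a : Fin n × Fin n) : Fin (n + n * n) :=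
  ⟨n + ((a.1 : ℕ) * n + a.2), by
    have : (a.1 : ℕ) * n + n ≤ n * n := by
      have h := Nat.mul_le_mul_right n (show (a.1 : ℕ) + 1 ≤ n from a.1.2)
      rwa [add_mul, one_mul] at h
    have := a.2.2
    omega⟩

theorem arcNode_injective : Function.Injective (arcNode (n := n)) := by
  rintro ⟨a, b⟩ ⟨c, d⟩ h
  have h1 : n + ((a : ℕ) * n + b) = n + ((c : ℕ) * n + d) := congrArg Fin.val h
  obtain ⟨h2, h3⟩ := position_inj b.2 d.2 (Nat.add_left_cancel h1)
  rw [Fin.ext h2, Fin.ext h3]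

theorem arcNode_ne (a : Fin n × Fin n) (u : Fin n) : Fin.castAdd (n * n) u ≠ arcNode a := by
  intro h
  have h1 : (u : ℕ) = n + ((a.1 : ℕ) * n + a.2) := congrArg Fin.val h
  omega

theorem eq_castAdd_or_arcNode (x : Fin (n + n * n)) :
    (∃ u, x = Fin.castAdd (n * n) u) ∨ ∃ a, x = arcNode a := by
  by_cases h : (x : ℕ) < n
  · exact .inl ⟨⟨x, h⟩, Fin.ext rfl⟩
  · have hn : 0 < n := by
      by_contra hc
      have h0 : n = 0 := by omega
      have := x.2
      simp [h0] at this
    refine .inr ⟨(⟨(x - n) / n, ?_⟩, ⟨(x - n) % n, Nat.mod_lt _ hn⟩), Fin.ext ?_⟩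
    · rw [Nat.div_lt_iff_lt_mul hn]
      have := x.2
      omega
    · have := Nat.div_add_mod' (x - n : ℕ) n
      simp only [arcNode]
      omega

/-- The graph in which every arc has been subdivided. -/
def subdivision (G : Digraph (Fin n)) (x y : Fin (n + n * n)) : Prop :=
  ∃ a : Fin n × Fin n, G.Adj a.1 a.2 ∧ (x = Fin.castAdd _ a.1 ∧ y = arcNode a ∨
    x = arcNode a ∧ y = Fin.castAdd _ a.2)

open Classical in
/-- The vertices that subdivide the arcs. -/
noncomputable def arcNodes (G : Digraph (Fin n)) : Finset (Fin (n + n * n)) :=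
  (Finset.univ.filter fun a : Fin n × Fin n => G.Adj a.1 a.2).map ⟨arcNode, arcNode_injective⟩

theorem mem_arcNodes {G : Digraph (Fin n)} {a : Fin n × Fin n} :
    arcNode a ∈ arcNodes G ↔ G.Adj a.1 a.2 := by
  simp [arcNodes]

theorem castAdd_not_mem_arcNodes {G : Digraph (Fin n)} {u : Fin n} :
    Fin.castAdd (n * n) u ∉ arcNodes G := by
  intro h
  obtain ⟨a, -, ha⟩ := Finset.mem_map.1 h
  exact arcNode_ne a u ha.symm

/-- The arcs whose subdividing vertex lies in `S`. -/
def arcsOf (S : Finset (Fin (n + n * n))) : Finset (Fin n × Fin n) :=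
  Finset.univ.filter fun a => arcNode a ∈ S

theorem mem_arcsOf {S : Finset (Fin (n + n * n))} {a : Fin n × Fin n} :
    a ∈ arcsOf S ↔ arcNode a ∈ S := by simp [arcsOf]

theorem reach_subdivision {G : Digraph (Fin n)} {S : Finset (Fin (n + n * n))}
    (hS : S ⊆ arcNodes G) {s t : Fin n} :
    ReflTransGen (Av (subdivision G) S) (Fin.castAdd _ s) (Fin.castAdd _ t) ↔
      ReflTransGen (fun u v => G.Adj u v ∧ (u, v) ∉ arcsOf S) s t := by
  have hV : ∀ u : Fin n, Fin.castAdd (n * n) u ∉ S := fun u h => castAdd_not_mem_arcNodes (hS h)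
  constructor
  · intro h
    have key : ∀ x, ReflTransGen (Av (subdivision G) S) (Fin.castAdd _ s) x →
        (∀ u, x = Fin.castAdd _ u →
          ReflTransGen (fun u v => G.Adj u v ∧ (u, v) ∉ arcsOf S) s u) ∧
        ∀ a, x = arcNode a → G.Adj a.1 a.2 ∧
          ReflTransGen (fun u v => G.Adj u v ∧ (u, v) ∉ arcsOf S) s a.1 := by
      intro x hx
      induction hx with
      | refl =>
        refine ⟨fun u hu => ?_, fun a ha => absurd ha (arcNode_ne _ _)⟩
        rw [Fin.castAdd_injective _ _ hu]
      | @tail b c _ hbc ih =>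
        obtain ⟨⟨a, haG, h | h⟩, hb, hc⟩ := hbc
        · refine ⟨fun u hu => absurd (hu.symm.trans h.2) (arcNode_ne _ _), fun a' ha' => ?_⟩
          rw [← arcNode_injective (h.2.symm.trans ha')]
          exact ⟨haG, ih.1 _ h.1⟩
        · refine ⟨fun u hu => ?_, fun a' ha' => absurd (h.2.symm.trans ha') (arcNode_ne _ _)⟩
          rw [← Fin.castAdd_injective _ _ (h.2.symm.trans hu)]
          refine (ih.2 a h.1).2.tail ⟨haG, fun hm => hb ?_⟩
          rw [h.1]
          exact mem_arcsOf.1 hm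
    exact (key _ h).1 t rfl
  · intro h
    induction h with
    | refl => exact .refl
    | @tail b c _ hbc ih =>
      have hm : arcNode (b, c) ∉ S := fun h => hbc.2 (mem_arcsOf.2 h)
      exact (ih.tail ⟨⟨(b, c), hbc.1, .inl ⟨rfl, rfl⟩⟩, hV _, hm⟩).tail
        ⟨⟨(b, c), hbc.1, .inr ⟨rfl, rfl⟩⟩, hm, hV _⟩

/-- The terminals in the subdivided graph. -/
def oldTerminals (T : Finset (Fin n)) : Finset (Fin (n + n * n)) :=
  T.map (Fin.castAddEmb (n * n))

theorem small_subdivision {G : Digraph (Fin n)} {T : Finset (Fin n)} {k : ℕ}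
    {S : Finset (Fin (n + n * n))} (h : Small (subdivision G) (oldTerminals T) (arcNodes G) k S) :
    IsEdgeMultiwayCut G T (arcsOf S) ∧ (arcsOf S).card ≤ k := by
  refine ⟨⟨fun a ha => mem_arcNodes.1 (h.sub (mem_arcsOf.1 ha)), fun s hs t ht hst hp => ?_⟩, ?_⟩
  · exact h.sol _ (Finset.mem_map_of_mem _ hs) _ (Finset.mem_map_of_mem _ ht)
      (fun hc => hst (Fin.castAdd_injective _ _ hc)) ((reach_subdivision h.sub).2 hp)
  · exact (Finset.card_le_card_of_injOn arcNode (fun a ha => mem_arcsOf.1 ha)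
      arcNode_injective.injOn).trans h.card_le

theorem small_of_edge {G : Digraph (Fin n)} {T : Finset (Fin n)} {k : ℕ}
    {F : Finset (Fin n × Fin n)} (h : IsEdgeMultiwayCut G T F) (hF : F.card ≤ k) :
    Small (subdivision G) (oldTerminals T) (arcNodes G) k
      (F.map ⟨arcNode, arcNode_injective⟩) := by
  have hsub : F.map ⟨arcNode, arcNode_injective⟩ ⊆ arcNodes G := by
    intro x hx
    obtain ⟨a, ha, rfl⟩ := Finset.mem_map.1 hx
    exact mem_arcNodes.2 (h.1 a ha)
  have harcs : arcsOf (F.map ⟨arcNode, arcNode_injective⟩) = F := by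
    ext a
    simp [mem_arcsOf]
  refine ⟨?_, hsub, by rwa [Finset.card_map]⟩
  intro x hx y hy hxy hp
  obtain ⟨s, hs, rfl⟩ := Finset.mem_map.1 hx
  obtain ⟨t, ht, rfl⟩ := Finset.mem_map.1 hy
  have hp' := (reach_subdivision hsub).1 hp
  rw [harcs] at hp'
  exact h.2 s hs t ht (fun hc => hxy (congrArg _ hc)) hp'

end Edge

end DirectedMultiwayCut

namespace DirectedMultiwayCut
open Cmd Relation

/-- The subdivided graph has a vertex for every vertex and one for every pair of vertices. -/
def edgeSize : Cmd := seq (assign 10 (.reg 0)) (rep 30 0 (assign 10 (.reg 10 + .reg 0)))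

/-- One entry of the adjacency matrix of the subdivided graph. -/
def edgeCell : Cmd := seq (assign 32 (.num 0)) (ite (.reg 0 - .reg 30)
  (ite (.reg 0 - .reg 31) skip (ite (.arr 0 (.reg 31 - .reg 0))
    (ite (.ne (.arr 33 (.reg 31 - .reg 0)) (.reg 30)) skip (assign 32 (.num 1))) skip))
  (ite (.arr 0 (.reg 30 - .reg 0))
    (ite (.ne (.arr 34 (.reg 30 - .reg 0)) (.reg 31)) skip (assign 32 (.num 1))) skip))

/-- Tabulate the ends of the arcs. -/
def endsCmd : Cmd := seq (tableCmd 0 35) (seq (fill₂ 30 0 31 0 35 33 32 (assign 32 (.reg 30)))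
  (fill₂ 30 0 31 0 35 34 32 (assign 32 (.reg 31))))

/-- Compute the set of the subdividing vertices. -/
def arcNodesCmd : Cmd := fill 30 10 14 32 (ite (.reg 0 - .reg 30) (assign 32 (.num 0))
  (assign 32 (.arr 0 (.reg 30 - .reg 0))))

/-- Load the instance of the edge version. -/
def edgeLoad : Cmd := seq endsCmd (seq (fill₂ 30 10 31 10 10 12 32 edgeCell)
  (seq (copyCmd 1 13) arcNodesCmd))

/-- Report whether a solution has been found, and store it as a matrix. -/
def edgeAnswer : Cmd := seq (copyCmd 2 36)
  (seq (fill 30 10 2 32 (assign 32 (.arr 36 (.reg 30 + .reg 0)))) (assign 0 (.reg 55)))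

theorem run_edgeSize {s : State} {n : ℕ} (h : s.reg 0 = n) :
    (edgeSize.run s).reg 10 = n + n * n := by
  have key := run_rep (x := 30) (b := 0) (s := (assign 10 (.reg 0)).run s)
    (c := assign 10 (.reg 10 + .reg 0)) (fun i s' => s'.reg 10 = n + i * n) (by simp [h]) (by
      intro i s' _ _ hag ih
      have e : s'.reg 0 = n := by
        rw [hag.reg 0 rfl]
        simp [h]
      simp [ih, e, add_mul, add_assoc])
  have e : ((assign 10 (.reg 0)).run s).reg 0 = n := by simp [h]
  rw [e] at key
  exact key

theorem run_endsCmd {s : State} {n : ℕ} (h : s.reg 0 = n) :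
    ∀ i < n, ∀ j < n, (endsCmd.run s).arr 33 (i * n + j) = i ∧
      (endsCmd.run s).arr 34 (i * n + j) = j := by
  have t := run_tableCmd (s := s) (x := 0) (a := 35) (by decide) (by decide)
  obtain ⟨s₁, hs₁⟩ : ∃ s₁, s₁ = (tableCmd 0 35).run s := ⟨_, rfl⟩
  rw [← hs₁, h] at t
  have a0 : s₁.reg 0 = n := by rw [hs₁, run_reg _ _ rfl, h]
  have k1 := run_fill₂ (x := 30) (bx := 0) (y := 31) (b := 0) (t := 35) (a := 33) (v := 32)
    (c := assign 32 (.reg 30)) (s := s₁) (fun i _ => i)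
    rfl rfl rfl rfl rfl (by decide) (by decide) (by decide) (by decide)
    (by rw [a0]; exact t) (by intro i _ j _ s' _ hx _; simp [hx])
  obtain ⟨s₂, hs₂⟩ : ∃ s₂, s₂ = (fill₂ 30 0 31 0 35 33 32 (assign 32 (.reg 30))).run s₁ := ⟨_, rfl⟩
  rw [← hs₂, a0] at k1
  have b0 : s₂.reg 0 = n := by rw [hs₂, run_reg _ _ rfl, a0]
  have b35 : s₂.arr 35 = s₁.arr 35 := by rw [hs₂, run_arr _ _ rfl]
  have k2 := run_fill₂ (x := 30) (bx := 0) (y := 31) (b := 0) (t := 35) (a := 34) (v := 32)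
    (c := assign 32 (.reg 31)) (s := s₂) (fun _ j => j)
    rfl rfl rfl rfl rfl (by decide) (by decide) (by decide) (by decide)
    (by rw [b0, b35]; exact t) (by intro i _ j _ s' _ _ hy; simp [hy])
  rw [b0] at k2
  have hrun : endsCmd.run s = (fill₂ 30 0 31 0 35 34 32 (assign 32 (.reg 31))).run s₂ := by
    rw [hs₂, hs₁]; rfl
  rw [hrun]
  exact fun i hi j hj => ⟨by rw [run_arr _ _ rfl, k1 i hi j hj], k2 i hi j hj⟩

theorem run_edgeCell {n k : ℕ} {G : Digraph (Fin n)} {T : Finset (Fin n)} {s : State}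
    (h0 : s.reg 0 = n) (ha : s.arr 0 = (inputState G T k).arr 0)
    (he : ∀ i < n, ∀ j < n, s.arr 33 (i * n + j) = i ∧ s.arr 34 (i * n + j) = j)
    {x y : Fin (n + n * n)} (hx : s.reg 30 = x) (hy : s.reg 31 = y) :
    (edgeCell.run s).reg 32 ≠ 0 ↔ subdivision G x y := by
  simp only [edgeCell, run_seq, run_ite, run_assign, run_skip, Expr.eval_sub, Expr.eval_reg,
    State.setReg_reg, Expr.eval_ne, Expr.eval_arr, Expr.eval_num, State.setReg_arr, h0, hx, hy,
    Nat.reduceEqDiff, if_false, ha]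
  have hcast : ∀ u : Fin n, n - ((Fin.castAdd (n * n) u : Fin (n + n * n)) : ℕ) ≠ 0 := by
    intro u
    have := u.2
    rw [Fin.val_castAdd]
    omega
  have hnode : ∀ a : Fin n × Fin n, n - (arcNode a : ℕ) = 0 ∧
      (arcNode a : ℕ) - n = (a.1 : ℕ) * n + a.2 := by
    intro a
    simp only [arcNode]
    omega
  rcases eq_castAdd_or_arcNode x with ⟨u, rfl⟩ | ⟨a, rfl⟩
  · rw [if_neg (hcast u)]
    rcases eq_castAdd_or_arcNode y with ⟨v, rfl⟩ | ⟨b, rfl⟩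
    · rw [if_neg (hcast v)]
      simp only [State.setReg_reg, if_true]
      refine ⟨fun h => absurd rfl h, ?_⟩
      rintro ⟨a, -, ⟨-, h⟩ | ⟨h, -⟩⟩
      · exact absurd h (arcNode_ne _ _)
      · exact absurd h (arcNode_ne _ _)
    · rw [if_pos (hnode b).1, (hnode b).2, (he _ b.1.2 _ b.2.2).1]
      have hG := inputState_graph G T k b.1 b.2
      have hval : ((Fin.castAdd (n * n) u : Fin (n + n * n)) : ℕ) = u := rfl
      have hsub : subdivision G (Fin.castAdd _ u) (arcNode b) ↔ G.Adj b.1 b.2 ∧ b.1 = u := by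
        constructor
        · rintro ⟨a, haG, ⟨h1, h2⟩ | ⟨h1, -⟩⟩
          · obtain rfl := arcNode_injective h2
            exact ⟨haG, (Fin.castAdd_injective _ _ h1).symm⟩
          · exact absurd h1 (arcNode_ne _ _)
        · rintro ⟨h1, rfl⟩
          exact ⟨b, h1, .inl ⟨rfl, rfl⟩⟩
      rw [hsub, ← hG, hval]
      split_ifs with c1 c2
      · simp [c1]
      · exact ⟨fun _ => ⟨c1, Fin.ext c2⟩, fun _ => by simp⟩
      · have : b.1 ≠ u := fun h => c2 (congrArg _ h)
        simp [this]
  · rw [if_pos (hnode a).1, (hnode a).2, (he _ a.1.2 _ a.2.2).2]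
    have hG := inputState_graph G T k a.1 a.2
    have hsub : subdivision G (arcNode a) y ↔ G.Adj a.1 a.2 ∧ (a.2 : ℕ) = y := by
      constructor
      · rintro ⟨b, hbG, ⟨h1, -⟩ | ⟨h1, h2⟩⟩
        · exact absurd h1.symm (arcNode_ne _ _)
        · obtain rfl := arcNode_injective h1
          exact ⟨hbG, by rw [h2]; rfl⟩
      · rintro ⟨h1, h2⟩
        exact ⟨a, h1, .inr ⟨rfl, Fin.ext h2.symm⟩⟩
    rw [hsub, ← hG]
    split_ifs with c1 c2
    · simp [c1]
    · exact ⟨fun _ => ⟨c1, c2⟩, fun _ => by simp⟩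
    · simp [c2]

theorem run_arcNodesCmd {n k : ℕ} {G : Digraph (Fin n)} {T : Finset (Fin n)} {s : State}
    (h0 : s.reg 0 = n) (h10 : s.reg 10 = n + n * n) (ha : s.arr 0 = (inputState G T k).arr 0) :
    vset (n + n * n) ((arcNodesCmd.run s).arr 14) = arcNodes G := by
  have key := run_fill (x := 30) (b := 10) (a := 14) (v := 32)
    (c := ite (.reg 0 - .reg 30) (assign 32 (.num 0)) (assign 32 (.arr 0 (.reg 30 - .reg 0))))
    (s := s) (fun i => if n - i = 0 then s.arr 0 (i - n) else 0) rfl rfl (by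
      intro i hi s' hag hx
      have e : s'.arr 0 = s.arr 0 := hag.arr 0 rfl
      have e0 : s'.reg 0 = n := by rw [hag.reg 0 rfl, h0]
      simp only [run_ite, run_assign, Expr.eval_sub, Expr.eval_reg, Expr.eval_num, Expr.eval_arr,
        hx, e, e0]
      by_cases hc : n - i = 0 <;> simp [hc])
  rw [h10] at key
  ext x
  rw [mem_vset, arcNodesCmd, key x x.2, ha]
  rcases eq_castAdd_or_arcNode x with ⟨u, rfl⟩ | ⟨a, rfl⟩
  · rw [if_neg (by
      have := u.2
      rw [Fin.val_castAdd]
      omega)]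
    exact ⟨fun h => absurd rfl h, fun h => absurd h castAdd_not_mem_arcNodes⟩
  · rw [if_pos (by simp [arcNode]), mem_arcNodes, ← inputState_graph G T k]
    simp [arcNode]

theorem run_edgeLoad {n k : ℕ} {G : Digraph (Fin n)} {T : Finset (Fin n)} {s : State}
    (h : Env (n + n * n) k s) (h0 : s.reg 0 = n) (ha0 : s.arr 0 = (inputState G T k).arr 0)
    (ha1 : s.arr 1 = (inputState G T k).arr 1) :
    adj (n + n * n) ((edgeLoad.run s).arr 12) = subdivision G ∧
      vset (n + n * n) ((edgeLoad.run s).arr 13) = oldTerminals T ∧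
      vset (n + n * n) ((edgeLoad.run s).arr 14) = arcNodes G := by
  have hends := run_endsCmd h0
  obtain ⟨s₁, hs₁⟩ : ∃ s₁, s₁ = endsCmd.run s := ⟨_, rfl⟩
  rw [← hs₁] at hends
  have h1 : Env (n + n * n) k s₁ := by rw [hs₁]; exact h.run rfl
  have b0 : s₁.reg 0 = n := by rw [hs₁, run_reg _ _ rfl, h0]
  have c0 : s₁.arr 0 = (inputState G T k).arr 0 := by rw [hs₁, run_arr _ _ rfl, ha0]
  have c1 : s₁.arr 1 = (inputState G T k).arr 1 := by rw [hs₁, run_arr _ _ rfl, ha1]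
  have key := run_fill₂ (x := 30) (bx := 10) (y := 31) (b := 10) (t := 10) (a := 12) (v := 32)
    (c := edgeCell) (s := s₁)
    (fun i j => (edgeCell.run ((s₁.setReg 30 i).setReg 31 j)).reg 32)
    rfl rfl rfl rfl rfl (by decide) (by decide) (by decide) (by decide)
    (by rw [h1.N_eq]; exact h1.mulN)
    (by
      intro i hi j hj s' hag hx hy
      have e0 : s'.arr 0 = s₁.arr 0 := hag.arr 0 rfl
      have e33 : s'.arr 33 = s₁.arr 33 := hag.arr 33 rfl
      have e34 : s'.arr 34 = s₁.arr 34 := hag.arr 34 rfl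
      have r0 : s'.reg 0 = s₁.reg 0 := hag.reg 0 rfl
      simp only [edgeCell, run_seq, run_ite, run_assign, run_skip, Expr.eval_sub, Expr.eval_reg,
        State.setReg_reg, Expr.eval_ne, Expr.eval_arr, Expr.eval_num, State.setReg_arr,
        Nat.reduceEqDiff, if_false, if_true, e0, e33, e34, r0, hx, hy]
      split_ifs <;> simp_all)
  rw [h1.N_eq] at key
  obtain ⟨s₂, hs₂⟩ : ∃ s₂, s₂ = (fill₂ 30 10 31 10 10 12 32 edgeCell).run s₁ := ⟨_, rfl⟩
  rw [← hs₂] at key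
  have d10 : s₂.reg 10 = n + n * n := by rw [hs₂, run_reg _ _ rfl, h1.N_eq]
  have d1 : s₂.arr 1 = (inputState G T k).arr 1 := by rw [hs₂, run_arr _ _ rfl, c1]
  have d0 : s₂.arr 0 = (inputState G T k).arr 0 := by rw [hs₂, run_arr _ _ rfl, c0]
  have dr0 : s₂.reg 0 = n := by rw [hs₂, run_reg _ _ rfl, b0]
  have hT := run_copyCmd d10 (a := 1) (b := 13) (by decide)
  obtain ⟨s₃, hs₃⟩ : ∃ s₃, s₃ = (copyCmd 1 13).run s₂ := ⟨_, rfl⟩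
  rw [← hs₃, d1] at hT
  have hP := run_arcNodesCmd (G := G) (T := T) (k := k) (s := s₃)
    (by rw [hs₃, run_reg _ _ rfl, dr0]) (by rw [hs₃, run_reg _ _ rfl, d10])
    (by rw [hs₃, run_arr _ _ rfl, d0])
  have hrun : edgeLoad.run s = arcNodesCmd.run s₃ := by rw [hs₃, hs₂, hs₁]; rfl
  rw [hrun]
  refine ⟨?_, ?_, hP⟩
  · rw [run_arr _ _ rfl, hs₃, run_arr _ _ rfl]
    funext x y
    rw [adj, key x x.2 y y.2]
    exact propext (run_edgeCell (G := G) (T := T) (k := k) (by simp [b0]) (by simpa using c0)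
      (by simpa using hends) (by simp) (by simp))
  · rw [run_arr _ _ rfl, hT]
    ext x
    rw [mem_vset]
    rcases eq_castAdd_or_arcNode x with ⟨u, rfl⟩ | ⟨a, rfl⟩
    · have h1 := inputState_terminals_ne G T k u
      rw [Fin.val_castAdd, h1]
      simp [oldTerminals]
    · rw [inputState_terminals]
      refine ⟨fun h => ?_, fun h => ?_⟩
      · split_ifs at h with hc
        · obtain ⟨v, -, hv⟩ := hc
          exact absurd (Fin.ext hv.symm : Fin.castAdd _ v = arcNode a) (arcNode_ne _ _)
        · exact absurd rfl h
      · obtain ⟨v, -, hv⟩ := Finset.mem_map.1 h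
        exact absurd hv (arcNode_ne _ _)

theorem run_edgeAnswer {n : ℕ} {s : State} (h0 : s.reg 0 = n) (h10 : s.reg 10 = n + n * n) :
    (edgeAnswer.run s).reg 0 = s.reg 55 ∧
      ∀ u v : Fin n, (edgeAnswer.run s).arr 2 ((u : ℕ) * n + v) = s.arr 2 (arcNode (u, v)) := by
  have k1 := run_fill (x := 30) (b := 10) (a := 36) (v := 32) (c := assign 32 (.arr 2 (.reg 30)))
    (s := s) (s.arr 2) rfl rfl (by
      intro i hi s' hag hx
      have e : s'.arr 2 = s.arr 2 := hag.arr 2 rfl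
      simp [hx, e])
  rw [h10] at k1
  obtain ⟨s₁, hs₁⟩ : ∃ s₁, s₁ = (fill 30 10 36 32 (assign 32 (.arr 2 (.reg 30)))).run s := ⟨_, rfl⟩
  rw [← hs₁] at k1
  have e10 : s₁.reg 10 = n + n * n := by rw [hs₁, run_reg _ _ rfl, h10]
  have k2 := run_fill (x := 30) (b := 10) (a := 2) (v := 32)
    (c := assign 32 (.arr 36 (.reg 30 + .reg 0))) (s := s₁) (fun i => s₁.arr 36 (i + n)) rfl rfl (by
      intro i hi s' hag hx
      have e : s'.arr 36 = s₁.arr 36 := hag.arr 36 rfl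
      have e0 : s'.reg 0 = n := by rw [hag.reg 0 rfl, hs₁, run_reg _ _ rfl, h0]
      simp [hx, e, e0])
  rw [e10] at k2
  obtain ⟨s₂, hs₂⟩ : ∃ s₂, s₂ = (fill 30 10 2 32 (assign 32 (.arr 36 (.reg 30 + .reg 0)))).run s₁ :=
    ⟨_, rfl⟩
  rw [← hs₂] at k2
  have hrun : edgeAnswer.run s = (assign 0 (.reg 55)).run s₂ := by rw [hs₂, hs₁]; rfl
  rw [hrun]
  refine ⟨?_, fun u v => ?_⟩
  · simp only [run_assign, State.setReg_reg, if_true, Expr.eval_reg]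
    rw [hs₂, run_reg _ _ rfl, hs₁, run_reg _ _ rfl]
  · have hlt : n + ((u : ℕ) * n + v) < n + n * n := (arcNode (u, v)).2
    have hval : (arcNode (u, v) : ℕ) = n + ((u : ℕ) * n + v) := rfl
    rw [run_arr _ _ rfl, k2 _ (by omega), k1 _ (by omega), hval, add_comm n]

theorem exists_edge_program : ∃ (P : Prog) (c : ℕ),
    ∀ (n : ℕ) (G : Digraph (Fin n)) (T : Finset (Fin n)) (k : ℕ), ∃ (t : ℕ) (s : State),
      Exec P (inputState G T k) t s ∧ t ≤ c * k ^ (c * k) * (n + 1) ^ c ∧ AnswersEdge G T k s := by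
  obtain ⟨c, hc⟩ := exists_time_solve (size := edgeSize) (load := edgeLoad)
    (answer := edgeAnswer) rfl rfl rfl rfl rfl rfl
  refine ⟨(solve edgeSize edgeLoad edgeAnswer).toProg, c, fun n G T k => ⟨_, _,
    exec _ rfl _, hc _ (n + n * n) (run_edgeSize rfl) (Nat.le_add_right _ _) le_rfl, ?_⟩⟩
  have hdisj : Disjoint (arcNodes G) (oldTerminals T) := by
    rw [Finset.disjoint_right]
    intro x hx
    obtain ⟨v, -, rfl⟩ := Finset.mem_map.1 hx
    exact castAdd_not_mem_arcNodes
  obtain ⟨s', h10, hreg, hrun, hs'⟩ := run_solve (size := edgeSize) (load := edgeLoad)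
    (answer := edgeAnswer) (s := inputState G T k) (N := n + n * n) (k := k)
    (run_edgeSize rfl) rfl rfl rfl hdisj
    (fun s' hE hr ha => run_edgeLoad hE (hr 0 rfl rfl) (ha 0 rfl rfl) (ha 1 rfl rfl))
  obtain ⟨o1, o2⟩ := run_edgeAnswer (n := n) (hreg 0 rfl rfl rfl rfl) h10
  rw [hrun, AnswersEdge, o1]
  rcases hs' with ⟨h55, S, hS, hout⟩ | ⟨h55, hno⟩
  · obtain ⟨g1, g2⟩ := small_subdivision hS
    refine .inl ⟨h55, arcsOf S, g1, g2, fun u v => ?_⟩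
    rw [o2, hout]
    simp only [mem_arcsOf]
  · exact .inr ⟨h55, fun ⟨F, g1, g2⟩ => hno ⟨_, small_of_edge g1 g2⟩⟩

/-! ### Comparison of the running times -/

theorem pow_mul_isLittleO_two_rpow_sq (c : ℕ) {ε : ℝ} (hε : 0 < ε) :
    Asymptotics.IsLittleO Filter.atTop (fun k : ℕ => (k : ℝ) ^ (c * k))
      (fun k : ℕ => (2 : ℝ) ^ (ε * (k : ℝ) ^ 2)) := by
  have hlog : Filter.Tendsto (fun k : ℕ => Real.log k / k) Filter.atTop (nhds 0) := by
    have h := Real.isLittleO_log_id_atTop.tendsto_div_nhds_zero.comp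
      (tendsto_natCast_atTop_atTop (R := ℝ))
    exact h
  have h2 : 0 < Real.log 2 := Real.log_pos (by norm_num)
  have hlim : Filter.Tendsto (fun k : ℕ => c * (Real.log k / k) - ε * Real.log 2) Filter.atTop
      (nhds (c * 0 - ε * Real.log 2)) := (hlog.const_mul _).sub_const _
  have hsq : Filter.Tendsto (fun k : ℕ => (k : ℝ) ^ 2) Filter.atTop Filter.atTop :=
    (Filter.tendsto_pow_atTop (by norm_num)).comp tendsto_natCast_atTop_atTop
  have hneg := hsq.atTop_mul_neg (by nlinarith : c * 0 - ε * Real.log 2 < 0) hlim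
  have hexp := Real.tendsto_exp_atBot.comp hneg
  rw [Asymptotics.isLittleO_iff_tendsto (fun k hk => absurd hk (by positivity))]
  refine hexp.congr' ?_
  filter_upwards [Filter.eventually_gt_atTop 0] with k hk
  have hk' : (0 : ℝ) < k := by exact_mod_cast hk
  have hpow : (k : ℝ) ^ (c * k) = Real.exp (Real.log k * (c * k : ℕ)) := by
    rw [← Real.rpow_natCast, Real.rpow_def_of_pos hk']
  rw [Function.comp_apply, Real.rpow_def_of_pos (by norm_num : (0 : ℝ) < 2), hpow, ← Real.exp_sub]
  congr 1
  push_cast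
  field_simp

end DirectedMultiwayCut

theorem mainTheorem11 :
    (∃ (P : DirectedMultiwayCut.Prog) (c : ℕ),
      ∀ (n : ℕ) (G : Digraph (Fin n)) (T : Finset (Fin n)) (k : ℕ),
        ∃ (t : ℕ) (s : DirectedMultiwayCut.State),
          DirectedMultiwayCut.Exec P (DirectedMultiwayCut.inputState G T k) t s ∧
          t ≤ c * k ^ (c * k) * (n + 1) ^ c ∧
          DirectedMultiwayCut.AnswersVertex G T k s) ∧
    (∃ (P : DirectedMultiwayCut.Prog) (c : ℕ),
      ∀ (n : ℕ) (G : Digraph (Fin n)) (T : Finset (Fin n)) (k : ℕ),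
        ∃ (t : ℕ) (s : DirectedMultiwayCut.State),
          DirectedMultiwayCut.Exec P (DirectedMultiwayCut.inputState G T k) t s ∧
          t ≤ c * k ^ (c * k) * (n + 1) ^ c ∧
          DirectedMultiwayCut.AnswersEdge G T k s) ∧
    (∀ (c : ℕ) (ε : ℝ), 0 < ε →
      Asymptotics.IsLittleO Filter.atTop
        (fun k : ℕ => (k : ℝ) ^ (c * k)) (fun k : ℕ => (2 : ℝ) ^ (ε * (k : ℝ) ^ 2))) := by
  exact ⟨DirectedMultiwayCut.exists_vertex_program, DirectedMultiwayCut.exists_edge_program,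
    fun c _ hε => DirectedMultiwayCut.pow_mul_isLittleO_two_rpow_sq c hε⟩
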